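/- **Theorem 3.1 (label LWP).** Let $\mathbb T=\mathbb R/2\pi\mathbb Z$ and $\langle y\rangle=\sqrt{1+|y|^2}$. For $b,s\ge 0$ let $X_{b,s}$ be the space of $u\in L^2(\mathbb R\times\mathbb T)$ with $$\|u\|_{X_{b,s}}^2=\sum_{k\in\mathbb Z}\int_{\mathbb R}\langle k\rangle^{2s}\,\langle \tau+k^4+k^2\rangle^{2b}\,|\hat u(k,\tau)|^2\,d\tau<\infty ,$$ where $\hat u$ is the space-time Fourier transform (so that the weight is adapted to $i\partial_t+\partial_x^2-\partial_x^4$). For an open interval $I$ let $X_{b,s}(I)$ be the space of restrictions to $I\times\mathbb T$ of elements of $X_{b,s}$, with norm $\|u\|_{X_{b,s}(I)}=\inf\{\|\tilde u\|_{X_{b,s}}:\tilde u=u\text{ on } I\times\mathbb T\}$, and let $X^T_{b,s}=X_{b,s}((0,T))$. Let $T>0$, $s\ge 0$, $\lambda\in\mathbb R$ and $\tfrac12\le b<\tfrac{11}{16}$. Let $a\in C^\infty(\mathbb T)$ and $\varphi\in C_0^\infty(\mathbb R)$ be real valued. For every $u_0\in H^s(\mathbb T)$ and $g\in L^2([-T,T];H^s(\mathbb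 T))$ there is a unique weak solution $u\in X^T_{b,s}$ on $(0,T)$ of $$i\partial_t u+\partial_x^2u-\partial_x^4u+i\varphi^2(t)a^2(x)u=\lambda|u|^2u+g,\qquad u(\cdot,0)=u_0 .$$ Here $u$ is a weak solution if $|u|^2u$ is integrable on $(0,T)\times\mathbb T$ and, for every smooth $\theta:\mathbb R\times\mathbb T\to\mathbb C$ vanishing for $t$ near $T$, $$\int_0^T\!\!\int_{\mathbb T}\Big[u\,(-i\partial_t\theta+\partial_x^2\theta-\partial_x^4\theta)+\big(i\varphi^2a^2u-\lambda|u|^2u-g\big)\theta\Big]dx\,dt=i\int_{\mathbb T}u_0(x)\,\theta(0,x)\,dx .$$ Furthermore, the flow map $$F:H^s(\mathbb T)\times L^2([-T,T];H^s(\mathbb T))\to X^T_{b,s},\qquad (u_0,g)\mapsto u,$$ is Lipschitz on every bounded subset. The same holds backward in time, that is, on $(-T,0)$ with $X_{b,s}((-T,0))$ in place of $X^T_{b,s}$ (with $T$ replaced by $-T$ in the definition of a weak solution). For $s=0$, all of this also holds for every real-valued $a\in L^\infty(\mathbb T)$. -/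

import Mathlib

open MeasureTheory Set
open scoped ENNReal NNReal ContDiff FourierTransform

noncomputable section

namespace FourthOrderNLS

instance fact_two_pi_pos : Fact (0 < 2 * Real.pi) := ⟨Real.two_pi_pos⟩

/-- The torus `ℝ / 2πℤ`. A space-time function is a function `u (t, x)` on `ℝ × Torus`. -/
abbrev Torus : Type := AddCircle (2 * Real.pi)

/-! ### Sobolev spaces on the torus -/

/-- The norm of `H^s(𝕋)`: `(∑ₖ ⟨k⟩^{2s} |f̂(k)|²)^{1/2}`, for `f ∈ L²(𝕋)`. -/
def hsNorm (s : ℝ) (f : Torus → ℂ) : ℝ≥0∞ :=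
  (∑' k : ℤ, ENNReal.ofReal ((1 + (k : ℝ) ^ 2) ^ s) * ‖fourierCoeff f k‖ₑ ^ 2) ^ (1 / 2 : ℝ)

/-- `f ∈ H^s(𝕋)`, for `s ≥ 0`. -/
def MemHs (s : ℝ) (f : Torus → ℂ) : Prop :=
  MemLp f 2 volume ∧ hsNorm s f < ⊤

/-- Lebesgue measure on `I × 𝕋`. -/
def slab (I : Set ℝ) : Measure (ℝ × Torus) :=
  volume.restrict (I ×ˢ univ)

/-- The norm of `L²([-T, T]; H^s(𝕋))`. -/
def l2HsNorm (T s : ℝ) (g : ℝ × Torus → ℂ) : ℝ≥0∞ :=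
  (∫⁻ t in Icc (-T) T, hsNorm s (fun x => g (t, x)) ^ 2) ^ (1 / 2 : ℝ)

/-- `g ∈ L²([-T, T]; H^s(𝕋))`, for `s ≥ 0`. -/
def MemL2Hs (T s : ℝ) (g : ℝ × Torus → ℂ) : Prop :=
  MemLp g 2 (slab (Icc (-T) T)) ∧ l2HsNorm T s g < ⊤

/-! ### Bourgain spaces -/

open Classical in
/-- The `L²(ℝ)` (Plancherel) Fourier transform, `ξ ↦ ∫ e^{-2πi t ξ} f(t) dt` for `f ∈ L¹ ∩ L²`. -/
def l2Fourier (f : ℝ → ℂ) : ℝ → ℂ :=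
  if h : MemLp f 2 volume then ((𝓕 (h.toLp f) : Lp ℂ 2 (volume : Measure ℝ)) : ℝ → ℂ) else 0

/-- The space-time Fourier transform `û(k, τ)` of `u ∈ L²(ℝ × 𝕋)` at time frequency `τ = 2πξ`. -/
def spaceTimeFourier (u : ℝ × Torus → ℂ) (k : ℤ) (ξ : ℝ) : ℂ :=
  l2Fourier (fun t => fourierCoeff (fun x => u (t, x)) k) ξ

/-- The Bourgain norm
`(∑ₖ ∫ ⟨k⟩^{2s} ⟨τ - p(k)⟩^{2b} |û(k, τ)|² dτ)^{1/2}` with `τ = 2πξ` (up to the constant factor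
from `dτ = 2π dξ`), where `τ = p(k) = -(k⁴ + k²)` is the characteristic set of
`i∂ₜ + ∂ₓ² - ∂ₓ⁴`. -/
def bourgainNorm (b s : ℝ) (u : ℝ × Torus → ℂ) : ℝ≥0∞ :=
  (∑' k : ℤ, ∫⁻ ξ : ℝ,
    ENNReal.ofReal ((1 + (k : ℝ) ^ 2) ^ s *
      (1 + (2 * Real.pi * ξ + ((k : ℝ) ^ 4 + (k : ℝ) ^ 2)) ^ 2) ^ b) *
      ‖spaceTimeFourier u k ξ‖ₑ ^ 2) ^ (1 / 2 : ℝ)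

/-- `u ∈ X_{b,s}`, for `b, s ≥ 0` (so that `X_{b,s} ⊆ L²(ℝ × 𝕋)`). -/
def MemBourgain (b s : ℝ) (u : ℝ × Torus → ℂ) : Prop :=
  MemLp u 2 volume ∧ bourgainNorm b s u < ⊤

/-- `v` is an extension in `X_{b,s}` of the restriction of `u` to `I × 𝕋`. -/
def IsExtension (b s : ℝ) (I : Set ℝ) (u v : ℝ × Torus → ℂ) : Prop :=
  MemBourgain b s v ∧ v =ᵐ[slab I] u

/-- `u ∈ X_{b,s}(I)`; only the values of `u` on `I × 𝕋` matter. -/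
def MemBourgainOn (b s : ℝ) (I : Set ℝ) (u : ℝ × Torus → ℂ) : Prop :=
  ∃ v, IsExtension b s I u v

/-- The restriction norm of `X_{b,s}(I)`. -/
def bourgainNormOn (b s : ℝ) (I : Set ℝ) (u : ℝ × Torus → ℂ) : ℝ≥0∞ :=
  ⨅ (v : ℝ × Torus → ℂ) (_ : IsExtension b s I u v), bourgainNorm b s v

/-! ### Weak solutions -/

/-- The time derivative `∂ₜθ`. -/
def dt (θ : ℝ × Torus → ℂ) (t : ℝ) (x : Torus) : ℂ :=
  deriv (fun r : ℝ => θ (r, x)) t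

/-- The space derivative `∂ₓⁿθ`. -/
def dx (n : ℕ) (θ : ℝ × Torus → ℂ) (t : ℝ) (x : Torus) : ℂ :=
  iteratedDeriv n (fun y : ℝ => θ (t, x + (y : Torus))) 0

/-- Test functions: smooth functions on `ℝ × 𝕋` that vanish for `t` near `S`. -/
def IsTestFunction (S : ℝ) (θ : ℝ × Torus → ℂ) : Prop :=
  ContDiff ℝ ∞ (fun z : ℝ × ℝ => θ (z.1, (z.2 : Torus))) ∧
    ∃ ε > 0, ∀ t x, |t - S| < ε → θ (t, x) = 0

/-- `u` is a weak solution, on the time interval between `0` and `S` (where `S` may be negative), of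
`i∂ₜu + ∂ₓ²u - ∂ₓ⁴u + iφ²(t)a²(x)u = lam |u|²u + g`, `u(0) = u₀`. The outer integral is oriented,
and the initial datum enters through test functions that need not vanish at `t = 0`. -/
structure IsSolution (S lam : ℝ) (a : Torus → ℝ) (φ : ℝ → ℝ) (u₀ : Torus → ℂ)
    (g u : ℝ × Torus → ℂ) : Prop where
  /-- The nonlinearity is integrable, so that it is a distribution. -/
  integrable_cubic : Integrable (fun z => ((‖u z‖ ^ 2 : ℝ) : ℂ) * u z) (slab (uIoo 0 S))
  /-- The equation tested against `θ`, with all derivatives moved to `θ`. -/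
  weak_eq : ∀ θ : ℝ × Torus → ℂ, IsTestFunction S θ →
    ∫ t in (0 : ℝ)..S, ∫ x : Torus,
      (u (t, x) * (-Complex.I * dt θ t x + dx 2 θ t x - dx 4 θ t x)
        + (Complex.I * (((φ t) ^ 2 * (a x) ^ 2 : ℝ) : ℂ) * u (t, x)
          - (lam : ℂ) * (((‖u (t, x)‖ ^ 2 : ℝ) : ℂ) * u (t, x)) - g (t, x)) * θ (t, x))
    = Complex.I * ∫ x : Torus, u₀ x * θ (0, x)

end FourthOrderNLS

end

open FourthOrderNLS

section

open MeasureTheory Set Filter Topology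
open scoped ENNReal NNReal ContDiff FourierTransform Convolution SchwartzMap

noncomputable section

namespace FourthOrderNLS

variable {β : ℝ} {C : ℝ≥0∞}

theorem integral_lp_fourier_smul (F : Lp ℂ 2 (volume : Measure ℝ)) (φ : 𝓢(ℝ, ℂ)) :
    ∫ x, φ x • ((𝓕 F : Lp ℂ 2 (volume : Measure ℝ)) : ℝ → ℂ) x = ∫ x, (𝓕 φ) x • (F : ℝ → ℂ) x := by
  have h := congrArg (fun T => T φ) (Lp.fourier_toTemperedDistribution_eq F)
  simp only [TemperedDistribution.fourier_apply] at h
  rw [Lp.toTemperedDistribution_apply, Lp.toTemperedDistribution_apply] at h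
  exact h.symm

theorem integral_lp_fourierInv_smul (F : Lp ℂ 2 (volume : Measure ℝ)) (φ : 𝓢(ℝ, ℂ)) :
    ∫ x, φ x • ((𝓕⁻ F : Lp ℂ 2 (volume : Measure ℝ)) : ℝ → ℂ) x
      = ∫ x, (𝓕⁻ φ) x • (F : ℝ → ℂ) x := by
  have h := congrArg (fun T => T φ) (Lp.fourierInv_toTemperedDistribution_eq F)
  simp only [TemperedDistribution.fourierInv_apply] at h
  rw [Lp.toTemperedDistribution_apply, Lp.toTemperedDistribution_apply] at h
  exact h.symm

theorem integral_fourier_flip {f g : ℝ → ℂ} (hf : Integrable f) (hg : Integrable g) :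
    ∫ ξ, 𝓕 f ξ * g ξ = ∫ x, f x * 𝓕 g x := by
  simpa using! (VectorFourier.integral_fourierIntegral_smul_eq_flip (L := innerₗ ℝ)
    Real.continuous_fourierChar continuous_inner hf hg)

theorem integral_fourierInv_flip {f g : ℝ → ℂ} (hf : Integrable f) (hg : Integrable g) :
    ∫ ξ, 𝓕⁻ f ξ * g ξ = ∫ x, f x * 𝓕⁻ g x := by
  rw [Real.fourierInv_eq_fourier_comp_neg f, integral_fourier_flip hf.comp_neg hg,
    ← integral_neg_eq_self]
  simp [Real.fourierInv_eq_fourier_neg]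

theorem continuous_fourier_of_integrable {f : ℝ → ℂ} (hf : Integrable f) : Continuous (𝓕 f) :=
  VectorFourier.fourierIntegral_continuous Real.continuous_fourierChar
    (by exact continuous_inner) hf

theorem continuous_fourierInv_of_integrable {f : ℝ → ℂ} (hf : Integrable f) :
    Continuous (𝓕⁻ f) := by
  rw [Real.fourierInv_eq_fourier_comp_neg]
  exact continuous_fourier_of_integrable hf.comp_neg

theorem l2Fourier_of_memLp {f : ℝ → ℂ} (h : MemLp f 2 volume) :
    l2Fourier f = ((𝓕 (h.toLp f) : Lp ℂ 2 (volume : Measure ℝ)) : ℝ → ℂ) := by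
  simp [l2Fourier, h]

theorem memLp_l2Fourier (f : ℝ → ℂ) : MemLp (l2Fourier f) 2 volume := by
  by_cases h : MemLp f 2 volume
  · rw [l2Fourier_of_memLp h]; exact Lp.memLp _
  · simp [l2Fourier, h]

theorem eLpNorm_l2Fourier {f : ℝ → ℂ} (h : MemLp f 2 volume) :
    eLpNorm (l2Fourier f) 2 volume = eLpNorm f 2 volume := by
  rw [l2Fourier_of_memLp h]
  have h1 := Lp.norm_fourier_eq (h.toLp f)
  rw [Lp.norm_def, Lp.norm_toLp, ENNReal.toReal_eq_toReal_iff' (Lp.eLpNorm_ne_top _)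
    h.eLpNorm_ne_top] at h1
  exact h1

theorem l2Fourier_congr {f g : ℝ → ℂ} (h : f =ᵐ[volume] g) : l2Fourier f = l2Fourier g := by
  by_cases hf : MemLp f 2 volume
  · have hg : MemLp g 2 volume := (memLp_congr_ae h).1 hf
    rw [l2Fourier_of_memLp hf, l2Fourier_of_memLp hg, MemLp.toLp_congr hf hg h]
  · have hg : ¬ MemLp g 2 volume := fun hg => hf ((memLp_congr_ae h).2 hg)
    simp [l2Fourier, hf, hg]

theorem l2Fourier_add {f g : ℝ → ℂ} (hf : MemLp f 2 volume) (hg : MemLp g 2 volume) :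
    l2Fourier (f + g) =ᵐ[volume] l2Fourier f + l2Fourier g := by
  rw [l2Fourier_of_memLp hf, l2Fourier_of_memLp hg, l2Fourier_of_memLp (hf.add hg),
    MemLp.toLp_add, FourierAdd.fourier_add]
  exact Lp.coeFn_add _ _

theorem l2Fourier_const_smul {f : ℝ → ℂ} (c : ℂ) (hf : MemLp f 2 volume) :
    l2Fourier (c • f) =ᵐ[volume] c • l2Fourier f := by
  rw [l2Fourier_of_memLp hf, l2Fourier_of_memLp (hf.const_smul c),
    MemLp.toLp_const_smul, FourierSMul.fourier_smul]
  exact Lp.coeFn_smul _ _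

theorem ae_eq_of_l2Fourier_ae_eq {f g : ℝ → ℂ} (hf : MemLp f 2 volume) (hg : MemLp g 2 volume)
    (h : l2Fourier f =ᵐ[volume] l2Fourier g) : f =ᵐ[volume] g := by
  rw [l2Fourier_of_memLp hf, l2Fourier_of_memLp hg] at h
  have h1 := (Lp.fourierTransformₗᵢ ℝ ℂ).injective (Lp.ext h)
  exact (MemLp.toLp_eq_toLp_iff hf hg).1 h1

theorem l2Fourier_ae_eq_fourier {f : ℝ → ℂ} (h1 : Integrable f) (h2 : MemLp f 2 volume) :
    l2Fourier f =ᵐ[volume] 𝓕 f := by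
  refine ae_eq_of_integral_contDiff_smul_eq ((memLp_l2Fourier f).locallyIntegrable (by norm_num))
    (continuous_fourier_of_integrable h1).locallyIntegrable fun g hg hgc => ?_
  have hc : HasCompactSupport (fun x => (g x : ℂ)) := hgc.comp_left (g := fun r : ℝ => (r : ℂ)) (by simp)
  have hd : ContDiff ℝ ∞ (fun x => (g x : ℂ)) := Complex.ofRealCLM.contDiff.comp hg
  set φ : 𝓢(ℝ, ℂ) := hc.toSchwartzMap hd
  have e1 := integral_lp_fourier_smul (h2.toLp f) φ
  rw [← l2Fourier_of_memLp h2] at e1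
  have e2 := integral_fourier_flip h1 φ.integrable
  have e3 : ∀ x, φ x = g x := fun x => rfl
  simp only [smul_eq_mul, e3, Complex.real_smul] at e1 e2 ⊢
  rw [e1]
  calc _ = ∫ x, (𝓕 φ) x * f x := integral_congr_ae (by
          filter_upwards [h2.coeFn_toLp] with x hx; rw [hx])
    _ = ∫ x, f x * 𝓕 (φ : ℝ → ℂ) x := by
          congr 1; ext x; rw [mul_comm, SchwartzMap.fourier_coe]
    _ = _ := by rw [← e2]; congr 1; ext x; rw [mul_comm]

theorem l2Fourier_fourierInv_ae_eq {g : ℝ → ℂ} (h1 : Integrable g) (h2 : MemLp g 2 volume) :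
    MemLp (𝓕⁻ g) 2 volume ∧ l2Fourier (𝓕⁻ g) =ᵐ[volume] g := by
  have key : (((𝓕⁻ (h2.toLp g) : Lp ℂ 2 (volume : Measure ℝ)) : ℝ → ℂ)) =ᵐ[volume] 𝓕⁻ g := by
    refine ae_eq_of_integral_contDiff_smul_eq ((Lp.memLp _).locallyIntegrable (by norm_num))
      (continuous_fourierInv_of_integrable h1).locallyIntegrable fun ψ hg hgc => ?_
    have hc : HasCompactSupport (fun x => (ψ x : ℂ)) := hgc.comp_left (g := fun r : ℝ => (r : ℂ)) (by simp)
    have hd : ContDiff ℝ ∞ (fun x => (ψ x : ℂ)) := Complex.ofRealCLM.contDiff.comp hg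
    set φ : 𝓢(ℝ, ℂ) := hc.toSchwartzMap hd
    have e1 := integral_lp_fourierInv_smul (h2.toLp g) φ
    have e2 := integral_fourierInv_flip h1 φ.integrable
    have e3 : ∀ x, φ x = ψ x := fun x => rfl
    simp only [smul_eq_mul, e3, Complex.real_smul] at e1 e2 ⊢
    rw [e1]
    calc _ = ∫ x, (𝓕⁻ φ) x * g x := integral_congr_ae (by
            filter_upwards [h2.coeFn_toLp] with x hx; rw [hx])
      _ = ∫ x, g x * 𝓕⁻ (φ : ℝ → ℂ) x := by
            congr 1; ext x; rw [mul_comm, SchwartzMap.fourierInv_coe]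
      _ = _ := by rw [← e2]; congr 1; ext x; rw [mul_comm]
  have hm : MemLp (𝓕⁻ g) 2 volume := (memLp_congr_ae key).1 (Lp.memLp _)
  refine ⟨hm, ?_⟩
  rw [← l2Fourier_congr key, l2Fourier_of_memLp (Lp.memLp _), Lp.toLp_coeFn,
    FourierTransform.fourier_fourierInv_eq]
  exact h2.coeFn_toLp

/-- The Haar measure on the frequency space `ℤ × ℝ`. -/
abbrev nu : Measure (ℤ × ℝ) := (Measure.count : Measure ℤ).prod volume

/-- Lebesgue measure on space-time. -/
abbrev vol : Measure (ℝ × Torus) := (volume : Measure ℝ).prod (volume : Measure Torus)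

theorem nu_eq_sum : nu = Measure.sum fun k : ℤ => (volume : Measure ℝ).map (Prod.mk k) := by
  simp only [nu, Measure.count, Measure.prod_sum_left, Measure.dirac_prod]

theorem lintegral_nu (f : ℤ × ℝ → ℝ≥0∞) : ∫⁻ q, f q ∂nu = ∑' k, ∫⁻ ξ, f (k, ξ) := by
  rw [nu_eq_sum, lintegral_sum_measure]
  simp_rw [(measurableEmbedding_prodMk_left _).lintegral_map]

theorem ae_nu {P : ℤ × ℝ → Prop} : (∀ᵐ q ∂nu, P q) ↔ ∀ k, ∀ᵐ ξ : ℝ, P (k, ξ) := by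
  rw [nu_eq_sum, Measure.ae_sum_iff]
  simp_rw [(measurableEmbedding_prodMk_left _).ae_map_iff]

theorem aestronglyMeasurable_nu {f : ℤ × ℝ → ℂ} :
    AEStronglyMeasurable f nu ↔ ∀ k, AEStronglyMeasurable (fun ξ => f (k, ξ)) volume := by
  rw [nu_eq_sum, aestronglyMeasurable_sum_measure_iff]
  simp_rw [(measurableEmbedding_prodMk_left _).aestronglyMeasurable_map_iff]
  rfl

theorem hasSum_integral_nu {f : ℤ × ℝ → ℂ} (hf : Integrable f nu) :
    HasSum (fun k => ∫ ξ, f (k, ξ)) (∫ q, f q ∂nu) := by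
  rw [nu_eq_sum] at hf ⊢
  have := hasSum_integral_measure hf
  simp_rw [(measurableEmbedding_prodMk_left _).integral_map] at this
  exact this

theorem Integrable.nu_slice {f : ℤ × ℝ → ℂ} (hf : Integrable f nu) (k : ℤ) :
    Integrable (fun ξ => f (k, ξ)) := by
  refine ⟨aestronglyMeasurable_nu.1 hf.1 k, lt_of_le_of_lt ?_ hf.2⟩
  rw [lintegral_nu]
  exact ENNReal.le_tsum (f := fun k => ∫⁻ ξ, ‖f (k, ξ)‖ₑ) k

instance nu_isNegInvariant : nu.IsNegInvariant := by
  constructor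
  have h1 : MeasurePreserving (fun k : ℤ => -k) Measure.count Measure.count :=
    by
    refine ⟨measurable_neg, ?_⟩
    ext s hs
    rw [Measure.map_apply measurable_neg hs]
    simp
  have h2 : MeasurePreserving (fun k : ℝ => -k) volume volume := Measure.measurePreserving_neg _
  exact (h1.prod h2).map_eq

theorem eLpNorm_two_sq {α : Type*} [MeasurableSpace α] (μ : Measure α) (f : α → ℂ) :
    eLpNorm f 2 μ ^ 2 = ∫⁻ x, ‖f x‖ₑ ^ 2 ∂μ := by
  rw [eLpNorm_eq_lintegral_rpow_enorm_toReal (by norm_num) (by norm_num), ← ENNReal.rpow_natCast,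
    ← ENNReal.rpow_mul]
  norm_num

theorem memLp_two_iff_lintegral {α : Type*} [MeasurableSpace α] {μ : Measure α} {f : α → ℂ} :
    MemLp f 2 μ ↔ AEStronglyMeasurable f μ ∧ ∫⁻ x, ‖f x‖ₑ ^ 2 ∂μ < ⊤ := by
  rw [MemLp, ← eLpNorm_two_sq]
  simp [ENNReal.pow_lt_top_iff]

/-- The Fourier coefficient in space of a space-time function. -/
def coef (u : ℝ × Torus → ℂ) (k : ℤ) (t : ℝ) : ℂ := fourierCoeff (fun x => u (t, x)) k

theorem fourierCoeff_eq_integral (f : Torus → ℂ) (k : ℤ) :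
    fourierCoeff f k = ((2 * Real.pi)⁻¹ : ℝ) * ∫ x, fourier (-k) x * f x := by
  rw [fourierCoeff, AddCircle.integral_haarAddCircle]
  simp [Complex.real_smul]

theorem ae_haar_iff {P : Torus → Prop} :
    (∀ᵐ x ∂(AddCircle.haarAddCircle : Measure Torus), P x) ↔ ∀ᵐ x, P x := by
  rw [AddCircle.volume_eq_smul_haarAddCircle,
    Measure.ae_ennreal_smul_measure_iff (by simp [Real.pi_pos])]

theorem haar_eq_smul_volume : (AddCircle.haarAddCircle : Measure Torus)
    = (ENNReal.ofReal (2 * Real.pi))⁻¹ • volume := by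
  rw [AddCircle.volume_eq_smul_haarAddCircle, smul_smul, ENNReal.inv_mul_cancel, one_smul]
  · simp [Real.pi_pos]
  · exact ENNReal.ofReal_ne_top

theorem memLp_haar_iff {f : Torus → ℂ} {p : ℝ≥0∞} :
    MemLp f p (AddCircle.haarAddCircle : Measure Torus) ↔ MemLp f p volume := by
  constructor
  · intro h
    rw [AddCircle.volume_eq_smul_haarAddCircle]
    exact h.smul_measure ENNReal.ofReal_ne_top
  · intro h
    rw [haar_eq_smul_volume]
    exact h.smul_measure (by simp [Real.pi_pos])

theorem integrable_haar_iff {f : Torus → ℂ} :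
    Integrable f (AddCircle.haarAddCircle : Measure Torus) ↔ Integrable f volume := by
  rw [← memLp_one_iff_integrable, ← memLp_one_iff_integrable, memLp_haar_iff]

theorem fourierCoeff_sub {f g : Torus → ℂ} (hf : Integrable f) (hg : Integrable g) (k : ℤ) :
    fourierCoeff (f - g) k = fourierCoeff f k - fourierCoeff g k := by
  have h1 : fourierCoeff (f + (-1 : ℂ) • g) k = fourierCoeff f k + fourierCoeff ((-1 : ℂ) • g) k :=
    congrFun (fourierCoeff.add (integrable_haar_iff.2 hf)
      ((integrable_haar_iff.2 hg).smul (-1 : ℂ))) k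
  rw [fourierCoeff.const_smul] at h1
  simpa [sub_eq_add_neg] using h1

theorem fourierCoeff_congr_volume {f g : Torus → ℂ} (h : f =ᵐ[volume] g) (k : ℤ) :
    fourierCoeff f k = fourierCoeff g k :=
  congrFun (fourierCoeff_congr_ae (ae_haar_iff.2 h)) k

/-- Parseval's identity on the torus. -/
theorem tsum_enorm_fourierCoeff_sq {f : Torus → ℂ} (hf : MemLp f 2 volume) :
    ENNReal.ofReal (2 * Real.pi) * ∑' k, ‖fourierCoeff f k‖ₑ ^ 2 = ∫⁻ x, ‖f x‖ₑ ^ 2 := by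
  have hf' := memLp_haar_iff.2 hf
  have h := hasSum_sq_fourierCoeff (hf'.toLp f)
  have e : ∀ k, fourierCoeff (hf'.toLp f) k = fourierCoeff f k := fun k =>
    congrFun (fourierCoeff_congr_ae hf'.coeFn_toLp) k
  have e2 : ∫ x, ‖(hf'.toLp f) x‖ ^ 2 ∂AddCircle.haarAddCircle
      = ∫ x, ‖f x‖ ^ 2 ∂(AddCircle.haarAddCircle : Measure Torus) :=
    integral_congr_ae (by filter_upwards [hf'.coeFn_toLp] with x hx; rw [hx])
  simp only [e, e2] at h
  have h3 : ∑' k, ‖fourierCoeff f k‖ₑ ^ 2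
      = ∫⁻ x, ‖f x‖ₑ ^ 2 ∂(AddCircle.haarAddCircle : Measure Torus) := by
    have h4 := ENNReal.ofReal_tsum_of_nonneg (fun k => sq_nonneg ‖fourierCoeff f k‖) h.summable
    rw [h.tsum_eq, ofReal_integral_eq_lintegral_ofReal hf'.norm.integrable_sq
      (ae_of_all _ fun x => sq_nonneg _)] at h4
    simpa [ENNReal.ofReal_pow, ofReal_norm] using h4.symm
  rw [h3, AddCircle.volume_eq_smul_haarAddCircle, lintegral_smul_measure, smul_eq_mul]

theorem aestronglyMeasurable_coef {u : ℝ × Torus → ℂ} {μ : Measure ℝ} [SFinite μ]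
    (hu : AEStronglyMeasurable u (μ.prod volume)) (k : ℤ) :
    AEStronglyMeasurable (coef u k) μ := by
  have : coef u k = fun t => (((2 * Real.pi)⁻¹ : ℝ) : ℂ) * ∫ x, fourier (-k) x * u (t, x) := by
    ext t; exact fourierCoeff_eq_integral _ _
  rw [this]
  refine AEStronglyMeasurable.const_mul ?_ _
  refine AEStronglyMeasurable.integral_prod_right' (f := fun z : ℝ × Torus => fourier (-k) z.2 * u z) ?_
  exact (((fourier (-k)).continuous.comp continuous_snd).aestronglyMeasurable).mul hu

theorem lintegral_coef_sq_of_slice {u : ℝ × Torus → ℂ} {μ : Measure ℝ} [SFinite μ]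
    (hu : AEStronglyMeasurable u (μ.prod volume))
    (h : ∀ᵐ t ∂μ, MemLp (fun x => u (t, x)) 2 volume) :
    ENNReal.ofReal (2 * Real.pi) * ∑' k, ∫⁻ t, ‖coef u k t‖ₑ ^ 2 ∂μ
      = ∫⁻ z, ‖u z‖ₑ ^ 2 ∂(μ.prod volume) := by
  rw [lintegral_prod _ (hu.enorm.pow_const 2), ← lintegral_tsum
    (fun k => (aestronglyMeasurable_coef hu k).enorm.pow_const 2), ← lintegral_const_mul'' _
    (AEMeasurable.tsum fun k => (aestronglyMeasurable_coef hu k).enorm.pow_const 2)]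
  refine lintegral_congr_ae ?_
  filter_upwards [h] with t ht
  exact tsum_enorm_fourierCoeff_sq ht

theorem ae_memLp_slice {u : ℝ × Torus → ℂ} {μ : Measure ℝ} [SFinite μ]
    (hu : MemLp u 2 (μ.prod volume)) : ∀ᵐ t ∂μ, MemLp (fun x => u (t, x)) 2 volume := by
  have h1 := (memLp_two_iff_lintegral.1 hu).2
  rw [lintegral_prod _ (hu.1.enorm.pow_const 2)] at h1
  filter_upwards [ae_lt_top' (hu.1.enorm.pow_const 2).lintegral_prod_right' h1.ne,
    hu.1.prodMk_left] with t ht ht2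
  exact memLp_two_iff_lintegral.2 ⟨ht2, ht⟩

/-- Parseval's identity in space, integrated in time. -/
theorem lintegral_coef_sq {u : ℝ × Torus → ℂ} {μ : Measure ℝ} [SFinite μ]
    (hu : MemLp u 2 (μ.prod volume)) :
    ENNReal.ofReal (2 * Real.pi) * ∑' k, ∫⁻ t, ‖coef u k t‖ₑ ^ 2 ∂μ
      = ∫⁻ z, ‖u z‖ₑ ^ 2 ∂(μ.prod volume) :=
  lintegral_coef_sq_of_slice hu.1 (ae_memLp_slice hu)

theorem two_pi_ne_zero' : ENNReal.ofReal (2 * Real.pi) ≠ 0 := by simp [Real.pi_pos]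

theorem memLp_coef {u : ℝ × Torus → ℂ} {μ : Measure ℝ} [SFinite μ]
    (hu : MemLp u 2 (μ.prod volume)) (k : ℤ) : MemLp (coef u k) 2 μ := by
  refine memLp_two_iff_lintegral.2 ⟨aestronglyMeasurable_coef hu.1 k, ?_⟩
  have h := (memLp_two_iff_lintegral.1 hu).2
  rw [← lintegral_coef_sq hu] at h
  refine lt_of_le_of_lt (ENNReal.le_tsum (f := fun k => ∫⁻ t, ‖coef u k t‖ₑ ^ 2 ∂μ) k) ?_
  exact ENNReal.lt_top_of_mul_ne_top_right h.ne two_pi_ne_zero'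

theorem ae_integrable_slice {u : ℝ × Torus → ℂ} {μ : Measure ℝ} [SFinite μ]
    (hu : Integrable u (μ.prod volume)) : ∀ᵐ t ∂μ, Integrable (fun x => u (t, x)) :=
  hu.prod_right_ae

theorem integrable_coef {u : ℝ × Torus → ℂ} {μ : Measure ℝ} [SFinite μ]
    (hu : Integrable u (μ.prod volume)) (k : ℤ) : Integrable (coef u k) μ := by
  have : coef u k = fun t => (((2 * Real.pi)⁻¹ : ℝ) : ℂ) * ∫ x, fourier (-k) x * u (t, x) := by
    ext t; exact fourierCoeff_eq_integral _ _
  rw [this]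
  refine Integrable.const_mul ?_ _
  refine Integrable.integral_prod_left (f := fun z : ℝ × Torus => fourier (-k) z.2 * u z) ?_
  refine hu.bdd_mul (c := 1) ((fourier (-k)).continuous.comp continuous_snd).aestronglyMeasurable
    (ae_of_all _ fun z => ?_)
  rw [fourier_apply, Circle.norm_coe]

theorem coef_sub_ae {u v : ℝ × Torus → ℂ} {μ : Measure ℝ} [SFinite μ]
    (hu : Integrable u (μ.prod volume)) (hv : Integrable v (μ.prod volume)) (k : ℤ) :
    coef (u - v) k =ᵐ[μ] coef u k - coef v k := by
  filter_upwards [ae_integrable_slice hu, ae_integrable_slice hv] with t h1 h2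
  exact fourierCoeff_sub h1 h2 k

theorem coef_congr_ae {u v : ℝ × Torus → ℂ} {μ : Measure ℝ} [SFinite μ]
    (h : u =ᵐ[μ.prod volume] v) (k : ℤ) : coef u k =ᵐ[μ] coef v k := by
  filter_upwards [Measure.ae_ae_of_ae_prod h] with t ht
  exact fourierCoeff_congr_volume ht k

theorem coef_const_mul (u : ℝ × Torus → ℂ) (f : ℝ → ℂ) (k : ℤ) (t : ℝ) :
    coef (fun z => f z.1 * u z) k t = f t * coef u k t :=
  fourierCoeff.const_mul (fun x => u (t, x)) (f t) k

theorem ae_eq_of_coef_ae_eq {u v : ℝ × Torus → ℂ} {μ : Measure ℝ} [SFinite μ]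
    (hu : MemLp u 2 (μ.prod volume)) (hv : MemLp v 2 (μ.prod volume))
    (h : ∀ k, coef u k =ᵐ[μ] coef v k) : u =ᵐ[μ.prod volume] v := by
  have h1 := lintegral_coef_sq (hu.sub hv)
  have h2 : ∀ k, ∫⁻ t, ‖coef (u - v) k t‖ₑ ^ 2 ∂μ = 0 := fun k => by
    rw [← lintegral_zero (μ := μ)]
    refine lintegral_congr_ae ?_
    filter_upwards [h k, ae_memLp_slice hu, ae_memLp_slice hv] with t ht h3 h4
    have : coef (u - v) k t = coef u k t - coef v k t :=
      fourierCoeff_sub (h3.integrable (by norm_num)) (h4.integrable (by norm_num)) k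
    simp [this, ht]
  simp only [h2, tsum_zero, mul_zero] at h1
  have h3 := (lintegral_eq_zero_iff' ((hu.sub hv).1.enorm.pow_const 2)).1 h1.symm
  filter_upwards [h3] with x hx
  simpa [sub_eq_zero] using hx

/-- `w` is the space-time Fourier transform of `u`, both square integrable. -/
structure FT (u : ℝ × Torus → ℂ) (w : ℤ × ℝ → ℂ) : Prop where
  memLp_left : MemLp u 2 vol
  memLp_right : MemLp w 2 nu
  ae_eq : ∀ k, l2Fourier (coef u k) =ᵐ[volume] fun ξ => w (k, ξ)

theorem FT.lintegral_sq {u : ℝ × Torus → ℂ} {w : ℤ × ℝ → ℂ} (h : FT u w) :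
    ENNReal.ofReal (2 * Real.pi) * ∫⁻ q, ‖w q‖ₑ ^ 2 ∂nu
      = ∫⁻ z, ‖u z‖ₑ ^ 2 ∂vol := by
  rw [← lintegral_coef_sq h.memLp_left, lintegral_nu]
  congr 2 with k
  rw [← eLpNorm_two_sq, ← eLpNorm_two_sq, ← eLpNorm_l2Fourier (memLp_coef h.memLp_left k),
    eLpNorm_congr_ae (h.ae_eq k)]

theorem exists_FT_right {u : ℝ × Torus → ℂ} (hu : MemLp u 2 vol) :
    FT u fun q => l2Fourier (coef u q.1) q.2 := by
  refine ⟨hu, memLp_two_iff_lintegral.2 ⟨aestronglyMeasurable_nu.2 fun k =>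
    (memLp_l2Fourier (coef u k)).1, ?_⟩, fun k => Eventually.of_forall fun ξ => rfl⟩
  have h := (memLp_two_iff_lintegral.1 hu).2
  rw [← lintegral_coef_sq hu] at h
  rw [lintegral_nu]
  convert ENNReal.lt_top_of_mul_ne_top_right h.ne two_pi_ne_zero' using 3 with k
  rw [← eLpNorm_two_sq, ← eLpNorm_two_sq, ← eLpNorm_l2Fourier (memLp_coef hu k)]

theorem FT.sub {u v : ℝ × Torus → ℂ} {w y : ℤ × ℝ → ℂ} (h : FT u w) (h' : FT v y) :
    FT (u - v) (w - y) := by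
  refine ⟨h.memLp_left.sub h'.memLp_left, h.memLp_right.sub h'.memLp_right, fun k => ?_⟩
  have hu := memLp_coef h.memLp_left k
  have hv := memLp_coef h'.memLp_left k
  have e : coef (u - v) k =ᵐ[volume] coef u k + (-1 : ℂ) • coef v k := by
    filter_upwards [ae_memLp_slice h.memLp_left, ae_memLp_slice h'.memLp_left] with t h3 h4
    have : coef (u - v) k t = coef u k t - coef v k t :=
      fourierCoeff_sub (h3.integrable (by norm_num)) (h4.integrable (by norm_num)) k
    rw [this]; simp [sub_eq_add_neg]
  rw [l2Fourier_congr e]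
  filter_upwards [l2Fourier_add hu (hv.const_smul (-1 : ℂ)), l2Fourier_const_smul (-1 : ℂ) hv,
    h.ae_eq k, h'.ae_eq k] with ξ h1 h2 h3 h4
  rw [h1, Pi.add_apply, h2, Pi.smul_apply, h3, h4]
  simp [sub_eq_add_neg]

theorem FT.const_smul {u : ℝ × Torus → ℂ} {w : ℤ × ℝ → ℂ} (h : FT u w) (c : ℂ) :
    FT (c • u) (c • w) := by
  refine ⟨h.memLp_left.const_smul c, h.memLp_right.const_smul c, fun k => ?_⟩
  have e : coef (c • u) k = c • coef u k := by
    ext t; exact fourierCoeff.const_smul (fun x => u (t, x)) c k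
  rw [e]
  filter_upwards [l2Fourier_const_smul c (memLp_coef h.memLp_left k), h.ae_eq k] with ξ h1 h2
  rw [h1, Pi.smul_apply, h2]; rfl

theorem FT.add {u v : ℝ × Torus → ℂ} {w y : ℤ × ℝ → ℂ} (h : FT u w) (h' : FT v y) :
    FT (u + v) (w + y) := by
  have := h.sub (h'.const_smul (-1))
  simpa using this

theorem FT.congr_left {u v : ℝ × Torus → ℂ} {w : ℤ × ℝ → ℂ} (h : FT u w)
    (e : u =ᵐ[vol] v) : FT v w :=
  ⟨(memLp_congr_ae e).1 h.memLp_left, h.memLp_right, fun k => by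
    rw [← l2Fourier_congr (coef_congr_ae e k)]; exact h.ae_eq k⟩

theorem FT.congr_right {u : ℝ × Torus → ℂ} {w y : ℤ × ℝ → ℂ} (h : FT u w)
    (e : w =ᵐ[nu] y) : FT u y :=
  ⟨h.memLp_left, (memLp_congr_ae e).1 h.memLp_right, fun k => by
    filter_upwards [h.ae_eq k, ae_nu.1 e k] with ξ h1 h2; rw [h1, h2]⟩

theorem FT.right_unique {u : ℝ × Torus → ℂ} {w y : ℤ × ℝ → ℂ} (h : FT u w) (h' : FT u y) :
    w =ᵐ[nu] y := by
  refine ae_nu.2 fun k => ?_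
  filter_upwards [h.ae_eq k, h'.ae_eq k] with ξ h1 h2
  rw [← h1, h2]

theorem FT.eLpNorm_eq {u : ℝ × Torus → ℂ} {w : ℤ × ℝ → ℂ} (h : FT u w) :
    eLpNorm u 2 vol = ENNReal.ofReal (2 * Real.pi) ^ (1 / 2 : ℝ) * eLpNorm w 2 nu := by
  have h1 := h.lintegral_sq
  rw [← eLpNorm_two_sq, ← eLpNorm_two_sq] at h1
  have h2 := congrArg (fun x : ℝ≥0∞ => x ^ (1 / 2 : ℝ)) h1
  rw [ENNReal.mul_rpow_of_nonneg _ _ (by norm_num), ← ENNReal.rpow_natCast, ← ENNReal.rpow_natCast,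
    ← ENNReal.rpow_mul, ← ENNReal.rpow_mul] at h2
  norm_num at h2 ⊢
  exact h2.symm

/-! ### The inverse transform of integrable functions -/

/-- The character of `ℤ × ℝ` given by the point `z` of space-time. -/
def chr (z : ℝ × Torus) (q : ℤ × ℝ) : ℂ :=
  Real.fourierChar (q.2 * z.1) * fourier q.1 z.2

theorem norm_chr (z : ℝ × Torus) (q : ℤ × ℝ) : ‖chr z q‖ = 1 := by
  rw [chr, norm_mul, fourier_apply, Circle.norm_coe, Circle.norm_coe, one_mul]

theorem chr_add (z : ℝ × Torus) (q r : ℤ × ℝ) : chr z (q + r) = chr z q * chr z r := by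
  simp only [chr, Prod.fst_add, Prod.snd_add, add_mul, AddChar.map_add_eq_mul, fourier_add,
    Circle.coe_mul]
  ring

theorem measurable_chr {α : Type*} [MeasurableSpace α] {f : α → ℝ × Torus} {g : α → ℤ × ℝ}
    (hf : Measurable f) (hg : Measurable g) : Measurable fun a => chr (f a) (g a) := by
  have h1 : Measurable fun a => (Real.fourierChar ((g a).2 * (f a).1) : ℂ) :=
    (continuous_subtype_val.comp Real.continuous_fourierChar).measurable.comp
      (hg.snd.mul hf.fst)
  have h2 : Measurable fun p : Torus × ℤ => (fourier p.2 p.1 : ℂ) :=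
    measurable_from_prod_countable_left fun k => (fourier k).continuous.measurable
  exact h1.mul (h2.comp (hf.snd.prodMk hg.fst))

theorem continuous_chr (q : ℤ × ℝ) : Continuous fun z => chr z q := by
  have h1 : Continuous fun z : ℝ × Torus => (Real.fourierChar (q.2 * z.1) : ℂ) :=
    continuous_subtype_val.comp (Real.continuous_fourierChar.comp (by fun_prop))
  exact h1.mul ((fourier q.1).continuous.comp continuous_snd)

theorem measurable_chr_right (z : ℝ × Torus) : Measurable (chr z) :=
  measurable_chr measurable_const measurable_id

/-- The inverse space-time Fourier transform of an integrable function. -/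
def check (w : ℤ × ℝ → ℂ) (z : ℝ × Torus) : ℂ := ∫ q, w q * chr z q ∂nu

theorem integrable_mul_chr {w : ℤ × ℝ → ℂ} (hw : Integrable w nu) (z : ℝ × Torus) :
    Integrable (fun q => w q * chr z q) nu := by
  refine hw.mul_bdd (c := 1) (measurable_chr_right z).aestronglyMeasurable
    (ae_of_all _ fun q => (norm_chr z q).le)

theorem continuous_check {w : ℤ × ℝ → ℂ} (hw : Integrable w nu) : Continuous (check w) := by
  refine continuous_of_dominated (bound := fun q => ‖w q‖)
    (fun z => (integrable_mul_chr hw z).1) (fun z => ae_of_all _ fun q => ?_) hw.norm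
    (ae_of_all _ fun q => continuous_const.mul (continuous_chr q))
  rw [norm_mul, norm_chr, mul_one]

theorem norm_check_le (w : ℤ × ℝ → ℂ) (z : ℝ × Torus) : ‖check w z‖ ≤ ∫ q, ‖w q‖ ∂nu := by
  refine (norm_integral_le_integral_norm _).trans_eq ?_
  simp [norm_chr]

theorem check_sum {ι : Type*} (s : Finset ι) {w : ι → ℤ × ℝ → ℂ}
    (hw : ∀ i ∈ s, Integrable (w i) nu) : check (∑ i ∈ s, w i) = ∑ i ∈ s, check (w i) := by
  ext z
  simp only [check, Finset.sum_apply, Finset.sum_mul]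
  exact integral_finsetSum s fun i hi => integrable_mul_chr (hw i hi) z

theorem coef_check {w : ℤ × ℝ → ℂ} (hw : Integrable w nu) (k : ℤ) (t : ℝ) :
    coef (check w) k t = 𝓕⁻ (fun ξ => w (k, ξ)) t := by
  have hi : Integrable (Function.uncurry fun (x : Torus) (q : ℤ × ℝ) =>
      fourier (-k) x * (w q * chr (t, x) q)) (AddCircle.haarAddCircle.prod nu) := by
    have h1 : Integrable (fun p : Torus × (ℤ × ℝ) => w p.2) (AddCircle.haarAddCircle.prod nu) :=
      hw.comp_snd _
    refine (h1.mul_bdd (c := 1) (g := fun p : Torus × (ℤ × ℝ) => fourier (-k) p.1 * chr (t, p.1) p.2)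
      ?_ (ae_of_all _ fun p => ?_)).congr (ae_of_all _ fun p => ?_)
    · refine Measurable.aestronglyMeasurable (Measurable.mul ?_ ?_)
      · exact (fourier (-k)).continuous.measurable.comp measurable_fst
      · exact measurable_chr (measurable_const.prodMk measurable_fst) measurable_snd
    · rw [norm_mul, norm_chr, fourier_apply, Circle.norm_coe, one_mul]
    · simp [Function.uncurry]; ring
  have e1 : coef (check w) k t = ∫ q, ∫ x, fourier (-k) x * (w q * chr (t, x) q)
      ∂AddCircle.haarAddCircle ∂nu := by
    rw [← integral_integral_swap hi]
    simp only [coef, fourierCoeff, check, smul_eq_mul, integral_const_mul]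
  have e2 : ∀ q : ℤ × ℝ, ∫ x, fourier (-k) x * (w q * chr (t, x) q) ∂AddCircle.haarAddCircle
      = (w q * Real.fourierChar (q.2 * t)) * (if q.1 = k then 1 else 0) := by
    intro q
    have := congrFun (fourierCoeff_fourier (T := 2 * Real.pi) q.1) k
    rw [Pi.single_apply, fourierCoeff] at this
    simp_rw [eq_comm (a := q.1) (b := k), ← this, ← integral_const_mul, chr, smul_eq_mul]
    congr 1; ext x; ring
  simp_rw [e1, e2]
  have hi2 : Integrable (fun q : ℤ × ℝ => w q * Real.fourierChar (q.2 * t) * (if q.1 = k then 1 else 0)) nu := by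
    have := hi.integral_prod_right
    simp only [Function.uncurry, e2] at this
    exact this
  rw [← (hasSum_integral_nu hi2).tsum_eq, tsum_eq_single k (fun j hj => by simp [hj])]
  simp only [if_true, mul_one, Real.fourierInv_eq', smul_eq_mul]
  congr 1; ext ξ
  rw [Real.fourierChar_apply, mul_comm]
  simp [mul_comm, mul_left_comm]

theorem FT_check {w : ℤ × ℝ → ℂ} (hw : Integrable w nu) (hw2 : MemLp w 2 nu) :
    FT (check w) w := by
  have hs : ∀ k, MemLp (fun ξ => w (k, ξ)) 2 volume := fun k => by
    refine memLp_two_iff_lintegral.2 ⟨aestronglyMeasurable_nu.1 hw.1 k, ?_⟩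
    have := (memLp_two_iff_lintegral.1 hw2).2
    rw [lintegral_nu] at this
    exact lt_of_le_of_lt (ENNReal.le_tsum (f := fun k => ∫⁻ ξ, ‖w (k, ξ)‖ₑ ^ 2) k) this
  have hc : ∀ k, coef (check w) k = 𝓕⁻ (fun ξ => w (k, ξ)) := fun k => by
    ext t; exact coef_check hw k t
  have hk := fun k => l2Fourier_fourierInv_ae_eq (Integrable.nu_slice hw k) (hs k)
  refine ⟨memLp_two_iff_lintegral.2 ⟨(continuous_check hw).aestronglyMeasurable, ?_⟩, hw2,
    fun k => by rw [hc]; exact (hk k).2⟩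
  rw [← lintegral_coef_sq_of_slice (continuous_check hw).aestronglyMeasurable]
  · have h := (memLp_two_iff_lintegral.1 hw2).2
    rw [lintegral_nu] at h
    refine ENNReal.mul_lt_top ENNReal.ofReal_lt_top ?_
    convert h using 3 with k
    rw [hc, ← eLpNorm_two_sq, ← eLpNorm_two_sq, ← eLpNorm_l2Fourier (hk k).1,
      eLpNorm_congr_ae (hk k).2]
  · refine ae_of_all _ fun t => ?_
    have : Continuous fun x => check w (t, x) := (continuous_check hw).comp (by fun_prop)
    exact MemLp.of_bound this.aestronglyMeasurable (∫ q, ‖w q‖ ∂nu)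
      (ae_of_all _ fun x => norm_check_le w _)

theorem check_mul_check {w y : ℤ × ℝ → ℂ} (hw : Integrable w nu) (hy : Integrable y nu)
    (z : ℝ × Torus) : check w z * check y z
      = check (w ⋆[ContinuousLinearMap.mul ℂ ℂ, nu] y) z := by
  have h := integral_convolution (ContinuousLinearMap.mul ℂ ℂ) (integrable_mul_chr hw z)
    (integrable_mul_chr hy z)
  rw [ContinuousLinearMap.mul_apply'] at h
  rw [check, check, ← h, check]
  congr 1; ext Q
  simp only [convolution, ContinuousLinearMap.mul_apply']
  rw [← integral_mul_const]
  congr 1; ext q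
  have : chr z Q = chr z q * chr z (Q - q) := by rw [← chr_add]; congr 1; abel
  rw [this]; ring

/-! ### Truncation in frequency -/

/-- The frequencies of modulus at most `n`. -/
def box (n : ℕ) : Set (ℤ × ℝ) := Icc (-n : ℤ) n ×ˢ Icc (-n : ℝ) n

theorem measurableSet_box (n : ℕ) : MeasurableSet (box n) :=
  (measurableSet_Icc).prod measurableSet_Icc

theorem nu_box_lt_top (n : ℕ) : nu (box n) < ⊤ := by
  rw [box, nu, Measure.prod_prod]
  refine ENNReal.mul_lt_top ?_ (by simp)
  exact Measure.count_apply_lt_top.2 (finite_Icc _ _)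

theorem box_mono {n m : ℕ} (h : n ≤ m) : box n ⊆ box m := by
  have h1 : (n : ℤ) ≤ m := by exact_mod_cast h
  have h2 : (n : ℝ) ≤ m := by exact_mod_cast h
  exact prod_mono (Icc_subset_Icc (by omega) h1) (Icc_subset_Icc (by linarith) h2)

theorem eventually_mem_box (q : ℤ × ℝ) : ∀ᶠ n in atTop, q ∈ box n := by
  obtain ⟨N, hN⟩ := exists_nat_ge (max (|q.1| : ℝ) |q.2|)
  filter_upwards [eventually_ge_atTop N] with n hn
  refine box_mono hn ?_
  have h1 : |(q.1 : ℝ)| ≤ N := (le_max_left _ _).trans hN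
  have h2 := abs_le.1 ((le_max_right _ _).trans hN)
  have h3 : |q.1| ≤ N := by exact_mod_cast h1
  exact ⟨⟨(abs_le.1 h3).1, (abs_le.1 h3).2⟩, ⟨h2.1, h2.2⟩⟩

theorem tendsto_lintegral_compl_box {F : ℤ × ℝ → ℝ≥0∞} (hF : AEMeasurable F nu)
    (h : ∫⁻ q, F q ∂nu ≠ ⊤) :
    Tendsto (fun n => ∫⁻ q, (box n)ᶜ.indicator F q ∂nu) atTop (𝓝 0) := by
  rw [← lintegral_zero (α := ℤ × ℝ) (μ := nu)]
  refine tendsto_lintegral_of_dominated_convergence' F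
    (fun n => hF.indicator (measurableSet_box n).compl)
    (fun n => ae_of_all _ fun q => indicator_le_self _ _ _) h (ae_of_all _ fun q => ?_)
  refine tendsto_const_nhds.congr' ?_
  filter_upwards [eventually_mem_box q] with n hn
  simp [hn]

/-- The restriction of `w` to the frequencies of modulus at most `n`. -/
def trunc (n : ℕ) (w : ℤ × ℝ → ℂ) : ℤ × ℝ → ℂ := (box n).indicator w

theorem memLp_trunc {w : ℤ × ℝ → ℂ} (hw : MemLp w 2 nu) (n : ℕ) : MemLp (trunc n w) 2 nu :=
  hw.indicator (measurableSet_box n)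

theorem integrable_trunc {w : ℤ × ℝ → ℂ} (hw : MemLp w 2 nu) (n : ℕ) :
    Integrable (trunc n w) nu := by
  rw [trunc, integrable_indicator_iff (measurableSet_box n)]
  have : IsFiniteMeasure (nu.restrict (box n)) := ⟨by simpa using nu_box_lt_top n⟩
  exact (hw.restrict (box n)).integrable (by norm_num)

theorem enorm_sub_trunc_sq (n : ℕ) (w : ℤ × ℝ → ℂ) (q : ℤ × ℝ) :
    ‖(w - trunc n w) q‖ₑ ^ 2 = (box n)ᶜ.indicator (fun q => ‖w q‖ₑ ^ 2) q := by
  by_cases h : q ∈ box n <;> simp [trunc, h]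

theorem tendsto_eLpNorm_of_sq {ι α : Type*} [MeasurableSpace α] {μ : Measure α} {l : Filter ι}
    {f : ι → α → ℂ} (h : Tendsto (fun n => ∫⁻ x, ‖f n x‖ₑ ^ 2 ∂μ) l (𝓝 0)) :
    Tendsto (fun n => eLpNorm (f n) 2 μ) l (𝓝 0) := by
  have h1 := (ENNReal.continuous_rpow_const (y := (1 / 2 : ℝ))).tendsto 0 |>.comp h
  rw [ENNReal.zero_rpow_of_pos (by norm_num)] at h1
  refine h1.congr fun n => ?_
  simp only [Function.comp]
  rw [← eLpNorm_two_sq, ← ENNReal.rpow_natCast, ← ENNReal.rpow_mul]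
  norm_num

theorem tendsto_trunc {w : ℤ × ℝ → ℂ} (hw : MemLp w 2 nu) :
    Tendsto (fun n => eLpNorm (w - trunc n w) 2 nu) atTop (𝓝 0) := by
  refine tendsto_eLpNorm_of_sq ?_
  simp_rw [enorm_sub_trunc_sq]
  exact tendsto_lintegral_compl_box (hw.1.enorm.pow_const 2) (memLp_two_iff_lintegral.1 hw).2.ne

theorem ae_eq_of_eLpNorm_sub_tendsto {α : Type*} [MeasurableSpace α] {μ : Measure α}
    {p : ℝ≥0∞} (hp : 1 ≤ p)
    {f : ℕ → α → ℂ} {g h : α → ℂ} (hf : ∀ n, AEStronglyMeasurable (f n) μ)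
    (hg : AEStronglyMeasurable g μ) (hh : AEStronglyMeasurable h μ)
    (h1 : Tendsto (fun n => eLpNorm (g - f n) p μ) atTop (𝓝 0))
    (h2 : Tendsto (fun n => eLpNorm (h - f n) p μ) atTop (𝓝 0)) : g =ᵐ[μ] h := by
  have h3 : eLpNorm (g - h) p μ = 0 := by
    refine le_antisymm ?_ bot_le
    have := h1.add h2
    rw [add_zero] at this
    refine ge_of_tendsto this (Eventually.of_forall fun n => ?_)
    calc eLpNorm (g - h) p μ = eLpNorm ((g - f n) - (h - f n)) p μ := by congr 1; abel
      _ ≤ _ := eLpNorm_sub_le (hg.sub (hf n)) (hh.sub (hf n)) hp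
  rw [eLpNorm_eq_zero_iff (hg.sub hh) (by positivity)] at h3
  filter_upwards [h3] with x hx
  simpa [sub_eq_zero] using hx

theorem FT.of_tendsto {u : ℝ × Torus → ℂ} {w : ℤ × ℝ → ℂ} {un : ℕ → ℝ × Torus → ℂ}
    {wn : ℕ → ℤ × ℝ → ℂ} (h : ∀ n, FT (un n) (wn n)) (hu : MemLp u 2 vol)
    (hw : MemLp w 2 nu)
    (h1 : Tendsto (fun n => eLpNorm (u - un n) 2 vol) atTop (𝓝 0))
    (h2 : Tendsto (fun n => eLpNorm (w - wn n) 2 nu) atTop (𝓝 0)) : FT u w := by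
  have hy := exists_FT_right hu
  refine hy.congr_right ?_
  refine ae_eq_of_eLpNorm_sub_tendsto (p := 2) (by norm_num) (fun n => (h n).memLp_right.1)
    hy.memLp_right.1 hw.1 ?_ h2
  have h3 := fun n => (hy.sub (h n)).eLpNorm_eq
  simp only [h3] at h1
  have h4 := ENNReal.Tendsto.const_mul (a := (ENNReal.ofReal (2 * Real.pi) ^ (1 / 2 : ℝ))⁻¹) h1
    (Or.inr (by
      rw [ne_eq, ENNReal.inv_eq_top, ENNReal.rpow_eq_zero_iff_of_pos (by norm_num)]
      exact two_pi_ne_zero'))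
  rw [mul_zero] at h4
  refine h4.congr fun n => ?_
  rw [← mul_assoc, ENNReal.inv_mul_cancel, one_mul]
  · rw [ne_eq, ENNReal.rpow_eq_zero_iff_of_pos (by norm_num)]
    exact two_pi_ne_zero'
  · exact ENNReal.rpow_ne_top_of_nonneg (by norm_num) ENNReal.ofReal_ne_top

theorem FT_check_trunc {w : ℤ × ℝ → ℂ} (hw : MemLp w 2 nu) (n : ℕ) :
    FT (check (trunc n w)) (trunc n w) := FT_check (integrable_trunc hw n) (memLp_trunc hw n)

theorem exists_FT_left {w : ℤ × ℝ → ℂ} (hw : MemLp w 2 nu) : ∃ u, FT u w := by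
  set c := ENNReal.ofReal (2 * Real.pi) ^ (1 / 2 : ℝ) with hc
  have hct : c ≠ ⊤ := ENNReal.rpow_ne_top_of_nonneg (by norm_num) ENNReal.ofReal_ne_top
  set U : ℕ → Lp ℂ 2 ((volume : Measure ℝ).prod (volume : Measure Torus)) :=
    fun n => (FT_check_trunc hw n).memLp_left.toLp _ with hU
  set W : ℕ → Lp ℂ 2 nu := fun n => (memLp_trunc hw n).toLp _ with hW
  have hd : ∀ n m, dist (U n) (U m) = c.toReal * dist (W n) (W m) := fun n m => by
    rw [hU, hW]
    simp only [Lp.dist_def]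
    rw [← ENNReal.toReal_mul, ← eLpNorm_congr_ae ((MemLp.coeFn_toLp (FT_check_trunc hw n).memLp_left).sub
      (MemLp.coeFn_toLp (FT_check_trunc hw m).memLp_left)).symm,
      ← eLpNorm_congr_ae ((MemLp.coeFn_toLp (memLp_trunc hw n)).sub
      (MemLp.coeFn_toLp (memLp_trunc hw m))).symm,
      ((FT_check_trunc hw n).sub (FT_check_trunc hw m)).eLpNorm_eq]
  have hWt : Tendsto W atTop (𝓝 (hw.toLp w)) := by
    rw [Lp.tendsto_Lp_iff_tendsto_eLpNorm'']
    have := tendsto_trunc hw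
    refine this.congr fun n => ?_
    rw [eLpNorm_sub_comm]
  have hUc : CauchySeq U := by
    have hWc := hWt.cauchySeq
    rw [Metric.cauchySeq_iff] at hWc ⊢
    intro ε hε
    obtain ⟨N, hN⟩ := hWc (ε / (c.toReal + 1)) (by positivity)
    refine ⟨N, fun m hm n hn => ?_⟩
    rw [hd]
    have := hN m hm n hn
    rw [lt_div_iff₀ (by positivity)] at this
    nlinarith [dist_nonneg (x := W m) (y := W n), ENNReal.toReal_nonneg (a := c)]
  obtain ⟨u, hu⟩ := cauchySeq_tendsto_of_complete hUc
  refine ⟨u, FT.of_tendsto (FT_check_trunc hw) (Lp.memLp u) hw ?_ (tendsto_trunc hw)⟩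
  rw [Lp.tendsto_Lp_iff_tendsto_eLpNorm'] at hu
  refine hu.congr fun n => ?_
  rw [eLpNorm_sub_comm]
  refine eLpNorm_congr_ae (EventuallyEq.sub (EventuallyEq.refl _ _) ?_)
  exact MemLp.coeFn_toLp _

/-! ### The Fourier transform of integrable space-time functions -/

/-- The space-time Fourier transform of an integrable function. -/
def hat (H : ℝ × Torus → ℂ) (q : ℤ × ℝ) : ℂ := 𝓕 (coef H q.1) q.2

theorem hat_eq_integral {H : ℝ × Torus → ℂ} (hH : Integrable H vol) (q : ℤ × ℝ) :
    hat H q = ((2 * Real.pi)⁻¹ : ℝ) * ∫ z, H z * starRingEnd ℂ (chr z q) ∂vol := by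
  have hi : Integrable (fun z => H z * starRingEnd ℂ (chr z q)) vol := by
    refine hH.mul_bdd (c := 1) (Complex.continuous_conj.comp (continuous_chr q)).aestronglyMeasurable
      (ae_of_all _ fun z => ?_)
    simp [norm_chr]
  rw [hat, Real.fourier_real_eq, integral_prod _ hi, ← integral_const_mul]
  congr 1; ext t
  rw [coef, fourierCoeff_eq_integral, Circle.smul_def, smul_eq_mul, mul_left_comm,
    ← integral_const_mul]
  congr 2; ext x
  simp only [chr, map_mul, fourier_neg]
  have : (Real.fourierChar (-(t * q.2)) : ℂ) = starRingEnd ℂ (Real.fourierChar (q.2 * t) : ℂ) := by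
    rw [AddChar.map_neg_eq_inv, Circle.coe_inv_eq_conj, mul_comm]
  rw [this]; ring

theorem measurable_hat {H : ℝ × Torus → ℂ} (hH : Integrable H vol) :
    Measurable (hat H) := by
  refine measurable_from_prod_countable_right fun k => ?_
  exact (continuous_fourier_of_integrable (integrable_coef hH k)).measurable

theorem norm_hat_le {H : ℝ × Torus → ℂ} (hH : Integrable H vol) (q : ℤ × ℝ) :
    ‖hat H q‖ ≤ (2 * Real.pi)⁻¹ * ∫ z, ‖H z‖ ∂vol := by
  rw [hat_eq_integral hH, norm_mul, Complex.norm_real, Real.norm_of_nonneg (by positivity)]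
  gcongr
  refine (norm_integral_le_integral_norm _).trans_eq ?_
  simp [norm_chr]

theorem hat_sub {G H : ℝ × Torus → ℂ} (hG : Integrable G vol)
    (hH : Integrable H vol) : hat (G - H) = hat G - hat H := by
  ext q
  have h1 : 𝓕 (coef (G - H) q.1) q.2 = 𝓕 (coef G q.1 - coef H q.1) q.2 :=
    Real.fourier_congr_ae (coef_sub_ae hG hH q.1) q.2
  simp only [hat, h1, Pi.sub_apply, Real.fourier_real_eq, smul_sub]
  have := fun (f : ℝ → ℂ) (hf : Integrable f) =>
    (Real.fourierIntegral_convergent_iff (V := ℝ) q.2).2 hf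
  refine integral_sub ?_ ?_
  · simpa [mul_comm] using this _ (integrable_coef hG q.1)
  · simpa [mul_comm] using this _ (integrable_coef hH q.1)

theorem FT_hat {H : ℝ × Torus → ℂ} (h1 : Integrable H vol)
    (h2 : MemLp H 2 vol) : FT H (hat H) := by
  have h := exists_FT_right h2
  refine h.congr_right (ae_nu.2 fun k => ?_)
  exact l2Fourier_ae_eq_fourier (integrable_coef h1 k) (memLp_coef h2 k)

theorem integral_hat_mul_conj {H : ℝ × Torus → ℂ} {w : ℤ × ℝ → ℂ}
    (hH : Integrable H vol) (hw : Integrable w nu) :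
    ∫ q, hat H q * starRingEnd ℂ (w q) ∂nu = ((2 * Real.pi)⁻¹ : ℝ) *
      ∫ z, H z * starRingEnd ℂ (check w z) ∂vol := by
  have hi : Integrable (Function.uncurry fun (z : ℝ × Torus) (q : ℤ × ℝ) =>
      H z * starRingEnd ℂ (w q * chr z q)) (vol.prod nu) := by
    have hw' : Integrable (fun q => starRingEnd ℂ (w q)) nu :=
      (LinearIsometryEquiv.integrable_comp_iff Complex.conjLIE).2 hw
    have h1 := hH.mul_prod hw'
    refine (h1.mul_bdd (c := 1) (g := fun p : (ℝ × Torus) × (ℤ × ℝ) => starRingEnd ℂ (chr p.1 p.2))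
      ?_ (ae_of_all _ fun p => ?_)).congr (ae_of_all _ fun p => ?_)
    · exact (Complex.continuous_conj.measurable.comp
        (measurable_chr measurable_fst measurable_snd)).aestronglyMeasurable
    · simp [norm_chr]
    · simp [Function.uncurry]; ring
  have e1 : ∀ z, H z * starRingEnd ℂ (check w z)
      = ∫ q, H z * starRingEnd ℂ (w q * chr z q) ∂nu := fun z => by
    rw [integral_const_mul, check, ← integral_conj]
  simp_rw [e1]
  rw [integral_integral_swap hi, ← integral_const_mul]
  congr 1; ext q
  rw [hat_eq_integral hH, mul_assoc, ← integral_mul_const]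
  congr 2; ext z
  simp; ring

/-! ### Modulation weights and the bilinear estimate -/

/-- The symbol `k⁴ + k²` of `∂ₓ⁴ - ∂ₓ²`. -/
def symb (k : ℤ) : ℝ := (k : ℝ) ^ 4 + (k : ℝ) ^ 2

/-- The modulation `τ + k⁴ + k²` at `τ = 2πξ`. -/
def modul (q : ℤ × ℝ) : ℝ := 2 * Real.pi * q.2 + symb q.1

/-- The weight `⟨τ + k⁴ + k²⟩^β`. -/
def wt (β : ℝ) (q : ℤ × ℝ) : ℝ := (1 + modul q ^ 2) ^ (β / 2)

theorem wt_pos (β : ℝ) (q : ℤ × ℝ) : 0 < wt β q := Real.rpow_pos_of_pos (by positivity) _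

theorem wt_mul (β β' : ℝ) (q : ℤ × ℝ) : wt β q * wt β' q = wt (β + β') q := by
  rw [wt, wt, wt, ← Real.rpow_add (by positivity)]; ring_nf

theorem wt_zero (q : ℤ × ℝ) : wt 0 q = 1 := by simp [wt]

theorem wt_mono {β β' : ℝ} (h : β ≤ β') (q : ℤ × ℝ) : wt β q ≤ wt β' q :=
  Real.rpow_le_rpow_of_exponent_le (by nlinarith [sq_nonneg (modul q)]) (by linarith)

theorem measurable_modul : Measurable modul := by
  have h : Measurable symb := measurable_from_top
  exact (measurable_snd.const_mul _).add (h.comp measurable_fst)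

theorem measurable_wt (β : ℝ) : Measurable (wt β) :=
  ((measurable_modul.pow_const 2).const_add 1).pow_const _

theorem abs_symb_sub_ge (K k j : ℤ) :
    2 * (((k : ℝ) - j) * (k + j - K)) ^ 2
      ≤ |(symb k + symb (K - k)) - (symb j + symb (K - j))| := by
  set X : ℝ := ((k : ℝ) - j) * (k + j - K) with hX
  set A : ℝ := (2 * (k : ℝ) - K) ^ 2
  set B : ℝ := (2 * (j : ℝ) - K) ^ 2
  have hAB : A - B = 4 * X := by simp only [A, B, X]; ring
  have hA : 0 ≤ A := sq_nonneg _
  have hB : 0 ≤ B := sq_nonneg _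
  have e : (symb k + symb (K - k)) - (symb j + symb (K - j))
      = 4 * X * ((A + B) / 8 + 6 * (K : ℝ) ^ 2 / 8 + 1 / 2) := by
    rw [← hAB]; simp only [symb, A, B]; push_cast; ring
  rw [e, abs_mul, abs_mul, abs_of_pos (show (0 : ℝ) < 4 by norm_num)]
  have h1 : |4 * X| ≤ A + B := by rw [← hAB]; exact abs_le.2 ⟨by linarith, by linarith⟩
  rw [abs_mul, abs_of_pos (show (0 : ℝ) < 4 by norm_num)] at h1
  have h2 : |X| / 2 ≤ |(A + B) / 8 + 6 * (K : ℝ) ^ 2 / 8 + 1 / 2| := by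
    refine le_trans ?_ (le_abs_self _)
    nlinarith [sq_nonneg (K : ℝ)]
  rw [← sq_abs X]
  nlinarith [abs_nonneg X, mul_le_mul_of_nonneg_left h2 (abs_nonneg X)]

theorem rpow_neg_mul_le {x y δ β : ℝ} (hδ : 0 ≤ δ) (h : δ ≤ β) :
    (1 + x ^ 2) ^ (-β) * (1 + y ^ 2) ^ (-β) ≤ 4 ^ δ * (1 + (x + y) ^ 2) ^ (-δ) *
      ((1 + x ^ 2) ^ (-(2 * β - δ)) + (1 + y ^ 2) ^ (-(2 * β - δ))) := by
  have key : ∀ x y : ℝ, x ^ 2 ≤ y ^ 2 → (1 + x ^ 2) ^ (-β) * (1 + y ^ 2) ^ (-β)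
      ≤ 4 ^ δ * (1 + (x + y) ^ 2) ^ (-δ) * (1 + x ^ 2) ^ (-(2 * β - δ)) := by
    intro x y hxy
    have hA : 0 < 1 + x ^ 2 := by positivity
    have hB : 0 < 1 + y ^ 2 := by positivity
    have hS : 0 < 1 + (x + y) ^ 2 := by positivity
    have e1 : (1 + y ^ 2) ^ (-β) = (1 + y ^ 2) ^ (-δ) * (1 + y ^ 2) ^ (-(β - δ)) := by
      rw [← Real.rpow_add hB]; ring_nf
    have e2 : (1 + x ^ 2) ^ (-(2 * β - δ)) = (1 + x ^ 2) ^ (-β) * (1 + x ^ 2) ^ (-(β - δ)) := by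
      rw [← Real.rpow_add hA]; ring_nf
    have h1 : (1 + y ^ 2) ^ (-(β - δ)) ≤ (1 + x ^ 2) ^ (-(β - δ)) :=
      Real.rpow_le_rpow_of_nonpos hA (by linarith) (by linarith)
    have h2 : (1 + y ^ 2) ^ (-δ) ≤ 4 ^ δ * (1 + (x + y) ^ 2) ^ (-δ) := by
      have : (1 + (x + y) ^ 2) / 4 ≤ 1 + y ^ 2 := by nlinarith [sq_nonneg (x - y)]
      refine (Real.rpow_le_rpow_of_nonpos (by positivity) this (by linarith)).trans_eq ?_
      rw [Real.div_rpow hS.le (by norm_num), Real.rpow_neg (by norm_num : (0 : ℝ) ≤ 4), div_inv_eq_mul,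
        mul_comm]
    rw [e1, e2]
    calc _ = (1 + y ^ 2) ^ (-δ) * ((1 + x ^ 2) ^ (-β) * (1 + y ^ 2) ^ (-(β - δ))) := by ring
      _ ≤ (4 ^ δ * (1 + (x + y) ^ 2) ^ (-δ)) * ((1 + x ^ 2) ^ (-β) * (1 + x ^ 2) ^ (-(β - δ))) := by
        gcongr
  have n1 : 0 ≤ 4 ^ δ * (1 + (x + y) ^ 2) ^ (-δ) := by positivity
  rw [mul_add]
  rcases le_total (x ^ 2) (y ^ 2) with hxy | hxy
  · exact (key x y hxy).trans (le_add_of_nonneg_right (mul_nonneg n1 (by positivity)))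
  · have h := key y x hxy
    rw [mul_comm, add_comm y x] at h
    exact h.trans (le_add_of_nonneg_left (mul_nonneg n1 (by positivity)))

theorem lintegral_rpow_lt_top {r : ℝ} (hr : 1 / 2 < r) :
    ∫⁻ x : ℝ, ENNReal.ofReal ((1 + x ^ 2) ^ (-r)) < ⊤ := by
  have h := integrable_rpow_neg_one_add_norm_sq (E := ℝ) (μ := volume) (r := 2 * r)
    (by simp; linarith)
  have := h.lintegral_lt_top
  simpa [Real.norm_eq_abs, sq_abs, neg_div] using this

theorem lintegral_rpow_affine_le {r : ℝ} (hr : 1 / 2 < r) (c : ℝ) :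
    ∫⁻ x : ℝ, ENNReal.ofReal ((1 + (2 * Real.pi * x + c) ^ 2) ^ (-r))
      ≤ ∫⁻ x : ℝ, ENNReal.ofReal ((1 + x ^ 2) ^ (-r)) := by
  rw [← lintegral_add_right_eq_self (μ := (volume : Measure ℝ))
    (fun x : ℝ => ENNReal.ofReal ((1 + x ^ 2) ^ (-r))) (c / (2 * Real.pi))]
  refine lintegral_mono fun x => ENNReal.ofReal_le_ofReal ?_
  refine Real.rpow_le_rpow_of_nonpos (by positivity) ?_ (by linarith)
  have h : 2 * Real.pi * x + c = 2 * Real.pi * (x + c / (2 * Real.pi)) := by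
    field_simp
  rw [h, mul_pow]
  have h2 : 1 ≤ (2 * Real.pi) ^ 2 := by nlinarith [Real.pi_gt_three]
  nlinarith [sq_nonneg (x + c / (2 * Real.pi))]

theorem tsum_int_rpow_lt_top {r : ℝ} (hr : 1 / 2 < r) :
    ∑' l : ℤ, ENNReal.ofReal ((1 + (l : ℝ) ^ 2) ^ (-r)) < ⊤ := by
  have h1 : Summable fun l : ℤ => |(l : ℝ)| ^ (-(2 * r)) :=
    Real.summable_abs_int_rpow (by linarith)
  have h2 : Summable fun l : ℤ => (1 + (l : ℝ) ^ 2) ^ (-r) := by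
    refine Summable.of_norm_bounded_eventually h1 ?_
    have : ∀ᶠ l : ℤ in cofinite, l ≠ 0 := (finite_singleton (0 : ℤ)).compl_mem_cofinite
    filter_upwards [this] with l hl
    rw [Real.norm_of_nonneg (by positivity)]
    have hl' : 0 < |(l : ℝ)| := by simpa using hl
    have : |(l : ℝ)| ^ (-(2 * r)) = ((l : ℝ) ^ 2) ^ (-r) := by
      rw [← sq_abs, ← Real.rpow_natCast, ← Real.rpow_mul hl'.le]; norm_num
    rw [this]
    exact Real.rpow_le_rpow_of_nonpos (by positivity) (by linarith) (by linarith)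
  exact h2.tsum_ofReal_lt_top

/-- The counting estimate: uniformly in `τ` and `K`, the level sets of `k⁴ + k² + (K-k)⁴ + (K-k)²`
are sparse. -/
theorem tsum_resonance_le {δ : ℝ} (hδ : 1 / 8 < δ) (K : ℤ) (τ : ℝ) :
    ∑' k : ℤ, ENNReal.ofReal ((1 + (τ + (symb k + symb (K - k))) ^ 2) ^ (-δ))
      ≤ ENNReal.ofReal (18 ^ δ) *
        (2 * ∑' l : ℤ, ENNReal.ofReal ((1 + (l : ℝ) ^ 2) ^ (-(4 * δ)))) := by
  set a : ℤ → ℝ := fun k => τ + (symb k + symb (K - k))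
  obtain ⟨k₀, hk₀⟩ : ∃ k₀, ∀ k, |a k₀| ≤ |a k| + 1 := by
    have hb : BddBelow (range fun k => |a k|) := ⟨0, by rintro _ ⟨k, rfl⟩; exact abs_nonneg _⟩
    obtain ⟨k₀, h⟩ := exists_lt_of_ciInf_lt (f := fun k => |a k|) (lt_add_one _)
    exact ⟨k₀, fun k => h.le.trans (by simpa using ciInf_le hb k)⟩
  have key : ∀ k : ℤ, (1 + a k ^ 2) ^ (-δ) ≤ 18 ^ δ * ((1 + ((k - k₀ : ℤ) : ℝ) ^ 2) ^ (-(4 * δ))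
      + (1 + ((k - (K - k₀) : ℤ) : ℝ) ^ 2) ^ (-(4 * δ))) := by
    intro k
    have h1 := abs_symb_sub_ge K k k₀
    have h2 : |(symb k + symb (K - k)) - (symb k₀ + symb (K - k₀))| ≤ 2 * |a k| + 1 := by
      calc _ = |a k - a k₀| := by simp only [a]; congr 1; ring
        _ ≤ |a k| + |a k₀| := abs_sub _ _
        _ ≤ _ := by linarith [hk₀ k]
    have h3 : ∀ d : ℝ, d ^ 4 ≤ (((k : ℝ) - k₀) * (k + k₀ - K)) ^ 2 →
        (1 + a k ^ 2) ^ (-δ) ≤ 18 ^ δ * (1 + d ^ 2) ^ (-(4 * δ)) := by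
      intro d hd
      have h4 : d ^ 4 ≤ |a k| + 1 / 2 := by linarith
      have h5 : (1 + d ^ 2) ^ 2 ≤ 2 * (|a k| + 3 / 2) := by nlinarith [sq_nonneg (d ^ 2 - 1)]
      have h6 : (1 + d ^ 2) ^ 4 ≤ 18 * (1 + a k ^ 2) := by
        have : (1 + d ^ 2) ^ 4 ≤ (2 * (|a k| + 3 / 2)) ^ 2 := by
          have := pow_le_pow_left₀ (by positivity) h5 2
          calc _ = ((1 + d ^ 2) ^ 2) ^ 2 := by ring
            _ ≤ _ := this
        nlinarith [sq_abs (a k), sq_nonneg (|a k| - 1), sq_nonneg (a k)]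
      have h7 : (1 + d ^ 2) ^ 4 / 18 ≤ 1 + a k ^ 2 := by linarith
      refine (Real.rpow_le_rpow_of_nonpos (by positivity) h7 (by linarith)).trans_eq ?_
      rw [Real.div_rpow (by positivity) (by norm_num), Real.rpow_neg (by norm_num : (0 : ℝ) ≤ 18),
        div_inv_eq_mul, mul_comm, ← Real.rpow_natCast, ← Real.rpow_mul (by positivity)]
      norm_num
    have hn : ∀ d : ℝ, 0 ≤ (18 : ℝ) ^ δ * (1 + d ^ 2) ^ (-(4 * δ)) := fun d => by positivity
    rw [mul_add]
    rcases le_total (((k - k₀ : ℤ) : ℝ) ^ 2) (((k - (K - k₀) : ℤ) : ℝ) ^ 2) with h | h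
    · refine (h3 ((k - k₀ : ℤ) : ℝ) ?_).trans (le_add_of_nonneg_right (hn _))
      push_cast at h ⊢
      nlinarith [mul_le_mul_of_nonneg_left h (sq_nonneg ((k : ℝ) - k₀))]
    · refine (h3 ((k - (K - k₀) : ℤ) : ℝ) ?_).trans (le_add_of_nonneg_left (hn _))
      push_cast at h ⊢
      nlinarith [mul_le_mul_of_nonneg_left h (sq_nonneg ((k : ℝ) - (K - k₀)))]
  have hshift : ∀ c : ℤ, ∑' k : ℤ, ENNReal.ofReal ((1 + ((k - c : ℤ) : ℝ) ^ 2) ^ (-(4 * δ)))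
      = ∑' l : ℤ, ENNReal.ofReal ((1 + (l : ℝ) ^ 2) ^ (-(4 * δ))) := fun c =>
    (Equiv.subRight c).tsum_eq fun l : ℤ => ENNReal.ofReal ((1 + (l : ℝ) ^ 2) ^ (-(4 * δ)))
  calc _ ≤ ∑' k : ℤ, ENNReal.ofReal (18 ^ δ) *
        (ENNReal.ofReal ((1 + ((k - k₀ : ℤ) : ℝ) ^ 2) ^ (-(4 * δ)))
          + ENNReal.ofReal ((1 + ((k - (K - k₀) : ℤ) : ℝ) ^ 2) ^ (-(4 * δ)))) := by
        refine ENNReal.tsum_le_tsum fun k => ?_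
        rw [← ENNReal.ofReal_add (by positivity) (by positivity),
          ← ENNReal.ofReal_mul (by positivity)]
        exact ENNReal.ofReal_le_ofReal (key k)
    _ = _ := by
        rw [ENNReal.tsum_mul_left, ENNReal.tsum_add, hshift, hshift, two_mul]

theorem exists_lintegral_wt_conv_le {β : ℝ} (h1 : 5 / 16 < β) :
    ∃ C : ℝ≥0∞, C ≠ ⊤ ∧ ∀ Q : ℤ × ℝ,
      ∫⁻ q, ENNReal.ofReal (wt (-β) q ^ 2 * wt (-β) (Q - q) ^ 2) ∂nu ≤ C := by
  set δ := β - 3 / 16 with hδ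
  set r := 2 * β - δ with hr
  have hδ' : 1 / 8 < δ := by linarith
  have hr' : 1 / 2 < r := by linarith
  set I := ∫⁻ x : ℝ, ENNReal.ofReal ((1 + x ^ 2) ^ (-r)) with hI
  set D := ENNReal.ofReal (18 ^ δ) *
        (2 * ∑' l : ℤ, ENNReal.ofReal ((1 + (l : ℝ) ^ 2) ^ (-(4 * δ)))) with hD
  have hDt : D ≠ ⊤ := ENNReal.mul_ne_top ENNReal.ofReal_ne_top
    (ENNReal.mul_ne_top (by norm_num) (tsum_int_rpow_lt_top (by linarith)).ne)
  refine ⟨ENNReal.ofReal (4 ^ δ) * (I + I) * D, ?_, fun Q => ?_⟩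
  · have := (lintegral_rpow_lt_top hr').ne
    exact ENNReal.mul_ne_top (ENNReal.mul_ne_top ENNReal.ofReal_ne_top
      (ENNReal.add_ne_top.2 ⟨this, this⟩)) hDt
  have hw : ∀ q, wt (-β) q ^ 2 = (1 + modul q ^ 2) ^ (-β) := fun q => by
    rw [wt, ← Real.rpow_natCast, ← Real.rpow_mul (by positivity)]
    congr 1; push_cast; ring
  rw [lintegral_nu]
  calc _ ≤ ∑' k : ℤ, ENNReal.ofReal (4 ^ δ) *
          ENNReal.ofReal ((1 + (2 * Real.pi * Q.2 + (symb k + symb (Q.1 - k))) ^ 2) ^ (-δ))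
          * (I + I) := by
        refine ENNReal.tsum_le_tsum fun k => ?_
        calc _ ≤ ∫⁻ ξ : ℝ, ENNReal.ofReal (4 ^ δ) *
              ENNReal.ofReal ((1 + (2 * Real.pi * Q.2 + (symb k + symb (Q.1 - k))) ^ 2) ^ (-δ))
              * (ENNReal.ofReal ((1 + (2 * Real.pi * ξ + symb k) ^ 2) ^ (-r)) +
                ENNReal.ofReal ((1 + (2 * Real.pi * (Q.2 - ξ) + symb (Q.1 - k)) ^ 2) ^ (-r))) := by
              refine lintegral_mono fun ξ => ?_
              simp only [hw]
              rw [← ENNReal.ofReal_add (by positivity) (by positivity),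
                ← ENNReal.ofReal_mul (by positivity), ← ENNReal.ofReal_mul (by positivity)]
              refine ENNReal.ofReal_le_ofReal ?_
              have := rpow_neg_mul_le (x := modul (k, ξ)) (y := modul (Q - (k, ξ))) (δ := δ) (β := β)
                (by linarith) (by linarith)
              have e : modul (k, ξ) + modul (Q - (k, ξ))
                  = 2 * Real.pi * Q.2 + (symb k + symb (Q.1 - k)) := by
                simp only [modul, Prod.fst_sub, Prod.snd_sub]; ring
              rw [e] at this
              exact this
          _ ≤ _ := by
              rw [lintegral_const_mul' _ _ (ENNReal.mul_ne_top ENNReal.ofReal_ne_top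
                ENNReal.ofReal_ne_top)]
              gcongr
              rw [lintegral_add_left (by fun_prop)]
              refine add_le_add (lintegral_rpow_affine_le hr' _) ?_
              rw [lintegral_sub_left_eq_self (μ := (volume : Measure ℝ)) (fun x : ℝ =>
                ENNReal.ofReal ((1 + (2 * Real.pi * x + symb (Q.1 - k)) ^ 2) ^ (-r))) Q.2]
              exact lintegral_rpow_affine_le hr' _
    _ = ENNReal.ofReal (4 ^ δ) * (I + I) * ∑' k : ℤ,
          ENNReal.ofReal ((1 + (2 * Real.pi * Q.2 + (symb k + symb (Q.1 - k))) ^ 2) ^ (-δ)) := by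
        rw [← ENNReal.tsum_mul_left]; congr 1; ext k; ring
    _ ≤ _ := by gcongr; exact tsum_resonance_le hδ' _ _

/-- Convolution of nonnegative functions on the frequency space. -/
def lconv (f g : ℤ × ℝ → ℝ≥0∞) (Q : ℤ × ℝ) : ℝ≥0∞ := ∫⁻ q, f q * g (Q - q) ∂nu

theorem AEMeasurable.lconv_integrand {f g : ℤ × ℝ → ℝ≥0∞} (hf : AEMeasurable f nu)
    (hg : AEMeasurable g nu) :
    AEMeasurable (fun p : (ℤ × ℝ) × (ℤ × ℝ) => f p.2 * g (p.1 - p.2)) (nu.prod nu) :=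
  (hf.comp_quasiMeasurePreserving Measure.quasiMeasurePreserving_snd).mul
    (hg.comp_quasiMeasurePreserving (quasiMeasurePreserving_sub_of_right_invariant nu nu))

theorem AEMeasurable.lconv {f g : ℤ × ℝ → ℝ≥0∞} (hf : AEMeasurable f nu)
    (hg : AEMeasurable g nu) : AEMeasurable (lconv f g) nu :=
  (AEMeasurable.lconv_integrand hf hg).lintegral_prod_right'

theorem lintegral_lconv {f g : ℤ × ℝ → ℝ≥0∞} (hf : AEMeasurable f nu)
    (hg : AEMeasurable g nu) :
    ∫⁻ Q, lconv f g Q ∂nu = (∫⁻ q, f q ∂nu) * ∫⁻ q, g q ∂nu := by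
  simp only [lconv]
  rw [lintegral_lintegral_swap (AEMeasurable.lconv_integrand hf hg)]
  simp_rw [fun q : ℤ × ℝ => lintegral_const_mul'' (f q) (μ := nu) (f := fun Q => g (Q - q))
    (hg.comp_quasiMeasurePreserving (measurePreserving_sub_right nu q).quasiMeasurePreserving),
    lintegral_sub_right_eq_self (μ := nu) g]
  exact lintegral_mul_const'' _ hf

theorem lintegral_mul_sq_le {α : Type*} [MeasurableSpace α] {μ : Measure α} {f g : α → ℝ≥0∞}
    (hf : AEMeasurable f μ) (hg : AEMeasurable g μ) :
    (∫⁻ x, f x * g x ∂μ) ^ 2 ≤ (∫⁻ x, f x ^ 2 ∂μ) * ∫⁻ x, g x ^ 2 ∂μ := by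
  have h := ENNReal.lintegral_mul_le_Lp_mul_Lq μ Real.HolderConjugate.two_two hf hg
  have h2 := pow_le_pow_left' h 2
  rw [mul_pow, ← ENNReal.rpow_natCast, ← ENNReal.rpow_natCast, ← ENNReal.rpow_natCast,
    ← ENNReal.rpow_mul, ← ENNReal.rpow_mul] at h2
  simpa using h2

/-- The bilinear `L²` estimate behind the `L⁴` Strichartz inequality. -/
theorem exists_lintegral_lconv_sq_le {β : ℝ} (h1 : 5 / 16 < β) :
    ∃ C : ℝ≥0∞, C ≠ ⊤ ∧ ∀ f g : ℤ × ℝ → ℝ≥0∞, AEMeasurable f nu → AEMeasurable g nu →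
      ∫⁻ Q, lconv f g Q ^ 2 ∂nu ≤ C * ((∫⁻ q, (ENNReal.ofReal (wt β q) * f q) ^ 2 ∂nu) *
        ∫⁻ q, (ENNReal.ofReal (wt β q) * g q) ^ 2 ∂nu) := by
  obtain ⟨C, hC, hC'⟩ := exists_lintegral_wt_conv_le h1
  refine ⟨C, hC, fun f g hf hg => ?_⟩
  have hwm := fun b => (measurable_wt b).ennreal_ofReal
  have hF : AEMeasurable (fun q => (ENNReal.ofReal (wt β q) * f q) ^ 2) nu :=
    ((hwm β).aemeasurable.mul hf).pow_const 2
  have hG : AEMeasurable (fun q => (ENNReal.ofReal (wt β q) * g q) ^ 2) nu :=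
    ((hwm β).aemeasurable.mul hg).pow_const 2
  rw [← lintegral_lconv hF hG, ← lintegral_const_mul'' _ (AEMeasurable.lconv hF hG)]
  refine lintegral_mono fun Q => ?_
  have hw1 : ∀ q, ENNReal.ofReal (wt (-β) q) * ENNReal.ofReal (wt β q) = 1 := fun q => by
    rw [← ENNReal.ofReal_mul (wt_pos _ _).le, wt_mul]; simp [wt_zero]
  have e : lconv f g Q = ∫⁻ q, (ENNReal.ofReal (wt (-β) q) * ENNReal.ofReal (wt (-β) (Q - q))) *
      ((ENNReal.ofReal (wt β q) * f q) * (ENNReal.ofReal (wt β (Q - q)) * g (Q - q))) ∂nu := by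
    rw [lconv]; congr 1; ext q
    calc f q * g (Q - q) = (ENNReal.ofReal (wt (-β) q) * ENNReal.ofReal (wt β q)) *
          (ENNReal.ofReal (wt (-β) (Q - q)) * ENNReal.ofReal (wt β (Q - q))) * (f q * g (Q - q)) := by
            rw [hw1, hw1, one_mul, one_mul]
      _ = _ := by ring
  have hs : Measurable fun q : ℤ × ℝ => Q - q := measurable_const.sub measurable_id
  have hgs : AEMeasurable (fun q => g (Q - q)) nu :=
    hg.comp_quasiMeasurePreserving (quasiMeasurePreserving_sub_left nu Q)
  rw [e]
  refine (lintegral_mul_sq_le (((hwm _).mul ((hwm _).comp hs)).aemeasurable)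
    (((hwm _).aemeasurable.mul hf).mul (((hwm _).comp hs).aemeasurable.mul hgs))).trans ?_
  refine mul_le_mul' (le_trans (le_of_eq ?_) (hC' Q)) (le_of_eq ?_)
  · congr 1; ext q
    simp only [Pi.mul_apply, Function.comp]
    rw [← ENNReal.ofReal_mul (wt_pos _ _).le, ← ENNReal.ofReal_pow (by
      have := wt_pos (-β) q; have := wt_pos (-β) (Q - q); positivity), mul_pow]
  · rw [lconv]; congr 1; ext q; simp only [Pi.mul_apply, Function.comp]; ring

/-! ### Weighted norms -/

theorem enorm_complex_ofReal (r : ℝ) : ‖(r : ℂ)‖ₑ = ‖r‖ₑ := by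
  rw [← ofReal_norm, ← ofReal_norm, Complex.norm_real]

/-- The norm `‖m(k) ⟨τ + k⁴ + k²⟩^β w‖` in `L²(ℤ × ℝ)`. -/
def XN (β : ℝ) (m : ℤ → ℝ) (w : ℤ × ℝ → ℂ) : ℝ≥0∞ :=
  eLpNorm (fun q => ((m q.1 * wt β q : ℝ) : ℂ) * w q) 2 nu

theorem measurable_fst_comp (m : ℤ → ℝ) : Measurable fun q : ℤ × ℝ => m q.1 :=
  (measurable_from_top (f := m)).comp measurable_fst

theorem measurable_weight (β : ℝ) (m : ℤ → ℝ) : Measurable fun q : ℤ × ℝ => m q.1 * wt β q :=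
  (measurable_fst_comp m).mul (measurable_wt β)

theorem aestronglyMeasurable_weight_mul {w : ℤ × ℝ → ℂ} (hw : AEStronglyMeasurable w nu)
    (β : ℝ) (m : ℤ → ℝ) :
    AEStronglyMeasurable (fun q => ((m q.1 * wt β q : ℝ) : ℂ) * w q) nu :=
  (Complex.measurable_ofReal.comp (measurable_weight β m)).aestronglyMeasurable.mul hw

theorem XN_sq (β : ℝ) (m : ℤ → ℝ) (w : ℤ × ℝ → ℂ) :
    XN β m w ^ 2 = ∫⁻ q, (ENNReal.ofReal (|m q.1| * wt β q) * ‖w q‖ₑ) ^ 2 ∂nu := by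
  rw [XN, eLpNorm_two_sq]
  congr 1; ext q
  rw [enorm_mul, enorm_complex_ofReal, ← ofReal_norm, Real.norm_eq_abs, abs_mul,
    abs_of_pos (wt_pos β q)]

theorem XN_congr {β : ℝ} {m : ℤ → ℝ} {w y : ℤ × ℝ → ℂ} (h : w =ᵐ[nu] y) : XN β m w = XN β m y :=
  eLpNorm_congr_ae (by filter_upwards [h] with q hq; rw [hq])

theorem XN_mono_enorm {β β' : ℝ} {m m' : ℤ → ℝ} {w y : ℤ × ℝ → ℂ}
    (h : ∀ q, |m q.1| * wt β q * ‖w q‖ ≤ |m' q.1| * wt β' q * ‖y q‖) : XN β m w ≤ XN β' m' y := by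
  refine eLpNorm_mono fun q => ?_
  have := h q
  simpa [abs_of_pos (wt_pos _ _)] using this

theorem XN_mono {β β' : ℝ} (hβ : β ≤ β') {m m' : ℤ → ℝ} (hm : ∀ k, |m k| ≤ |m' k|)
    (w : ℤ × ℝ → ℂ) : XN β m w ≤ XN β' m' w :=
  XN_mono_enorm fun q => by
    have h1 := wt_mono hβ q
    have h2 := (wt_pos β q).le
    exact mul_le_mul_of_nonneg_right (mul_le_mul (hm _) h1 h2 (abs_nonneg _)) (norm_nonneg _)

theorem XN_add_le {β : ℝ} {m : ℤ → ℝ} {w y : ℤ × ℝ → ℂ} (hw : AEStronglyMeasurable w nu)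
    (hy : AEStronglyMeasurable y nu) : XN β m (w + y) ≤ XN β m w + XN β m y := by
  refine le_trans (le_of_eq ?_) (eLpNorm_add_le (aestronglyMeasurable_weight_mul hw β m)
    (aestronglyMeasurable_weight_mul hy β m) (by norm_num))
  rw [XN]; congr 1; ext q; simp [mul_add]

theorem XN_const_mul (β : ℝ) (m : ℤ → ℝ) (c : ℂ) (w : ℤ × ℝ → ℂ) :
    XN β m (c • w) = ‖c‖ₑ * XN β m w := by
  rw [XN, XN, ← eLpNorm_const_smul]
  congr 1; ext q; simp; ring

theorem XN_sub_le {β : ℝ} {m : ℤ → ℝ} {w y : ℤ × ℝ → ℂ} (hw : AEStronglyMeasurable w nu)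
    (hy : AEStronglyMeasurable y nu) : XN β m (w - y) ≤ XN β m w + XN β m y := by
  have h := XN_add_le (β := β) (m := m) hw (hy.const_smul (-1 : ℂ))
  rw [XN_const_mul] at h
  simpa [sub_eq_add_neg] using h

theorem XN_trunc_le (β : ℝ) (m : ℤ → ℝ) (n : ℕ) (w : ℤ × ℝ → ℂ) :
    XN β m (trunc n w) ≤ XN β m w :=
  XN_mono_enorm fun q => by
    by_cases h : q ∈ box n
    · simp [trunc, h]
    · simp only [trunc, h, not_false_eq_true, indicator_of_notMem, norm_zero, mul_zero]
      have := (wt_pos β q).le; positivity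

theorem tendsto_XN_trunc {β : ℝ} {m : ℤ → ℝ} {w : ℤ × ℝ → ℂ} (hw : AEStronglyMeasurable w nu)
    (h : XN β m w ≠ ⊤) : Tendsto (fun n => XN β m (w - trunc n w)) atTop (𝓝 0) := by
  refine tendsto_eLpNorm_of_sq ?_
  have h2 : ∫⁻ q, ‖((m q.1 * wt β q : ℝ) : ℂ) * w q‖ₑ ^ 2 ∂nu ≠ ⊤ := by
    rw [← eLpNorm_two_sq]; exact ENNReal.pow_ne_top h
  refine (tendsto_lintegral_compl_box ((aestronglyMeasurable_weight_mul hw β m).enorm.pow_const 2)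
    h2).congr fun n => ?_
  congr 1; ext q
  by_cases hq : q ∈ box n <;> simp [trunc, hq]

theorem lintegral_le_of_box {F : ℤ × ℝ → ℝ≥0∞} (hF : AEMeasurable F nu) {B : ℝ≥0∞}
    (h : ∀ n, ∫⁻ q, (box n).indicator F q ∂nu ≤ B) : ∫⁻ q, F q ∂nu ≤ B := by
  calc ∫⁻ q, F q ∂nu = ∫⁻ q, liminf (fun n => (box n).indicator F q) atTop ∂nu := by
        congr 1; ext q
        refine (Tendsto.liminf_eq ?_).symm
        refine tendsto_const_nhds.congr' ?_
        filter_upwards [eventually_mem_box q] with n hn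
        simp [hn]
    _ ≤ liminf (fun n => ∫⁻ q, (box n).indicator F q ∂nu) atTop :=
        lintegral_liminf_le' fun n => hF.indicator (measurableSet_box n)
    _ ≤ B := (liminf_le_liminf (Eventually.of_forall h)).trans_eq (by simp)

/-- Duality: a bound for pairings with band-limited functions bounds the dual weighted norm. -/
theorem XN_neg_le_of_pairing {β : ℝ} {m : ℤ → ℝ} {h : ℤ × ℝ → ℂ} (hh : Measurable h)
    {D : ℝ} (hD : ∀ q, ‖h q‖ ≤ D) {B : ℝ≥0∞}
    (H : ∀ (n : ℕ) (ψ : ℤ × ℝ → ℂ), MemLp ψ 2 nu → trunc n ψ = ψ → XN β 1 ψ ≠ ⊤ →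
      ‖∫ q, h q * starRingEnd ℂ (m q.1 * ψ q) ∂nu‖ₑ ≤ B * XN β 1 ψ) :
    XN (-β) m h ≤ B := by
  rw [← ENNReal.pow_le_pow_left_iff (n := 2) (by norm_num), XN_sq]
  have hFm : AEMeasurable (fun q => (ENNReal.ofReal (|m q.1| * wt (-β) q) * ‖h q‖ₑ) ^ 2) nu := by
    refine AEMeasurable.pow_const (AEMeasurable.mul ?_ hh.enorm.aemeasurable) 2
    exact (((measurable_fst_comp (fun k => |m k|)).mul (measurable_wt _)).ennreal_ofReal).aemeasurable
  refine lintegral_le_of_box hFm fun n => ?_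
  set A := ∫⁻ q, (box n).indicator
    (fun q => (ENNReal.ofReal (|m q.1| * wt (-β) q) * ‖h q‖ₑ) ^ 2) q ∂nu with hA
  set ψ : ℤ × ℝ → ℂ := trunc n fun q => ((m q.1 * wt (-β) q * wt (-β) q : ℝ) : ℂ) * h q with hψ
  -- all weights are bounded on the box
  obtain ⟨Mm, hMm⟩ : ∃ M : ℝ, ∀ q ∈ box n, |m q.1| ≤ M := by
    obtain ⟨M, hM⟩ := ((finite_Icc (-n : ℤ) n).image fun k => |m k|).bddAbove
    exact ⟨M, fun q hq => hM (mem_image_of_mem _ hq.1)⟩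
  obtain ⟨Mw, hMw0, hMw⟩ : ∃ M : ℝ, 0 ≤ M ∧ ∀ b ∈ ({-β, β} : Set ℝ), ∀ q ∈ box n, wt b q ≤ M := by
    have hb : ∀ q ∈ box n, 1 + modul q ^ 2 ≤ 1 + (2 * Real.pi * n + ((n : ℝ) ^ 4 + (n : ℝ) ^ 2)) ^ 2 := by
      intro q hq
      have h1 : |q.2| ≤ n := abs_le.2 ⟨hq.2.1, hq.2.2⟩
      have h2 : |(q.1 : ℝ)| ≤ n := by
        have := hq.1
        exact abs_le.2 ⟨by exact_mod_cast this.1, by exact_mod_cast this.2⟩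
      have h3 : |modul q| ≤ 2 * Real.pi * n + ((n : ℝ) ^ 4 + (n : ℝ) ^ 2) := by
        rw [modul, symb]
        refine (abs_add_le _ _).trans (add_le_add ?_ ?_)
        · rw [abs_mul, abs_of_pos Real.two_pi_pos]; gcongr
        · rw [abs_of_nonneg (by positivity), ← Even.pow_abs (by decide : Even 4), ← sq_abs (q.1 : ℝ)]
          gcongr
      rw [← sq_abs (modul q)]
      gcongr
    refine ⟨(1 + (2 * Real.pi * n + ((n : ℝ) ^ 4 + (n : ℝ) ^ 2)) ^ 2) ^ (|β| / 2), by positivity,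
      fun b hb' q hq => ?_⟩
    have : wt b q ≤ wt |β| q := by
      refine wt_mono ?_ q
      rcases hb' with h | h <;> rw [h]
      · exact neg_le_abs β
      · exact le_abs_self β
    refine this.trans ?_
    exact Real.rpow_le_rpow (by positivity) (hb q hq) (by positivity)
  have hψm : AEStronglyMeasurable ψ nu := by
    refine AEStronglyMeasurable.indicator ?_ (measurableSet_box n)
    exact ((Complex.measurable_ofReal.comp ((measurable_weight (-β) m).mul
      (measurable_wt (-β)))).mul hh).aestronglyMeasurable
  have hψb : ∀ q, ‖ψ q‖ ≤ Mm * Mw * Mw * D := by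
    intro q
    by_cases hq : q ∈ box n
    · have a1 := hMw (-β) (by simp) q hq
      have a2 := (wt_pos (-β) q).le
      have a3 := hMm q hq
      have a4 := (abs_nonneg _).trans a3
      have a5 := hD q
      simp only [hψ, trunc, hq, indicator_of_mem, norm_mul, Complex.norm_real, Real.norm_eq_abs,
        abs_of_pos (wt_pos _ _)]
      gcongr
    · simp only [hψ, trunc, hq, not_false_eq_true, indicator_of_notMem, norm_zero]
      have a4 : 0 ≤ Mm := (abs_nonneg _).trans (hMm (0, 0) (by simp [box]))
      have a5 := (norm_nonneg _).trans (hD q)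
      positivity
  have hψs : trunc n ψ = ψ := by simp [hψ, trunc]
  have hψ2 : MemLp ψ 2 nu := by
    refine memLp_two_iff_lintegral.2 ⟨hψm, ?_⟩
    calc ∫⁻ q, ‖ψ q‖ₑ ^ 2 ∂nu ≤ ∫⁻ q, (box n).indicator (fun _ => ENNReal.ofReal (Mm * Mw * Mw * D) ^ 2) q ∂nu := by
          refine lintegral_mono fun q => ?_
          by_cases hq : q ∈ box n
          · simp only [hq, indicator_of_mem]
            gcongr
            rw [← ofReal_norm]; exact ENNReal.ofReal_le_ofReal (hψb q)
          · simp [hψ, trunc, hq]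
      _ < ⊤ := by
          rw [lintegral_indicator (measurableSet_box n), setLIntegral_const]
          exact ENNReal.mul_lt_top (by simp) (nu_box_lt_top n)
  have hXA : XN β 1 ψ ^ 2 = A := by
    rw [XN_sq, hA]; congr 1; ext q
    by_cases hq : q ∈ box n
    · simp only [hψ, trunc, hq, indicator_of_mem, enorm_mul]
      congr 1
      rw [← mul_assoc]
      congr 1
      rw [enorm_complex_ofReal, ← ofReal_norm, ← ENNReal.ofReal_mul (by simpa using (wt_pos β q).le)]
      congr 1
      have : wt β q * wt (-β) q = 1 := by rw [wt_mul]; simp [wt_zero]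
      simp only [Pi.one_apply, abs_one, one_mul, norm_mul, Real.norm_eq_abs, abs_of_pos (wt_pos _ _)]
      calc _ = |m q.1| * wt (-β) q * (wt β q * wt (-β) q) := by ring
        _ = _ := by rw [this, mul_one]
    · simp [hψ, trunc, hq]
  have hAt : A ≠ ⊤ := by
    rw [← hXA, XN_sq]
    refine ne_of_lt (lt_of_le_of_lt (b := ENNReal.ofReal Mw ^ 2 * ∫⁻ q, ‖ψ q‖ₑ ^ 2 ∂nu) ?_ ?_)
    · rw [← lintegral_const_mul'' _ (hψm.enorm.pow_const 2)]
      refine lintegral_mono fun q => ?_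
      by_cases hq : q ∈ box n
      · simp only [Pi.one_apply, abs_one, one_mul, mul_pow]
        gcongr
        exact hMw β (by simp) q hq
      · simp [hψ, trunc, hq]
    · exact ENNReal.mul_lt_top (by simp) (memLp_two_iff_lintegral.1 hψ2).2
  have hpair : ‖∫ q, h q * starRingEnd ℂ (m q.1 * ψ q) ∂nu‖ₑ = A := by
    have e : ∀ q, h q * starRingEnd ℂ (m q.1 * ψ q)
        = (((box n).indicator (fun q => (|m q.1| * wt (-β) q * ‖h q‖) ^ 2) q : ℝ) : ℂ) := by
      intro q
      by_cases hq : q ∈ box n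
      · simp only [hψ, trunc, hq, indicator_of_mem, map_mul, Complex.conj_ofReal]
        rw [mul_pow, mul_pow, sq_abs]
        push_cast
        rw [← Complex.mul_conj']
        ring
      · simp [hψ, trunc, hq]
    simp_rw [e]
    rw [integral_complex_ofReal, enorm_complex_ofReal, hA,
      Real.enorm_of_nonneg (integral_nonneg fun q => indicator_nonneg (fun _ _ => sq_nonneg _) q),
      integral_eq_lintegral_of_nonneg_ae (ae_of_all _ fun q => indicator_nonneg (fun _ _ => sq_nonneg _) q)]
    · have e2 : ∀ q, ENNReal.ofReal ((box n).indicator (fun q => (|m q.1| * wt (-β) q * ‖h q‖) ^ 2) q)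
          = (box n).indicator (fun q => (ENNReal.ofReal (|m q.1| * wt (-β) q) * ‖h q‖ₑ) ^ 2) q := by
        intro q
        by_cases hq : q ∈ box n
        · simp only [hq, indicator_of_mem]
          have := (wt_pos (-β) q).le
          rw [ENNReal.ofReal_pow (by positivity), ENNReal.ofReal_mul (by positivity), ofReal_norm]
        · simp [hq]
      simp_rw [e2]
      exact ENNReal.ofReal_toReal hAt
    · refine Measurable.aestronglyMeasurable (Measurable.indicator ?_ (measurableSet_box n))
      exact (((measurable_fst_comp (fun k => |m k|)).mul (measurable_wt _)).mul hh.norm).pow_const 2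
  have hXt : XN β 1 ψ ≠ ⊤ := fun h => hAt (by rw [← hXA, h]; simp)
  have hmain := H n ψ hψ2 hψs hXt
  rw [hpair, ← hXA] at hmain
  rw [← hXA]
  refine pow_le_pow_left' ?_ 2
  by_cases h0 : XN β 1 ψ = 0
  · rw [h0]; exact bot_le
  · rw [sq] at hmain
    exact (ENNReal.mul_le_mul_iff_left h0 hXt).1 hmain

/-! ### The `L⁴` Strichartz inequality and its dual -/

instance holderTriple_four_four_two : ENNReal.HolderTriple 4 4 2 := ⟨by
  have h4 : (4 : ℝ≥0∞)⁻¹ = 2⁻¹ * 2⁻¹ := by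
    rw [← ENNReal.mul_inv (by simp) (by simp)]; norm_num
  rw [h4, ← mul_add, ENNReal.inv_two_add_inv_two, mul_one]⟩

instance holderTriple_two_four : ENNReal.HolderTriple 2 4 (4 / 3) := ⟨by
  have h2 : (2 : ℝ≥0∞)⁻¹ = 2 * 4⁻¹ := by
    rw [show (4 : ℝ≥0∞) = 2 * 2 by norm_num, ENNReal.mul_inv (by simp) (by simp), ← mul_assoc,
      ENNReal.mul_inv_cancel (by simp) (by simp), one_mul]
  rw [h2, ENNReal.inv_div (by simp) (by simp), div_eq_mul_inv]; ring⟩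

instance holderTriple_four_thirds_four : ENNReal.HolderTriple (4 / 3) 4 1 := ⟨by
  rw [ENNReal.inv_div (by simp) (by simp), div_eq_mul_inv, inv_one]
  calc (3 : ℝ≥0∞) * 4⁻¹ + 4⁻¹ = 4 * 4⁻¹ := by ring
    _ = 1 := ENNReal.mul_inv_cancel (by simp) (by simp)⟩

theorem eLpNorm_mul_le {α : Type*} [MeasurableSpace α] {μ : Measure α} (p q r : ℝ≥0∞)
    [ENNReal.HolderTriple p q r] {f g : α → ℂ} (hf : AEStronglyMeasurable f μ)
    (hg : AEStronglyMeasurable g μ) :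
    eLpNorm (fun x => f x * g x) r μ ≤ eLpNorm f p μ * eLpNorm g q μ :=
  (eLpNorm_le_eLpNorm_mul_eLpNorm'_of_norm (p := p) (q := q) hf hg (fun a b => a * b) 1
    (ae_of_all _ fun x => by simp)).trans_eq (by simp)

theorem enorm_integral_mul_le {α : Type*} [MeasurableSpace α] {μ : Measure α} {f g : α → ℂ}
    (hf : AEStronglyMeasurable f μ) (hg : AEStronglyMeasurable g μ) :
    ‖∫ x, f x * g x ∂μ‖ₑ ≤ eLpNorm f (4 / 3) μ * eLpNorm g 4 μ := by
  refine (enorm_integral_le_lintegral_enorm _).trans ?_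
  rw [← eLpNorm_one_eq_lintegral_enorm]
  exact eLpNorm_mul_le (4 / 3) 4 1 hf hg

theorem eLpNorm_four_sq {α : Type*} [MeasurableSpace α] (μ : Measure α) (f : α → ℂ) :
    eLpNorm f 4 μ ^ 2 = eLpNorm (fun x => f x * f x) 2 μ := by
  have h2 : eLpNorm f 4 μ = (∫⁻ x, ‖f x‖ₑ ^ 4 ∂μ) ^ (1 / 4 : ℝ) := by
    rw [eLpNorm_eq_lintegral_rpow_enorm_toReal (by norm_num) (by norm_num)]
    norm_num
  have h3 : eLpNorm (fun x => f x * f x) 2 μ = (∫⁻ x, ‖f x‖ₑ ^ 4 ∂μ) ^ (1 / 2 : ℝ) := by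
    rw [eLpNorm_eq_lintegral_rpow_enorm_toReal (by norm_num) (by norm_num)]
    norm_num
    congr 2; ext x; ring
  rw [h2, h3, ← ENNReal.rpow_natCast, ← ENNReal.rpow_mul]
  norm_num

theorem enorm_convolution_le (w y : ℤ × ℝ → ℂ) (Q : ℤ × ℝ) :
    ‖(w ⋆[ContinuousLinearMap.mul ℂ ℂ, nu] y) Q‖ₑ ≤ lconv (fun q => ‖w q‖ₑ) (fun q => ‖y q‖ₑ) Q := by
  rw [convolution, lconv]
  refine (enorm_integral_le_lintegral_enorm _).trans_eq ?_
  simp [enorm_mul]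

theorem lintegral_weight_sq (β : ℝ) (w : ℤ × ℝ → ℂ) :
    ∫⁻ q, (ENNReal.ofReal (wt β q) * ‖w q‖ₑ) ^ 2 ∂nu = XN β 1 w ^ 2 := by
  rw [XN_sq]; simp

theorem exists_strichartz_check {β : ℝ} (hβ : 5 / 16 < β) :
    ∃ C : ℝ≥0∞, C ≠ ⊤ ∧ ∀ w : ℤ × ℝ → ℂ, Integrable w nu → XN β 1 w ≠ ⊤ →
      eLpNorm (check w) 4 vol ≤ C * XN β 1 w := by
  obtain ⟨C, hC, hbil⟩ := exists_lintegral_lconv_sq_le hβ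
  set c := ENNReal.ofReal (2 * Real.pi) with hc
  refine ⟨(c * C) ^ (1 / 4 : ℝ), ENNReal.rpow_ne_top_of_nonneg (by norm_num)
    (ENNReal.mul_ne_top ENNReal.ofReal_ne_top hC), fun w hw hX => ?_⟩
  set y := w ⋆[ContinuousLinearMap.mul ℂ ℂ, nu] w with hy
  have hyi : Integrable y nu := hw.integrable_convolution _ hw
  have hy2 : ∫⁻ q, ‖y q‖ₑ ^ 2 ∂nu ≤ C * XN β 1 w ^ 4 := by
    calc _ ≤ ∫⁻ Q, lconv (fun q => ‖w q‖ₑ) (fun q => ‖w q‖ₑ) Q ^ 2 ∂nu := by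
          refine lintegral_mono fun Q => ?_
          exact pow_le_pow_left' (enorm_convolution_le w w Q) 2
      _ ≤ _ := (hbil _ _ hw.1.enorm hw.1.enorm).trans_eq (by
          rw [lintegral_weight_sq]; ring)
  have hym : MemLp y 2 nu := memLp_two_iff_lintegral.2 ⟨hyi.1, lt_of_le_of_lt hy2
    (ENNReal.mul_lt_top hC.lt_top (ENNReal.pow_lt_top hX.lt_top))⟩
  have hft := FT_check hyi hym
  have e : eLpNorm (check w) 4 vol ^ 4 = c * ∫⁻ q, ‖y q‖ₑ ^ 2 ∂nu := by
    rw [hft.lintegral_sq, ← eLpNorm_two_sq, show (4 : ℕ) = 2 * 2 from rfl, pow_mul, eLpNorm_four_sq]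
    congr 2; ext z; exact check_mul_check hw hw z
  have h4 : eLpNorm (check w) 4 vol ^ 4 ≤ ((c * C) ^ (1 / 4 : ℝ) * XN β 1 w) ^ 4 := by
    rw [e, mul_pow, ← ENNReal.rpow_natCast ((c * C) ^ (1 / 4 : ℝ)), ← ENNReal.rpow_mul]
    norm_num
    rw [mul_assoc]
    gcongr
  exact (ENNReal.pow_le_pow_left_iff (by norm_num)).1 h4

theorem exists_subseq_ae_tendsto {α : Type*} [MeasurableSpace α] {μ : Measure α}
    {f : ℕ → α → ℂ} {g : α → ℂ} {p : ℝ≥0∞} (hp : p ≠ 0) (hf : ∀ n, AEStronglyMeasurable (f n) μ)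
    (hg : AEStronglyMeasurable g μ) (h : Tendsto (fun n => eLpNorm (g - f n) p μ) atTop (𝓝 0)) :
    ∃ ns : ℕ → ℕ, StrictMono ns ∧ ∀ᵐ x ∂μ, Tendsto (fun i => f (ns i) x) atTop (𝓝 (g x)) := by
  have h' : Tendsto (fun n => eLpNorm (f n - g) p μ) atTop (𝓝 0) := by
    simpa only [eLpNorm_sub_comm] using h
  exact (tendstoInMeasure_of_tendsto_eLpNorm hp hf hg h').exists_seq_tendsto_ae

theorem eLpNorm_le_of_tendsto {α : Type*} [MeasurableSpace α] {μ : Measure α}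
    {f : ℕ → α → ℂ} {g : α → ℂ} {p p' : ℝ≥0∞} (hp : p ≠ 0) (hf : ∀ n, AEStronglyMeasurable (f n) μ)
    (hg : AEStronglyMeasurable g μ) (h : Tendsto (fun n => eLpNorm (g - f n) p μ) atTop (𝓝 0))
    {B : ℝ≥0∞} (hB : ∀ n, eLpNorm (f n) p' μ ≤ B) : eLpNorm g p' μ ≤ B := by
  obtain ⟨ns, -, hns⟩ := exists_subseq_ae_tendsto hp hf hg h
  refine (Lp.eLpNorm_lim_le_liminf_eLpNorm (fun n => hf (ns n)) g hns).trans ?_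
  exact (liminf_le_liminf (Eventually.of_forall fun n => hB (ns n))).trans_eq (by simp)

theorem FT.tendsto_check_trunc {u : ℝ × Torus → ℂ} {w : ℤ × ℝ → ℂ} (h : FT u w) :
    Tendsto (fun n => eLpNorm (u - check (trunc n w)) 2 vol) atTop (𝓝 0) := by
  have h1 := fun n => (h.sub (FT_check_trunc h.memLp_right n)).eLpNorm_eq
  simp_rw [h1]
  rw [← mul_zero (ENNReal.ofReal (2 * Real.pi) ^ (1 / 2 : ℝ))]
  exact ENNReal.Tendsto.const_mul (tendsto_trunc h.memLp_right)
    (Or.inr (ENNReal.rpow_ne_top_of_nonneg (by norm_num) ENNReal.ofReal_ne_top))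

/-- A constant for the Strichartz inequality and its dual. -/
structure IsStrichartzConst (β : ℝ) (C : ℝ≥0∞) : Prop where
  ne_top : C ≠ ⊤
  strichartz : ∀ {u : ℝ × Torus → ℂ} {w : ℤ × ℝ → ℂ}, FT u w →
    eLpNorm u 4 vol ≤ C * XN β 1 w
  dual : ∀ {H : ℝ × Torus → ℂ}, Integrable H vol →
    XN (-β) 1 (hat H) ≤ C * eLpNorm H (4 / 3) vol
  lconv : ∀ {f g : ℤ × ℝ → ℝ≥0∞}, AEMeasurable f nu → AEMeasurable g nu →
    ∫⁻ Q, lconv f g Q ^ 2 ∂nu ≤ C * ((∫⁻ q, (ENNReal.ofReal (wt β q) * f q) ^ 2 ∂nu) *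
        ∫⁻ q, (ENNReal.ofReal (wt β q) * g q) ^ 2 ∂nu)

theorem exists_isStrichartzConst {β : ℝ} (hβ : 5 / 16 < β) : ∃ C, IsStrichartzConst β C := by
  obtain ⟨C₀, hC₀, h0⟩ := exists_strichartz_check hβ
  obtain ⟨C₁, hC₁, h1⟩ := exists_lintegral_lconv_sq_le hβ
  have hle0 : C₀ ≤ C₀ + C₁ + 1 := by rw [add_assoc]; exact le_self_add
  have hle1 : C₁ ≤ C₀ + C₁ + 1 := by rw [add_right_comm]; exact le_add_self
  refine ⟨C₀ + C₁ + 1, by simp [hC₀, hC₁], ?_, ?_, ?_⟩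
  · intro u w h
    by_cases hX : XN β 1 w = ⊤
    · rw [hX, ENNReal.mul_top (by positivity)]; exact le_top
    · refine eLpNorm_le_of_tendsto (p := 2) (by norm_num) (fun n =>
        (FT_check_trunc h.memLp_right n).memLp_left.1) h.memLp_left.1 h.tendsto_check_trunc fun n => ?_
      have hn := XN_trunc_le β 1 n w
      exact (h0 _ (integrable_trunc h.memLp_right n) (ne_top_of_le_ne_top hX hn)).trans
        (mul_le_mul' hle0 hn)
  · intro H hH
    refine XN_neg_le_of_pairing (measurable_hat hH) (norm_hat_le hH) fun n ψ hψ hψn hX => ?_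
    have hψi : Integrable ψ nu := hψn ▸ integrable_trunc hψ n
    simp only [Pi.one_apply, Complex.ofReal_one, one_mul]
    rw [integral_hat_mul_conj hH hψi, enorm_mul]
    have e1 : ‖(((2 * Real.pi)⁻¹ : ℝ) : ℂ)‖ₑ ≤ 1 := by
      rw [← ofReal_norm, Complex.norm_real, Real.norm_of_nonneg (by positivity),
        ENNReal.ofReal_le_one]
      exact inv_le_one_of_one_le₀ (by nlinarith [Real.pi_gt_three])
    have hc := continuous_check hψi
    refine (mul_le_mul' e1 (enorm_integral_mul_le hH.1
      (Complex.continuous_conj.comp hc).aestronglyMeasurable)).trans ?_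
    have e2 : eLpNorm (fun z => starRingEnd ℂ (check ψ z)) 4 vol
        = eLpNorm (check ψ) 4 vol :=
      eLpNorm_congr_norm_ae (ae_of_all _ fun z => by simp)
    have e3 : eLpNorm (starRingEnd ℂ ∘ check ψ) 4 vol
        = eLpNorm (check ψ) 4 vol := e2
    rw [one_mul, e3, mul_comm (C₀ + C₁ + 1), mul_assoc]
    gcongr
    exact (h0 _ hψi hX).trans (mul_le_mul' hle0 le_rfl)
  · intro f g hf hg
    exact (h1 f g hf hg).trans (mul_le_mul' hle1 le_rfl)

/-! ### The damped resolvent -/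

/-- The symbol `γ + i(τ + k⁴ + k²)` of the damped linear flow. -/
def dmp (γ : ℝ) (q : ℤ × ℝ) : ℂ := γ + Complex.I * modul q

theorem norm_dmp (γ : ℝ) (q : ℤ × ℝ) : ‖dmp γ q‖ = (γ ^ 2 + modul q ^ 2) ^ (1 / 2 : ℝ) := by
  rw [← Real.sqrt_eq_rpow, dmp, mul_comm, Complex.norm_add_mul_I]

theorem le_norm_dmp {γ θ : ℝ} (hγ : 1 ≤ γ) (h0 : 0 ≤ θ) (h1 : θ ≤ 1) (q : ℤ × ℝ) :
    γ ^ θ * wt (1 - θ) q ≤ ‖dmp γ q‖ := by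
  have hA : 0 < γ ^ 2 + modul q ^ 2 := by positivity
  have e : γ ^ θ = (γ ^ 2) ^ (θ / 2) := by
    rw [← Real.rpow_natCast, ← Real.rpow_mul (by positivity)]; congr 1; push_cast; ring
  rw [norm_dmp, e, wt, show (1 / 2 : ℝ) = θ / 2 + (1 - θ) / 2 by ring, Real.rpow_add hA]
  have : 1 ≤ γ ^ 2 := by nlinarith
  gcongr
  linarith [sq_nonneg (modul q)]

theorem dmp_ne_zero {γ : ℝ} (hγ : 0 < γ) (q : ℤ × ℝ) : dmp γ q ≠ 0 := by
  intro h
  have := congrArg Complex.re h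
  simp [dmp] at this
  linarith

theorem measurable_dmp (γ : ℝ) : Measurable (dmp γ) :=
  ((Complex.measurable_ofReal.comp measurable_modul).const_mul _).const_add _

theorem XN_div_dmp_le {γ θ : ℝ} (hγ : 1 ≤ γ) (h0 : 0 ≤ θ) (h1 : θ ≤ 1) (β : ℝ) (m : ℤ → ℝ)
    (w : ℤ × ℝ → ℂ) :
    XN β m (fun q => w q / dmp γ q) ≤ ENNReal.ofReal (γ ^ (-θ)) * XN (β - 1 + θ) m w := by
  have hγ0 : 0 < γ := by linarith
  have e : ENNReal.ofReal (γ ^ (-θ)) = ‖((γ ^ (-θ) : ℝ) : ℂ)‖ₑ := by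
    rw [enorm_complex_ofReal, Real.enorm_of_nonneg (by positivity)]
  rw [e, ← XN_const_mul]
  refine XN_mono_enorm fun q => ?_
  have h := le_norm_dmp hγ h0 h1 q
  have hw := wt_pos (1 - θ) q
  have hd : 0 < ‖dmp γ q‖ := norm_pos_iff.2 (dmp_ne_zero hγ0 q)
  have hwm : wt β q = wt (β - 1 + θ) q * wt (1 - θ) q := by rw [wt_mul]; congr 1; ring
  simp only [norm_div, Pi.smul_apply, smul_eq_mul, norm_mul, Complex.norm_real,
    Real.norm_of_nonneg (Real.rpow_nonneg hγ0.le (-θ))]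
  rw [hwm, Real.rpow_neg hγ0.le]
  have hg : 0 < γ ^ θ := by positivity
  have : wt (1 - θ) q / ‖dmp γ q‖ ≤ (γ ^ θ)⁻¹ := by
    rw [div_le_iff₀ hd, ← div_eq_inv_mul, le_div_iff₀ hg]; linarith
  calc _ = |m q.1| * wt (β - 1 + θ) q * ‖w q‖ * (wt (1 - θ) q / ‖dmp γ q‖) := by ring
    _ ≤ |m q.1| * wt (β - 1 + θ) q * ‖w q‖ * (γ ^ θ)⁻¹ := by
        have := (wt_pos (β - 1 + θ) q).le
        gcongr
    _ = _ := by ring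

/-- The weighted `ℓ²` norm of a sequence of Fourier coefficients. -/
def l2n (m : ℤ → ℝ) (f : ℤ → ℂ) : ℝ≥0∞ :=
  (∑' k, (ENNReal.ofReal |m k| * ‖f k‖ₑ) ^ 2) ^ (1 / 2 : ℝ)

theorem l2n_sq (m : ℤ → ℝ) (f : ℤ → ℂ) : l2n m f ^ 2 = ∑' k, (ENNReal.ofReal |m k| * ‖f k‖ₑ) ^ 2 := by
  rw [l2n, ← ENNReal.rpow_natCast, ← ENNReal.rpow_mul]; norm_num

/-- A constant for the evolution of the initial datum in the weighted norms. -/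
def freeConst (β : ℝ) : ℝ≥0∞ :=
  (∫⁻ x : ℝ, ENNReal.ofReal ((1 + x ^ 2) ^ (-(1 - β)))) ^ (1 / 2 : ℝ)

theorem freeConst_ne_top {β : ℝ} (hβ : β < 1 / 2) : freeConst β ≠ ⊤ :=
  ENNReal.rpow_ne_top_of_nonneg (by norm_num) (lintegral_rpow_lt_top (by linarith)).ne

theorem XN_free_le {β : ℝ} (hβ : β < 1 / 2) (m : ℤ → ℝ) (f : ℤ → ℂ) {g : ℤ × ℝ → ℂ}
    (hg : ∀ q, ‖g q‖ ≤ ‖f q.1‖ * wt (-1) q) :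
    XN β m g ≤ freeConst β * l2n m f := by
  rw [← ENNReal.pow_le_pow_left_iff (n := 2) (by norm_num), XN_sq, mul_pow, l2n_sq, lintegral_nu,
    freeConst, ← ENNReal.rpow_natCast (_ ^ (1 / 2 : ℝ)), ← ENNReal.rpow_mul,
    show (1 / 2 : ℝ) * ((2 : ℕ) : ℝ) = 1 by norm_num, ENNReal.rpow_one, mul_comm,
    ← ENNReal.tsum_mul_right]
  refine ENNReal.tsum_le_tsum fun k => ?_
  have hr : 1 / 2 < 1 - β := by linarith
  calc _ ≤ ∫⁻ ξ : ℝ, (ENNReal.ofReal |m k| * ‖f k‖ₑ) ^ 2 *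
          ENNReal.ofReal ((1 + (2 * Real.pi * ξ + symb k) ^ 2) ^ (-(1 - β))) := by
        refine lintegral_mono fun ξ => ?_
        have h1 : ENNReal.ofReal (|m k| * wt β (k, ξ)) * ‖g (k, ξ)‖ₑ
            ≤ (ENNReal.ofReal |m k| * ‖f k‖ₑ) * ENNReal.ofReal (wt (β - 1) (k, ξ)) := by
          rw [← ofReal_norm, ← ofReal_norm, ← ENNReal.ofReal_mul (by
            have := (wt_pos β (k, ξ)).le; positivity), ← ENNReal.ofReal_mul (by positivity),
            ← ENNReal.ofReal_mul (by positivity)]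
          refine ENNReal.ofReal_le_ofReal ?_
          have h2 := hg (k, ξ)
          have h3 := (wt_pos β (k, ξ)).le
          calc _ ≤ |m k| * wt β (k, ξ) * (‖f k‖ * wt (-1) (k, ξ)) := by gcongr
            _ = |m k| * ‖f k‖ * (wt β (k, ξ) * wt (-1) (k, ξ)) := by ring
            _ = _ := by rw [wt_mul]; rfl
        refine (pow_le_pow_left' h1 2).trans_eq ?_
        rw [mul_pow, ← ENNReal.ofReal_pow (wt_pos _ _).le]
        congr 2
        rw [wt, modul, ← Real.rpow_natCast, ← Real.rpow_mul (by positivity)]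
        congr 1; push_cast; ring
    _ ≤ _ := by
        rw [lintegral_const_mul _ (by fun_prop)]
        exact mul_le_mul' le_rfl (lintegral_rpow_affine_le hr (symb k))

theorem norm_div_dmp_le {γ : ℝ} (hγ : 1 ≤ γ) (c : ℂ) (q : ℤ × ℝ) :
    ‖c / dmp γ q‖ ≤ ‖c‖ * wt (-1) q := by
  have h := le_norm_dmp hγ le_rfl zero_le_one q
  rw [Real.rpow_zero, one_mul, sub_zero] at h
  have e : wt (-1) q = (wt 1 q)⁻¹ := by
    rw [wt, wt, ← Real.rpow_neg (by positivity)]; norm_num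
  rw [norm_div, e, ← div_eq_mul_inv]
  have := wt_pos 1 q
  gcongr

/-! ### The damped kernel in time -/

/-- The kernel `1_{t > 0} e^{-(γ + ip)t}`. -/
def ker (γ p : ℝ) (t : ℝ) : ℂ := (Ioi (0 : ℝ)).indicator (fun t => Complex.exp (-(γ + Complex.I * p) * t)) t

theorem integrable_ker {γ : ℝ} (hγ : 0 < γ) (p : ℝ) : Integrable (ker γ p) := by
  have h := integrableOn_exp_mul_complex_Ioi (a := -(γ + Complex.I * p)) (by simpa using hγ) 0
  exact h.integrable_indicator measurableSet_Ioi

theorem norm_ker_le {γ : ℝ} (hγ : 0 < γ) (p t : ℝ) : ‖ker γ p t‖ ≤ 1 := by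
  by_cases ht : 0 < t
  · simp only [ker, mem_Ioi, ht, indicator_of_mem, Complex.norm_exp]
    rw [Real.exp_le_one_iff]
    simp
    positivity
  · simp [ker, ht]

theorem fourier_ker {γ : ℝ} (hγ : 0 < γ) (k : ℤ) (ξ : ℝ) :
    𝓕 (ker γ (symb k)) ξ = 1 / dmp γ (k, ξ) := by
  rw [Real.fourier_real_eq_integral_exp_smul]
  have e : ∀ v : ℝ, Complex.exp (↑(-2 * Real.pi * v * ξ) * Complex.I) • ker γ (symb k) v
      = (Ioi (0 : ℝ)).indicator (fun t : ℝ => Complex.exp (-dmp γ (k, ξ) * t)) v := by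
    intro v
    by_cases hv : 0 < v
    · simp only [ker, mem_Ioi, hv, indicator_of_mem, smul_eq_mul, ← Complex.exp_add]
      congr 1
      simp only [dmp, modul]; push_cast; ring
    · simp [ker, hv]
  simp_rw [e]
  rw [integral_indicator measurableSet_Ioi, integral_exp_mul_complex_Ioi (by simpa [dmp] using hγ)]
  simp [div_neg, neg_div]

theorem memLp_two_of_integrable_of_bound {α : Type*} [MeasurableSpace α] {μ : Measure α}
    {f : α → ℂ} (hf : Integrable f μ) {D : ℝ} (hD : ∀ x, ‖f x‖ ≤ D) : MemLp f 2 μ := by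
  refine memLp_two_iff_lintegral.2 ⟨hf.1, ?_⟩
  calc ∫⁻ x, ‖f x‖ₑ ^ 2 ∂μ ≤ ∫⁻ x, ENNReal.ofReal D * ‖f x‖ₑ ∂μ := by
        refine lintegral_mono fun x => ?_
        simp only [sq]
        gcongr
        rw [← ofReal_norm]; exact ENNReal.ofReal_le_ofReal (hD x)
    _ < ⊤ := by
        rw [lintegral_const_mul' _ _ ENNReal.ofReal_ne_top]
        exact ENNReal.mul_lt_top ENNReal.ofReal_lt_top hf.2

/-- The solution of the damped linear equation with frequency `k` on the half-line. -/
def dampedCoef (γ : ℝ) (f : ℤ → ℂ) (H : ℝ × Torus → ℂ) (k : ℤ) : ℝ → ℂ :=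
  f k • ker γ (symb k) + (coef H k ⋆[ContinuousLinearMap.mul ℂ ℂ, volume] ker γ (symb k))

theorem integrable_dampedCoef {γ : ℝ} (hγ : 0 < γ) (f : ℤ → ℂ) {H : ℝ × Torus → ℂ}
    (hH : Integrable H vol) (k : ℤ) : Integrable (dampedCoef γ f H k) :=
  ((integrable_ker hγ _).smul _).add ((integrable_coef hH k).integrable_convolution _
    (integrable_ker hγ _))

theorem memLp_dampedCoef {γ : ℝ} (hγ : 0 < γ) (f : ℤ → ℂ) {H : ℝ × Torus → ℂ}
    (hH : Integrable H vol) (k : ℤ) : MemLp (dampedCoef γ f H k) 2 volume := by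
  refine memLp_two_of_integrable_of_bound (integrable_dampedCoef hγ f hH k)
    (D := ‖f k‖ + ∫ r, ‖coef H k r‖) fun t => ?_
  refine (norm_add_le _ _).trans (add_le_add ?_ ?_)
  · rw [Pi.smul_apply, norm_smul]
    exact mul_le_of_le_one_right (norm_nonneg _) (norm_ker_le hγ _ _)
  · rw [convolution]
    refine (norm_integral_le_integral_norm _).trans ?_
    refine integral_mono_of_nonneg (ae_of_all _ fun _ => norm_nonneg _) (integrable_coef hH k).norm
      (ae_of_all _ fun r => ?_)
    simp only [ContinuousLinearMap.mul_apply', norm_mul]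
    exact mul_le_of_le_one_right (norm_nonneg _) (norm_ker_le hγ _ _)

theorem fourier_dampedCoef {γ : ℝ} (hγ : 0 < γ) (f : ℤ → ℂ) {H : ℝ × Torus → ℂ}
    (hH : Integrable H vol) (k : ℤ) (ξ : ℝ) :
    𝓕 (dampedCoef γ f H k) ξ = (f k + hat H (k, ξ)) / dmp γ (k, ξ) := by
  have hk := integrable_ker hγ (symb k)
  have hc := (integrable_coef hH k).integrable_convolution (ContinuousLinearMap.mul ℂ ℂ) hk
  have h1 : 𝓕 (dampedCoef γ f H k) ξ = 𝓕 (f k • ker γ (symb k)) ξ +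
      𝓕 (coef H k ⋆[ContinuousLinearMap.mul ℂ ℂ, volume] ker γ (symb k)) ξ := by
    simp only [dampedCoef, Real.fourier_real_eq, Pi.add_apply, smul_add]
    have := fun (f : ℝ → ℂ) (hf : Integrable f) =>
      (Real.fourierIntegral_convergent_iff (V := ℝ) ξ).2 hf
    refine integral_add ?_ ?_
    · simpa [mul_comm] using this _ (hk.smul (f k))
    · simpa [mul_comm] using this _ hc
  have h2 : 𝓕 (f k • ker γ (symb k)) ξ = f k * 𝓕 (ker γ (symb k)) ξ := by
    simp only [Real.fourier_real_eq, Pi.smul_apply, smul_eq_mul, Circle.smul_def,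
      ← integral_const_mul]
    congr 1; ext v; ring
  rw [h1, h2, Real.fourier_mul_convolution_eq (integrable_coef hH k) hk, fourier_ker hγ, hat]
  ring

theorem coef_ae_eq_dampedCoef {γ : ℝ} (hγ : 0 < γ) (f : ℤ → ℂ) {H : ℝ × Torus → ℂ}
    (hH : Integrable H vol) {z : ℝ × Torus → ℂ}
    (hz : FT z fun q => (f q.1 + hat H q) / dmp γ q) (k : ℤ) :
    coef z k =ᵐ[volume] dampedCoef γ f H k := by
  refine ae_eq_of_l2Fourier_ae_eq (memLp_coef hz.memLp_left k) (memLp_dampedCoef hγ f hH k) ?_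
  refine (hz.ae_eq k).trans ?_
  refine EventuallyEq.trans ?_ (l2Fourier_ae_eq_fourier (integrable_dampedCoef hγ f hH k)
    (memLp_dampedCoef hγ f hH k)).symm
  exact ae_of_all _ fun ξ => (fourier_dampedCoef hγ f hH k ξ).symm

/-- The Fourier coefficients of the mild solution with datum `f` and forcing `h`. -/
def mildCoef (f : ℤ → ℂ) (h : ℝ × Torus → ℂ) (k : ℤ) (t : ℝ) : ℂ :=
  Complex.exp (-(Complex.I * symb k * t)) *
    (f k + ∫ r in (0 : ℝ)..t, Complex.exp (Complex.I * symb k * r) * coef h k r)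

/-- Multiplication by `e^{-γt}`. -/
def gauge (γ : ℝ) (u : ℝ × Torus → ℂ) (z : ℝ × Torus) : ℂ := (Real.exp (-γ * z.1) : ℂ) * u z

theorem dampedCoef_gauge {γ : ℝ} (f : ℤ → ℂ) {h : ℝ × Torus → ℂ}
    (h0 : ∀ z : ℝ × Torus, z.1 ≤ 0 → h z = 0) (k : ℤ) (t : ℝ) :
    dampedCoef γ f (gauge γ h) k t = (Ioi (0 : ℝ)).indicator
      (fun t => (Real.exp (-γ * t) : ℂ) * mildCoef f h k t) t := by
  have hc : ∀ r, coef (gauge γ h) k r = (Real.exp (-γ * r) : ℂ) * coef h k r := fun r =>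
    coef_const_mul h (fun r => (Real.exp (-γ * r) : ℂ)) k r
  have hc0 : ∀ r ≤ 0, coef h k r = 0 := fun r hr => by
    have : (fun x => h (r, x)) = fun _ => 0 := funext fun x => h0 (r, x) hr
    rw [coef, this]; simp [fourierCoeff]
  simp only [dampedCoef, Pi.add_apply, Pi.smul_apply, smul_eq_mul, convolution,
    ContinuousLinearMap.mul_apply']
  by_cases ht : 0 < t
  · have e : ∀ r, coef (gauge γ h) k r * ker γ (symb k) (t - r)
        = (Ioo 0 t).indicator (fun r => Complex.exp (-(γ + Complex.I * symb k) * t) *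
          (Complex.exp (Complex.I * symb k * r) * coef h k r)) r := by
      intro r
      by_cases hr : 0 < r
      · by_cases hr2 : r < t
        · have h1 : r ∈ Ioo 0 t := ⟨hr, hr2⟩
          have h2 : t - r ∈ Ioi (0 : ℝ) := by simpa using hr2
          rw [indicator_of_mem h1, ker, indicator_of_mem h2, hc, ← mul_assoc, ← Complex.exp_add,
            mul_assoc, mul_comm, mul_comm (coef h k r), Complex.ofReal_exp, mul_right_comm,
            ← Complex.exp_add]
          congr 2
          push_cast; ring
        · have h2 : t - r ∉ Ioi (0 : ℝ) := by simpa using hr2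
          rw [ker, indicator_of_notMem h2, mul_zero, indicator_of_notMem (fun h => hr2 h.2)]
      · rw [hc, hc0 r (not_lt.1 hr), indicator_of_notMem (fun h => hr h.1)]; simp
    simp_rw [e]
    rw [integral_indicator measurableSet_Ioo, ← integral_Ioc_eq_integral_Ioo, integral_const_mul,
      ← intervalIntegral.integral_of_le ht.le, indicator_of_mem (show t ∈ Ioi (0 : ℝ) from ht), ker,
      indicator_of_mem (show t ∈ Ioi (0 : ℝ) from ht), mildCoef, ← mul_assoc, Complex.ofReal_exp,
      ← Complex.exp_add]
    have : (((-γ * t : ℝ) : ℂ) + -(Complex.I * symb k * t)) = -(γ + Complex.I * symb k) * t := by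
      push_cast; ring
    rw [this]; ring
  · have h2 : t ∉ Ioi (0 : ℝ) := ht
    rw [indicator_of_notMem h2, ker, indicator_of_notMem h2, mul_zero, zero_add]
    refine integral_eq_zero_of_ae (ae_of_all _ fun r => ?_)
    by_cases hr : 0 < r
    · have h2 : t - r ∉ Ioi (0 : ℝ) := by simp; linarith
      simp [ker, indicator_of_notMem h2]
    · simp [hc, hc0 r (not_lt.1 hr)]

/-! ### Linear estimates for mild solutions -/

/-- `u` vanishes outside the time interval `(0, τ)`. -/
def SuppIn (τ : ℝ) (u : ℝ × Torus → ℂ) : Prop := ∀ z : ℝ × Torus, z.1 ∉ Ioo 0 τ → u z = 0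

/-- The truncation of `u` to the time interval `(0, τ)`. -/
def cut (τ : ℝ) (u : ℝ × Torus → ℂ) : ℝ × Torus → ℂ := (Ioo 0 τ ×ˢ univ).indicator u

theorem measurableSet_strip (τ : ℝ) : MeasurableSet (Ioo 0 τ ×ˢ (univ : Set Torus)) :=
  measurableSet_Ioo.prod MeasurableSet.univ

theorem suppIn_cut (τ : ℝ) (u : ℝ × Torus → ℂ) : SuppIn τ (cut τ u) := fun z hz => by
  simp [cut, hz]

theorem cut_apply {τ : ℝ} {u : ℝ × Torus → ℂ} {z : ℝ × Torus} (hz : z.1 ∈ Ioo 0 τ) :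
    cut τ u z = u z := by
  rw [cut, indicator_of_mem]; exact ⟨hz, mem_univ _⟩

theorem SuppIn.cut_eq {τ : ℝ} {u : ℝ × Torus → ℂ} (h : SuppIn τ u) : cut τ u = u := by
  ext z
  by_cases hz : z.1 ∈ Ioo 0 τ
  · exact cut_apply hz
  · rw [suppIn_cut τ u z hz, h z hz]

theorem SuppIn.sub {τ : ℝ} {u v : ℝ × Torus → ℂ} (hu : SuppIn τ u) (hv : SuppIn τ v) :
    SuppIn τ (u - v) := fun z hz => by simp [hu z hz, hv z hz]

theorem SuppIn.gauge {τ : ℝ} {u : ℝ × Torus → ℂ} (hu : SuppIn τ u) (γ : ℝ) :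
    SuppIn τ (gauge γ u) := fun z hz => by simp [FourthOrderNLS.gauge, hu z hz]

theorem strip_restrict (τ : ℝ) : vol.restrict (Ioo 0 τ ×ˢ univ)
    = ((volume : Measure ℝ).restrict (Ioo 0 τ)).prod (volume : Measure Torus) := by
  rw [← Measure.prod_restrict, Measure.restrict_univ]

instance strip_finite (τ : ℝ) : IsFiniteMeasure (vol.restrict (Ioo 0 τ ×ˢ univ)) := by
  rw [strip_restrict]; infer_instance

theorem SuppIn.eLpNorm_restrict {τ : ℝ} {u : ℝ × Torus → ℂ} (h : SuppIn τ u) (p : ℝ≥0∞) :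
    eLpNorm u p (vol.restrict (Ioo 0 τ ×ˢ univ)) = eLpNorm u p vol := by
  conv_rhs => rw [← h.cut_eq, cut, eLpNorm_indicator_eq_eLpNorm_restrict (measurableSet_strip τ)]

theorem SuppIn.memLp_of_le {τ : ℝ} {u : ℝ × Torus → ℂ} (h : SuppIn τ u) {p q : ℝ≥0∞}
    (hu : MemLp u p vol) (hqp : q ≤ p) : MemLp u q vol := by
  have h1 := (hu.restrict (Ioo 0 τ ×ˢ univ)).mono_exponent hqp
  exact ⟨hu.1, by rw [← h.eLpNorm_restrict]; exact h1.2⟩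

theorem SuppIn.integrable {τ : ℝ} {u : ℝ × Torus → ℂ} (h : SuppIn τ u) {p : ℝ≥0∞}
    (hu : MemLp u p vol) (hp : 1 ≤ p) : Integrable u vol :=
  memLp_one_iff_integrable.1 (h.memLp_of_le hu hp)

theorem four_thirds_le_two : (4 / 3 : ℝ≥0∞) ≤ 2 := by
  rw [ENNReal.div_le_iff (by norm_num) (by norm_num)]; norm_num

theorem one_le_four_thirds : 1 ≤ (4 / 3 : ℝ≥0∞) := by
  rw [ENNReal.le_div_iff_mul_le (by norm_num) (by norm_num)]; norm_num

theorem four_thirds_le_four : (4 / 3 : ℝ≥0∞) ≤ 4 :=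
  four_thirds_le_two.trans (by norm_num)

/-- A constant for the inclusions of Lebesgue spaces on `(0, τ) × 𝕋`. -/
def incl (τ : ℝ) : ℝ≥0∞ := 1 + vol (Ioo 0 τ ×ˢ univ)

theorem incl_ne_top (τ : ℝ) : incl τ ≠ ⊤ := by
  have := (strip_finite τ).measure_univ_lt_top
  rw [Measure.restrict_apply_univ] at this
  exact ENNReal.add_ne_top.2 ⟨by norm_num, this.ne⟩

theorem incl_mono {τ τ' : ℝ} (h : τ ≤ τ') : incl τ ≤ incl τ' := by
  unfold incl
  gcongr

theorem SuppIn.eLpNorm_le {τ : ℝ} {u : ℝ × Torus → ℂ} (h : SuppIn τ u) {p q : ℝ≥0∞}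
    (hu : AEStronglyMeasurable u vol) (hqp : q ≤ p) (hq : 1 ≤ q) :
    eLpNorm u q vol ≤ incl τ * eLpNorm u p vol := by
  rw [← h.eLpNorm_restrict q, ← h.eLpNorm_restrict p, mul_comm (incl τ)]
  refine (eLpNorm_le_eLpNorm_mul_rpow_measure_univ hqp hu.restrict).trans ?_
  gcongr
  rw [Measure.restrict_apply_univ]
  have h0 : 0 ≤ 1 / q.toReal - 1 / p.toReal ∧ 1 / q.toReal - 1 / p.toReal ≤ 1 := by
    by_cases hp : p = ⊤
    · simp only [hp, ENNReal.toReal_top, div_zero, sub_zero]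
      by_cases hq' : q = ⊤
      · simp [hq']
      · have : 1 ≤ q.toReal := by
          rw [← ENNReal.toReal_one]; exact ENNReal.toReal_mono hq' hq
        exact ⟨by positivity, by rw [div_le_one (by linarith)]; exact this⟩
    · have hq' : q ≠ ⊤ := ne_top_of_le_ne_top hp hqp
      have h1 : 1 ≤ q.toReal := by
        rw [← ENNReal.toReal_one]; exact ENNReal.toReal_mono hq' hq
      have h2 : q.toReal ≤ p.toReal := ENNReal.toReal_mono hp hqp
      have h3 : 1 / p.toReal ≤ 1 / q.toReal := by gcongr
      have h4 : 1 / q.toReal ≤ 1 := by rw [div_le_one (by linarith)]; exact h1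
      have h5 : 0 ≤ 1 / p.toReal := by positivity
      exact ⟨by linarith, by linarith⟩
  calc _ ≤ (1 + vol (Ioo 0 τ ×ˢ univ)) ^ (1 / q.toReal - 1 / p.toReal) :=
        ENNReal.rpow_le_rpow le_add_self h0.1
    _ ≤ (1 + vol (Ioo 0 τ ×ˢ univ)) ^ (1 : ℝ) :=
        ENNReal.rpow_le_rpow_of_exponent_le le_self_add h0.2
    _ = _ := by rw [ENNReal.rpow_one]; rfl

theorem SuppIn.norm_gauge_le {τ : ℝ} {u : ℝ × Torus → ℂ} (h : SuppIn τ u) {γ : ℝ} (hγ : 0 ≤ γ)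
    (z : ℝ × Torus) : ‖FourthOrderNLS.gauge γ u z‖ ≤ ‖u z‖ := by
  by_cases hz : z.1 ∈ Ioo 0 τ
  · rw [FourthOrderNLS.gauge, norm_mul, Complex.norm_real, Real.norm_of_nonneg (Real.exp_pos _).le]
    refine mul_le_of_le_one_left (norm_nonneg _) (Real.exp_le_one_iff.2 ?_)
    nlinarith [hz.1]
  · simp [FourthOrderNLS.gauge, h z hz]

theorem SuppIn.norm_le_gauge {τ : ℝ} {u : ℝ × Torus → ℂ} (h : SuppIn τ u) {γ : ℝ} (hγ : 0 ≤ γ)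
    (z : ℝ × Torus) : ‖u z‖ ≤ Real.exp (γ * τ) * ‖FourthOrderNLS.gauge γ u z‖ := by
  by_cases hz : z.1 ∈ Ioo 0 τ
  · rw [FourthOrderNLS.gauge, norm_mul, Complex.norm_real, Real.norm_of_nonneg (Real.exp_pos _).le,
      ← mul_assoc, ← Real.exp_add]
    refine le_mul_of_one_le_left (norm_nonneg _) (Real.one_le_exp ?_)
    nlinarith [hz.2]
  · rw [h z hz, norm_zero]; positivity

theorem aestronglyMeasurable_gauge {u : ℝ × Torus → ℂ} (hu : AEStronglyMeasurable u vol) (γ : ℝ) :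
    AEStronglyMeasurable (gauge γ u) vol := by
  refine AEStronglyMeasurable.mul ?_ hu
  exact (Complex.continuous_ofReal.comp (Real.continuous_exp.comp
    (continuous_const.mul continuous_fst))).aestronglyMeasurable

theorem SuppIn.memLp_gauge {τ : ℝ} {u : ℝ × Torus → ℂ} (h : SuppIn τ u) {γ : ℝ} (hγ : 0 ≤ γ)
    {p : ℝ≥0∞} (hu : MemLp u p vol) : MemLp (FourthOrderNLS.gauge γ u) p vol :=
  hu.mono (aestronglyMeasurable_gauge hu.1 γ) (ae_of_all _ (h.norm_gauge_le hγ))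

theorem SuppIn.eLpNorm_gauge_le {τ : ℝ} {u : ℝ × Torus → ℂ} (h : SuppIn τ u) {γ : ℝ} (hγ : 0 ≤ γ)
    (p : ℝ≥0∞) : eLpNorm (FourthOrderNLS.gauge γ u) p vol ≤ eLpNorm u p vol :=
  eLpNorm_mono (h.norm_gauge_le hγ)

theorem SuppIn.eLpNorm_le_gauge {τ : ℝ} {u : ℝ × Torus → ℂ} (h : SuppIn τ u) {γ : ℝ} (hγ : 0 ≤ γ)
    (p : ℝ≥0∞) : eLpNorm u p vol
      ≤ ENNReal.ofReal (Real.exp (γ * τ)) * eLpNorm (FourthOrderNLS.gauge γ u) p vol :=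
  eLpNorm_le_mul_eLpNorm_of_ae_le_mul (ae_of_all _ (h.norm_le_gauge hγ)) p

theorem SuppIn.memLp_of_gauge {τ : ℝ} {u : ℝ × Torus → ℂ} (h : SuppIn τ u) {γ : ℝ} (hγ : 0 ≤ γ)
    {p : ℝ≥0∞} (hu : AEStronglyMeasurable u vol)
    (hg : eLpNorm (FourthOrderNLS.gauge γ u) p vol ≠ ⊤) : MemLp u p vol :=
  ⟨hu, (h.eLpNorm_le_gauge hγ p).trans_lt (ENNReal.mul_lt_top ENNReal.ofReal_lt_top hg.lt_top)⟩

/-- `u` is the mild solution on `(0, τ)` with datum `f` and forcing `h`. -/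
def IsMild (τ : ℝ) (f : ℤ → ℂ) (h u : ℝ × Torus → ℂ) : Prop :=
  ∀ k, ∀ᵐ t : ℝ, t ∈ Ioo 0 τ → coef u k t = mildCoef f h k t

theorem XN_zero_one (w : ℤ × ℝ → ℂ) : XN 0 1 w = eLpNorm w 2 nu := by
  rw [XN]; congr 1; ext q; simp [wt_zero]

theorem memLp_two_of_XN {β : ℝ} (hβ : 0 ≤ β) {w : ℤ × ℝ → ℂ} (hw : AEStronglyMeasurable w nu)
    (h : XN β 1 w ≠ ⊤) : MemLp w 2 nu := by
  refine ⟨hw, ?_⟩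
  rw [← XN_zero_one]
  exact (XN_mono hβ (fun _ => le_rfl) w).trans_lt h.lt_top

/-- The transform of the damped solution with datum `f` and forcing `H`. -/
def dampedHat (γ : ℝ) (f : ℤ → ℂ) (H : ℝ × Torus → ℂ) (q : ℤ × ℝ) : ℂ :=
  (f q.1 + hat H q) / dmp γ q

theorem measurable_dampedHat (γ : ℝ) (f : ℤ → ℂ) {H : ℝ × Torus → ℂ} (hH : Integrable H vol) :
    Measurable (dampedHat γ f H) :=
  (((measurable_from_top (f := f)).comp measurable_fst).add (measurable_hat hH)).div
    (measurable_dmp γ)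

theorem XN_dampedHat_le {β γ : ℝ} (hβ0 : 0 ≤ β) (hβ : β < 1 / 2) (hγ : 1 ≤ γ) (m : ℤ → ℝ)
    (f : ℤ → ℂ) {H : ℝ × Torus → ℂ} (hH : Integrable H vol) :
    XN β m (dampedHat γ f H) ≤ freeConst β * l2n m f
      + ENNReal.ofReal (γ ^ (-(1 - 2 * β))) * XN (-β) m (hat H) := by
  have e : dampedHat γ f H = (fun q => f q.1 / dmp γ q) + fun q => hat H q / dmp γ q := by
    ext q; simp [dampedHat, add_div]
  rw [e]
  refine (XN_add_le ?_ ?_).trans (add_le_add ?_ ?_)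
  · exact ((measurable_from_top.comp measurable_fst).div (measurable_dmp γ)).aestronglyMeasurable
  · exact ((measurable_hat hH).div (measurable_dmp γ)).aestronglyMeasurable
  · exact XN_free_le hβ m f fun q => norm_div_dmp_le hγ _ q
  · refine (XN_div_dmp_le hγ (θ := 1 - 2 * β) (by linarith) (by linarith) β m _).trans_eq ?_
    congr 2; ring

/-- Admissible exponents, with a Strichartz constant. -/
structure IsExponent (β : ℝ) (C : ℝ≥0∞) : Prop extends IsStrichartzConst β C where
  lt_half : β < 1 / 2
  five_lt : 5 / 16 < β

theorem IsExponent.XN_dampedHat_one_le (hC : IsExponent β C) {γ : ℝ} (hγ : 1 ≤ γ)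
    (f : ℤ → ℂ) {H : ℝ × Torus → ℂ} (hH : Integrable H vol) :
    XN β 1 (dampedHat γ f H) ≤ freeConst β * l2n 1 f
      + ENNReal.ofReal (γ ^ (-(1 - 2 * β))) * (C * eLpNorm H (4 / 3) vol) := by
  have := hC.five_lt
  refine (XN_dampedHat_le (by linarith) hC.lt_half hγ 1 f hH).trans ?_
  gcongr
  exact hC.dual hH

theorem IsExponent.exists_damped (hC : IsExponent β C) {γ : ℝ} (hγ : 1 ≤ γ)
    {f : ℤ → ℂ} (hf : l2n 1 f ≠ ⊤) {H : ℝ × Torus → ℂ} (hH : Integrable H vol)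
    (hH' : eLpNorm H (4 / 3) vol ≠ ⊤) :
    ∃ z, FT z (dampedHat γ f H) := by
  have := hC.five_lt
  refine exists_FT_left (memLp_two_of_XN (β := β) (by linarith)
    (measurable_dampedHat γ f hH).aestronglyMeasurable
    (ne_top_of_le_ne_top ?_ (hC.XN_dampedHat_one_le hγ f hH)))
  exact ENNReal.add_ne_top.2 ⟨ENNReal.mul_ne_top (freeConst_ne_top hC.lt_half) hf,
    ENNReal.mul_ne_top ENNReal.ofReal_ne_top (ENNReal.mul_ne_top hC.ne_top hH')⟩

theorem coef_damped {γ : ℝ} (hγ : 0 < γ) {f : ℤ → ℂ} {τ : ℝ} {h : ℝ × Torus → ℂ} (hs : SuppIn τ h)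
    (hi : Integrable h vol) {z : ℝ × Torus → ℂ} (hz : FT z (dampedHat γ f (gauge γ h))) (k : ℤ) :
    coef z k =ᵐ[volume] (Ioi (0 : ℝ)).indicator
      (fun t => (Real.exp (-γ * t) : ℂ) * mildCoef f h k t) := by
  have hg : Integrable (gauge γ h) vol :=
    memLp_one_iff_integrable.1 (hs.memLp_gauge hγ.le (memLp_one_iff_integrable.2 hi))
  refine (coef_ae_eq_dampedCoef hγ f hg hz k).trans (ae_of_all _ fun t => ?_)
  exact dampedCoef_gauge f (fun z hz => hs z fun h => absurd h.1 (not_lt.2 hz)) k t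

theorem cut_sub (τ : ℝ) (u v : ℝ × Torus → ℂ) : cut τ (u - v) = cut τ u - cut τ v :=
  indicator_sub _ u v

theorem coef_cut {τ : ℝ} (u : ℝ × Torus → ℂ) (k : ℤ) {t : ℝ} (ht : t ∈ Ioo 0 τ) :
    coef (cut τ u) k t = coef u k t := by
  unfold coef; congr 1; ext x; exact cut_apply ht

theorem coef_of_suppIn {τ : ℝ} {u : ℝ × Torus → ℂ} (h : SuppIn τ u) (k : ℤ) {t : ℝ}
    (ht : t ∉ Ioo 0 τ) : coef u k t = 0 := by
  have : (fun x => u (t, x)) = fun _ => 0 := funext fun x => h (t, x) ht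
  rw [coef, this]; simp [fourierCoeff]

/-- A mild solution is, up to the gauge factor, the damped solution. -/
theorem IsMild.gauge_ae_eq {γ : ℝ} (hγ : 0 < γ) {f : ℤ → ℂ} {τ : ℝ} {h u z : ℝ × Torus → ℂ}
    (hs : SuppIn τ h) (hi : Integrable h vol) (hu : MemLp u 2 vol) (hus : SuppIn τ u)
    (hm : IsMild τ f h u) (hz : FT z (dampedHat γ f (gauge γ h))) :
    gauge γ u =ᵐ[vol] cut τ z := by
  refine ae_eq_of_coef_ae_eq (hus.memLp_gauge hγ.le hu)
    (hz.memLp_left.indicator (measurableSet_strip τ)) fun k => ?_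
  filter_upwards [hm k, coef_damped hγ hs hi hz k] with t h1 h2
  by_cases ht : t ∈ Ioo 0 τ
  · rw [coef_cut z k ht, h2, indicator_of_mem (show t ∈ Ioi (0 : ℝ) from ht.1), ← h1 ht]
    exact coef_const_mul u (fun r => (Real.exp (-γ * r) : ℂ)) k t
  · rw [coef_of_suppIn (suppIn_cut τ z) k ht, coef_of_suppIn (hus.gauge γ) k ht]

theorem eLpNorm_cut_le (τ : ℝ) (z : ℝ × Torus → ℂ) (p : ℝ≥0∞) :
    eLpNorm (cut τ z) p vol ≤ eLpNorm z p vol :=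
  eLpNorm_mono fun _ => norm_indicator_le_norm_self _ _

/-- The basic estimate for mild solutions. -/
theorem IsExponent.eLpNorm_gauge_le (hC : IsExponent β C) {γ : ℝ} (hγ : 1 ≤ γ)
    {f : ℤ → ℂ} (hf : l2n 1 f ≠ ⊤) {τ : ℝ} {h u : ℝ × Torus → ℂ}
    (hs : SuppIn τ h) (hh : MemLp h (4 / 3) vol) (hu : MemLp u 2 vol) (hus : SuppIn τ u)
    (hm : IsMild τ f h u) :
    eLpNorm (gauge γ u) 4 vol ≤ C * (freeConst β * l2n 1 f
      + ENNReal.ofReal (γ ^ (-(1 - 2 * β))) * (C * eLpNorm (gauge γ h) (4 / 3) vol)) := by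
  have hγ0 : 0 < γ := by linarith
  have hi := hs.integrable hh one_le_four_thirds
  have hg := hs.memLp_gauge hγ0.le hh
  have hgi := (hs.gauge γ).integrable hg one_le_four_thirds
  obtain ⟨z, hz⟩ := hC.exists_damped hγ hf hgi hg.eLpNorm_ne_top
  rw [eLpNorm_congr_ae (hm.gauge_ae_eq hγ0 hs hi hu hus hz)]
  refine (eLpNorm_cut_le _ _ _).trans ((hC.strichartz hz).trans ?_)
  gcongr
  exact hC.XN_dampedHat_one_le hγ f hgi

theorem IsExponent.memLp_four (hC : IsExponent β C)
    {f : ℤ → ℂ} (hf : l2n 1 f ≠ ⊤) {τ : ℝ} {h u : ℝ × Torus → ℂ}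
    (hs : SuppIn τ h) (hh : MemLp h (4 / 3) vol) (hu : MemLp u 2 vol) (hus : SuppIn τ u)
    (hm : IsMild τ f h u) : MemLp u 4 vol := by
  refine hus.memLp_of_gauge zero_le_one hu.1 (ne_top_of_le_ne_top ?_
    (hC.eLpNorm_gauge_le le_rfl hf hs hh hu hus hm))
  exact ENNReal.mul_ne_top hC.ne_top (ENNReal.add_ne_top.2 ⟨ENNReal.mul_ne_top
    (freeConst_ne_top hC.lt_half) hf, ENNReal.mul_ne_top ENNReal.ofReal_ne_top
      (ENNReal.mul_ne_top hC.ne_top (hs.memLp_gauge zero_le_one hh).eLpNorm_ne_top)⟩)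

theorem IsExponent.exists_mild (hC : IsExponent β C)
    {f : ℤ → ℂ} (hf : l2n 1 f ≠ ⊤) {τ : ℝ} {h : ℝ × Torus → ℂ}
    (hs : SuppIn τ h) (hh : MemLp h (4 / 3) vol) :
    ∃ u, SuppIn τ u ∧ MemLp u 2 vol ∧ IsMild τ f h u := by
  have hi := hs.integrable hh one_le_four_thirds
  have hg := hs.memLp_gauge zero_le_one hh
  have hgi := (hs.gauge 1).integrable hg one_le_four_thirds
  obtain ⟨z, hz⟩ := hC.exists_damped le_rfl hf hgi hg.eLpNorm_ne_top
  have hm : MemLp (cut τ z) 2 vol := hz.memLp_left.indicator (measurableSet_strip τ)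
  have hus : SuppIn τ (gauge (-1) (cut τ z)) := (suppIn_cut τ z).gauge _
  have hgg : gauge 1 (gauge (-1) (cut τ z)) = cut τ z := by
    ext x; simp only [gauge]; rw [← mul_assoc, ← Complex.ofReal_mul, ← Real.exp_add]; simp
  refine ⟨gauge (-1) (cut τ z), hus, ?_, fun k => ?_⟩
  · refine hus.memLp_of_gauge zero_le_one (aestronglyMeasurable_gauge hm.1 _) ?_
    rw [hgg]; exact hm.eLpNorm_ne_top
  · filter_upwards [coef_damped one_pos hs hi hz k] with t h2 ht
    have e : coef (gauge (-1) (cut τ z)) k t = (Real.exp (-(-1) * t) : ℂ) * coef (cut τ z) k t :=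
      coef_const_mul (cut τ z) (fun r => (Real.exp (-(-1) * r) : ℂ)) k t
    rw [e, coef_cut z k ht, h2, indicator_of_mem (show t ∈ Ioi (0 : ℝ) from ht.1), ← mul_assoc,
      ← Complex.ofReal_mul, ← Real.exp_add]
    simp

theorem exists_gamma_le {θ : ℝ} (hθ : 0 < θ) {X ε : ℝ≥0∞} (hX : X ≠ ⊤) (hε : 0 < ε) :
    ∃ γ : ℝ, 1 ≤ γ ∧ ENNReal.ofReal (γ ^ (-θ)) * X ≤ ε := by
  have h1 : Tendsto (fun γ : ℝ => ENNReal.ofReal (γ ^ (-θ)) * X) atTop (𝓝 0) := by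
    have h2 := ENNReal.tendsto_ofReal (tendsto_rpow_neg_atTop hθ)
    rw [ENNReal.ofReal_zero] at h2
    simpa using ENNReal.Tendsto.mul_const (b := X) h2 (Or.inr hX)
  obtain ⟨γ, h⟩ := ((h1.eventually (eventually_le_nhds hε)).and (eventually_ge_atTop 1)).exists
  exact ⟨γ, h.2, h.1⟩

/-! ### The energy inequality for mild solutions -/

theorem exp_mul_sq_integral_eq {p : ℝ → ℝ} {t : ℝ} (hp : IntervalIntegrable p volume 0 t)
    (c γ : ℝ) :
    Real.exp (-(2 * γ) * t) * (c + ∫ r in (0 : ℝ)..t, p r) ^ 2 = c ^ 2 + ∫ r in (0 : ℝ)..t,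
      Real.exp (-(2 * γ) * r) * (2 * (p r * (c + ∫ v in (0 : ℝ)..r, p v))
        - 2 * γ * (c + ∫ v in (0 : ℝ)..r, p v) ^ 2) := by
  set P : ℝ → ℝ := fun r => c + ∫ v in (0 : ℝ)..r, p v with hP
  have hP1 : AbsolutelyContinuousOnInterval P 0 t := by
    have h1 : AbsolutelyContinuousOnInterval (fun _ : ℝ => c) 0 t :=
      contDiffOn_const.absolutelyContinuousOnInterval
    exact h1.add (hp.absolutelyContinuousOnInterval_intervalIntegral left_mem_uIcc)
  have hE : AbsolutelyContinuousOnInterval (fun r : ℝ => Real.exp (-(2 * γ) * r)) 0 t := by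
    apply ContDiffOn.absolutelyContinuousOnInterval
    fun_prop
  have h := (hE.mul (hP1.mul hP1)).integral_deriv_eq_sub
  have e : ∫ r in (0 : ℝ)..t, deriv ((fun r : ℝ => Real.exp (-(2 * γ) * r)) * (P * P)) r
      = ∫ r in (0 : ℝ)..t, Real.exp (-(2 * γ) * r) * (2 * (p r * P r) - 2 * γ * P r ^ 2) := by
    refine intervalIntegral.integral_congr_ae ?_
    filter_upwards [hp.ae_hasDerivAt_integral] with r hr hrt
    have hd := (hr (uIoc_subset_uIcc hrt) 0 left_mem_uIcc).const_add c
    have hx : HasDerivAt (fun r : ℝ => Real.exp (-(2 * γ) * r))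
        (Real.exp (-(2 * γ) * r) * (-(2 * γ) * 1)) r :=
      ((hasDerivAt_id r).const_mul (-(2 * γ))).exp
    rw [(hx.mul (HasDerivAt.mul hd hd)).deriv]
    simp only [hP, Pi.mul_apply]
    ring
  rw [e] at h
  rw [h]
  simp [hP]
  ring

theorem exp_mul_norm_sq_integral_eq {h : ℝ → ℂ} {t : ℝ} (hh : IntervalIntegrable h volume 0 t)
    (c : ℂ) (γ : ℝ) :
    Real.exp (-(2 * γ) * t) * ‖c + ∫ r in (0 : ℝ)..t, h r‖ ^ 2 = ‖c‖ ^ 2 + ∫ r in (0 : ℝ)..t,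
      Real.exp (-(2 * γ) * r) *
        (2 * (h r * starRingEnd ℂ (c + ∫ v in (0 : ℝ)..r, h v)).re
          - 2 * γ * ‖c + ∫ v in (0 : ℝ)..r, h v‖ ^ 2) := by
  have hre : IntervalIntegrable (fun r => (h r).re) volume 0 t :=
    ⟨hh.1.re, hh.2.re⟩
  have him : IntervalIntegrable (fun r => (h r).im) volume 0 t :=
    ⟨hh.1.im, hh.2.im⟩
  have hI : ∀ r ∈ uIcc 0 t, (∫ v in (0 : ℝ)..r, h v).re = ∫ v in (0 : ℝ)..r, (h v).re ∧
      (∫ v in (0 : ℝ)..r, h v).im = ∫ v in (0 : ℝ)..r, (h v).im := by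
    intro r hr
    have := hh.mono_set (uIcc_subset_uIcc_left hr)
    exact ⟨(intervalIntegral.intervalIntegral_re this).symm,
      (intervalIntegral.intervalIntegral_im this).symm⟩
  have hn : ∀ z : ℂ, ‖z‖ ^ 2 = z.re ^ 2 + z.im ^ 2 := fun z => by
    rw [← Complex.normSq_eq_norm_sq, Complex.normSq_apply]; ring
  have h1 := exp_mul_sq_integral_eq hre c.re γ
  have h2 := exp_mul_sq_integral_eq him c.im γ
  have hcont : ∀ p : ℝ → ℝ, IntervalIntegrable p volume 0 t → ∀ c : ℝ,
      IntervalIntegrable (fun r => Real.exp (-(2 * γ) * r) *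
        (2 * (p r * (c + ∫ v in (0 : ℝ)..r, p v)) - 2 * γ * (c + ∫ v in (0 : ℝ)..r, p v) ^ 2))
        volume 0 t := by
    intro p hp c
    have hc : ContinuousOn (fun r => c + ∫ v in (0 : ℝ)..r, p v) (uIcc 0 t) :=
      continuousOn_const.add (hp.absolutelyContinuousOnInterval_intervalIntegral
        left_mem_uIcc).continuousOn
    refine IntervalIntegrable.continuousOn_mul (IntervalIntegrable.sub ?_ ?_) (by fun_prop)
    · exact (hp.mul_continuousOn hc).const_mul 2
    · exact (continuousOn_const.mul (hc.pow 2)).intervalIntegrable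
  rw [hn, hn, Complex.add_re, Complex.add_im, (hI t right_mem_uIcc).1, (hI t right_mem_uIcc).2,
    mul_add, h1, h2, add_add_add_comm, ← intervalIntegral.integral_add (hcont _ hre _)
      (hcont _ him _)]
  congr 1
  refine intervalIntegral.integral_congr fun r hr => ?_
  simp only [hn, map_add, Complex.mul_re, Complex.add_re, Complex.add_im, Complex.conj_re,
    Complex.conj_im, (hI r hr).1, (hI r hr).2]
  ring

theorem norm_exp_I_mul (x : ℝ) (t : ℝ) : ‖Complex.exp (Complex.I * x * t)‖ = 1 := by
  rw [mul_assoc, mul_comm, ← Complex.ofReal_mul, Complex.norm_exp_ofReal_mul_I]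

theorem intervalIntegrable_exp_mul {h : ℝ → ℂ} (hh : Integrable h) (x a b : ℝ) :
    IntervalIntegrable (fun r => Complex.exp (Complex.I * x * r) * h r) volume a b := by
  refine (Integrable.bdd_mul (c := 1) hh ?_ (ae_of_all _ fun r => ?_)).intervalIntegrable
  · exact (by fun_prop : Continuous fun r : ℝ => Complex.exp (Complex.I * x * r)).aestronglyMeasurable
  · rw [norm_exp_I_mul]

theorem norm_mildCoef (f : ℤ → ℂ) (h : ℝ × Torus → ℂ) (k : ℤ) (t : ℝ) :
    ‖mildCoef f h k t‖
      = ‖f k + ∫ r in (0 : ℝ)..t, Complex.exp (Complex.I * symb k * r) * coef h k r‖ := by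
  have : -(Complex.I * symb k * t) = Complex.I * ((-symb k : ℝ) : ℂ) * t := by push_cast; ring
  rw [mildCoef, norm_mul, this, norm_exp_I_mul, one_mul]

/-- The energy identity for a single Fourier coefficient. -/
theorem energy_mildCoef {f : ℤ → ℂ} {h : ℝ × Torus → ℂ} (hh : Integrable h vol) (k : ℤ)
    (γ t : ℝ) :
    Real.exp (-(2 * γ) * t) * ‖mildCoef f h k t‖ ^ 2 = ‖f k‖ ^ 2 + ∫ r in (0 : ℝ)..t,
      Real.exp (-(2 * γ) * r) *
        (2 * (coef h k r * starRingEnd ℂ (mildCoef f h k r)).re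
          - 2 * γ * ‖mildCoef f h k r‖ ^ 2) := by
  have hi := intervalIntegrable_exp_mul (integrable_coef hh k) (symb k) 0 t
  rw [norm_mildCoef, exp_mul_norm_sq_integral_eq hi (f k) γ]
  congr 1
  refine intervalIntegral.integral_congr fun r _ => ?_
  have e : coef h k r * starRingEnd ℂ (mildCoef f h k r)
      = Complex.exp (Complex.I * symb k * r) * coef h k r * starRingEnd ℂ
        (f k + ∫ v in (0 : ℝ)..r, Complex.exp (Complex.I * symb k * v) * coef h k v) := by
    rw [mildCoef, map_mul, ← Complex.exp_conj]
    simp only [map_neg, map_mul, Complex.conj_I, Complex.conj_ofReal, neg_mul, neg_neg]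
    ring
  simp only [norm_mildCoef, e]

/-- The projection to the frequencies `|k| ≤ N`. -/
def proj (N : ℕ) (u : ℝ × Torus → ℂ) (z : ℝ × Torus) : ℂ :=
  ∑ k ∈ Finset.Icc (-N : ℤ) N, coef u k z.1 * fourier k z.2

theorem memLp_mul_fourier {c : ℝ → ℂ} (hc : MemLp c 2 volume) (k : ℤ) :
    MemLp (fun z : ℝ × Torus => c z.1 * fourier k z.2) 2 vol := by
  have h1 : MemLp (fun z : ℝ × Torus => c z.1) 2 vol := hc.comp_fst _
  refine h1.mono (h1.1.mul ((fourier k).continuous.comp continuous_snd).aestronglyMeasurable)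
    (ae_of_all _ fun z => ?_)
  rw [norm_mul, fourier_apply, Circle.norm_coe, mul_one]

theorem memLp_proj {u : ℝ × Torus → ℂ} (hu : MemLp u 2 vol) (N : ℕ) : MemLp (proj N u) 2 vol := by
  have : proj N u = ∑ k ∈ Finset.Icc (-N : ℤ) N, fun z => coef u k z.1 * fourier k z.2 := by
    ext z; simp [proj]
  rw [this]
  exact memLp_finsetSum' _ fun k _ => memLp_mul_fourier (memLp_coef hu k) k

theorem coef_proj (N : ℕ) (u : ℝ × Torus → ℂ) (k : ℤ) (t : ℝ) :
    coef (proj N u) k t = if k ∈ Finset.Icc (-N : ℤ) N then coef u k t else 0 := by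
  have e : (fun x => proj N u (t, x))
      = ∑ j ∈ Finset.Icc (-N : ℤ) N, fun x : Torus => coef u j t * fourier j x := by
    ext x; simp [proj]
  have h : ∀ j, fourierCoeff (fun x : Torus => coef u j t * fourier j x) k
      = coef u j t * if k = j then 1 else 0 := fun j => by
    rw [fourierCoeff.const_mul (T := 2 * Real.pi) (fun x : Torus => fourier j x) _ k,
      fourierCoeff_fourier, Pi.single_apply]
  unfold coef at *
  rw [e, fourierCoeff.sum, Finset.sum_apply, Finset.sum_congr rfl fun j _ => h j]
  · simp
  · intro j _
    exact (continuous_const.mul (fourier j).continuous).integrable_of_hasCompactSupport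
      (HasCompactSupport.of_compactSpace _)

theorem l2Fourier_zero : l2Fourier (fun _ => 0) =ᵐ[volume] 0 := by
  have := l2Fourier_const_smul (f := fun _ => 0) 0 MemLp.zero'
  simpa [← Pi.zero_def] using this

/-- The restriction of `w` to the frequencies `|k| ≤ N`. -/
def projHat (N : ℕ) (w : ℤ × ℝ → ℂ) : ℤ × ℝ → ℂ :=
  (Icc (-N : ℤ) N ×ˢ univ).indicator w

theorem FT.proj {u : ℝ × Torus → ℂ} {w : ℤ × ℝ → ℂ} (h : FT u w) (N : ℕ) :
    FT (proj N u) (projHat N w) := by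
  refine ⟨memLp_proj h.memLp_left N, h.memLp_right.indicator
    (measurableSet_Icc.prod MeasurableSet.univ), fun k => ?_⟩
  by_cases hk : k ∈ Icc (-N : ℤ) N
  · have e : coef (FourthOrderNLS.proj N u) k = coef u k := by
      ext t; rw [coef_proj, if_pos (Finset.mem_Icc.2 hk)]
    rw [e]
    refine (h.ae_eq k).trans (ae_of_all _ fun ξ => ?_)
    simp only [projHat]
    rw [indicator_of_mem]
    exact ⟨hk, mem_univ _⟩
  · have e : coef (FourthOrderNLS.proj N u) k = fun _ => 0 := by
      ext t; rw [coef_proj, if_neg fun h => hk (Finset.mem_Icc.1 h)]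
    rw [e]
    refine l2Fourier_zero.trans (ae_of_all _ fun ξ => ?_)
    simp only [projHat]
    rw [indicator_of_notMem fun h => hk h.1]; rfl

theorem tendsto_XN_projHat {β : ℝ} {m : ℤ → ℝ} {w : ℤ × ℝ → ℂ} (hw : AEStronglyMeasurable w nu)
    (h : XN β m w ≠ ⊤) : Tendsto (fun n => XN β m (w - projHat n w)) atTop (𝓝 0) := by
  refine tendsto_of_tendsto_of_tendsto_of_le_of_le tendsto_const_nhds (tendsto_XN_trunc hw h)
    (fun _ => bot_le) fun n => XN_mono_enorm fun q => ?_
  refine mul_le_mul_of_nonneg_left ?_ (mul_nonneg (abs_nonneg _) (wt_pos _ _).le)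
  simp only [Pi.sub_apply, projHat, trunc]
  by_cases hq : q ∈ box n
  · have : q ∈ Icc (-n : ℤ) n ×ˢ (univ : Set ℝ) := ⟨hq.1, mem_univ _⟩
    simp [hq, this]
  · by_cases hq' : q ∈ Icc (-n : ℤ) n ×ˢ (univ : Set ℝ) <;> simp [hq, hq']

theorem IsStrichartzConst.tendsto_proj (hC : IsStrichartzConst β C)
    {u : ℝ × Torus → ℂ} {w : ℤ × ℝ → ℂ} (h : FT u w) (hX : XN β 1 w ≠ ⊤) :
    Tendsto (fun N => eLpNorm (u - proj N u) 4 vol) atTop (𝓝 0) := by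
  have h1 := ENNReal.Tendsto.const_mul (a := C) (tendsto_XN_projHat h.memLp_right.1 hX)
    (Or.inr hC.ne_top)
  rw [mul_zero] at h1
  exact tendsto_of_tendsto_of_tendsto_of_le_of_le tendsto_const_nhds h1 (fun _ => bot_le)
    fun N => hC.strichartz (h.sub (h.proj N))

theorem cut_proj (τ : ℝ) (N : ℕ) (u : ℝ × Torus → ℂ) : proj N (cut τ u) = cut τ (proj N u) := by
  ext z
  by_cases hz : z.1 ∈ Ioo 0 τ
  · rw [cut_apply hz]; simp only [proj, coef_cut u _ hz]
  · rw [suppIn_cut τ _ z hz]; simp [proj, coef_of_suppIn (suppIn_cut τ u) _ hz]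

theorem proj_congr {u v : ℝ × Torus → ℂ} (h : u =ᵐ[vol] v) (N : ℕ) :
    proj N u =ᵐ[vol] proj N v := by
  have h1 : ∀ k, ∀ᵐ z : ℝ × Torus ∂vol, coef u k z.1 = coef v k z.1 := fun k =>
    Measure.quasiMeasurePreserving_fst.ae (coef_congr_ae h k)
  filter_upwards [ae_all_iff.2 h1] with z hz
  simp [proj, hz]

theorem IsExponent.tendsto_proj_gauge (hC : IsExponent β C) {γ : ℝ} (hγ : 1 ≤ γ)
    {f : ℤ → ℂ} (hf : l2n 1 f ≠ ⊤) {τ : ℝ} {h u : ℝ × Torus → ℂ}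
    (hs : SuppIn τ h) (hh : MemLp h (4 / 3) vol) (hu : MemLp u 2 vol) (hus : SuppIn τ u)
    (hm : IsMild τ f h u) :
    Tendsto (fun N => eLpNorm (gauge γ u - proj N (gauge γ u)) 4 vol) atTop (𝓝 0) := by
  have hγ0 : 0 < γ := by linarith
  have hi := hs.integrable hh one_le_four_thirds
  have hg := hs.memLp_gauge hγ0.le hh
  have hgi := (hs.gauge γ).integrable hg one_le_four_thirds
  obtain ⟨z, hz⟩ := hC.exists_damped hγ hf hgi hg.eLpNorm_ne_top
  have hX : XN β 1 (dampedHat γ f (gauge γ h)) ≠ ⊤ :=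
    ne_top_of_le_ne_top (ENNReal.add_ne_top.2 ⟨ENNReal.mul_ne_top
      (freeConst_ne_top hC.lt_half) hf, ENNReal.mul_ne_top ENNReal.ofReal_ne_top
        (ENNReal.mul_ne_top hC.ne_top hg.eLpNorm_ne_top)⟩) (hC.XN_dampedHat_one_le hγ f hgi)
  have e := hm.gauge_ae_eq hγ0 hs hi hu hus hz
  refine tendsto_of_tendsto_of_tendsto_of_le_of_le tendsto_const_nhds (hC.tendsto_proj hz hX)
    (fun _ => bot_le) fun N => ?_
  have e2 : gauge γ u - proj N (gauge γ u) =ᵐ[vol] cut τ (z - proj N z) := by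
    rw [cut_sub, ← cut_proj]
    exact e.sub (proj_congr e N)
  simp only []
  rw [eLpNorm_congr_ae e2]
  exact eLpNorm_cut_le _ _ _

theorem integrable_mul_conj_fourier {G : ℝ × Torus → ℂ} (hG : Integrable G vol) {c : ℝ → ℂ}
    (hc : AEStronglyMeasurable c volume) {D : ℝ} (hD : ∀ᵐ t, ‖c t‖ ≤ D) (k : ℤ) :
    Integrable (fun z : ℝ × Torus => G z * starRingEnd ℂ (c z.1 * fourier k z.2)) vol := by
  refine hG.mul_bdd (c := D) ?_ ?_
  · exact Complex.continuous_conj.comp_aestronglyMeasurable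
      (hc.comp_fst.mul ((fourier k).continuous.comp continuous_snd).aestronglyMeasurable)
  · filter_upwards [Measure.quasiMeasurePreserving_fst.ae hD] with z hz
    rwa [RCLike.norm_conj, norm_mul, fourier_apply, Circle.norm_coe, mul_one]

theorem integral_mul_conj_fourier {G : ℝ × Torus → ℂ} (hG : Integrable G vol) {c : ℝ → ℂ}
    (hc : AEStronglyMeasurable c volume) {D : ℝ} (hD : ∀ᵐ t, ‖c t‖ ≤ D) (k : ℤ) (S : Set ℝ) :
    ∫ z in S ×ˢ univ, G z * starRingEnd ℂ (c z.1 * fourier k z.2) ∂vol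
      = (2 * Real.pi : ℝ) * ∫ r in S, coef G k r * starRingEnd ℂ (c r) := by
  rw [setIntegral_prod _ (integrable_mul_conj_fourier hG hc hD k).integrableOn,
    ← integral_const_mul]
  congr 1; ext r
  rw [coef, fourierCoeff_eq_integral, Measure.restrict_univ, ← mul_assoc, ← mul_assoc,
    ← Complex.ofReal_mul, mul_inv_cancel₀ (by positivity), Complex.ofReal_one, one_mul,
    ← integral_mul_const]
  congr 1; ext x
  rw [map_mul, fourier_neg]
  ring

theorem integrable_mul_conj_proj {G v : ℝ × Torus → ℂ} (hG : Integrable G vol)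
    (hv : AEStronglyMeasurable v vol) {D : ℤ → ℝ} (hD : ∀ k, ∀ᵐ t, ‖coef v k t‖ ≤ D k) (N : ℕ) :
    Integrable (fun z => G z * starRingEnd ℂ (proj N v z)) vol := by
  simp only [proj, map_sum, Finset.mul_sum]
  exact integrable_finsetSum _ fun k _ =>
    integrable_mul_conj_fourier hG (aestronglyMeasurable_coef hv k) (hD k) k

theorem integral_mul_conj_proj {G v : ℝ × Torus → ℂ} (hG : Integrable G vol)
    (hv : AEStronglyMeasurable v vol) {D : ℤ → ℝ} (hD : ∀ k, ∀ᵐ t, ‖coef v k t‖ ≤ D k) (N : ℕ)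
    (S : Set ℝ) :
    ∫ z in S ×ˢ univ, G z * starRingEnd ℂ (proj N v z) ∂vol = (2 * Real.pi : ℝ) *
      ∑ k ∈ Finset.Icc (-N : ℤ) N, ∫ r in S, coef G k r * starRingEnd ℂ (coef v k r) := by
  simp only [proj, map_sum, Finset.mul_sum]
  rw [integral_finsetSum _ fun k _ => (integrable_mul_conj_fourier hG
    (aestronglyMeasurable_coef hv k) (hD k) k).integrableOn]
  exact Finset.sum_congr rfl fun k _ => integral_mul_conj_fourier hG
    (aestronglyMeasurable_coef hv k) (hD k) k S

theorem norm_mildCoef_le (f : ℤ → ℂ) {h : ℝ × Torus → ℂ} (hh : Integrable h vol) (k : ℤ) {t : ℝ}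
    (ht : 0 ≤ t) : ‖mildCoef f h k t‖ ≤ ‖f k‖ + ∫ r, ‖coef h k r‖ := by
  rw [norm_mildCoef]
  refine (norm_add_le _ _).trans ?_
  gcongr
  refine (intervalIntegral.norm_integral_le_integral_norm ht).trans ?_
  simp only [norm_mul, norm_exp_I_mul, one_mul]
  rw [intervalIntegral.integral_of_le ht]
  exact setIntegral_le_integral (integrable_coef hh k).norm (ae_of_all _ fun _ => norm_nonneg _)

theorem coef_gauge (γ : ℝ) (u : ℝ × Torus → ℂ) (k : ℤ) (t : ℝ) :
    coef (gauge γ u) k t = (Real.exp (-γ * t) : ℂ) * coef u k t :=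
  coef_const_mul u (fun r => (Real.exp (-γ * r) : ℂ)) k t

theorem IsMild.norm_coef_gauge_le {γ τ : ℝ} (hγ : 0 ≤ γ) {f : ℤ → ℂ} {h u : ℝ × Torus → ℂ}
    (hh : Integrable h vol) (hus : SuppIn τ u) (hm : IsMild τ f h u) (k : ℤ) :
    ∀ᵐ t, ‖coef (gauge γ u) k t‖ ≤ ‖f k‖ + ∫ r, ‖coef h k r‖ := by
  filter_upwards [hm k] with t ht
  by_cases hτ : t ∈ Ioo 0 τ
  · rw [coef_gauge, ht hτ, norm_mul, Complex.norm_real, Real.norm_of_nonneg (Real.exp_pos _).le]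
    refine (mul_le_of_le_one_left (norm_nonneg _) (Real.exp_le_one_iff.2 ?_)).trans
      (norm_mildCoef_le f hh k hτ.1.le)
    nlinarith [hτ.1]
  · rw [coef_of_suppIn (hus.gauge γ) k hτ, norm_zero]
    exact add_nonneg (norm_nonneg _) (integral_nonneg fun _ => norm_nonneg _)

theorem IsMild.energy_proj {γ τ t : ℝ} (hγ : 0 ≤ γ) {f : ℤ → ℂ} {h u : ℝ × Torus → ℂ}
    (hh : Integrable h vol) (hs : SuppIn τ h) (hus : SuppIn τ u) (hu : Integrable u vol)
    (hm : IsMild τ f h u) (ht : t ∈ Icc 0 τ) (N : ℕ) :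
    ∑ k ∈ Finset.Icc (-N : ℤ) N, Real.exp (-(2 * γ) * t) * ‖mildCoef f h k t‖ ^ 2
      = ∑ k ∈ Finset.Icc (-N : ℤ) N, ‖f k‖ ^ 2
        + (2 * Real.pi)⁻¹ * (∫ z in Ioo 0 t ×ˢ univ, (2 * gauge γ h z - 2 * γ * gauge γ u z) *
            starRingEnd ℂ (proj N (gauge γ u) z) ∂vol).re := by
  have hgh : Integrable (gauge γ h) vol :=
    memLp_one_iff_integrable.1 (hs.memLp_gauge hγ (memLp_one_iff_integrable.2 hh))
  have hgu : Integrable (gauge γ u) vol :=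
    memLp_one_iff_integrable.1 (hus.memLp_gauge hγ (memLp_one_iff_integrable.2 hu))
  have hG : Integrable (fun z => 2 * gauge γ h z - 2 * γ * gauge γ u z) vol :=
    (hgh.const_mul _).sub (hgu.const_mul _)
  have hD := hm.norm_coef_gauge_le hγ hh hus
  rw [integral_mul_conj_proj hG hgu.1 hD, Complex.re_ofReal_mul, ← mul_assoc,
    inv_mul_cancel₀ (by positivity), one_mul, Complex.re_sum, ← Finset.sum_add_distrib]
  refine Finset.sum_congr rfl fun k _ => ?_
  rw [energy_mildCoef hh, intervalIntegral.integral_of_le ht.1, integral_Ioc_eq_integral_Ioo]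
  congr 1
  have hi : Integrable (fun r => coef (fun z => 2 * gauge γ h z - 2 * γ * gauge γ u z) k r
      * starRingEnd ℂ (coef (gauge γ u) k r)) := by
    refine (integrable_coef hG k).mul_bdd (c := ‖f k‖ + ∫ r, ‖coef h k r‖)
      (Complex.continuous_conj.comp_aestronglyMeasurable (aestronglyMeasurable_coef hgu.1 k)) ?_
    filter_upwards [hD k] with r hr
    rwa [RCLike.norm_conj]
  rw [← Complex.reCLM_apply, ← ContinuousLinearMap.integral_comp_comm _ hi.integrableOn]
  refine setIntegral_congr_ae measurableSet_Ioo ?_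
  have hc : coef (fun z => 2 * gauge γ h z - 2 * γ * gauge γ u z) k =ᵐ[volume]
      coef (fun z => 2 * gauge γ h z) k - coef (fun z => 2 * γ * gauge γ u z) k :=
    coef_sub_ae (hgh.const_mul 2) (hgu.const_mul _) k
  filter_upwards [hm k, hc] with r hr hc hrt
  have hr' : r ∈ Ioo 0 τ := ⟨hrt.1, hrt.2.trans_le ht.2⟩
  rw [hc, Pi.sub_apply, coef_const_mul (gauge γ h) (fun _ => (2 : ℂ)),
    coef_const_mul (gauge γ u) (fun _ => (2 * γ : ℂ)), coef_gauge, coef_gauge, hr hr']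
  have e : Real.exp (-(2 * γ) * r) = Real.exp (-γ * r) * Real.exp (-γ * r) := by
    rw [← Real.exp_add]; congr 1; ring
  rw [e, ← Complex.normSq_eq_norm_sq, Complex.normSq_apply, Complex.reCLM_apply]
  generalize Real.exp (-γ * r) = E
  simp
  ring

/-- The energy inequality: `d` bounds the rate of change of the damped energy. -/
theorem IsExponent.energy_le (hC : IsExponent β C) {γ τ t : ℝ} (hγ : 1 ≤ γ)
    {f : ℤ → ℂ} (hf : l2n 1 f ≠ ⊤) {h u : ℝ × Torus → ℂ}
    (hs : SuppIn τ h) (hh : MemLp h (4 / 3) vol) (hu : MemLp u 2 vol) (hus : SuppIn τ u)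
    (hm : IsMild τ f h u) (ht : t ∈ Icc 0 τ) {d : ℝ × Torus → ℝ} (hd : Integrable d vol)
    (hd0 : 0 ≤ d)
    (hdle : ∀ᵐ z ∂vol, 2 * (h z * starRingEnd ℂ (u z)).re - 2 * γ * ‖u z‖ ^ 2 ≤ d z) :
    l2n 1 (fun k => mildCoef f h k t) ^ 2
      ≤ ENNReal.ofReal (Real.exp (2 * γ * τ)) * (l2n 1 f ^ 2 + ∫⁻ z, ENNReal.ofReal (d z) ∂vol) := by
  have hγ0 : 0 ≤ γ := by linarith
  have hi := hs.integrable hh one_le_four_thirds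
  have hui := hus.integrable hu (by norm_num)
  have hu4 := hC.memLp_four hf hs hh hu hus hm
  have hf2 : ∑' k, ‖f k‖ₑ ^ 2 ≠ ⊤ := by
    have := ENNReal.pow_ne_top (n := 2) hf
    rw [l2n_sq] at this; simpa using this
  have hfs : Summable fun k => ‖f k‖ ^ 2 := by
    have := ENNReal.summable_toReal hf2
    simpa using this
  set v := gauge γ u with hv
  set G : ℝ × Torus → ℂ := fun z => 2 * gauge γ h z - 2 * γ * v z with hG
  have hgh := hs.memLp_gauge hγ0 hh
  have hv4 : MemLp v 4 vol := hus.memLp_gauge hγ0 hu4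
  have hGm : MemLp G (4 / 3) vol :=
    (hgh.const_mul 2).sub (((hus.gauge γ).memLp_of_le hv4 four_thirds_le_four).const_mul (2 * γ : ℂ))
  have hGi : Integrable G vol := (((hs.gauge γ).integrable hgh one_le_four_thirds).const_mul 2).sub
    (((hus.gauge γ).integrable hv4 (by norm_num)).const_mul (2 * γ : ℂ))
  have hD := hm.norm_coef_gauge_le hγ0 hi hus
  have hGv : Integrable (fun z => G z * starRingEnd ℂ (v z)) vol := by
    refine memLp_one_iff_integrable.1 ⟨hGm.1.mul
      (Complex.continuous_conj.comp_aestronglyMeasurable hv4.1), ?_⟩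
    refine (eLpNorm_mul_le (4 / 3) 4 1 hGm.1
      (Complex.continuous_conj.comp_aestronglyMeasurable hv4.1)).trans_lt ?_
    refine ENNReal.mul_lt_top hGm.2 ?_
    have : eLpNorm (fun z => starRingEnd ℂ (v z)) 4 vol = eLpNorm v 4 vol :=
      eLpNorm_congr_norm_ae (ae_of_all _ fun z => by simp)
    exact this.trans_lt hv4.2
  set S : Set (ℝ × Torus) := Ioo 0 t ×ˢ univ with hS
  have hlim : Tendsto (fun N => ∫ z in S, G z * starRingEnd ℂ (proj N v z) ∂vol) atTop
      (𝓝 (∫ z in S, G z * starRingEnd ℂ (v z) ∂vol)) := by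
    rw [tendsto_iff_edist_tendsto_0]
    have h1 := ENNReal.Tendsto.const_mul (a := eLpNorm G (4 / 3) vol)
      (hC.tendsto_proj_gauge hγ hf hs hh hu hus hm) (Or.inr hGm.2.ne)
    rw [mul_zero] at h1
    refine tendsto_of_tendsto_of_tendsto_of_le_of_le tendsto_const_nhds h1 (fun _ => bot_le)
      fun N => ?_
    simp only []
    have hPm : AEStronglyMeasurable (v - proj N v) vol :=
      hv4.1.sub (memLp_proj (hus.memLp_gauge hγ0 hu) N).1
    rw [edist_comm, edist_eq_enorm_sub, ← integral_sub hGv.integrableOn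
      (integrable_mul_conj_proj hGi hv4.1 hD N).integrableOn]
    have e : ∀ z, G z * starRingEnd ℂ (v z) - G z * starRingEnd ℂ (proj N v z)
        = G z * starRingEnd ℂ ((v - proj N v) z) := fun z => by
      rw [Pi.sub_apply, map_sub]; ring
    simp_rw [e]
    refine (enorm_integral_mul_le hGm.1.restrict
      (Complex.continuous_conj.comp_aestronglyMeasurable hPm).restrict).trans ?_
    refine mul_le_mul' (eLpNorm_mono_measure _ Measure.restrict_le_self) ?_
    refine (eLpNorm_mono_measure _ Measure.restrict_le_self).trans_eq ?_
    exact eLpNorm_congr_norm_ae (ae_of_all _ fun z => RCLike.norm_conj _)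
  have hle : (∫ z in S, G z * starRingEnd ℂ (v z) ∂vol).re ≤ ∫ z, d z ∂vol := by
    rw [← Complex.reCLM_apply, ← ContinuousLinearMap.integral_comp_comm _ hGv.integrableOn]
    have h2 : ∫ z in S, d z ∂vol ≤ ∫ z, d z ∂vol :=
      setIntegral_le_integral hd (ae_of_all _ hd0)
    refine le_trans (integral_mono_ae (Complex.reCLM.integrable_comp hGv.integrableOn)
      hd.integrableOn ?_) h2
    filter_upwards [ae_restrict_of_ae hdle, ae_restrict_mem
      (measurableSet_Ioo.prod MeasurableSet.univ)] with z hz hzS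
    have e : G z * starRingEnd ℂ (v z) = (Real.exp (-γ * z.1) ^ 2 : ℝ) *
        (2 * (h z * starRingEnd ℂ (u z)) - 2 * γ * (‖u z‖ ^ 2 : ℝ)) := by
      rw [← Complex.normSq_eq_norm_sq, Complex.normSq_eq_conj_mul_self]
      simp only [hG, hv, gauge, map_mul, Complex.conj_ofReal]
      push_cast; ring
    rw [Complex.reCLM_apply, e, Complex.re_ofReal_mul]
    have e2 : (2 * (h z * starRingEnd ℂ (u z)) - 2 * γ * (‖u z‖ ^ 2 : ℝ) : ℂ).re
        = 2 * (h z * starRingEnd ℂ (u z)).re - 2 * γ * ‖u z‖ ^ 2 := by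
      have : (2 * γ * (‖u z‖ ^ 2 : ℝ) : ℂ) = ((2 * γ * ‖u z‖ ^ 2 : ℝ) : ℂ) := by push_cast; ring
      rw [this, Complex.sub_re, Complex.ofReal_re]; simp
    rw [e2]
    refine (mul_le_mul_of_nonneg_left hz (sq_nonneg _)).trans
      (mul_le_of_le_one_left (hd0 z) (pow_le_one₀ (Real.exp_pos _).le (Real.exp_le_one_iff.2 ?_)))
    nlinarith [hzS.1.1]
  have hmain : ∀ N : ℕ, ∑ k ∈ Finset.Icc (-N : ℤ) N, Real.exp (-(2 * γ) * t) * ‖mildCoef f h k t‖ ^ 2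
      ≤ ∑' k, ‖f k‖ ^ 2 + ∫ z, d z ∂vol := by
    intro N
    have h3 : Tendsto (fun N => ∑' k, ‖f k‖ ^ 2 + (2 * Real.pi)⁻¹ *
        (∫ z in S, G z * starRingEnd ℂ (proj N v z) ∂vol).re) atTop
        (𝓝 (∑' k, ‖f k‖ ^ 2 + (2 * Real.pi)⁻¹ * (∫ z in S, G z * starRingEnd ℂ (v z) ∂vol).re)) :=
      (((Complex.continuous_re.tendsto _).comp hlim).const_mul _).const_add _
    have h4 := ge_of_tendsto h3 (b := ∑ k ∈ Finset.Icc (-N : ℤ) N,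
      Real.exp (-(2 * γ) * t) * ‖mildCoef f h k t‖ ^ 2) ?_
    · refine h4.trans ?_
      gcongr
      have h5 : 0 ≤ ∫ z, d z ∂vol := integral_nonneg hd0
      refine (mul_le_mul_of_nonneg_left hle (by positivity)).trans ?_
      exact mul_le_of_le_one_left h5 (inv_le_one_of_one_le₀ (by nlinarith [Real.pi_gt_three]))
    · filter_upwards [eventually_ge_atTop N] with M hM
      calc _ ≤ ∑ k ∈ Finset.Icc (-M : ℤ) M, Real.exp (-(2 * γ) * t) * ‖mildCoef f h k t‖ ^ 2 := by
            refine Finset.sum_le_sum_of_subset_of_nonneg (Finset.Icc_subset_Icc ?_ ?_)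
              fun _ _ _ => by positivity
            · simpa using hM
            · simpa using hM
        _ ≤ _ := by
            rw [hm.energy_proj hγ0 hi hs hus hui ht M]
            gcongr
            exact hfs.sum_le_tsum _ fun k _ => sq_nonneg _
  have hfin : ∀ s : Finset ℤ, ∑ k ∈ s, (ENNReal.ofReal |(1 : ℤ → ℝ) k| * ‖mildCoef f h k t‖ₑ) ^ 2
      ≤ ENNReal.ofReal (Real.exp (2 * γ * τ)) * (l2n 1 f ^ 2 + ∫⁻ z, ENNReal.ofReal (d z) ∂vol) := by
    intro s
    obtain ⟨N, hN⟩ : ∃ N : ℕ, s ⊆ Finset.Icc (-N : ℤ) N := by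
      refine ⟨∑ k ∈ s, k.natAbs, fun k hk => ?_⟩
      have := Finset.single_le_sum (f := fun k : ℤ => k.natAbs) (fun _ _ => bot_le) hk
      rw [Finset.mem_Icc]; omega
    have e1 : ∑ k ∈ s, (ENNReal.ofReal |(1 : ℤ → ℝ) k| * ‖mildCoef f h k t‖ₑ) ^ 2
        = ENNReal.ofReal (∑ k ∈ s, ‖mildCoef f h k t‖ ^ 2) := by
      rw [ENNReal.ofReal_sum_of_nonneg fun _ _ => sq_nonneg _]
      refine Finset.sum_congr rfl fun k _ => ?_
      rw [ENNReal.ofReal_pow (norm_nonneg _), ofReal_norm]; simp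
    have e2 : l2n 1 f ^ 2 + ∫⁻ z, ENNReal.ofReal (d z) ∂vol
        = ENNReal.ofReal (∑' k, ‖f k‖ ^ 2 + ∫ z, d z ∂vol) := by
      rw [ENNReal.ofReal_add (tsum_nonneg fun _ => sq_nonneg _) (integral_nonneg hd0),
        ofReal_integral_eq_lintegral_ofReal hd (ae_of_all _ hd0),
        ENNReal.ofReal_tsum_of_nonneg (fun _ => sq_nonneg _) hfs, l2n_sq]
      congr 2; ext k
      rw [ENNReal.ofReal_pow (norm_nonneg _), ofReal_norm]; simp
    rw [e1, e2, ← ENNReal.ofReal_mul (Real.exp_pos _).le]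
    refine ENNReal.ofReal_le_ofReal ?_
    have h6 := (Finset.sum_le_sum_of_subset_of_nonneg
      (f := fun k => Real.exp (-(2 * γ) * t) * ‖mildCoef f h k t‖ ^ 2) hN
      fun k _ _ => by positivity).trans (hmain N)
    rw [← Finset.mul_sum] at h6
    have h7 := mul_le_mul_of_nonneg_left h6 (Real.exp_pos (2 * γ * t)).le
    rw [← mul_assoc, ← Real.exp_add, show 2 * γ * t + -(2 * γ) * t = 0 by ring, Real.exp_zero,
      one_mul] at h7
    refine h7.trans (mul_le_mul_of_nonneg_right (Real.exp_le_exp.2 ?_)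
      (add_nonneg (tsum_nonneg fun _ => sq_nonneg _) (integral_nonneg hd0)))
    nlinarith [ht.2]
  rw [l2n_sq, ENNReal.tsum_eq_iSup_sum]
  exact iSup_le hfin

/-! ### The nonlinear equation in `L⁴` -/

/-- The cubic nonlinearity `|u|²u`. -/
def cubic (u : ℝ × Torus → ℂ) (z : ℝ × Torus) : ℂ := ((‖u z‖ ^ 2 : ℝ) : ℂ) * u z

/-- The forcing term of the equation `∂ₜu = i∂ₓ²u - i∂ₓ⁴u + forcing`. -/
def forcing (ℓ : ℝ → ℝ) (c : ℝ × Torus → ℝ) (g u : ℝ × Torus → ℂ) (z : ℝ × Torus) : ℂ :=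
  -(Complex.I * ((ℓ z.1 : ℂ) * cubic u z)) - c z * u z - Complex.I * g z

/-- Measurable coefficients bounded by `Λ`. -/
structure IsCoeff (Λ : ℝ≥0) (ℓ : ℝ → ℝ) (c : ℝ × Torus → ℝ) : Prop where
  measurable_left : Measurable ℓ
  left_le : ∀ t, |ℓ t| ≤ Λ
  aestronglyMeasurable_right : AEStronglyMeasurable c vol
  right_le : ∀ᵐ z ∂vol, |c z| ≤ Λ

theorem norm_cubic_sub_le (u v : ℝ × Torus → ℂ) (z : ℝ × Torus) :
    ‖cubic u z - cubic v z‖ ≤ 2 * (‖u z‖ ^ 2 + ‖v z‖ ^ 2) * ‖u z - v z‖ := by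
  have e : cubic u z - cubic v z = ((‖u z‖ ^ 2 : ℝ) : ℂ) * (u z - v z)
      + (((‖u z‖ - ‖v z‖) * (‖u z‖ + ‖v z‖) : ℝ) : ℂ) * v z := by
    simp only [cubic]; push_cast; ring
  rw [e]
  refine (norm_add_le _ _).trans ?_
  rw [norm_mul, norm_mul, Complex.norm_real, Complex.norm_real, Real.norm_of_nonneg (by positivity),
    norm_mul, Real.norm_of_nonneg (show 0 ≤ ‖u z‖ + ‖v z‖ by positivity), Real.norm_eq_abs]
  have h1 := abs_norm_sub_norm_le (u z) (v z)
  have h2 : |‖u z‖ - ‖v z‖| * (‖u z‖ + ‖v z‖) * ‖v z‖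
      ≤ ‖u z - v z‖ * (‖u z‖ + ‖v z‖) * ‖v z‖ := by gcongr
  nlinarith [mul_nonneg (norm_nonneg (u z - v z)) (sq_nonneg (‖u z‖ - ‖v z‖)),
    mul_nonneg (norm_nonneg (u z - v z)) (sq_nonneg (‖u z‖))]

theorem aestronglyMeasurable_cubic {u : ℝ × Torus → ℂ} {μ : Measure (ℝ × Torus)}
    (hu : AEStronglyMeasurable u μ) : AEStronglyMeasurable (cubic u) μ :=
  (Complex.continuous_ofReal.comp_aestronglyMeasurable (hu.norm.pow 2)).mul hu

theorem IsCoeff.aestronglyMeasurable_forcing {Λ : ℝ≥0} {ℓ : ℝ → ℝ} {c : ℝ × Torus → ℝ}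
    (hL : IsCoeff Λ ℓ c) {g u : ℝ × Torus → ℂ} (hu : AEStronglyMeasurable u vol)
    (hg : AEStronglyMeasurable g vol) : AEStronglyMeasurable (forcing ℓ c g u) vol := by
  have h1 : AEStronglyMeasurable (fun z : ℝ × Torus => (ℓ z.1 : ℂ)) vol :=
    (Complex.measurable_ofReal.comp (hL.measurable_left.comp measurable_fst)).aestronglyMeasurable
  have h2 : AEStronglyMeasurable (fun z : ℝ × Torus => (c z : ℂ)) vol :=
    Complex.continuous_ofReal.comp_aestronglyMeasurable hL.aestronglyMeasurable_right
  exact (((h1.mul (aestronglyMeasurable_cubic hu)).const_mul _).neg.sub (h2.mul hu)).sub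
    (hg.const_mul _)

theorem norm_forcing_sub_le {Λ : ℝ≥0} {ℓ : ℝ → ℝ} {c : ℝ × Torus → ℝ} (hL : IsCoeff Λ ℓ c)
    (g g' u v : ℝ × Torus → ℂ) :
    ∀ᵐ z ∂vol, ‖forcing ℓ c g u z - forcing ℓ c g' v z‖
      ≤ Λ * (2 * (‖u z‖ ^ 2 + ‖v z‖ ^ 2)) * ‖u z - v z‖ + Λ * ‖u z - v z‖ + ‖g z - g' z‖ := by
  filter_upwards [hL.right_le] with z hz
  have e : forcing ℓ c g u z - forcing ℓ c g' v z = -(Complex.I * ((ℓ z.1 : ℂ) *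
      (cubic u z - cubic v z))) - c z * (u z - v z) - Complex.I * (g z - g' z) := by
    simp only [forcing]; ring
  rw [e]
  refine (norm_sub_le _ _).trans (add_le_add ((norm_sub_le _ _).trans (add_le_add ?_ ?_)) ?_)
  · rw [norm_neg, norm_mul, norm_mul, Complex.norm_I, one_mul, Complex.norm_real, Real.norm_eq_abs,
      mul_assoc]
    exact mul_le_mul (hL.left_le _) (norm_cubic_sub_le u v z) (norm_nonneg _) Λ.2
  · rw [norm_mul, Complex.norm_real, Real.norm_eq_abs]
    gcongr
  · rw [norm_mul, Complex.norm_I, one_mul]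

/-- The local Lipschitz constant of the forcing term. -/
def lipConst (Λ : ℝ≥0) (τ : ℝ) (B : ℝ≥0∞) : ℝ≥0∞ := 2 * Λ * (B ^ 2 + B ^ 2) + Λ * incl τ

theorem lipConst_ne_top (Λ : ℝ≥0) (τ : ℝ) {B : ℝ≥0∞} (hB : B ≠ ⊤) : lipConst Λ τ B ≠ ⊤ := by
  have h1 := ENNReal.pow_ne_top (n := 2) hB
  exact ENNReal.add_ne_top.2 ⟨ENNReal.mul_ne_top (by finiteness)
    (ENNReal.add_ne_top.2 ⟨h1, h1⟩), ENNReal.mul_ne_top (by simp) (incl_ne_top τ)⟩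

theorem IsCoeff.eLpNorm_forcing_sub_le {Λ : ℝ≥0} {ℓ : ℝ → ℝ} {c : ℝ × Torus → ℝ}
    (hL : IsCoeff Λ ℓ c) {γ τ : ℝ} (hγ : 0 ≤ γ) {g g' u v : ℝ × Torus → ℂ}
    (hu : AEStronglyMeasurable u vol) (hv : AEStronglyMeasurable v vol)
    (hg : AEStronglyMeasurable g vol) (hg' : AEStronglyMeasurable g' vol)
    (hus : SuppIn τ u) (hvs : SuppIn τ v) {B : ℝ≥0∞} (huB : eLpNorm u 4 vol ≤ B)
    (hvB : eLpNorm v 4 vol ≤ B) :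
    eLpNorm (gauge γ (cut τ (forcing ℓ c g u) - cut τ (forcing ℓ c g' v))) (4 / 3) vol
      ≤ lipConst Λ τ B * eLpNorm (gauge γ (u - v)) 4 vol + incl τ * eLpNorm (g - g') 2 vol := by
  set W := gauge γ (u - v) with hW
  have hWm : AEStronglyMeasurable W vol := aestronglyMeasurable_gauge (hu.sub hv) γ
  set A : ℝ × Torus → ℂ := fun z => (2 * Λ : ℝ≥0) * (u z * u z) with hA
  set A' : ℝ × Torus → ℂ := fun z => (2 * Λ : ℝ≥0) * (v z * v z) with hA'
  have hAm : AEStronglyMeasurable A vol := (hu.mul hu).const_mul _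
  have hAm' : AEStronglyMeasurable A' vol := (hv.mul hv).const_mul _
  have hAn : ∀ w : ℝ × Torus → ℂ, eLpNorm (fun z => ((2 * Λ : ℝ≥0) : ℂ) * (w z * w z)) 2 vol
      = 2 * Λ * eLpNorm w 4 vol ^ 2 := fun w => by
    rw [eLpNorm_four_sq]
    refine (eLpNorm_const_smul (((2 * Λ : ℝ≥0) : ℂ)) (fun z => w z * w z) 2 vol).trans ?_
    congr 1
    rw [enorm_eq_nnnorm]
    have : ‖(((2 * Λ : ℝ≥0) : ℝ≥0) : ℂ)‖₊ = 2 * Λ := by ext; simp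
    push_cast at this
    push_cast
    rw [this]; push_cast; rfl
  have hD : AEStronglyMeasurable (cut τ (g - g')) vol :=
    (hg.sub hg').indicator (measurableSet_strip τ)
  have h1 : ∀ᵐ z ∂vol, ‖gauge γ (cut τ (forcing ℓ c g u) - cut τ (forcing ℓ c g' v)) z‖
      ≤ ‖A z * W z‖ + ‖A' z * W z‖ + ‖((Λ : ℝ) : ℂ) * W z‖ + ‖cut τ (g - g') z‖ := by
    filter_upwards [norm_forcing_sub_le hL g g' u v] with z hz
    by_cases hzτ : z.1 ∈ Ioo 0 τ
    · simp only [gauge, Pi.sub_apply, cut_apply hzτ, hA, hA', hW, norm_mul, Complex.norm_real,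
        Real.norm_of_nonneg (Real.exp_pos _).le]
      have h2 : Real.exp (-γ * z.1) ≤ 1 := Real.exp_le_one_iff.2 (by nlinarith [hzτ.1])
      have h3 : ‖(((2 * Λ : ℝ≥0) : ℝ≥0) : ℝ)‖ = 2 * Λ := by simp
      have h3' : ‖(Λ : ℝ)‖ = Λ := by simp
      rw [h3, h3']
      have h4 := mul_le_mul_of_nonneg_left hz (Real.exp_pos (-γ * z.1)).le
      have h5 := mul_le_of_le_one_left (norm_nonneg (g z - g' z)) h2
      refine h4.trans ?_
      linarith
    · rw [gauge, Pi.sub_apply, suppIn_cut τ _ z hzτ, suppIn_cut τ _ z hzτ, sub_zero, mul_zero,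
        norm_zero]
      positivity
  refine (eLpNorm_mono_ae_real h1).trans ?_
  have n1 : AEStronglyMeasurable (fun z => ‖A z * W z‖) vol := (hAm.mul hWm).norm
  have n2 : AEStronglyMeasurable (fun z => ‖A' z * W z‖) vol := (hAm'.mul hWm).norm
  have n3 : AEStronglyMeasurable (fun z => ‖((Λ : ℝ) : ℂ) * W z‖) vol := (hWm.const_mul _).norm
  refine (eLpNorm_add_le ((n1.add n2).add n3) hD.norm one_le_four_thirds).trans ?_
  refine (add_le_add_left (eLpNorm_add_le (n1.add n2) n3 one_le_four_thirds) _).trans ?_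
  refine (add_le_add_left (add_le_add_left (eLpNorm_add_le n1 n2 one_le_four_thirds) _) _).trans ?_
  simp only [eLpNorm_norm]
  have k1 : eLpNorm (fun z => A z * W z) (4 / 3) vol ≤ 2 * Λ * B ^ 2 * eLpNorm W 4 vol := by
    refine (eLpNorm_mul_le 2 4 (4 / 3) hAm hWm).trans ?_
    rw [hA, hAn]
    gcongr
  have k2 : eLpNorm (fun z => A' z * W z) (4 / 3) vol ≤ 2 * Λ * B ^ 2 * eLpNorm W 4 vol := by
    refine (eLpNorm_mul_le 2 4 (4 / 3) hAm' hWm).trans ?_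
    rw [hA', hAn]
    gcongr
  have k3 : eLpNorm (fun z => ((Λ : ℝ) : ℂ) * W z) (4 / 3) vol
      ≤ Λ * (incl τ * eLpNorm W 4 vol) := by
    refine (eLpNorm_const_smul (((Λ : ℝ) : ℂ)) W (4 / 3) vol).le.trans ?_
    have : ‖((Λ : ℝ) : ℂ)‖ₑ = Λ := by
      rw [enorm_eq_nnnorm]; congr 1; ext; simp
    rw [this]
    gcongr
    exact ((hus.sub hvs).gauge γ).eLpNorm_le hWm four_thirds_le_four one_le_four_thirds
  have k4 : eLpNorm (cut τ (g - g')) (4 / 3) vol ≤ incl τ * eLpNorm (g - g') 2 vol := by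
    refine ((suppIn_cut τ (g - g')).eLpNorm_le hD four_thirds_le_two one_le_four_thirds).trans ?_
    gcongr
    exact eLpNorm_cut_le _ _ _
  refine (add_le_add (add_le_add (add_le_add k1 k2) k3) k4).trans_eq ?_
  rw [lipConst]; ring

theorem forcing_zero (ℓ : ℝ → ℝ) (c : ℝ × Torus → ℝ) : forcing ℓ c 0 0 = 0 := by
  ext z; simp [forcing, cubic]

theorem gauge_zero (u : ℝ × Torus → ℂ) : gauge 0 u = u := by ext z; simp [gauge]

theorem IsCoeff.eLpNorm_forcing_le {Λ : ℝ≥0} {ℓ : ℝ → ℝ} {c : ℝ × Torus → ℝ}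
    (hL : IsCoeff Λ ℓ c) {τ : ℝ} {g u : ℝ × Torus → ℂ}
    (hu : AEStronglyMeasurable u vol) (hg : AEStronglyMeasurable g vol)
    (hus : SuppIn τ u) {B : ℝ≥0∞} (huB : eLpNorm u 4 vol ≤ B) :
    eLpNorm (cut τ (forcing ℓ c g u)) (4 / 3) vol
      ≤ lipConst Λ τ B * eLpNorm u 4 vol + incl τ * eLpNorm g 2 vol := by
  have h := hL.eLpNorm_forcing_sub_le (τ := τ) le_rfl hu aestronglyMeasurable_zero hg
    aestronglyMeasurable_zero hus (fun z _ => rfl) huB (by simp)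
  have e : cut τ (0 : ℝ × Torus → ℂ) = 0 := by ext z; simp [cut]
  rw [forcing_zero, gauge_zero, gauge_zero, e] at h
  simpa using h

theorem IsCoeff.memLp_forcing {Λ : ℝ≥0} {ℓ : ℝ → ℝ} {c : ℝ × Torus → ℝ}
    (hL : IsCoeff Λ ℓ c) {τ : ℝ} {g u : ℝ × Torus → ℂ} (hu : MemLp u 4 vol) (hg : MemLp g 2 vol)
    (hus : SuppIn τ u) : MemLp (cut τ (forcing ℓ c g u)) (4 / 3) vol := by
  refine ⟨(hL.aestronglyMeasurable_forcing hu.1 hg.1).indicator (measurableSet_strip τ), ?_⟩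
  refine (hL.eLpNorm_forcing_le hu.1 hg.1 hus le_rfl).trans_lt (ENNReal.add_lt_top.2 ⟨?_, ?_⟩)
  · exact ENNReal.mul_lt_top (lipConst_ne_top Λ τ hu.2.ne).lt_top hu.2
  · exact ENNReal.mul_lt_top (incl_ne_top τ).lt_top hg.2

theorem mildCoef_sub {f f' : ℤ → ℂ} {h h' : ℝ × Torus → ℂ} (hh : Integrable h vol)
    (hh' : Integrable h' vol) (k : ℤ) (t : ℝ) :
    mildCoef (f - f') (h - h') k t = mildCoef f h k t - mildCoef f' h' k t := by
  have e : ∫ r in (0 : ℝ)..t, Complex.exp (Complex.I * symb k * r) * coef (h - h') k r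
      = (∫ r in (0 : ℝ)..t, Complex.exp (Complex.I * symb k * r) * coef h k r)
        - ∫ r in (0 : ℝ)..t, Complex.exp (Complex.I * symb k * r) * coef h' k r := by
    rw [← intervalIntegral.integral_sub (intervalIntegrable_exp_mul (integrable_coef hh k) _ _ _)
      (intervalIntegrable_exp_mul (integrable_coef hh' k) _ _ _)]
    refine intervalIntegral.integral_congr_ae ?_
    filter_upwards [coef_sub_ae hh hh' k] with r hr _
    rw [hr, Pi.sub_apply]; ring
  simp only [mildCoef, e, Pi.sub_apply]
  ring

theorem IsMild.sub {τ : ℝ} {f f' : ℤ → ℂ} {h h' u u' : ℝ × Torus → ℂ} (hh : Integrable h vol)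
    (hh' : Integrable h' vol) (hu : Integrable u vol) (hu' : Integrable u' vol)
    (hm : IsMild τ f h u) (hm' : IsMild τ f' h' u') :
    IsMild τ (f - f') (h - h') (u - u') := fun k => by
  filter_upwards [hm k, hm' k, coef_sub_ae hu hu' k] with t h1 h2 h3 ht
  rw [h3, Pi.sub_apply, h1 ht, h2 ht, mildCoef_sub hh hh']

/-- `u` is an `L⁴` mild solution of the nonlinear equation on `(0, τ)`. -/
structure IsNLS (τ : ℝ) (f : ℤ → ℂ) (ℓ : ℝ → ℝ) (c : ℝ × Torus → ℝ) (g u : ℝ × Torus → ℂ) :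
    Prop where
  supp : SuppIn τ u
  memLp : MemLp u 4 vol
  mild : IsMild τ f (cut τ (forcing ℓ c g u)) u

theorem IsNLS.memLp_two {τ : ℝ} {f : ℤ → ℂ} {ℓ : ℝ → ℝ} {c : ℝ × Torus → ℝ} {g u : ℝ × Torus → ℂ}
    (h : IsNLS τ f ℓ c g u) : MemLp u 2 vol := h.supp.memLp_of_le h.memLp (by norm_num)

theorem l2n_sub_ne_top {f f' : ℤ → ℂ} (hf : l2n 1 f ≠ ⊤) (hf' : l2n 1 f' ≠ ⊤) :
    l2n 1 (f - f') ≠ ⊤ := by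
  have h1 := ENNReal.pow_ne_top (n := 2) hf
  have h2 := ENNReal.pow_ne_top (n := 2) hf'
  rw [l2n_sq] at h1 h2
  have h3 : l2n 1 (f - f') ^ 2 ≠ ⊤ := by
    rw [l2n_sq]
    refine ne_top_of_le_ne_top (ENNReal.mul_ne_top (a := 2) (by norm_num)
      (ENNReal.add_ne_top.2 ⟨h1, h2⟩)) ?_
    rw [← ENNReal.tsum_add, ← ENNReal.tsum_mul_left]
    refine ENNReal.tsum_le_tsum fun k => ?_
    simp only [Pi.one_apply, abs_one, ENNReal.ofReal_one, one_mul, Pi.sub_apply]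
    have h4 : ‖f k - f' k‖ ^ 2 ≤ 2 * (‖f k‖ ^ 2 + ‖f' k‖ ^ 2) := by
      have := norm_sub_le (f k) (f' k)
      nlinarith [norm_nonneg (f k - f' k), sq_nonneg (‖f k‖ - ‖f' k‖)]
    have := ENNReal.ofReal_le_ofReal h4
    rw [ENNReal.ofReal_mul (by norm_num), ENNReal.ofReal_add (by positivity) (by positivity)] at this
    simpa [ENNReal.ofReal_pow, ofReal_norm] using this
  intro h
  exact h3 (by rw [h]; rfl)

/-- The basic difference estimate. -/
theorem IsExponent.eLpNorm_gauge_sub_le (hC : IsExponent β C) {γ : ℝ}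
    (hγ : 1 ≤ γ) {Λ : ℝ≥0} {ℓ : ℝ → ℝ} {c : ℝ × Torus → ℝ} (hL : IsCoeff Λ ℓ c) {τ : ℝ}
    {f f' : ℤ → ℂ} (hf : l2n 1 f ≠ ⊤) (hf' : l2n 1 f' ≠ ⊤) {g g' y y' u u' : ℝ × Torus → ℂ}
    (hg : MemLp g 2 vol) (hg' : MemLp g' 2 vol) (hy : MemLp y 4 vol) (hy' : MemLp y' 4 vol)
    (hys : SuppIn τ y) (hys' : SuppIn τ y') (hus : SuppIn τ u) (hus' : SuppIn τ u')
    (hu : MemLp u 2 vol) (hu' : MemLp u' 2 vol)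
    (hm : IsMild τ f (cut τ (forcing ℓ c g y)) u) (hm' : IsMild τ f' (cut τ (forcing ℓ c g' y')) u')
    {B : ℝ≥0∞} (hB : eLpNorm y 4 vol ≤ B) (hB' : eLpNorm y' 4 vol ≤ B) :
    eLpNorm (gauge γ (u - u')) 4 vol ≤ C * (freeConst β * l2n 1 (f - f')
      + ENNReal.ofReal (γ ^ (-(1 - 2 * β))) * (C * (lipConst Λ τ B * eLpNorm (gauge γ (y - y')) 4 vol
        + incl τ * eLpNorm (g - g') 2 vol))) := by
  have h1 := hL.memLp_forcing hy hg hys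
  have h2 := hL.memLp_forcing hy' hg' hys'
  have hs : SuppIn τ (cut τ (forcing ℓ c g y) - cut τ (forcing ℓ c g' y')) :=
    (suppIn_cut _ _).sub (suppIn_cut _ _)
  have hmm := IsMild.sub ((suppIn_cut _ _).integrable h1 one_le_four_thirds)
    ((suppIn_cut _ _).integrable h2 one_le_four_thirds) (hus.integrable hu (by norm_num))
    (hus'.integrable hu' (by norm_num)) hm hm'
  refine (hC.eLpNorm_gauge_le hγ (l2n_sub_ne_top hf hf') hs (h1.sub h2) (hu.sub hu')
    (hus.sub hus') hmm).trans ?_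
  gcongr
  exact hL.eLpNorm_forcing_sub_le (by linarith) hy.1 hy'.1 hg.1 hg'.1 hys hys' hB hB'

theorem le_two_mul_of_le_add_half {x a : ℝ≥0∞} (hx : x ≠ ⊤) (h : x ≤ a + 2⁻¹ * x) :
    x ≤ 2 * a := by
  by_cases ha : a = ⊤
  · rw [ha, ENNReal.mul_top (by norm_num)]; exact le_top
  lift x to ℝ≥0 using hx
  lift a to ℝ≥0 using ha
  have h2 : x ≤ a + 2⁻¹ * x := by
    rw [← ENNReal.coe_le_coe]; push_cast; exact h
  have h3 : (x : ℝ) ≤ a + 2⁻¹ * x := by exact_mod_cast h2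
  have : x ≤ 2 * a := by rw [← NNReal.coe_le_coe]; push_cast; linarith
  exact_mod_cast this

theorem mildCoef_congr {f : ℤ → ℂ} {h h' : ℝ × Torus → ℂ} (e : h =ᵐ[vol] h') (k : ℤ) (t : ℝ) :
    mildCoef f h k t = mildCoef f h' k t := by
  simp only [mildCoef]
  congr 2
  refine intervalIntegral.integral_congr_ae ?_
  filter_upwards [coef_congr_ae e k] with r hr _
  rw [hr]

theorem forcing_congr {ℓ : ℝ → ℝ} {c : ℝ × Torus → ℝ} {g u v : ℝ × Torus → ℂ} {z : ℝ × Torus}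
    (e : u z = v z) : forcing ℓ c g u z = forcing ℓ c g v z := by simp [forcing, cubic, e]

theorem cut_congr {τ : ℝ} {u v : ℝ × Torus → ℂ} (e : ∀ᵐ z ∂vol, z.1 ∈ Ioo 0 τ → u z = v z) :
    cut τ u =ᵐ[vol] cut τ v := by
  filter_upwards [e] with z hz
  by_cases h : z.1 ∈ Ioo 0 τ
  · rw [cut_apply h, cut_apply h, hz h]
  · rw [suppIn_cut τ u z h, suppIn_cut τ v z h]

theorem isMild_zero (τ : ℝ) : IsMild τ 0 0 0 := fun k => ae_of_all _ fun t _ => by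
  simp [mildCoef, coef, fourierCoeff]

theorem ofReal_rpow_neg_le_one {γ θ : ℝ} (hγ : 1 ≤ γ) (hθ : 0 ≤ θ) :
    ENNReal.ofReal (γ ^ (-θ)) ≤ 1 := by
  rw [ENNReal.ofReal_le_one]
  exact Real.rpow_le_one_of_one_le_of_nonpos hγ (by linarith)

/-- The solution depends Lipschitz continuously on the data in `L⁴`, on bounded sets. -/
theorem IsExponent.exists_gauge_sub_le (hC : IsExponent β C) (Λ : ℝ≥0) (τ : ℝ)
    {B : ℝ≥0∞} (hB : B ≠ ⊤) : ∃ γ : ℝ, 1 ≤ γ ∧ ∀ {ℓ : ℝ → ℝ} {c : ℝ × Torus → ℝ}, IsCoeff Λ ℓ c →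
      ∀ {f f' : ℤ → ℂ} {g g' u u' : ℝ × Torus → ℂ}, l2n 1 f ≠ ⊤ → l2n 1 f' ≠ ⊤ →
      MemLp g 2 vol → MemLp g' 2 vol → IsNLS τ f ℓ c g u → IsNLS τ f' ℓ c g' u' →
      eLpNorm u 4 vol ≤ B → eLpNorm u' 4 vol ≤ B →
      eLpNorm (gauge γ (u - u')) 4 vol
        ≤ 2 * (C * (freeConst β * l2n 1 (f - f') + C * (incl τ * eLpNorm (g - g') 2 vol))) := by
  have hβ := hC.lt_half
  obtain ⟨γ, hγ, hγX⟩ := exists_gamma_le (θ := 1 - 2 * β) (by linarith)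
    (X := C * (C * lipConst Λ τ B)) (ε := 2⁻¹)
    (ENNReal.mul_ne_top hC.ne_top (ENNReal.mul_ne_top hC.ne_top (lipConst_ne_top Λ τ hB)))
    (by norm_num)
  refine ⟨γ, hγ, fun hL f f' g g' u u' hf hf' hg hg' hu hu' huB huB' => ?_⟩
  have h := hC.eLpNorm_gauge_sub_le hγ hL hf hf' hg hg' hu.memLp hu'.memLp hu.supp hu'.supp hu.supp
    hu'.supp hu.memLp_two hu'.memLp_two hu.mild hu'.mild huB huB'
  refine le_two_mul_of_le_add_half ?_ (h.trans ?_)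
  · exact ((hu.supp.sub hu'.supp).memLp_gauge (by linarith) (hu.memLp.sub hu'.memLp)).2.ne
  · set x := eLpNorm (gauge γ (u - u')) 4 vol
    set e := ENNReal.ofReal (γ ^ (-(1 - 2 * β)))
    have he : e ≤ 1 := ofReal_rpow_neg_le_one hγ (by linarith)
    calc _ = C * (freeConst β * l2n 1 (f - f') + e * (C * (incl τ * eLpNorm (g - g') 2 vol)))
          + e * (C * (C * lipConst Λ τ B)) * x := by ring
      _ ≤ C * (freeConst β * l2n 1 (f - f') + 1 * (C * (incl τ * eLpNorm (g - g') 2 vol)))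
          + 2⁻¹ * x := by gcongr
      _ = _ := by rw [one_mul]

theorem IsExponent.unique (hC : IsExponent β C) {Λ : ℝ≥0} {τ : ℝ}
    {ℓ : ℝ → ℝ} {c : ℝ × Torus → ℝ} (hL : IsCoeff Λ ℓ c) {f : ℤ → ℂ} (hf : l2n 1 f ≠ ⊤)
    {g u u' : ℝ × Torus → ℂ} (hg : MemLp g 2 vol) (hu : IsNLS τ f ℓ c g u)
    (hu' : IsNLS τ f ℓ c g u') : u =ᵐ[vol] u' := by
  obtain ⟨γ, hγ, h⟩ := hC.exists_gauge_sub_le Λ τ (B := eLpNorm u 4 vol + eLpNorm u' 4 vol)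
    (ENNReal.add_ne_top.2 ⟨hu.memLp.2.ne, hu'.memLp.2.ne⟩)
  have h1 := h hL hf hf hg hg hu hu' le_self_add le_add_self
  have h2 : l2n 1 (0 : ℤ → ℂ) = 0 := by simp [l2n]
  rw [sub_self, sub_self, h2, eLpNorm_zero] at h1
  simp only [mul_zero, add_zero, nonpos_iff_eq_zero] at h1
  have hs := hu.supp.sub hu'.supp
  have h3 := hs.eLpNorm_le_gauge (γ := γ) (by linarith) 4
  rw [h1, mul_zero, nonpos_iff_eq_zero, eLpNorm_eq_zero_iff (hu.memLp.1.sub hu'.memLp.1)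
    (by norm_num)] at h3
  filter_upwards [h3] with z hz
  simpa [sub_eq_zero] using hz

theorem lipConst_mono (Λ : ℝ≥0) {τ τ' : ℝ} (h : τ ≤ τ') (B : ℝ≥0∞) :
    lipConst Λ τ B ≤ lipConst Λ τ' B := by
  unfold lipConst
  gcongr
  exact incl_mono h

/-- Local existence, on a time interval that depends only on the size of the data. -/
theorem IsExponent.exists_local (hC : IsExponent β C) (Λ : ℝ≥0)
    {A G : ℝ≥0∞} (hA : A ≠ ⊤) (hG : G ≠ ⊤) :
    ∃ δ : ℝ, 0 < δ ∧ ∃ M : ℝ≥0∞, M ≠ ⊤ ∧ ∀ {ℓ : ℝ → ℝ} {c : ℝ × Torus → ℝ}, IsCoeff Λ ℓ c →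
      ∀ {f : ℤ → ℂ} {g : ℝ × Torus → ℂ}, l2n 1 f ≤ A → MemLp g 2 vol → eLpNorm g 2 vol ≤ G →
      ∃ u, IsNLS δ f ℓ c g u ∧ eLpNorm u 4 vol ≤ M := by
  have hβ := hC.lt_half
  set e₁ := ENNReal.ofReal (Real.exp 1) with he₁
  have he₁1 : 1 ≤ e₁ := by
    rw [he₁, ENNReal.one_le_ofReal]; exact Real.one_le_exp zero_le_one
  set M : ℝ≥0∞ := e₁ * (C * (freeConst β * A)) + 1 with hM
  have hMt : M ≠ ⊤ := ENNReal.add_ne_top.2 ⟨ENNReal.mul_ne_top ENNReal.ofReal_ne_top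
    (ENNReal.mul_ne_top hC.ne_top (ENNReal.mul_ne_top (freeConst_ne_top hβ) hA)), by norm_num⟩
  set K := lipConst Λ 1 M with hK
  obtain ⟨γ, hγ, hγX⟩ := exists_gamma_le (θ := 1 - 2 * β) (by linarith)
    (X := e₁ * (C * (C * (K * (M + 1) + incl 1 * G)))) (ε := 2⁻¹)
    (by
      have h1 := hC.ne_top
      have h2 : K ≠ ⊤ := lipConst_ne_top Λ 1 hMt
      have h3 := incl_ne_top 1
      have h4 : e₁ ≠ ⊤ := ENNReal.ofReal_ne_top
      finiteness)
    (by norm_num)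
  have hγ0 : 0 < γ := by linarith
  set δ := 1 / γ with hδ
  have hδ1 : δ ≤ 1 := by rw [hδ, div_le_one hγ0]; exact hγ
  set ε := ENNReal.ofReal (γ ^ (-(1 - 2 * β))) with hε
  have hγδ : ENNReal.ofReal (Real.exp (γ * δ)) = e₁ := by
    rw [hδ, mul_one_div_cancel hγ0.ne']
  have hε1 : e₁ * (C * (ε * (C * (K * M + incl 1 * G)))) ≤ 1 := by
    refine le_trans ?_ (hγX.trans (by norm_num))
    calc _ = ε * (e₁ * (C * (C * (K * M + incl 1 * G)))) := by ring
      _ ≤ _ := by gcongr; exact le_self_add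
  have hε2 : e₁ * (C * (ε * (C * K))) ≤ 2⁻¹ := by
    refine le_trans ?_ hγX
    calc _ = ε * (e₁ * (C * (C * (K * 1)))) := by ring
      _ ≤ _ := by
        gcongr
        refine le_trans ?_ le_self_add
        gcongr; exact le_add_self
  refine ⟨δ, by positivity, M, hMt, fun {ℓ c} hL {f g} hf hg hgG => ?_⟩
  have hft : l2n 1 f ≠ ⊤ := ne_top_of_le_ne_top hA hf
  have : Fact ((1 : ℝ≥0∞) ≤ 4) := ⟨by norm_num⟩
  have hY : ∀ w : Lp ℂ 4 vol, MemLp (cut δ w) 4 vol := fun w =>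
    (Lp.memLp w).indicator (measurableSet_strip δ)
  have hex : ∀ w : Lp ℂ 4 vol, ∃ u, SuppIn δ u ∧ MemLp u 4 vol ∧
      IsMild δ f (cut δ (forcing ℓ c g (cut δ w))) u := fun w => by
    have h1 := hL.memLp_forcing (hY w) hg (suppIn_cut δ w)
    obtain ⟨u, hu1, hu2, hu3⟩ := hC.exists_mild hft (suppIn_cut _ _) h1
    exact ⟨u, hu1, hC.memLp_four hft (suppIn_cut _ _) h1 hu2 hu1 hu3, hu3⟩
  choose U hUs hU4 hUm using hex
  set Φ : Lp ℂ 4 vol → Lp ℂ 4 vol := fun w => (hU4 w).toLp (U w) with hΦ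
  have hball : ∀ w : Lp ℂ 4 vol, w ∈ Metric.closedBall (0 : Lp ℂ 4 vol) M.toReal ↔
      eLpNorm w 4 vol ≤ M := fun w => by
    rw [mem_closedBall_zero_iff, Lp.norm_def, ENNReal.toReal_le_toReal (Lp.memLp w).2.ne hMt]
  have hU2 : ∀ w, MemLp (U w) 2 vol := fun w => (hUs w).memLp_of_le (hU4 w) (by norm_num)
  have hYM : ∀ w : Lp ℂ 4 vol, eLpNorm w 4 vol ≤ M → eLpNorm (cut δ w) 4 vol ≤ M :=
    fun w hw => (eLpNorm_cut_le _ _ _).trans hw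
  have hKδ := lipConst_mono Λ hδ1 M
  have hmaps : MapsTo Φ (Metric.closedBall 0 M.toReal) (Metric.closedBall 0 M.toReal) := by
    intro w hw
    rw [hball] at hw ⊢
    rw [hΦ, eLpNorm_congr_ae (MemLp.coeFn_toLp _)]
    refine ((hUs w).eLpNorm_le_gauge hγ0.le 4).trans ?_
    rw [hγδ]
    have e0 : cut δ (forcing ℓ c 0 0) = 0 := by rw [forcing_zero]; ext z; simp [cut]
    have h := hC.eLpNorm_gauge_sub_le hγ hL hft (f' := 0) (by simp [l2n]) hg (g' := 0)
      MemLp.zero (hY w) (y' := 0) MemLp.zero (suppIn_cut δ w) (fun _ _ => rfl) (hUs w)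
      (u' := 0) (fun _ _ => rfl) (hU2 w) MemLp.zero (hUm w) (by rw [e0]; exact isMild_zero δ)
      (hYM w hw) (by simp)
    simp only [sub_zero] at h
    calc _ ≤ e₁ * (C * (freeConst β * A + ε * (C * (K * M + incl 1 * G)))) := by
          refine mul_le_mul' le_rfl (h.trans ?_)
          gcongr
          · exact ((suppIn_cut δ w).eLpNorm_gauge_le hγ0.le 4).trans (hYM w hw)
          · exact incl_mono hδ1
      _ = e₁ * (C * (freeConst β * A)) + e₁ * (C * (ε * (C * (K * M + incl 1 * G)))) := by ring
      _ ≤ M := by rw [hM]; gcongr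
  have hcontr : ContractingWith 2⁻¹ (hmaps.restrict Φ _ _) := by
    refine ⟨by
      rw [← NNReal.coe_lt_coe]; norm_num, fun w w' => ?_⟩
    have hw := (hball _).1 w.2
    have hw' := (hball _).1 w'.2
    rw [Subtype.edist_eq, Subtype.edist_eq, MapsTo.val_restrict_apply, MapsTo.val_restrict_apply,
      hΦ, Lp.edist_toLp_toLp, Lp.edist_def]
    refine (((hUs _).sub (hUs _)).eLpNorm_le_gauge hγ0.le 4).trans ?_
    rw [hγδ]
    have h := hC.eLpNorm_gauge_sub_le hγ hL hft hft hg hg (hY w) (hY w') (suppIn_cut δ _)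
      (suppIn_cut δ _) (hUs _) (hUs _) (hU2 _) (hU2 _) (hUm _) (hUm _) (hYM _ hw) (hYM _ hw')
    have h0 : l2n 1 (0 : ℤ → ℂ) = 0 := by simp [l2n]
    rw [sub_self, sub_self, h0, eLpNorm_zero, mul_zero, zero_add, mul_zero, add_zero] at h
    have h5 : eLpNorm (gauge γ (cut δ w - cut δ w')) 4 vol ≤ eLpNorm (w.1 - w'.1 : ℝ × Torus → ℂ) 4 vol := by
      rw [← cut_sub]
      exact ((suppIn_cut δ _).eLpNorm_gauge_le hγ0.le 4).trans (eLpNorm_cut_le _ _ _)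
    calc _ ≤ e₁ * (C * (ε * (C * (K * eLpNorm (w.1 - w'.1 : ℝ × Torus → ℂ) 4 vol)))) := by
          refine mul_le_mul' le_rfl (h.trans ?_)
          gcongr
      _ = e₁ * (C * (ε * (C * K))) * eLpNorm (w.1 - w'.1 : ℝ × Torus → ℂ) 4 vol := by ring
      _ ≤ _ := by
        rw [ENNReal.coe_inv (by norm_num)]
        gcongr
        exact_mod_cast hε2
  obtain ⟨w, hwS, hwfix, -⟩ := hcontr.exists_fixedPoint' Metric.isClosed_closedBall.isComplete hmaps
    (Metric.mem_closedBall_self ENNReal.toReal_nonneg) (edist_ne_top _ _)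
  have hwU : (w : ℝ × Torus → ℂ) =ᵐ[vol] U w := by
    have h1 : Φ w = w := hwfix
    have h2 : (Φ w : ℝ × Torus → ℂ) =ᵐ[vol] U w := MemLp.coeFn_toLp _
    rwa [h1] at h2
  refine ⟨U w, ⟨hUs w, hU4 w, fun k => ?_⟩, ?_⟩
  · filter_upwards [hUm w k] with t ht htδ
    rw [ht htδ]
    refine mildCoef_congr (cut_congr ?_) k t
    filter_upwards [hwU] with z hz hzδ
    exact forcing_congr (by rw [cut_apply hzδ, hz])
  · rw [← eLpNorm_congr_ae hwU]; exact (hball w).1 hwS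

theorem two_mul_re_forcing_le {Λ : ℝ≥0} {ℓ : ℝ → ℝ} {c : ℝ × Torus → ℝ} {g u : ℝ × Torus → ℂ}
    {z : ℝ × Torus} (hc : |c z| ≤ Λ) :
    2 * (forcing ℓ c g u z * starRingEnd ℂ (u z)).re - 2 * (Λ + 1) * ‖u z‖ ^ 2 ≤ ‖g z‖ ^ 2 := by
  have e : forcing ℓ c g u z * starRingEnd ℂ (u z)
      = -(((ℓ z.1 * ‖u z‖ ^ 4 : ℝ) : ℂ) * Complex.I) - ((c z * ‖u z‖ ^ 2 : ℝ) : ℂ)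
        - Complex.I * (g z * starRingEnd ℂ (u z)) := by
    have h : u z * starRingEnd ℂ (u z) = ((‖u z‖ ^ 2 : ℝ) : ℂ) := by
      rw [Complex.mul_conj, Complex.normSq_eq_norm_sq]
    calc _ = -(((ℓ z.1 * ‖u z‖ ^ 2 : ℝ) : ℂ) * (u z * starRingEnd ℂ (u z)) * Complex.I)
          - c z * (u z * starRingEnd ℂ (u z)) - Complex.I * (g z * starRingEnd ℂ (u z)) := by
          simp only [forcing, cubic]; push_cast; ring
      _ = _ := by rw [h]; push_cast; ring
  rw [e, Complex.sub_re, Complex.sub_re, Complex.neg_re, Complex.re_ofReal_mul, Complex.I_re,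
    mul_zero, neg_zero, zero_sub, Complex.ofReal_re]
  have h1 : -(Complex.I * (g z * starRingEnd ℂ (u z))).re ≤ ‖g z‖ * ‖u z‖ := by
    refine (neg_le_abs _).trans ((Complex.abs_re_le_norm _).trans_eq ?_)
    rw [norm_mul, Complex.norm_I, one_mul, norm_mul, RCLike.norm_conj]
  have h2 : -(c z * ‖u z‖ ^ 2) ≤ Λ * ‖u z‖ ^ 2 := by
    rw [← neg_mul]
    exact mul_le_mul_of_nonneg_right ((neg_le_abs _).trans hc) (sq_nonneg _)
  nlinarith [sq_nonneg (‖g z‖ - ‖u z‖), sq_nonneg ‖u z‖]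

theorem lintegral_ofReal_sq {α : Type*} [MeasurableSpace α] (μ : Measure α) (g : α → ℂ) :
    ∫⁻ z, ENNReal.ofReal (‖g z‖ ^ 2) ∂μ = eLpNorm g 2 μ ^ 2 := by
  rw [eLpNorm_two_sq]
  congr 1; ext z; rw [ENNReal.ofReal_pow (norm_nonneg _), ofReal_norm]

/-- The a priori bound of the `L²` norm. -/
theorem IsNLS.energy_le (hC : IsExponent β C) {Λ : ℝ≥0} {ℓ : ℝ → ℝ}
    {c : ℝ × Torus → ℝ} (hL : IsCoeff Λ ℓ c) {τ t : ℝ} {f : ℤ → ℂ} (hf : l2n 1 f ≠ ⊤)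
    {g u : ℝ × Torus → ℂ} (hg : MemLp g 2 vol) (hu : IsNLS τ f ℓ c g u) (ht : t ∈ Icc 0 τ) :
    l2n 1 (fun k => mildCoef f (cut τ (forcing ℓ c g u)) k t) ^ 2
      ≤ ENNReal.ofReal (Real.exp (2 * (Λ + 1) * τ)) * (l2n 1 f ^ 2 + eLpNorm g 2 vol ^ 2) := by
  rw [← lintegral_ofReal_sq vol g]
  have hd : Integrable (fun z => ‖g z‖ ^ 2) vol := hg.norm.integrable_sq
  refine hC.energy_le (γ := Λ + 1) (by simp) hf (suppIn_cut _ _)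
    (hL.memLp_forcing hu.memLp hg hu.supp) hu.memLp_two hu.supp hu.mild ht hd
    (fun z => sq_nonneg _) ?_
  filter_upwards [hL.right_le] with z hz
  by_cases hzτ : z.1 ∈ Ioo 0 τ
  · rw [cut_apply hzτ]; exact two_mul_re_forcing_le hz
  · rw [hu.supp z hzτ]; simp

/-! ### Translation in time and global existence -/

/-- Translation in time. -/
def shift {α : Type*} (τ : ℝ) (v : ℝ × Torus → α) (z : ℝ × Torus) : α := v (z.1 - τ, z.2)

theorem measurePreserving_shift (τ : ℝ) :
    MeasurePreserving (fun z : ℝ × Torus => (z.1 - τ, z.2)) vol vol :=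
  (measurePreserving_sub_right volume τ).prod (MeasurePreserving.id _)

theorem memLp_shift {v : ℝ × Torus → ℂ} {p : ℝ≥0∞} (hv : MemLp v p vol) (τ : ℝ) :
    MemLp (shift τ v) p vol :=
  hv.comp_measurePreserving (measurePreserving_shift τ)

theorem eLpNorm_shift {v : ℝ × Torus → ℂ} (hv : AEStronglyMeasurable v vol) (p : ℝ≥0∞) (τ : ℝ) :
    eLpNorm (shift τ v) p vol = eLpNorm v p vol :=
  eLpNorm_comp_measurePreserving hv (measurePreserving_shift τ)

theorem IsCoeff.shift {Λ : ℝ≥0} {ℓ : ℝ → ℝ} {c : ℝ × Torus → ℝ} (hL : IsCoeff Λ ℓ c) (τ : ℝ) :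
    IsCoeff Λ (fun t => ℓ (t - τ)) (shift τ c) :=
  ⟨hL.measurable_left.comp (measurable_id.sub_const τ), fun _ => hL.left_le _,
    hL.aestronglyMeasurable_right.comp_measurePreserving (measurePreserving_shift τ),
    (measurePreserving_shift τ).quasiMeasurePreserving.ae hL.right_le⟩

theorem mildCoef_congr_on {f : ℤ → ℂ} {h h' : ℝ × Torus → ℂ} {k : ℤ} {t : ℝ} (ht : 0 ≤ t)
    (e : ∀ r ∈ Ioo 0 t, coef h k r = coef h' k r) : mildCoef f h k t = mildCoef f h' k t := by
  simp only [mildCoef]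
  rw [intervalIntegral.integral_of_le ht, intervalIntegral.integral_of_le ht,
    integral_Ioc_eq_integral_Ioo, integral_Ioc_eq_integral_Ioo,
    setIntegral_congr_fun measurableSet_Ioo fun r hr => by rw [e r hr]]

theorem mildCoef_add {f : ℤ → ℂ} {h : ℝ × Torus → ℂ} (hh : Integrable h vol) (k : ℤ) (τ t : ℝ) :
    mildCoef f h k (τ + t)
      = mildCoef (fun k => mildCoef f h k τ) (shift (-τ) h) k t := by
  have hi := fun a b => intervalIntegrable_exp_mul (integrable_coef hh k) (symb k) a b
  have hc : ∀ r, coef (shift (-τ) h) k r = coef h k (r + τ) := fun r => by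
    simp [coef, shift]
  have e : ∫ r in (0 : ℝ)..t, Complex.exp (Complex.I * symb k * r) * coef (shift (-τ) h) k r
      = Complex.exp (-(Complex.I * symb k * τ)) * ∫ r in τ..(τ + t),
        Complex.exp (Complex.I * symb k * r) * coef h k r := by
    have h1 := intervalIntegral.integral_comp_add_right (a := 0) (b := t)
      (fun r => Complex.exp (Complex.I * symb k * r) * coef h k r) τ
    rw [zero_add, add_comm t] at h1
    rw [← h1, ← intervalIntegral.integral_const_mul]
    refine intervalIntegral.integral_congr fun r _ => ?_
    simp only [hc]
    rw [← mul_assoc, ← Complex.exp_add]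
    congr 2
    push_cast; ring
  simp only [mildCoef, e]
  rw [← intervalIntegral.integral_add_adjacent_intervals (hi 0 τ) (hi τ (τ + t))]
  have e2 : Complex.exp (-(Complex.I * symb k * (τ + t : ℝ)))
      = Complex.exp (-(Complex.I * symb k * t)) * Complex.exp (-(Complex.I * symb k * τ)) := by
    rw [← Complex.exp_add]; congr 1; push_cast; ring
  rw [e2]; ring

theorem coef_congr_slice {u v : ℝ × Torus → ℂ} {t : ℝ} (h : ∀ x, u (t, x) = v (t, x)) (k : ℤ) :
    coef u k t = coef v k t := by
  unfold coef; congr 1; ext x; exact h x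

/-- Solutions on adjacent time intervals can be glued. -/
theorem IsNLS.glue {Λ : ℝ≥0} {ℓ : ℝ → ℝ} {c : ℝ × Torus → ℝ} (hL : IsCoeff Λ ℓ c) {τ δ : ℝ}
    (hτ : 0 ≤ τ) (hδ : 0 ≤ δ) {f : ℤ → ℂ} {g u v : ℝ × Torus → ℂ} (hg : MemLp g 2 vol)
    (hu : IsNLS τ f ℓ c g u)
    (hv : IsNLS δ (fun k => mildCoef f (cut τ (forcing ℓ c g u)) k τ) (fun t => ℓ (t - -τ))
      (shift (-τ) c) (shift (-τ) g) v) :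
    IsNLS (τ + δ) f ℓ c g (u + shift τ v) := by
  set U := u + shift τ v with hU
  have hU1 : ∀ z : ℝ × Torus, z.1 ∈ Ioo 0 τ → U z = u z := fun z hz => by
    have : v (z.1 - τ, z.2) = 0 := hv.supp _ fun h => by linarith [h.1, hz.2]
    simp [hU, shift, this]
  have hU2 : ∀ z : ℝ × Torus, τ ≤ z.1 → U z = v (z.1 - τ, z.2) := fun z hz => by
    have : u z = 0 := hu.supp _ fun h => by linarith [h.2]
    simp [hU, shift, this]
  have hUs : SuppIn (τ + δ) U := fun z hz => by
    by_cases h : τ ≤ z.1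
    · rw [hU2 z h]; exact hv.supp _ fun h' => hz ⟨by linarith [h'.1], by linarith [h'.2]⟩
    · have h' : z.1 ∉ Ioo 0 τ := fun h' => hz ⟨h'.1, by linarith [h'.2]⟩
      have : v (z.1 - τ, z.2) = 0 := hv.supp _ fun h'' => by simp at h''; linarith [h''.1]
      simp [hU, shift, this, hu.supp z h']
  have hU4 : MemLp U 4 vol := hu.memLp.add (memLp_shift hv.memLp τ)
  set H := cut (τ + δ) (forcing ℓ c g U) with hH
  have hHi : Integrable H vol :=
    (suppIn_cut _ _).integrable (hL.memLp_forcing hU4 hg hUs) one_le_four_thirds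
  have h1 : ∀ k, ∀ r ∈ Ioo 0 τ, coef (cut τ (forcing ℓ c g u)) k r = coef H k r := by
    intro k r hr
    refine coef_congr_slice (fun x => ?_) k
    rw [hH, cut_apply hr, cut_apply (show r ∈ Ioo 0 (τ + δ) from ⟨hr.1, by linarith [hr.2]⟩)]
    exact forcing_congr (hU1 (r, x) hr).symm
  have hf' : (fun k => mildCoef f (cut τ (forcing ℓ c g u)) k τ) = fun k => mildCoef f H k τ := by
    ext k; exact mildCoef_congr_on hτ (h1 k)
  refine ⟨hUs, hU4, fun k => ?_⟩
  have hne : ∀ᵐ t : ℝ, t ≠ τ := by simp [ae_iff, measure_singleton]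
  filter_upwards [hu.mild k, hne,
    (measurePreserving_sub_right volume τ).quasiMeasurePreserving.ae (hv.mild k)] with t ht1 htne ht2 ht
  rcases lt_or_gt_of_ne htne with h | h
  · have htτ : t ∈ Ioo 0 τ := ⟨ht.1, h⟩
    rw [coef_congr_slice (fun x => hU1 (t, x) htτ), ht1 htτ]
    exact mildCoef_congr_on ht.1.le fun r hr => h1 k r ⟨hr.1, hr.2.trans h⟩
  · have e1 : coef U k t = coef v k (t - τ) := by
      unfold coef; congr 1; ext x; exact hU2 (t, x) h.le
    have htδ : t - τ ∈ Ioo 0 δ := ⟨by linarith, by linarith [ht.2]⟩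
    have e2 := mildCoef_add (f := f) hHi k τ (t - τ)
    rw [add_sub_cancel] at e2
    rw [e1, ht2 htδ, e2, hf']
    refine mildCoef_congr_on htδ.1.le fun r hr => coef_congr_slice (fun x => ?_) k
    have hr' : r ∈ Ioo 0 δ := ⟨hr.1, hr.2.trans htδ.2⟩
    rw [cut_apply hr', shift, hH, cut_apply (show r - -τ ∈ Ioo 0 (τ + δ) from
      ⟨by linarith [hr'.1], by linarith [hr'.2]⟩)]
    have e3 : U (r - -τ, x) = v (r, x) := by
      rw [hU2 _ (by simp only; linarith [hr'.1])]; congr 2; ring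
    simp only [forcing, cubic, shift, e3]

theorem IsNLS.restrict {ℓ : ℝ → ℝ} {c : ℝ × Torus → ℝ} {τ τ' : ℝ} (hτ : τ' ≤ τ)
    {f : ℤ → ℂ} {g u : ℝ × Torus → ℂ} (hu : IsNLS τ f ℓ c g u) :
    IsNLS τ' f ℓ c g (cut τ' u) := by
  refine ⟨suppIn_cut _ _, hu.memLp.indicator (measurableSet_strip τ'), fun k => ?_⟩
  filter_upwards [hu.mild k] with t h ht
  rw [coef_cut u k ht, h ⟨ht.1, ht.2.trans_le hτ⟩]
  refine mildCoef_congr_on ht.1.le fun r hr => coef_congr_slice (fun x => ?_) k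
  have hr' : r ∈ Ioo 0 τ' := ⟨hr.1, hr.2.trans ht.2⟩
  rw [cut_apply (show r ∈ Ioo 0 τ from ⟨hr'.1, hr'.2.trans_le hτ⟩), cut_apply hr']
  exact forcing_congr (cut_apply hr').symm

/-- Global existence, with a bound on bounded sets of data. -/
theorem IsExponent.exists_global (hC : IsExponent β C) (Λ : ℝ≥0) {τ : ℝ}
    (hτ : 0 ≤ τ) {A G : ℝ≥0∞} (hA : A ≠ ⊤) (hG : G ≠ ⊤) :
    ∃ M : ℝ≥0∞, M ≠ ⊤ ∧ ∀ {ℓ : ℝ → ℝ} {c : ℝ × Torus → ℝ}, IsCoeff Λ ℓ c →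
      ∀ {f : ℤ → ℂ} {g : ℝ × Torus → ℂ}, l2n 1 f ≤ A → MemLp g 2 vol → eLpNorm g 2 vol ≤ G →
      ∃ u, IsNLS τ f ℓ c g u ∧ eLpNorm u 4 vol ≤ M := by
  set A' : ℝ≥0∞ := (ENNReal.ofReal (Real.exp (2 * (Λ + 1) * τ)) * (A ^ 2 + G ^ 2)) ^ (1 / 2 : ℝ)
  have hA' : A' ≠ ⊤ := ENNReal.rpow_ne_top_of_nonneg (by norm_num) (ENNReal.mul_ne_top
    ENNReal.ofReal_ne_top (ENNReal.add_ne_top.2 ⟨ENNReal.pow_ne_top hA, ENNReal.pow_ne_top hG⟩))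
  obtain ⟨δ, hδ, M, hM, hloc⟩ := hC.exists_local Λ hA' hG
  have key : ∀ n : ℕ, (n - 1 : ℝ) * δ ≤ τ → ∀ {ℓ : ℝ → ℝ} {c : ℝ × Torus → ℝ}, IsCoeff Λ ℓ c →
      ∀ {f : ℤ → ℂ} {g : ℝ × Torus → ℂ}, l2n 1 f ≤ A → MemLp g 2 vol → eLpNorm g 2 vol ≤ G →
      ∃ u, IsNLS (n * δ) f ℓ c g u ∧ eLpNorm u 4 vol ≤ n * M := by
    intro n
    induction n with
    | zero =>
      intro _ ℓ c _ f g _ _ _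
      refine ⟨0, ⟨fun _ _ => rfl, MemLp.zero, fun k => ae_of_all _ fun t ht => ?_⟩, by simp⟩
      simp at ht
    | succ n ih =>
      intro hn ℓ c hL f g hf hg hgG
      have hn' : (n : ℝ) * δ ≤ τ := by push_cast at hn; linarith
      obtain ⟨u, hu, huM⟩ := ih (by nlinarith) hL hf hg hgG
      have hen := hu.energy_le hC hL (ne_top_of_le_ne_top hA hf) hg (t := n * δ)
        ⟨by positivity, le_rfl⟩
      have hf' : l2n 1 (fun k => mildCoef f (cut (n * δ) (forcing ℓ c g u)) k (n * δ)) ≤ A' := by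
        rw [← ENNReal.pow_le_pow_left_iff (n := 2) (by norm_num)]
        refine hen.trans ?_
        rw [← ENNReal.rpow_natCast A', ← ENNReal.rpow_mul,
          show (1 / 2 : ℝ) * ((2 : ℕ) : ℝ) = 1 by norm_num, ENNReal.rpow_one]
        gcongr
      obtain ⟨v, hv, hvM⟩ := hloc (hL.shift (-(n * δ))) hf' (memLp_shift hg _)
        ((eLpNorm_shift hg.1 2 _).trans_le hgG)
      refine ⟨u + shift (n * δ) v, ?_, ?_⟩
      · have := hu.glue hL (by positivity) hδ.le hg hv
        rwa [show ((n + 1 : ℕ) : ℝ) * δ = n * δ + δ by push_cast; ring]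
      · refine (eLpNorm_add_le hu.memLp.1 (memLp_shift hv.memLp _).1 (by norm_num)).trans ?_
        rw [eLpNorm_shift hv.memLp.1]
        refine (add_le_add huM hvM).trans_eq ?_
        push_cast; ring
  refine ⟨((⌊τ / δ⌋₊ + 1 : ℕ) : ℝ≥0∞) * M, ENNReal.mul_ne_top (by finiteness) hM,
    fun {ℓ c} hL {f g} hf hg hgG => ?_⟩
  have h1 : (⌊τ / δ⌋₊ : ℝ) * δ ≤ τ := by
    rw [← le_div_iff₀ hδ]; exact Nat.floor_le (by positivity)
  have h2 : τ ≤ ((⌊τ / δ⌋₊ + 1 : ℕ) : ℝ) * δ := by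
    rw [← div_le_iff₀ hδ]; push_cast; exact (Nat.lt_floor_add_one _).le
  obtain ⟨u, hu, huM⟩ := key (⌊τ / δ⌋₊ + 1) (by push_cast; linarith) hL hf hg hgG
  exact ⟨cut τ u, hu.restrict h2, (eLpNorm_cut_le _ _ _).trans huM⟩

/-! ### Multiplication by functions of time -/

/-- The space-time Fourier transform of the function `ρ(t)`. -/
def timeHat (ρ : 𝓢(ℝ, ℂ)) (q : ℤ × ℝ) : ℂ := if q.1 = 0 then 𝓕 (ρ : ℝ → ℂ) q.2 else 0

theorem measurable_timeHat (ρ : 𝓢(ℝ, ℂ)) : Measurable (timeHat ρ) := by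
  refine Measurable.ite ?_ ?_ measurable_const
  · exact measurable_fst (measurableSet_singleton 0)
  · exact (continuous_fourier_of_integrable ρ.integrable).measurable.comp measurable_snd

theorem fourier_coe_eq (ρ : 𝓢(ℝ, ℂ)) : 𝓕 (ρ : ℝ → ℂ) = (𝓕 ρ : 𝓢(ℝ, ℂ)) :=
  (SchwartzMap.fourier_coe ρ)

/-- The norm of the multiplication by `ρ(t)`. -/
def multConst (b : ℝ) (ρ : 𝓢(ℝ, ℂ)) : ℝ≥0∞ :=
  ∫⁻ p, ENNReal.ofReal ((2 * (1 + (2 * Real.pi * p.2) ^ 2)) ^ (b / 2)) * ‖timeHat ρ p‖ₑ ∂nu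

theorem lintegral_timeHat (F : ℝ → ℝ≥0∞) (ρ : 𝓢(ℝ, ℂ)) :
    ∫⁻ p, F p.2 * ‖timeHat ρ p‖ₑ ∂nu = ∫⁻ ξ, F ξ * ‖𝓕 (ρ : ℝ → ℂ) ξ‖ₑ := by
  rw [lintegral_nu, tsum_eq_single 0]
  · simp [timeHat]
  · intro k hk; simp [timeHat, hk]

theorem multConst_ne_top {b : ℝ} (hb : b ≤ 2) (ρ : 𝓢(ℝ, ℂ)) :
    multConst b ρ ≠ ⊤ := by
  rw [multConst, lintegral_timeHat
    (fun ξ => ENNReal.ofReal ((2 * (1 + (2 * Real.pi * ξ) ^ 2)) ^ (b / 2)))]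
  have h1 := (𝓕 ρ : 𝓢(ℝ, ℂ)).integrable_pow_mul volume 0
  have h2 := (𝓕 ρ : 𝓢(ℝ, ℂ)).integrable_pow_mul volume 2
  have h3 := (h1.const_mul 2).add (h2.const_mul (8 * Real.pi ^ 2))
  refine ne_top_of_le_ne_top h3.2.ne (lintegral_mono fun ξ => ?_)
  rw [fourier_coe_eq, ← ofReal_norm, ← ofReal_norm, ← ENNReal.ofReal_mul (by positivity)]
  refine ENNReal.ofReal_le_ofReal ?_
  refine le_trans ?_ (le_abs_self _)
  have h4 : (2 * (1 + (2 * Real.pi * ξ) ^ 2)) ^ (b / 2) ≤ 2 * (1 + (2 * Real.pi * ξ) ^ 2) := by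
    conv_rhs => rw [← Real.rpow_one (2 * (1 + (2 * Real.pi * ξ) ^ 2))]
    refine Real.rpow_le_rpow_of_exponent_le ?_ (by linarith)
    nlinarith [sq_nonneg (2 * Real.pi * ξ)]
  refine (mul_le_mul_of_nonneg_right h4 (norm_nonneg _)).trans_eq ?_
  simp only [Pi.add_apply, Real.norm_eq_abs, sq_abs, pow_zero, one_mul]
  ring

theorem integrable_timeHat (ρ : 𝓢(ℝ, ℂ)) : Integrable (timeHat ρ) nu := by
  refine ⟨(measurable_timeHat ρ).aestronglyMeasurable, ?_⟩
  have h := lintegral_timeHat (fun _ => 1) ρ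
  simp only [one_mul] at h
  rw [HasFiniteIntegral, h, fourier_coe_eq]
  exact (𝓕 ρ : 𝓢(ℝ, ℂ)).integrable.2

theorem check_timeHat (ρ : 𝓢(ℝ, ℂ)) (z : ℝ × Torus) : check (timeHat ρ) z = ρ z.1 := by
  have h := hasSum_integral_nu (integrable_mul_chr (integrable_timeHat ρ) z)
  have h2 := hasSum_single (f := fun k => ∫ ξ, timeHat ρ (k, ξ) * chr z (k, ξ)) 0 fun k hk => by
    simp [timeHat, hk]
  rw [check, h.unique h2]
  have h3 : (𝓕⁻ (𝓕 ρ) : 𝓢(ℝ, ℂ)) z.1 = ρ z.1 := by rw [FourierTransform.fourierInv_fourier_eq]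
  rw [← h3, SchwartzMap.fourierInv_coe, Real.fourierInv_eq]
  refine integral_congr_ae (ae_of_all _ fun ξ => ?_)
  simp only [timeHat, if_true, chr, fourier_zero, mul_one, fourier_coe_eq]
  rw [Circle.smul_def, smul_eq_mul, mul_comm]
  congr 3
  simp [mul_comm]

/-- The action on transforms of the multiplication by `ρ(t)`. -/
def tmul (ρ : 𝓢(ℝ, ℂ)) (w : ℤ × ℝ → ℂ) : ℤ × ℝ → ℂ :=
  timeHat ρ ⋆[ContinuousLinearMap.mul ℂ ℂ, nu] w

theorem lintegral_lconv_sq_le {f g : ℤ × ℝ → ℝ≥0∞} (hf : AEMeasurable f nu)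
    (hg : AEMeasurable g nu) :
    ∫⁻ Q, lconv f g Q ^ 2 ∂nu ≤ (∫⁻ q, f q ∂nu) ^ 2 * ∫⁻ q, g q ^ 2 ∂nu := by
  have h1 : ∀ᵐ Q ∂nu, lconv f g Q ^ 2 ≤ (∫⁻ q, f q ∂nu) * lconv f (fun q => g q ^ 2) Q := by
    refine ae_of_all _ fun Q => ?_
    have hg' : AEMeasurable (fun q => g (Q - q)) nu :=
      hg.comp_quasiMeasurePreserving (quasiMeasurePreserving_sub_left nu Q)
    have h := lintegral_mul_sq_le (μ := nu) (f := fun q => f q ^ (1 / 2 : ℝ))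
      (g := fun q => f q ^ (1 / 2 : ℝ) * g (Q - q)) (hf.pow_const _) ((hf.pow_const _).mul hg')
    have e : ∀ x : ℝ≥0∞, (x ^ (1 / 2 : ℝ)) ^ 2 = x := fun x => by
      rw [← ENNReal.rpow_natCast, ← ENNReal.rpow_mul]; norm_num
    simp only [← mul_assoc, ← sq, e, mul_pow] at h
    exact h
  refine (lintegral_mono_ae h1).trans_eq ?_
  rw [lintegral_const_mul'' _ (AEMeasurable.lconv hf (hg.pow_const 2)),
    lintegral_lconv hf (hg.pow_const 2), sq, mul_assoc]

theorem wt_le_of_fst_eq_zero {b : ℝ} (hb : 0 ≤ b) {p q : ℤ × ℝ} (hp : p.1 = 0) :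
    wt b q ≤ (2 * (1 + (2 * Real.pi * p.2) ^ 2)) ^ (b / 2) * wt b (q - p) := by
  rw [wt, wt, ← Real.mul_rpow (by positivity) (by positivity)]
  refine Real.rpow_le_rpow (by positivity) ?_ (by linarith)
  have e : modul q = 2 * Real.pi * p.2 + modul (q - p) := by
    simp [modul, hp]; ring
  rw [e]
  set x := 2 * Real.pi * p.2
  set y := modul (q - p)
  nlinarith [sq_nonneg (x - y), sq_nonneg (x * y)]

theorem XN_tmul_le {b : ℝ} (hb : 0 ≤ b) (m : ℤ → ℝ) (ρ : 𝓢(ℝ, ℂ)) {w : ℤ × ℝ → ℂ}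
    (hw : AEStronglyMeasurable w nu) : XN b m (tmul ρ w) ≤ multConst b ρ * XN b m w := by
  rw [← ENNReal.pow_le_pow_left_iff (n := 2) (by norm_num), mul_pow, XN_sq, XN_sq, multConst]
  have hF : AEMeasurable (fun p : ℤ × ℝ => ENNReal.ofReal ((2 * (1 + (2 * Real.pi * p.2) ^ 2)) ^ (b / 2))
      * ‖timeHat ρ p‖ₑ) nu := by
    refine Measurable.aemeasurable (Measurable.mul ?_ (measurable_timeHat ρ).enorm)
    exact Measurable.ennreal_ofReal (((((measurable_snd.const_mul _).pow_const 2).const_add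
      1).const_mul 2).pow_const _)
  have hG : AEMeasurable (fun q => ENNReal.ofReal (|m q.1| * wt b q) * ‖w q‖ₑ) nu :=
    (((measurable_fst_comp (fun k => |m k|)).mul
      (measurable_wt _)).ennreal_ofReal).aemeasurable.mul hw.enorm
  refine le_trans (lintegral_mono fun Q => ?_) (lintegral_lconv_sq_le hF hG)
  refine pow_le_pow_left' ?_ 2
  refine (mul_le_mul' le_rfl (enorm_convolution_le (timeHat ρ) w Q)).trans ?_
  rw [lconv, lconv, ← lintegral_const_mul' _ _ ENNReal.ofReal_ne_top]
  refine lintegral_mono fun p => ?_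
  simp only
  by_cases hp : p.1 = 0
  · have h1 := wt_le_of_fst_eq_zero hb hp (q := Q)
    have h2 : (Q - p).1 = Q.1 := by simp [hp]
    calc _ = ENNReal.ofReal (|m Q.1| * wt b Q) * (‖timeHat ρ p‖ₑ * ‖w (Q - p)‖ₑ) := rfl
      _ ≤ ENNReal.ofReal ((2 * (1 + (2 * Real.pi * p.2) ^ 2)) ^ (b / 2)
          * (|m Q.1| * wt b (Q - p))) * (‖timeHat ρ p‖ₑ * ‖w (Q - p)‖ₑ) := by
          refine mul_le_mul' (ENNReal.ofReal_le_ofReal ?_) le_rfl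
          rw [mul_left_comm]
          exact mul_le_mul_of_nonneg_left h1 (abs_nonneg _)
      _ = _ := by
        rw [ENNReal.ofReal_mul (by positivity), h2]
        ring
  · simp [timeHat, hp]

theorem aestronglyMeasurable_tmul (ρ : 𝓢(ℝ, ℂ)) {w : ℤ × ℝ → ℂ}
    (hw : AEStronglyMeasurable w nu) : AEStronglyMeasurable (tmul ρ w) nu := by
  have h : AEStronglyMeasurable (Function.uncurry fun Q q : ℤ × ℝ =>
      timeHat ρ q * w (Q - q)) (nu.prod nu) := by
    refine AEStronglyMeasurable.mul ?_ ?_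
    · exact ((measurable_timeHat ρ).comp measurable_snd).aestronglyMeasurable
    · exact hw.comp_quasiMeasurePreserving (quasiMeasurePreserving_sub nu nu)
  exact h.integral_prod_right'

theorem memLp_tmul (ρ : 𝓢(ℝ, ℂ)) {w : ℤ × ℝ → ℂ} (hw : MemLp w 2 nu) :
    MemLp (tmul ρ w) 2 nu := by
  refine ⟨aestronglyMeasurable_tmul ρ hw.1, ?_⟩
  rw [← XN_zero_one]
  refine (XN_tmul_le le_rfl 1 ρ hw.1).trans_lt (ENNReal.mul_lt_top
    (multConst_ne_top (by norm_num) ρ).lt_top ?_)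
  rw [XN_zero_one]; exact hw.2

theorem integrable_tmul (ρ : 𝓢(ℝ, ℂ)) {w : ℤ × ℝ → ℂ} (hw : Integrable w nu) :
    Integrable (tmul ρ w) nu := (integrable_timeHat ρ).integrable_convolution _ hw

theorem check_tmul (ρ : 𝓢(ℝ, ℂ)) {w : ℤ × ℝ → ℂ} (hw : Integrable w nu) (z : ℝ × Torus) :
    check (tmul ρ w) z = ρ z.1 * check w z := by
  rw [tmul, ← check_mul_check (integrable_timeHat ρ) hw, check_timeHat]

theorem memLp_timeHat (ρ : 𝓢(ℝ, ℂ)) : MemLp (timeHat ρ) 2 nu := by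
  refine memLp_two_of_integrable_of_bound (integrable_timeHat ρ) (D := ∫ t, ‖ρ t‖) fun q => ?_
  have h0 : 0 ≤ ∫ t, ‖ρ t‖ := integral_nonneg fun _ => norm_nonneg _
  by_cases hq : q.1 = 0
  · simp only [timeHat, hq, if_true]
    exact VectorFourier.norm_fourierIntegral_le_integral_norm _ _ _ _ _
  · simpa [timeHat, hq] using h0

theorem tmul_sub (ρ : 𝓢(ℝ, ℂ)) {w y : ℤ × ℝ → ℂ} (hw : MemLp w 2 nu) (hy : MemLp y 2 nu) :
    tmul ρ (w - y) = tmul ρ w - tmul ρ y := by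
  ext Q
  have hi : ∀ {w : ℤ × ℝ → ℂ}, MemLp w 2 nu → Integrable (fun q => timeHat ρ q * w (Q - q)) nu :=
    fun hw => (memLp_timeHat ρ).integrable_mul (q := 2)
      (hw.comp_measurePreserving (Measure.measurePreserving_sub_left nu Q))
  simp only [tmul, convolution, ContinuousLinearMap.mul_apply', Pi.sub_apply, mul_sub]
  exact integral_sub (hi hw) (hi hy)

theorem exists_norm_le (ρ : 𝓢(ℝ, ℂ)) : ∃ D : ℝ, ∀ t, ‖ρ t‖ ≤ D := by
  obtain ⟨D, hD⟩ := ρ.decay 0 0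
  exact ⟨D, fun t => by simpa using hD.2 t⟩

theorem aestronglyMeasurable_time (ρ : 𝓢(ℝ, ℂ)) :
    AEStronglyMeasurable (fun z : ℝ × Torus => ρ z.1) vol :=
  (ρ.continuous.comp continuous_fst).aestronglyMeasurable

theorem memLp_time_mul (ρ : 𝓢(ℝ, ℂ)) {z : ℝ × Torus → ℂ} {p : ℝ≥0∞} (hz : MemLp z p vol) :
    MemLp (fun x => ρ x.1 * z x) p vol := by
  obtain ⟨D, hD⟩ := exists_norm_le ρ
  refine MemLp.of_le_mul (c := D) hz ((aestronglyMeasurable_time ρ).mul hz.1)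
    (ae_of_all _ fun x => ?_)
  rw [norm_mul]
  exact mul_le_mul_of_nonneg_right (hD _) (norm_nonneg _)

theorem eLpNorm_time_mul_le (ρ : 𝓢(ℝ, ℂ)) : ∃ D : ℝ≥0∞, D ≠ ⊤ ∧ ∀ (z : ℝ × Torus → ℂ) (p : ℝ≥0∞),
    eLpNorm (fun x => ρ x.1 * z x) p vol ≤ D * eLpNorm z p vol := by
  obtain ⟨D, hD⟩ := exists_norm_le ρ
  refine ⟨ENNReal.ofReal D, ENNReal.ofReal_ne_top, fun z p => ?_⟩
  refine eLpNorm_le_mul_eLpNorm_of_ae_le_mul (ae_of_all _ fun x => ?_) p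
  rw [norm_mul]
  exact mul_le_mul_of_nonneg_right (hD _) (norm_nonneg _)

theorem tendsto_zero_of_le_mul {a b : ℕ → ℝ≥0∞} {D : ℝ≥0∞} (hD : D ≠ ⊤) (h : ∀ n, a n ≤ D * b n)
    (hb : Tendsto b atTop (𝓝 0)) : Tendsto a atTop (𝓝 0) := by
  have h1 := ENNReal.Tendsto.const_mul (a := D) hb (Or.inr hD)
  rw [mul_zero] at h1
  exact tendsto_of_tendsto_of_tendsto_of_le_of_le tendsto_const_nhds h1 (fun _ => bot_le) h

theorem FT.time_mul {z : ℝ × Torus → ℂ} {w : ℤ × ℝ → ℂ} (h : FT z w) (ρ : 𝓢(ℝ, ℂ)) :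
    FT (fun x => ρ x.1 * z x) (tmul ρ w) := by
  obtain ⟨D, hD, hle⟩ := eLpNorm_time_mul_le ρ
  refine FT.of_tendsto (un := fun n x => ρ x.1 * check (trunc n w) x)
    (wn := fun n => tmul ρ (trunc n w)) (fun n => ?_) (memLp_time_mul ρ h.memLp_left)
    (memLp_tmul ρ h.memLp_right) ?_ ?_
  · have hi := integrable_trunc h.memLp_right n
    have := FT_check (integrable_tmul ρ hi) (memLp_tmul ρ (memLp_trunc h.memLp_right n))
    have e : check (tmul ρ (trunc n w)) = fun x => ρ x.1 * check (trunc n w) x :=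
      funext fun x => check_tmul ρ hi x
    rwa [e] at this
  · refine tendsto_zero_of_le_mul hD (fun n => ?_) h.tendsto_check_trunc
    refine le_trans (le_of_eq ?_) (hle _ _)
    congr 1; ext x; simp [mul_sub]
  · refine tendsto_zero_of_le_mul (multConst_ne_top (b := 0) (by norm_num) ρ) (fun n => ?_)
      (tendsto_trunc h.memLp_right)
    rw [← tmul_sub ρ h.memLp_right (memLp_trunc h.memLp_right n), ← XN_zero_one, ← XN_zero_one]
    exact XN_tmul_le le_rfl 1 ρ (h.memLp_right.1.sub (memLp_trunc h.memLp_right n).1)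

/-! ### The trilinear estimate -/

/-- The part of `w` at the spatial frequency `k`. -/
def slice {M : Type*} [Zero M] (k : ℤ) (w : ℤ × ℝ → M) (q : ℤ × ℝ) : M :=
  if q.1 = k then w q else 0

theorem slice_eq_indicator {M : Type*} [Zero M] (k : ℤ) (w : ℤ × ℝ → M) :
    slice k w = (({k} : Set ℤ) ×ˢ univ).indicator w := by
  ext q; simp [slice, indicator, Set.mem_prod]

theorem measurableSet_slice (k : ℤ) : MeasurableSet (({k} : Set ℤ) ×ˢ (univ : Set ℝ)) :=
  (measurableSet_singleton k).prod MeasurableSet.univ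

theorem integrable_slice {w : ℤ × ℝ → ℂ} (hw : Integrable w nu) (k : ℤ) :
    Integrable (slice k w) nu := by
  rw [slice_eq_indicator]; exact hw.indicator (measurableSet_slice k)

theorem memLp_slice {w : ℤ × ℝ → ℂ} (hw : MemLp w 2 nu) (k : ℤ) : MemLp (slice k w) 2 nu := by
  rw [slice_eq_indicator]; exact hw.indicator (measurableSet_slice k)

theorem AEMeasurable.slice {w : ℤ × ℝ → ℝ≥0∞} (hw : AEMeasurable w nu) (k : ℤ) :
    AEMeasurable (slice k w) nu := by
  rw [slice_eq_indicator]; exact hw.indicator (measurableSet_slice k)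

theorem enorm_slice (k : ℤ) (w : ℤ × ℝ → ℂ) (q : ℤ × ℝ) :
    ‖slice k w q‖ₑ = slice k (fun q => ‖w q‖ₑ) q := by
  unfold slice; split_ifs <;> simp

theorem sum_slice {M : Type*} [AddCommMonoid M] (J : Finset ℤ) (w : ℤ × ℝ → M) (q : ℤ × ℝ) :
    ∑ k ∈ J, slice k w q = if q.1 ∈ J then w q else 0 := by
  simp [slice]

theorem sum_slice_le (J : Finset ℤ) (w : ℤ × ℝ → ℝ≥0∞) (q : ℤ × ℝ) :
    ∑ k ∈ J, slice k w q ≤ w q := by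
  rw [sum_slice]; split_ifs <;> simp

theorem sum_slice_eq {n : ℕ} {w : ℤ × ℝ → ℂ} (hw : trunc n w = w) :
    w = ∑ k ∈ Finset.Icc (-n : ℤ) n, slice k w := by
  ext q
  rw [Finset.sum_apply, sum_slice]
  split_ifs with h
  · rfl
  · rw [← hw, trunc, indicator_of_notMem fun hq => h (Finset.mem_Icc.2 hq.1)]

theorem tmul_slice (ρ : 𝓢(ℝ, ℂ)) (k : ℤ) (w : ℤ × ℝ → ℂ) :
    tmul ρ (slice k w) = slice k (tmul ρ w) := by
  ext Q
  simp only [tmul, convolution, ContinuousLinearMap.mul_apply', slice]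
  by_cases hQ : Q.1 = k
  · simp only [hQ, if_true]
    congr 1; ext q
    by_cases hq : q.1 = 0
    · simp [hq, hQ]
    · simp [timeHat, hq]
  · simp only [hQ, if_false]
    refine integral_eq_zero_of_ae (ae_of_all _ fun q => ?_)
    by_cases hq : q.1 = 0
    · simp [hq, hQ]
    · simp [timeHat, hq]

theorem memLp_conv {a c : ℤ × ℝ → ℂ} (ha : Integrable a nu) (hc : Integrable c nu)
    (hc2 : MemLp c 2 nu) : MemLp (a ⋆[ContinuousLinearMap.mul ℂ ℂ, nu] c) 2 nu := by
  refine memLp_two_iff_lintegral.2 ⟨(ha.integrable_convolution _ hc).1, ?_⟩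
  refine lt_of_le_of_lt (lintegral_mono fun Q => pow_le_pow_left' (enorm_convolution_le a c Q) 2)
    ((lintegral_lconv_sq_le ha.1.enorm hc.1.enorm).trans_lt ?_)
  exact ENNReal.mul_lt_top (ENNReal.pow_lt_top ha.2) (memLp_two_iff_lintegral.1 hc2).2

/-- The quadrilinear form bounded by the absolute values of the transforms. -/
theorem enorm_integral_check_le {a b c d : ℤ × ℝ → ℂ} (ha : Integrable a nu) (ha2 : MemLp a 2 nu)
    (hb : Integrable b nu) (hc : Integrable c nu) (hc2 : MemLp c 2 nu)
    (hd : Integrable d nu) :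
    ‖∫ z, (check a z * check c z) * starRingEnd ℂ (check b z * check d z) ∂vol‖ₑ
      ≤ ENNReal.ofReal (2 * Real.pi) * ∫⁻ Q, lconv (fun q => ‖a q‖ₑ) (fun q => ‖c q‖ₑ) Q *
        lconv (fun q => ‖b q‖ₑ) (fun q => ‖d q‖ₑ) Q ∂nu := by
  set y := a ⋆[ContinuousLinearMap.mul ℂ ℂ, nu] c with hy
  set x := b ⋆[ContinuousLinearMap.mul ℂ ℂ, nu] d with hx
  have hyi : Integrable y nu := ha.integrable_convolution _ hc
  have hxi : Integrable x nu := hb.integrable_convolution _ hd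
  have hFT := FT_check hyi (memLp_conv ha hc hc2)
  have hH : Integrable (check y) vol := by
    have e : check y = fun z => check a z * check c z := funext fun z => (check_mul_check ha hc z).symm
    rw [e]
    exact (FT_check ha ha2).memLp_left.integrable_mul (FT_check hc hc2).memLp_left
  have h1 := integral_hat_mul_conj hH hxi
  have h2 := (FT_hat hH hFT.memLp_left).right_unique hFT
  have h3 : ∫ z, (check a z * check c z) * starRingEnd ℂ (check b z * check d z) ∂vol
      = (2 * Real.pi : ℝ) * ∫ q, hat (check y) q * starRingEnd ℂ (x q) ∂nu := by
    rw [h1, ← mul_assoc, ← Complex.ofReal_mul, mul_inv_cancel₀ (by positivity), Complex.ofReal_one,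
      one_mul]
    congr 1; ext z
    rw [check_mul_check ha hc, check_mul_check hb hd]
  rw [h3, enorm_mul]
  gcongr
  · rw [← ofReal_norm, Complex.norm_real, Real.norm_of_nonneg (by positivity)]
  · refine (enorm_integral_le_lintegral_enorm _).trans ?_
    refine (lintegral_congr_ae (g := fun q => ‖y q‖ₑ * ‖x q‖ₑ) ?_).trans_le ?_
    · filter_upwards [h2] with q hq
      rw [hq, enorm_mul]
      congr 1
      rw [← ofReal_norm, RCLike.norm_conj, ofReal_norm]
    · exact lintegral_mono fun Q => mul_le_mul' (enorm_convolution_le a c Q)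
        (enorm_convolution_le b d Q)

/-- The absolute quadrilinear form. -/
def quad (f₁ f₂ f₃ f₄ : ℤ × ℝ → ℝ≥0∞) : ℝ≥0∞ := ∫⁻ Q, lconv f₁ f₃ Q * lconv f₂ f₄ Q ∂nu

theorem quad_slice_eq_zero {f₁ f₂ f₃ f₄ : ℤ × ℝ → ℝ≥0∞} {k₁ k₂ k₃ k₄ : ℤ}
    (h : k₁ + k₃ ≠ k₂ + k₄) :
    quad (slice k₁ f₁) (slice k₂ f₂) (slice k₃ f₃) (slice k₄ f₄) = 0 := by
  have key : ∀ (f g : ℤ × ℝ → ℝ≥0∞) (j l : ℤ) (Q : ℤ × ℝ), Q.1 ≠ j + l →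
      lconv (slice j f) (slice l g) Q = 0 := fun f g j l Q hQ => by
    rw [lconv, ← lintegral_zero (μ := nu)]
    congr 1; ext q
    simp only [slice, Prod.fst_sub]
    split_ifs with h1 h2
    · exact absurd (by omega) hQ
    all_goals simp
  rw [quad, ← lintegral_zero (μ := nu)]
  congr 1; ext Q
  by_cases hQ : Q.1 = k₁ + k₃
  · rw [key f₂ f₄ k₂ k₄ Q (by omega), mul_zero]
  · rw [key f₁ f₃ k₁ k₃ Q hQ, zero_mul]

theorem sum_lconv_slice_le {f g : ℤ × ℝ → ℝ≥0∞} (hf : AEMeasurable f nu) (hg : AEMeasurable g nu)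
    (J : Finset ℤ) (Q : ℤ × ℝ) :
    ∑ j ∈ J, ∑ l ∈ J, lconv (slice j f) (slice l g) Q ≤ lconv f g Q := by
  have hm : ∀ j l, AEMeasurable (fun q => slice j f q * slice l g (Q - q)) nu := fun j l =>
    (AEMeasurable.slice hf j).mul ((AEMeasurable.slice hg l).comp_quasiMeasurePreserving
      (quasiMeasurePreserving_sub_left nu Q))
  simp only [lconv]
  rw [Finset.sum_congr rfl fun j _ => (lintegral_finsetSum' J fun l _ => hm j l).symm,
    ← lintegral_finsetSum' J fun j _ => Finset.aemeasurable_fun_sum _ fun l _ => hm j l]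
  refine lintegral_mono fun q => ?_
  simp only [← Finset.mul_sum, ← Finset.sum_mul]
  exact mul_le_mul' (sum_slice_le J f q) (sum_slice_le J g (Q - q))

theorem sum_quad_slice_le {f₁ f₂ f₃ f₄ : ℤ × ℝ → ℝ≥0∞} (h₁ : AEMeasurable f₁ nu)
    (h₂ : AEMeasurable f₂ nu) (h₃ : AEMeasurable f₃ nu) (h₄ : AEMeasurable f₄ nu) (J : Finset ℤ) :
    ∑ k₁ ∈ J, ∑ k₂ ∈ J, ∑ k₃ ∈ J, ∑ k₄ ∈ J,
      quad (slice k₁ f₁) (slice k₂ f₂) (slice k₃ f₃) (slice k₄ f₄) ≤ quad f₁ f₂ f₃ f₄ := by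
  have hm : ∀ k₁ k₂ k₃ k₄, AEMeasurable (fun Q => lconv (slice k₁ f₁) (slice k₃ f₃) Q *
      lconv (slice k₂ f₂) (slice k₄ f₄) Q) nu := fun k₁ k₂ k₃ k₄ =>
    (AEMeasurable.lconv (AEMeasurable.slice h₁ _) (AEMeasurable.slice h₃ _)).mul
      (AEMeasurable.lconv (AEMeasurable.slice h₂ _) (AEMeasurable.slice h₄ _))
  simp only [quad]
  have e : ∑ k₁ ∈ J, ∑ k₂ ∈ J, ∑ k₃ ∈ J, ∑ k₄ ∈ J,
      ∫⁻ Q, lconv (slice k₁ f₁) (slice k₃ f₃) Q * lconv (slice k₂ f₂) (slice k₄ f₄) Q ∂nu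
      = ∫⁻ Q, ∑ k₁ ∈ J, ∑ k₂ ∈ J, ∑ k₃ ∈ J, ∑ k₄ ∈ J,
        lconv (slice k₁ f₁) (slice k₃ f₃) Q * lconv (slice k₂ f₂) (slice k₄ f₄) Q ∂nu := by
    rw [lintegral_finsetSum' J fun _ _ => Finset.aemeasurable_fun_sum _ fun _ _ =>
      Finset.aemeasurable_fun_sum _ fun _ _ => Finset.aemeasurable_fun_sum _ fun _ _ => hm _ _ _ _]
    refine Finset.sum_congr rfl fun _ _ => ?_
    rw [lintegral_finsetSum' J fun _ _ =>
      Finset.aemeasurable_fun_sum _ fun _ _ => Finset.aemeasurable_fun_sum _ fun _ _ => hm _ _ _ _]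
    refine Finset.sum_congr rfl fun _ _ => ?_
    rw [lintegral_finsetSum' J fun _ _ => Finset.aemeasurable_fun_sum _ fun _ _ => hm _ _ _ _]
    refine Finset.sum_congr rfl fun _ _ => ?_
    rw [lintegral_finsetSum' J fun _ _ => hm _ _ _ _]
  rw [e]
  refine lintegral_mono fun Q => ?_
  refine le_trans (le_of_eq ?_) (mul_le_mul' (sum_lconv_slice_le h₁ h₃ J Q)
    (sum_lconv_slice_le h₂ h₄ J Q))
  rw [Finset.sum_mul]
  refine Finset.sum_congr rfl fun _ _ => ?_
  rw [Finset.sum_mul, Finset.sum_comm]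
  simp only [Finset.mul_sum]

theorem IsStrichartzConst.quad_le (hC : IsStrichartzConst β C)
    {f₁ f₂ f₃ f₄ : ℤ × ℝ → ℝ≥0∞} (h₁ : AEMeasurable f₁ nu)
    (h₂ : AEMeasurable f₂ nu) (h₃ : AEMeasurable f₃ nu) (h₄ : AEMeasurable f₄ nu)
    {n₁ n₂ n₃ n₄ : ℝ≥0∞} (e₁ : ∫⁻ q, (ENNReal.ofReal (wt β q) * f₁ q) ^ 2 ∂nu = n₁ ^ 2)
    (e₂ : ∫⁻ q, (ENNReal.ofReal (wt β q) * f₂ q) ^ 2 ∂nu = n₂ ^ 2)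
    (e₃ : ∫⁻ q, (ENNReal.ofReal (wt β q) * f₃ q) ^ 2 ∂nu = n₃ ^ 2)
    (e₄ : ∫⁻ q, (ENNReal.ofReal (wt β q) * f₄ q) ^ 2 ∂nu = n₄ ^ 2) :
    quad f₁ f₂ f₃ f₄ ≤ C * (n₁ * n₂ * n₃ * n₄) := by
  rw [← ENNReal.pow_le_pow_left_iff (n := 2) (by norm_num)]
  refine (lintegral_mul_sq_le (AEMeasurable.lconv h₁ h₃) (AEMeasurable.lconv h₂ h₄)).trans ?_
  refine (mul_le_mul' (hC.lconv h₁ h₃) (hC.lconv h₂ h₄)).trans_eq ?_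
  rw [e₁, e₂, e₃, e₄]; ring

theorem lintegral_weight_mul_sq (β : ℝ) {m : ℤ → ℝ} (hm : ∀ k, 0 ≤ m k) (w : ℤ × ℝ → ℂ) :
    ∫⁻ q, (ENNReal.ofReal (wt β q) * (ENNReal.ofReal (m q.1) * ‖w q‖ₑ)) ^ 2 ∂nu = XN β m w ^ 2 := by
  rw [XN_sq]
  congr 1; ext q
  rw [← mul_assoc, ← ENNReal.ofReal_mul (wt_pos _ _).le, abs_of_nonneg (hm _), mul_comm (wt β q)]

theorem lconv_const_mul_left {c : ℝ≥0∞} (hc : c ≠ ⊤) (f g : ℤ × ℝ → ℝ≥0∞) (Q : ℤ × ℝ) :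
    lconv (fun q => c * f q) g Q = c * lconv f g Q := by
  simp only [lconv, mul_assoc]; exact lintegral_const_mul' _ _ hc

theorem lconv_const_mul_right {c : ℝ≥0∞} (hc : c ≠ ⊤) (f g : ℤ × ℝ → ℝ≥0∞) (Q : ℤ × ℝ) :
    lconv f (fun q => c * g q) Q = c * lconv f g Q := by
  simp only [lconv, mul_left_comm _ c]; exact lintegral_const_mul' _ _ hc

/-- Multiplication by a function of the spatial frequency. -/
def wmul (m : ℤ → ℝ) (f : ℤ × ℝ → ℝ≥0∞) (q : ℤ × ℝ) : ℝ≥0∞ := ENNReal.ofReal (m q.1) * f q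

theorem AEMeasurable.wmul {f : ℤ × ℝ → ℝ≥0∞} (hf : AEMeasurable f nu) (m : ℤ → ℝ) :
    AEMeasurable (wmul m f) nu :=
  ((measurable_fst_comp m).ennreal_ofReal).aemeasurable.mul hf

theorem slice_wmul (k : ℤ) (m : ℤ → ℝ) (f : ℤ × ℝ → ℝ≥0∞) :
    slice k (wmul m f) = fun q => ENNReal.ofReal (m k) * slice k f q := by
  ext q; simp only [slice, wmul]; split_ifs with h <;> simp [h]

theorem quad_wmul₁ (m : ℤ → ℝ) (f₁ f₂ f₃ f₄ : ℤ × ℝ → ℝ≥0∞) (k : ℤ) :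
    quad (slice k (wmul m f₁)) f₂ f₃ f₄ = ENNReal.ofReal (m k) * quad (slice k f₁) f₂ f₃ f₄ := by
  simp only [quad, slice_wmul, lconv_const_mul_left ENNReal.ofReal_ne_top, mul_assoc]
  exact lintegral_const_mul' _ _ ENNReal.ofReal_ne_top

theorem quad_wmul₂ (m : ℤ → ℝ) (f₁ f₂ f₃ f₄ : ℤ × ℝ → ℝ≥0∞) (k : ℤ) :
    quad f₁ (slice k (wmul m f₂)) f₃ f₄ = ENNReal.ofReal (m k) * quad f₁ (slice k f₂) f₃ f₄ := by
  simp only [quad, slice_wmul, lconv_const_mul_left ENNReal.ofReal_ne_top, mul_left_comm _ (ENNReal.ofReal (m k))]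
  exact lintegral_const_mul' _ _ ENNReal.ofReal_ne_top

theorem quad_wmul₃ (m : ℤ → ℝ) (f₁ f₂ f₃ f₄ : ℤ × ℝ → ℝ≥0∞) (k : ℤ) :
    quad f₁ f₂ (slice k (wmul m f₃)) f₄ = ENNReal.ofReal (m k) * quad f₁ f₂ (slice k f₃) f₄ := by
  simp only [quad, slice_wmul, lconv_const_mul_right ENNReal.ofReal_ne_top, mul_assoc]
  exact lintegral_const_mul' _ _ ENNReal.ofReal_ne_top

/-- Weights compatible with the cubic interaction of frequencies. -/
structure IsWeight (A : ℝ≥0) (m : ℤ → ℝ) : Prop where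
  nonneg : ∀ k, 0 ≤ m k
  le : ∀ k₁ k₂ k₃, m (k₁ - k₂ + k₃) ≤ A * (m k₁ + m k₂ + m k₃)

theorem integrable_check_mul_check {a c : ℤ × ℝ → ℂ} (ha : Integrable a nu) (ha2 : MemLp a 2 nu)
    (hc : Integrable c nu) (hc2 : MemLp c 2 nu) :
    Integrable (fun z => check a z * check c z) vol :=
  (FT_check ha ha2).memLp_left.integrable_mul (FT_check hc hc2).memLp_left

theorem integrable_check_four {a b c d : ℤ × ℝ → ℂ} (ha : Integrable a nu) (ha2 : MemLp a 2 nu)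
    (hb : Integrable b nu) (hc : Integrable c nu) (hc2 : MemLp c 2 nu) (hd : Integrable d nu)
    (ρ : 𝓢(ℝ, ℂ)) :
    Integrable (fun z => ρ z.1 ^ 2 * (check a z * check c z) *
      starRingEnd ℂ (check b z * check d z)) vol := by
  obtain ⟨D, hD⟩ := exists_norm_le ρ
  have hD0 : 0 ≤ D := (norm_nonneg _).trans (hD 0)
  refine ((integrable_check_mul_check ha ha2 hc hc2).bdd_mul (c := D ^ 2)
    ((aestronglyMeasurable_time ρ).pow 2) (ae_of_all _ fun z => ?_)).mul_bdd
    (c := (∫ q, ‖b q‖ ∂nu) * ∫ q, ‖d q‖ ∂nu) ?_ (ae_of_all _ fun z => ?_)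
  · simp only [Pi.pow_apply, norm_pow]
    exact pow_le_pow_left₀ (norm_nonneg _) (hD _) 2
  · exact (Complex.continuous_conj.comp
      ((continuous_check hb).mul (continuous_check hd))).aestronglyMeasurable
  · rw [RCLike.norm_conj, norm_mul]
    exact mul_le_mul (norm_check_le b z) (norm_check_le d z) (norm_nonneg _)
      (integral_nonneg fun _ => norm_nonneg _)

theorem enorm_integral_check_time_le {a b c d : ℤ × ℝ → ℂ} (ha : Integrable a nu)
    (ha2 : MemLp a 2 nu) (hb : Integrable b nu) (hc : Integrable c nu)
    (hc2 : MemLp c 2 nu) (hd : Integrable d nu) {ρ : 𝓢(ℝ, ℂ)}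
    (hρ : ∀ t, starRingEnd ℂ (ρ t) = ρ t) :
    ‖∫ z, ρ z.1 ^ 2 * (check a z * check c z) * starRingEnd ℂ (check b z * check d z) ∂vol‖ₑ
      ≤ ENNReal.ofReal (2 * Real.pi) * quad (fun q => ‖a q‖ₑ) (fun q => ‖tmul ρ b q‖ₑ)
        (fun q => ‖tmul ρ c q‖ₑ) (fun q => ‖d q‖ₑ) ∧
    ‖∫ z, ρ z.1 ^ 2 * (check a z * check c z) * starRingEnd ℂ (check b z * check d z) ∂vol‖ₑ
      ≤ ENNReal.ofReal (2 * Real.pi) * quad (fun q => ‖tmul ρ a q‖ₑ) (fun q => ‖b q‖ₑ)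
        (fun q => ‖tmul ρ c q‖ₑ) (fun q => ‖d q‖ₑ) ∧
    ‖∫ z, ρ z.1 ^ 2 * (check a z * check c z) * starRingEnd ℂ (check b z * check d z) ∂vol‖ₑ
      ≤ ENNReal.ofReal (2 * Real.pi) * quad (fun q => ‖tmul ρ a q‖ₑ) (fun q => ‖tmul ρ b q‖ₑ)
        (fun q => ‖c q‖ₑ) (fun q => ‖d q‖ₑ) := by
  refine ⟨?_, ?_, ?_⟩
  · refine le_trans (le_of_eq ?_) (enorm_integral_check_le ha ha2 (integrable_tmul ρ hb)
      (integrable_tmul ρ hc) (memLp_tmul ρ hc2) hd)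
    congr 2; ext z
    simp only [check_tmul ρ hb, check_tmul ρ hc, map_mul, hρ]; ring
  · refine le_trans (le_of_eq ?_) (enorm_integral_check_le (integrable_tmul ρ ha)
      (memLp_tmul ρ ha2) hb (integrable_tmul ρ hc) (memLp_tmul ρ hc2) hd)
    congr 2; ext z
    simp only [check_tmul ρ ha, check_tmul ρ hc, map_mul]; ring
  · refine le_trans (le_of_eq ?_) (enorm_integral_check_le (integrable_tmul ρ ha)
      (memLp_tmul ρ ha2) (integrable_tmul ρ hb) hc hc2 hd)
    congr 2; ext z
    simp only [check_tmul ρ ha, check_tmul ρ hb, map_mul, hρ]; ring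

theorem integrable_of_trunc_eq {n : ℕ} {w : ℤ × ℝ → ℂ} (hw : MemLp w 2 nu) (hn : trunc n w = w) :
    Integrable w nu := hn ▸ integrable_trunc hw n

theorem check_eq_sum_slice {n : ℕ} {w : ℤ × ℝ → ℂ} (hw : MemLp w 2 nu) (hn : trunc n w = w)
    (z : ℝ × Torus) : check w z = ∑ k ∈ Finset.Icc (-n : ℤ) n, check (slice k w) z := by
  conv_lhs => rw [sum_slice_eq hn]
  rw [check_sum _ fun k _ => integrable_slice (integrable_of_trunc_eq hw hn) k, Finset.sum_apply]

theorem check_weight_eq_sum_slice {n : ℕ} {w : ℤ × ℝ → ℂ} (hw : MemLp w 2 nu) (hn : trunc n w = w)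
    (m : ℤ → ℝ) (z : ℝ × Torus) : check (fun q => (m q.1 : ℂ) * w q) z
      = ∑ k ∈ Finset.Icc (-n : ℤ) n, (m k : ℂ) * check (slice k w) z := by
  have e : (fun q => (m q.1 : ℂ) * w q)
      = ∑ k ∈ Finset.Icc (-n : ℤ) n, fun q => (m k : ℂ) * slice k w q := by
    ext q
    conv_lhs => rw [sum_slice_eq hn]
    simp only [Finset.sum_apply, Finset.mul_sum]
    refine Finset.sum_congr rfl fun k _ => ?_
    simp only [slice]; split_ifs with h <;> simp [h]
  rw [e, check_sum _ fun k _ => (integrable_slice (integrable_of_trunc_eq hw hn) k).const_mul _,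
    Finset.sum_apply]
  refine Finset.sum_congr rfl fun k _ => ?_
  simp only [check, mul_assoc]
  exact integral_const_mul _ _

theorem mul_sum_four (J : Finset ℤ) (r : ℂ) (x y v w : ℤ → ℂ) :
    r * ((∑ k ∈ J, x k) * ∑ k ∈ J, v k) * (∑ k ∈ J, y k) * (∑ k ∈ J, w k)
      = ∑ k₁ ∈ J, ∑ k₂ ∈ J, ∑ k₃ ∈ J, ∑ k₄ ∈ J, r * (x k₁ * v k₃) * y k₂ * w k₄ := by
  simp only [← Finset.mul_sum, ← Finset.sum_mul]

/-- The bound in the trilinear estimate. -/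
def triBound (β : ℝ) (m : ℤ → ℝ) (ρ : 𝓢(ℝ, ℂ)) (a b c : ℤ × ℝ → ℂ) : ℝ≥0∞ :=
  XN β m a * XN β 1 (tmul ρ b) * XN β 1 (tmul ρ c)
    + XN β 1 (tmul ρ a) * XN β m b * XN β 1 (tmul ρ c)
    + XN β 1 (tmul ρ a) * XN β 1 (tmul ρ b) * XN β m c

theorem IsStrichartzConst.pairing_le (hC : IsStrichartzConst β C) {A : ℝ≥0}
    {m : ℤ → ℝ} (hm : IsWeight A m) {ρ : 𝓢(ℝ, ℂ)} (hρ : ∀ t, starRingEnd ℂ (ρ t) = ρ t)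
    {n : ℕ} {a b c d : ℤ × ℝ → ℂ} (ha : MemLp a 2 nu) (han : trunc n a = a)
    (hb : MemLp b 2 nu) (hbn : trunc n b = b) (hc : MemLp c 2 nu) (hcn : trunc n c = c)
    (hd : MemLp d 2 nu) (hdn : trunc n d = d) :
    ‖∫ z, ρ z.1 ^ 2 * (check a z * check c z) * starRingEnd ℂ (check b z) *
        starRingEnd ℂ (check (fun q => (m q.1 : ℂ) * d q) z) ∂vol‖ₑ
      ≤ ENNReal.ofReal (2 * Real.pi) * A * C * triBound β m ρ a b c * XN β 1 d := by
  set J := Finset.Icc (-n : ℤ) n with hJ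
  have hai := integrable_of_trunc_eq ha han
  have hbi := integrable_of_trunc_eq hb hbn
  have hci := integrable_of_trunc_eq hc hcn
  have hdi := integrable_of_trunc_eq hd hdn
  set P : ℤ → ℤ → ℤ → ℤ → ℝ × Torus → ℂ := fun k₁ k₂ k₃ k₄ z =>
    ρ z.1 ^ 2 * (check (slice k₁ a) z * check (slice k₃ c) z) *
      starRingEnd ℂ (check (slice k₂ b) z * check (slice k₄ d) z) with hP
  have hPi : ∀ k₁ k₂ k₃ k₄, Integrable (P k₁ k₂ k₃ k₄) vol := fun k₁ k₂ k₃ k₄ =>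
    integrable_check_four (integrable_slice hai _) (memLp_slice ha _) (integrable_slice hbi _)
      (integrable_slice hci _) (memLp_slice hc _) (integrable_slice hdi _) ρ
  have e1 : ∀ z, ρ z.1 ^ 2 * (check a z * check c z) * starRingEnd ℂ (check b z) *
        starRingEnd ℂ (check (fun q => (m q.1 : ℂ) * d q) z)
      = ∑ k₁ ∈ J, ∑ k₂ ∈ J, ∑ k₃ ∈ J, ∑ k₄ ∈ J, (m k₄ : ℂ) * P k₁ k₂ k₃ k₄ z := by
    intro z
    rw [check_eq_sum_slice ha han, check_eq_sum_slice hb hbn, check_eq_sum_slice hc hcn,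
      check_weight_eq_sum_slice hd hdn, map_sum, map_sum]
    simp only [map_mul, Complex.conj_ofReal]
    rw [mul_sum_four]
    refine Finset.sum_congr rfl fun k₁ _ => Finset.sum_congr rfl fun k₂ _ =>
      Finset.sum_congr rfl fun k₃ _ => Finset.sum_congr rfl fun k₄ _ => ?_
    simp only [hP, map_mul]; ring
  have e2 : ∫ z, ρ z.1 ^ 2 * (check a z * check c z) * starRingEnd ℂ (check b z) *
        starRingEnd ℂ (check (fun q => (m q.1 : ℂ) * d q) z) ∂vol
      = ∑ k₁ ∈ J, ∑ k₂ ∈ J, ∑ k₃ ∈ J, ∑ k₄ ∈ J, (m k₄ : ℂ) * ∫ z, P k₁ k₂ k₃ k₄ z ∂vol := by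
    simp_rw [e1]
    have hi : ∀ k₁ k₂ k₃ k₄, Integrable (fun z => (m k₄ : ℂ) * P k₁ k₂ k₃ k₄ z) vol :=
      fun k₁ k₂ k₃ k₄ => (hPi k₁ k₂ k₃ k₄).const_mul _
    rw [integral_finsetSum _ fun _ _ => integrable_finsetSum _ fun _ _ =>
      integrable_finsetSum _ fun _ _ => integrable_finsetSum _ fun _ _ => hi _ _ _ _]
    refine Finset.sum_congr rfl fun _ _ => ?_
    rw [integral_finsetSum _ fun _ _ => integrable_finsetSum _ fun _ _ =>
      integrable_finsetSum _ fun _ _ => hi _ _ _ _]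
    refine Finset.sum_congr rfl fun _ _ => ?_
    rw [integral_finsetSum _ fun _ _ => integrable_finsetSum _ fun _ _ => hi _ _ _ _]
    refine Finset.sum_congr rfl fun _ _ => ?_
    rw [integral_finsetSum _ fun _ _ => hi _ _ _ _]
    exact Finset.sum_congr rfl fun _ _ => integral_const_mul _ _
  set fa : ℤ × ℝ → ℝ≥0∞ := fun q => ‖a q‖ₑ with hfa
  set fb : ℤ × ℝ → ℝ≥0∞ := fun q => ‖b q‖ₑ with hfb
  set fc : ℤ × ℝ → ℝ≥0∞ := fun q => ‖c q‖ₑ with hfc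
  set fd : ℤ × ℝ → ℝ≥0∞ := fun q => ‖d q‖ₑ with hfd
  set ga : ℤ × ℝ → ℝ≥0∞ := fun q => ‖tmul ρ a q‖ₑ with hga
  set gb : ℤ × ℝ → ℝ≥0∞ := fun q => ‖tmul ρ b q‖ₑ with hgb
  set gc : ℤ × ℝ → ℝ≥0∞ := fun q => ‖tmul ρ c q‖ₑ with hgc
  have mfa : AEMeasurable fa nu := ha.1.enorm
  have mfb : AEMeasurable fb nu := hb.1.enorm
  have mfc : AEMeasurable fc nu := hc.1.enorm
  have mfd : AEMeasurable fd nu := hd.1.enorm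
  have mga : AEMeasurable ga nu := (memLp_tmul ρ ha).1.enorm
  have mgb : AEMeasurable gb nu := (memLp_tmul ρ hb).1.enorm
  have mgc : AEMeasurable gc nu := (memLp_tmul ρ hc).1.enorm
  set c₀ := ENNReal.ofReal (2 * Real.pi) with hc₀
  have hterm : ∀ k₁ k₂ k₃ k₄, ‖(m k₄ : ℂ) * ∫ z, P k₁ k₂ k₃ k₄ z ∂vol‖ₑ ≤ c₀ * A *
      (quad (slice k₁ (wmul m fa)) (slice k₂ gb) (slice k₃ gc) (slice k₄ fd)
        + quad (slice k₁ ga) (slice k₂ (wmul m fb)) (slice k₃ gc) (slice k₄ fd)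
        + quad (slice k₁ ga) (slice k₂ gb) (slice k₃ (wmul m fc)) (slice k₄ fd)) := by
    intro k₁ k₂ k₃ k₄
    obtain ⟨h1, h2, h3⟩ := enorm_integral_check_time_le (integrable_slice hai k₁) (memLp_slice ha k₁)
      (integrable_slice hbi k₂) (integrable_slice hci k₃) (memLp_slice hc k₃)
      (integrable_slice hdi k₄) hρ
    simp only [tmul_slice, enorm_slice] at h1 h2 h3
    change _ ≤ c₀ * quad (slice k₁ fa) (slice k₂ gb) (slice k₃ gc) (slice k₄ fd) at h1
    change _ ≤ c₀ * quad (slice k₁ ga) (slice k₂ fb) (slice k₃ gc) (slice k₄ fd) at h2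
    change _ ≤ c₀ * quad (slice k₁ ga) (slice k₂ gb) (slice k₃ fc) (slice k₄ fd) at h3
    have hm4 : ‖(m k₄ : ℂ)‖ₑ = ENNReal.ofReal (m k₄) := by
      rw [← ofReal_norm, Complex.norm_real, Real.norm_of_nonneg (hm.nonneg _)]
    rw [enorm_mul, hm4]
    by_cases hk : k₁ + k₃ = k₂ + k₄
    · have h4 : ENNReal.ofReal (m k₄) ≤ A * (ENNReal.ofReal (m k₁) + ENNReal.ofReal (m k₂)
          + ENNReal.ofReal (m k₃)) := by
        have := hm.le k₁ k₂ k₃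
        rw [show k₁ - k₂ + k₃ = k₄ by omega] at this
        refine (ENNReal.ofReal_le_ofReal this).trans_eq ?_
        rw [ENNReal.ofReal_mul A.coe_nonneg, ENNReal.ofReal_add (add_nonneg (hm.nonneg _) (hm.nonneg _))
          (hm.nonneg _), ENNReal.ofReal_add (hm.nonneg _) (hm.nonneg _)]
        congr 1; exact ENNReal.ofReal_coe_nnreal
      rw [quad_wmul₁, quad_wmul₂, quad_wmul₃]
      calc _ ≤ A * (ENNReal.ofReal (m k₁) + ENNReal.ofReal (m k₂) + ENNReal.ofReal (m k₃)) *
            ‖∫ z, P k₁ k₂ k₃ k₄ z ∂vol‖ₑ := mul_le_mul' h4 le_rfl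
        _ = A * (ENNReal.ofReal (m k₁) * ‖∫ z, P k₁ k₂ k₃ k₄ z ∂vol‖ₑ
            + ENNReal.ofReal (m k₂) * ‖∫ z, P k₁ k₂ k₃ k₄ z ∂vol‖ₑ
            + ENNReal.ofReal (m k₃) * ‖∫ z, P k₁ k₂ k₃ k₄ z ∂vol‖ₑ) := by ring
        _ ≤ A * (ENNReal.ofReal (m k₁) * _ + ENNReal.ofReal (m k₂) * _
            + ENNReal.ofReal (m k₃) * _) := by
          refine mul_le_mul' le_rfl (add_le_add (add_le_add (mul_le_mul' le_rfl h1)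
            (mul_le_mul' le_rfl h2)) (mul_le_mul' le_rfl h3))
        _ = _ := by ring
    · rw [quad_slice_eq_zero hk, mul_zero] at h1
      rw [nonpos_iff_eq_zero.1 h1, mul_zero]
      exact bot_le
  have hXN1 : ∀ w : ℤ × ℝ → ℂ, ∫⁻ q, (ENNReal.ofReal (wt β q) * ‖w q‖ₑ) ^ 2 ∂nu = XN β 1 w ^ 2 :=
    lintegral_weight_sq β
  have hXNm := lintegral_weight_mul_sq β hm.nonneg
  rw [e2]
  calc _ ≤ ∑ k₁ ∈ J, ∑ k₂ ∈ J, ∑ k₃ ∈ J, ∑ k₄ ∈ J, c₀ * A *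
      (quad (slice k₁ (wmul m fa)) (slice k₂ gb) (slice k₃ gc) (slice k₄ fd)
        + quad (slice k₁ ga) (slice k₂ (wmul m fb)) (slice k₃ gc) (slice k₄ fd)
        + quad (slice k₁ ga) (slice k₂ gb) (slice k₃ (wmul m fc)) (slice k₄ fd)) := by
        refine (enorm_sum_le _ _).trans (Finset.sum_le_sum fun k₁ _ => ?_)
        refine (enorm_sum_le _ _).trans (Finset.sum_le_sum fun k₂ _ => ?_)
        refine (enorm_sum_le _ _).trans (Finset.sum_le_sum fun k₃ _ => ?_)
        exact (enorm_sum_le _ _).trans (Finset.sum_le_sum fun k₄ _ => hterm k₁ k₂ k₃ k₄)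
    _ ≤ c₀ * A * (quad (wmul m fa) gb gc fd + quad ga (wmul m fb) gc fd
        + quad ga gb (wmul m fc) fd) := by
        simp only [← Finset.mul_sum, Finset.sum_add_distrib]
        gcongr
        · exact sum_quad_slice_le (AEMeasurable.wmul mfa m) mgb mgc mfd J
        · exact sum_quad_slice_le mga (AEMeasurable.wmul mfb m) mgc mfd J
        · exact sum_quad_slice_le mga mgb (AEMeasurable.wmul mfc m) mfd J
    _ ≤ c₀ * A * (C * (XN β m a * XN β 1 (tmul ρ b) * XN β 1 (tmul ρ c) * XN β 1 d)
        + C * (XN β 1 (tmul ρ a) * XN β m b * XN β 1 (tmul ρ c) * XN β 1 d)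
        + C * (XN β 1 (tmul ρ a) * XN β 1 (tmul ρ b) * XN β m c * XN β 1 d)) := by
        gcongr
        · exact hC.quad_le (AEMeasurable.wmul mfa m) mgb mgc mfd (hXNm a) (hXN1 _) (hXN1 _) (hXN1 _)
        · exact hC.quad_le mga (AEMeasurable.wmul mfb m) mgc mfd (hXN1 _) (hXNm b) (hXN1 _) (hXN1 _)
        · exact hC.quad_le mga mgb (AEMeasurable.wmul mfc m) mfd (hXN1 _) (hXN1 _) (hXNm c) (hXN1 _)
    _ = _ := by rw [triBound]; ring

theorem tendsto_eLpNorm_mul {α : Type*} [MeasurableSpace α] {μ : Measure α} (p q r : ℝ≥0∞)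
    [ENNReal.HolderTriple p q r] (hr : 1 ≤ r) {f g : α → ℂ} {fn gn : ℕ → α → ℂ} (hf : MemLp f p μ)
    (hg : MemLp g q μ) (hfn : ∀ n, AEStronglyMeasurable (fn n) μ)
    (hgn : ∀ n, AEStronglyMeasurable (gn n) μ)
    (h1 : Tendsto (fun n => eLpNorm (f - fn n) p μ) atTop (𝓝 0))
    (h2 : Tendsto (fun n => eLpNorm (g - gn n) q μ) atTop (𝓝 0)) :
    Tendsto (fun n => eLpNorm ((fun x => f x * g x) - fun x => fn n x * gn n x) r μ) atTop
      (𝓝 0) := by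
  have h3 : Tendsto (fun n => eLpNorm f p μ * eLpNorm (g - gn n) q μ
      + eLpNorm (f - fn n) p μ * eLpNorm g q μ
      + eLpNorm (f - fn n) p μ * eLpNorm (g - gn n) q μ) atTop (𝓝 0) := by
    have a1 := ENNReal.Tendsto.const_mul (a := eLpNorm f p μ) h2 (Or.inr hf.2.ne)
    have a2 := ENNReal.Tendsto.mul_const (b := eLpNorm g q μ) h1 (Or.inr hg.2.ne)
    have a3 := ENNReal.Tendsto.mul h1 (Or.inr (by simp)) h2 (Or.inr (by simp))
    simpa using (a1.add a2).add a3
  refine tendsto_of_tendsto_of_tendsto_of_le_of_le tendsto_const_nhds h3 (fun _ => bot_le)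
    fun n => ?_
  have e : ((fun x => f x * g x) - fun x => fn n x * gn n x)
      = (fun x => f x * (g - gn n) x) + (fun x => (f - fn n) x * g x)
        - fun x => (f - fn n) x * (g - gn n) x := by
    ext x; simp only [Pi.sub_apply, Pi.add_apply]; ring
  have m1 := hf.1.sub (hfn n)
  have m2 := hg.1.sub (hgn n)
  simp only
  rw [e]
  refine (eLpNorm_sub_le ((hf.1.mul m2).add (m1.mul hg.1)) (m1.mul m2) hr).trans ?_
  refine add_le_add ((eLpNorm_add_le (hf.1.mul m2) (m1.mul hg.1) hr).trans (add_le_add ?_ ?_)) ?_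
  · exact eLpNorm_mul_le p q r hf.1 m2
  · exact eLpNorm_mul_le p q r m1 hg.1
  · exact eLpNorm_mul_le p q r m1 m2

theorem IsStrichartzConst.memLp_four (hC : IsStrichartzConst β C)
    {z : ℝ × Torus → ℂ} {w : ℤ × ℝ → ℂ} (h : FT z w) (hX : XN β 1 w ≠ ⊤) : MemLp z 4 vol :=
  ⟨h.memLp_left.1, (hC.strichartz h).trans_lt (ENNReal.mul_lt_top hC.ne_top.lt_top hX.lt_top)⟩

theorem IsStrichartzConst.tendsto_check_trunc_four (hC : IsStrichartzConst β C)
    {z : ℝ × Torus → ℂ} {w : ℤ × ℝ → ℂ} (h : FT z w) (hX : XN β 1 w ≠ ⊤) :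
    Tendsto (fun n => eLpNorm (z - check (trunc n w)) 4 vol) atTop (𝓝 0) :=
  tendsto_zero_of_le_mul hC.ne_top
    (fun n => hC.strichartz (h.sub (FT_check_trunc h.memLp_right n)))
    (tendsto_XN_trunc h.memLp_right.1 hX)

theorem trunc_trunc_of_le {n N : ℕ} (h : n ≤ N) (w : ℤ × ℝ → ℂ) :
    trunc N (trunc n w) = trunc n w := by
  have hs : box n ⊆ box N := by
    have h1 : (n : ℤ) ≤ N := by exact_mod_cast h
    have h2 : (n : ℝ) ≤ N := by exact_mod_cast h
    exact Set.prod_mono (Icc_subset_Icc (by linarith) h1) (Icc_subset_Icc (by linarith) h2)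
  rw [trunc, trunc, Set.indicator_indicator, Set.inter_eq_self_of_subset_right hs]

/-- The cubic expression `ρ(t)² z₁ z̄₂ z₃`. -/
def tri (ρ : 𝓢(ℝ, ℂ)) (z₁ z₂ z₃ : ℝ × Torus → ℂ) (x : ℝ × Torus) : ℂ :=
  ρ x.1 ^ 2 * ((z₁ x * z₃ x) * starRingEnd ℂ (z₂ x))

theorem memLp_conj {z : ℝ × Torus → ℂ} {p : ℝ≥0∞} (hz : MemLp z p vol) :
    MemLp (fun x => starRingEnd ℂ (z x)) p vol :=
  hz.mono (Complex.continuous_conj.comp_aestronglyMeasurable hz.1)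
    (ae_of_all _ fun _ => (RCLike.norm_conj _).le)

theorem memLp_mul {z z' : ℝ × Torus → ℂ} (p q r : ℝ≥0∞) [ENNReal.HolderTriple p q r]
    (hz : MemLp z p vol) (hz' : MemLp z' q vol) : MemLp (fun x => z x * z' x) r vol :=
  ⟨hz.1.mul hz'.1, (eLpNorm_mul_le p q r hz.1 hz'.1).trans_lt (ENNReal.mul_lt_top hz.2 hz'.2)⟩

theorem memLp_sq_time_mul (ρ : 𝓢(ℝ, ℂ)) {z : ℝ × Torus → ℂ} {p : ℝ≥0∞} (hz : MemLp z p vol) :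
    MemLp (fun x => ρ x.1 ^ 2 * z x) p vol := by
  have := memLp_time_mul ρ (memLp_time_mul ρ hz)
  simpa only [← mul_assoc, ← sq] using this

theorem integrable_tri (ρ : 𝓢(ℝ, ℂ)) {z₁ z₂ z₃ : ℝ × Torus → ℂ} (h₁ : MemLp z₁ 4 vol)
    (h₂ : MemLp z₂ 2 vol) (h₃ : MemLp z₃ 4 vol) : Integrable (tri ρ z₁ z₂ z₃) vol :=
  memLp_one_iff_integrable.1
    (memLp_sq_time_mul ρ (memLp_mul 2 2 1 (memLp_mul 4 4 2 h₁ h₃) (memLp_conj h₂)))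

theorem tendsto_XN_tmul_trunc {β : ℝ} (hβ0 : 0 ≤ β) (hβ : β ≤ 2) {ρ : 𝓢(ℝ, ℂ)} {w : ℤ × ℝ → ℂ}
    (hw : MemLp w 2 nu) (hX : XN β 1 w ≠ ⊤) :
    ∃ b : ℕ → ℝ≥0∞, (∀ n, XN β 1 (tmul ρ (trunc n w)) ≤ b n) ∧
      Tendsto b atTop (𝓝 (XN β 1 (tmul ρ w))) := by
  refine ⟨fun n => XN β 1 (tmul ρ w) + multConst β ρ * XN β 1 (w - trunc n w), fun n => ?_, ?_⟩
  · have e : tmul ρ (trunc n w) = tmul ρ w - tmul ρ (w - trunc n w) := by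
      rw [tmul_sub ρ hw (memLp_trunc hw n)]; abel
    have hm := hw.1.sub (memLp_trunc hw n).1
    rw [e]
    exact (XN_sub_le (aestronglyMeasurable_tmul ρ hw.1) (aestronglyMeasurable_tmul ρ hm)).trans
      (add_le_add le_rfl (XN_tmul_le hβ0 1 ρ hm))
  · have := ENNReal.Tendsto.const_mul (a := multConst β ρ) (tendsto_XN_trunc hw.1 hX)
      (Or.inr (multConst_ne_top hβ ρ))
    simpa using this.const_add (XN β 1 (tmul ρ w))

/-- The trilinear estimate. -/
theorem IsExponent.XN_tri_le (hC : IsExponent β C) {A : ℝ≥0}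
    {m : ℤ → ℝ} (hm : IsWeight A m) {ρ : 𝓢(ℝ, ℂ)} (hρ : ∀ t, starRingEnd ℂ (ρ t) = ρ t)
    {z₁ z₂ z₃ : ℝ × Torus → ℂ} {w₁ w₂ w₃ : ℤ × ℝ → ℂ} (h₁ : FT z₁ w₁) (h₂ : FT z₂ w₂)
    (h₃ : FT z₃ w₃) (hX₁ : XN β 1 w₁ ≠ ⊤) (hX₂ : XN β 1 w₂ ≠ ⊤) (hX₃ : XN β 1 w₃ ≠ ⊤)
    (hm₁ : XN β m w₁ ≠ ⊤) (hm₂ : XN β m w₂ ≠ ⊤) (hm₃ : XN β m w₃ ≠ ⊤) :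
    XN (-β) m (hat (tri ρ z₁ z₂ z₃))
      ≤ ENNReal.ofReal (2 * Real.pi) * A * C * triBound β m ρ w₁ w₂ w₃ := by
  have hβ0 : 0 ≤ β := by linarith [hC.five_lt]
  have hβ2 : β ≤ 2 := by linarith [hC.lt_half]
  have hS := hC.toIsStrichartzConst
  have h4₁ := hS.memLp_four h₁ hX₁
  have h4₂ := hS.memLp_four h₂ hX₂
  have h4₃ := hS.memLp_four h₃ hX₃
  have hi := integrable_tri ρ h4₁ h₂.memLp_left h4₃
  refine XN_neg_le_of_pairing (measurable_hat hi) (norm_hat_le hi) fun N ψ hψ hψN hψX => ?_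
  have hψi := integrable_of_trunc_eq hψ hψN
  -- the weighted test function
  set φ : ℤ × ℝ → ℂ := fun q => (m q.1 : ℂ) * ψ q with hφ
  have hφi : Integrable φ nu := by
    have e : φ = ∑ k ∈ Finset.Icc (-N : ℤ) N, fun q => (m k : ℂ) * slice k ψ q := by
      ext q
      rw [hφ]
      conv_lhs => rw [sum_slice_eq hψN]
      simp only [Finset.sum_apply, Finset.mul_sum]
      refine Finset.sum_congr rfl fun k _ => ?_
      simp only [slice]; split_ifs with h <;> simp [h]
    rw [e]
    exact integrable_finsetSum' _ fun k _ => (integrable_slice hψi k).const_mul _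
  rw [integral_hat_mul_conj hi hφi, enorm_mul]
  have e1 : ‖(((2 * Real.pi)⁻¹ : ℝ) : ℂ)‖ₑ ≤ 1 := by
    rw [← ofReal_norm, Complex.norm_real, Real.norm_of_nonneg (by positivity),
      ENNReal.ofReal_le_one]
    exact inv_le_one_of_one_le₀ (by nlinarith [Real.pi_gt_three])
  refine (mul_le_mul' e1 le_rfl).trans ?_
  rw [one_mul]
  set a : ℕ → ℤ × ℝ → ℂ := fun n => trunc n w₁
  set b : ℕ → ℤ × ℝ → ℂ := fun n => trunc n w₂
  set c : ℕ → ℤ × ℝ → ℂ := fun n => trunc n w₃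
  have hca : ∀ n, MemLp (check (a n)) 4 vol := fun n =>
    hS.memLp_four (FT_check_trunc h₁.memLp_right n) (ne_top_of_le_ne_top hX₁ (XN_trunc_le _ _ _ _))
  have hcc : ∀ n, MemLp (check (c n)) 4 vol := fun n =>
    hS.memLp_four (FT_check_trunc h₃.memLp_right n) (ne_top_of_le_ne_top hX₃ (XN_trunc_le _ _ _ _))
  have hcb : ∀ n, MemLp (check (b n)) 2 vol := fun n => (FT_check_trunc h₂.memLp_right n).memLp_left
  have hin : ∀ n, Integrable (tri ρ (check (a n)) (check (b n)) (check (c n))) vol := fun n =>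
    integrable_tri ρ (hca n) (hcb n) (hcc n)
  -- convergence of the approximations
  have hconv : Tendsto (fun n => eLpNorm (tri ρ z₁ z₂ z₃
      - tri ρ (check (a n)) (check (b n)) (check (c n))) 1 vol) atTop (𝓝 0) := by
    have t1 := tendsto_eLpNorm_mul 4 4 2 (by norm_num) h4₁ h4₃ (fun n => (hca n).1)
      (fun n => (hcc n).1) (hS.tendsto_check_trunc_four h₁ hX₁) (hS.tendsto_check_trunc_four h₃ hX₃)
    have t2 : Tendsto (fun n => eLpNorm ((fun x => starRingEnd ℂ (z₂ x))
        - fun x => starRingEnd ℂ (check (b n) x)) 2 vol) atTop (𝓝 0) := by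
      refine h₂.tendsto_check_trunc.congr fun n => ?_
      refine eLpNorm_congr_norm_ae (ae_of_all _ fun x => ?_)
      rw [Pi.sub_apply, Pi.sub_apply, ← map_sub, RCLike.norm_conj]
    have t3 := tendsto_eLpNorm_mul 2 2 1 le_rfl (memLp_mul 4 4 2 h4₁ h4₃) (memLp_conj h₂.memLp_left)
      (fun n => (memLp_mul 4 4 2 (hca n) (hcc n)).1) (fun n => (memLp_conj (hcb n)).1) t1 t2
    obtain ⟨D, hD, hle⟩ := eLpNorm_time_mul_le ρ
    refine tendsto_zero_of_le_mul (ENNReal.mul_ne_top hD hD) (fun n => ?_) t3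
    rw [mul_assoc]
    refine le_trans (le_of_eq ?_) ((hle _ _).trans (mul_le_mul' le_rfl (hle _ _)))
    congr 1; ext x; simp only [tri, Pi.sub_apply]; ring
  have hφb : ∀ z, ‖check φ z‖ ≤ ∫ q, ‖φ q‖ ∂nu := norm_check_le φ
  have hφm : AEStronglyMeasurable (fun z => starRingEnd ℂ (check φ z)) vol :=
    (Complex.continuous_conj.comp (continuous_check hφi)).aestronglyMeasurable
  have hφb' : ∀ᵐ z ∂vol, ‖starRingEnd ℂ (check φ z)‖ ≤ ∫ q, ‖φ q‖ ∂nu :=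
    ae_of_all _ fun z => (RCLike.norm_conj _).trans_le (hφb z)
  have hlim : Tendsto (fun n => ‖∫ z, tri ρ (check (a n)) (check (b n)) (check (c n)) z *
      starRingEnd ℂ (check φ z) ∂vol‖ₑ) atTop
      (𝓝 ‖∫ z, tri ρ z₁ z₂ z₃ z * starRingEnd ℂ (check φ z) ∂vol‖ₑ) := by
    refine (continuous_enorm.tendsto _).comp ?_
    rw [tendsto_iff_edist_tendsto_0]
    refine tendsto_zero_of_le_mul (D := ENNReal.ofReal (∫ q, ‖φ q‖ ∂nu)) ENNReal.ofReal_ne_top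
      (fun n => ?_) hconv
    rw [edist_comm, edist_eq_enorm_sub, ← integral_sub (hi.mul_bdd hφm hφb')
      ((hin n).mul_bdd hφm hφb'), eLpNorm_one_eq_lintegral_enorm,
      ← lintegral_const_mul' _ _ ENNReal.ofReal_ne_top]
    refine (enorm_integral_le_lintegral_enorm _).trans (lintegral_mono fun z => ?_)
    simp only
    rw [← sub_mul, enorm_mul, mul_comm, ← ofReal_norm (starRingEnd ℂ (check φ z)), RCLike.norm_conj]
    exact mul_le_mul' (ENNReal.ofReal_le_ofReal (hφb z)) le_rfl
  obtain ⟨b₁, hb₁, hl₁⟩ := tendsto_XN_tmul_trunc hβ0 hβ2 (ρ := ρ) h₁.memLp_right hX₁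
  obtain ⟨b₂, hb₂, hl₂⟩ := tendsto_XN_tmul_trunc hβ0 hβ2 (ρ := ρ) h₂.memLp_right hX₂
  obtain ⟨b₃, hb₃, hl₃⟩ := tendsto_XN_tmul_trunc hβ0 hβ2 (ρ := ρ) h₃.memLp_right hX₃
  have hV : ∀ {w : ℤ × ℝ → ℂ}, MemLp w 2 nu → XN β 1 w ≠ ⊤ → XN β 1 (tmul ρ w) ≠ ⊤ := fun hw hX =>
    ne_top_of_le_ne_top (ENNReal.mul_ne_top (multConst_ne_top hβ2 ρ) hX) (XN_tmul_le hβ0 1 ρ hw.1)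
  have hV₁ := hV h₁.memLp_right hX₁
  have hV₂ := hV h₂.memLp_right hX₂
  have hV₃ := hV h₃.memLp_right hX₃
  set K := ENNReal.ofReal (2 * Real.pi) * A * C with hK
  have hKt : K ≠ ⊤ := ENNReal.mul_ne_top (ENNReal.mul_ne_top ENNReal.ofReal_ne_top (by simp)) hC.ne_top
  have hlim2 : Tendsto (fun n => K * (XN β m w₁ * b₂ n * b₃ n + b₁ n * XN β m w₂ * b₃ n
      + b₁ n * b₂ n * XN β m w₃) * XN β 1 ψ) atTop (𝓝 (K * triBound β m ρ w₁ w₂ w₃ * XN β 1 ψ)) := by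
    have cm : ∀ {x y : ℕ → ℝ≥0∞} {x₀ y₀ : ℝ≥0∞}, Tendsto x atTop (𝓝 x₀) → Tendsto y atTop (𝓝 y₀) →
        x₀ ≠ ⊤ → y₀ ≠ ⊤ → Tendsto (fun n => x n * y n) atTop (𝓝 (x₀ * y₀)) :=
      fun hx hy h0 h0' => ENNReal.Tendsto.mul hx (Or.inr h0') hy (Or.inr h0)
    have k1 : Tendsto (fun _ : ℕ => XN β m w₁) atTop (𝓝 (XN β m w₁)) := tendsto_const_nhds
    have k2 : Tendsto (fun _ : ℕ => XN β m w₂) atTop (𝓝 (XN β m w₂)) := tendsto_const_nhds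
    have k3 : Tendsto (fun _ : ℕ => XN β m w₃) atTop (𝓝 (XN β m w₃)) := tendsto_const_nhds
    refine ENNReal.Tendsto.mul_const (ENNReal.Tendsto.const_mul (((?_ : Tendsto _ _ _).add ?_).add ?_)
      (Or.inr hKt)) (Or.inr hψX)
    · exact cm (cm k1 hl₂ hm₁ hV₂) hl₃ (ENNReal.mul_ne_top hm₁ hV₂) hV₃
    · exact cm (cm hl₁ k2 hV₁ hm₂) hl₃ (ENNReal.mul_ne_top hV₁ hm₂) hV₃
    · exact cm (cm hl₁ hl₂ hV₁ hV₂) k3 (ENNReal.mul_ne_top hV₁ hV₂) hm₃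
  refine le_of_tendsto_of_tendsto' (b := atTop) hlim hlim2 fun n => ?_
  have hp := hS.pairing_le hm hρ (n := max n N) (a := a n) (b := b n) (c := c n) (d := ψ)
    (memLp_trunc h₁.memLp_right n) ?_ (memLp_trunc h₂.memLp_right n) ?_
    (memLp_trunc h₃.memLp_right n) ?_ hψ ?_
  · have e2 : ∀ z, tri ρ (check (a n)) (check (b n)) (check (c n)) z * starRingEnd ℂ (check φ z)
        = ρ z.1 ^ 2 * (check (a n) z * check (c n) z) * starRingEnd ℂ (check (b n) z) *
          starRingEnd ℂ (check (fun q => (m q.1 : ℂ) * ψ q) z) := fun z => by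
      simp only [tri, hφ]; ring
    simp_rw [e2]
    refine hp.trans ?_
    rw [triBound]
    gcongr
    · exact XN_trunc_le _ _ _ _
    · exact hb₂ n
    · exact hb₃ n
    · exact hb₁ n
    · exact XN_trunc_le _ _ _ _
    · exact hb₃ n
    · exact hb₁ n
    · exact hb₂ n
    · exact XN_trunc_le _ _ _ _
  · exact trunc_trunc_of_le (le_max_left n N) _
  · exact trunc_trunc_of_le (le_max_left n N) _
  · exact trunc_trunc_of_le (le_max_left n N) _
  · rw [← hψN]
    exact trunc_trunc_of_le (le_max_right n N) _

/-! ### Fourier coefficients of smooth functions -/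

/-- The derivative `f⁽ⁿ⁾` on the torus. -/
def tderiv (n : ℕ) (f : Torus → ℂ) (x : Torus) : ℂ :=
  iteratedDeriv n (fun y : ℝ => f (x + (y : Torus))) 0

theorem tderiv_coe (n : ℕ) (f : Torus → ℂ) (x : ℝ) :
    tderiv n f (x : Torus) = iteratedDeriv n (fun y : ℝ => f (y : Torus)) x := by
  have h := congrFun (iteratedDeriv_comp_const_add n (fun y : ℝ => f (y : Torus)) x) 0
  simp only [add_zero] at h
  rw [tderiv, ← h]
  congr 1

theorem tderiv_zero (f : Torus → ℂ) : tderiv 0 f = f := by ext x; simp [tderiv]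

theorem hasDerivAt_tderiv {f : Torus → ℂ} (hf : ContDiff ℝ (⊤ : ℕ∞) fun x : ℝ => f (x : Torus)) (n : ℕ)
    (x : ℝ) : HasDerivAt (fun y : ℝ => tderiv n f (y : Torus)) (tderiv (n + 1) f (x : Torus)) x := by
  simp_rw [tderiv_coe]
  rw [iteratedDeriv_succ]
  exact ((hf.differentiable_iteratedDeriv n (by exact_mod_cast WithTop.coe_lt_top _)) x).hasDerivAt

theorem continuous_tderiv_coe {f : Torus → ℂ} (hf : ContDiff ℝ (⊤ : ℕ∞) fun x : ℝ => f (x : Torus)) (n : ℕ) :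
    Continuous fun y : ℝ => tderiv n f (y : Torus) :=
  continuous_iff_continuousAt.2 fun x => (hasDerivAt_tderiv hf n x).continuousAt

theorem continuous_tderiv {f : Torus → ℂ} (hf : ContDiff ℝ (⊤ : ℕ∞) fun x : ℝ => f (x : Torus)) (n : ℕ) :
    Continuous (tderiv n f) :=
  (QuotientAddGroup.isQuotientMap_mk (N := AddSubgroup.zmultiples (2 * Real.pi))).continuous_iff.2
    (continuous_tderiv_coe hf n)

theorem integral_fourier_mul_tderiv_succ {f : Torus → ℂ}
    (hf : ContDiff ℝ (⊤ : ℕ∞) fun x : ℝ => f (x : Torus)) (n : ℕ) (k : ℤ) :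
    ∫ x : Torus, fourier k x * tderiv (n + 1) f x
      = -(Complex.I * k) * ∫ x : Torus, fourier k x * tderiv n f x := by
  rw [← AddCircle.intervalIntegral_preimage (2 * Real.pi) 0,
    ← AddCircle.intervalIntegral_preimage (2 * Real.pi) 0, zero_add]
  have hd : ∀ x : ℝ, HasDerivAt (fun y : ℝ => fourier k (y : Torus))
      (Complex.I * k * fourier k (x : Torus)) x := fun x => by
    have h := hasDerivAt_fourier (2 * Real.pi) k x
    convert h using 1
    push_cast
    field_simp
  have hc : Continuous fun y : ℝ => (fourier k (y : Torus) : ℂ) :=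
    continuous_iff_continuousAt.2 fun x => (hd x).continuousAt
  have h := intervalIntegral.integral_mul_deriv_eq_deriv_mul (a := 0) (b := 2 * Real.pi)
    (fun x _ => hd x) (fun x _ => hasDerivAt_tderiv hf n x)
    ((continuous_const.mul hc).intervalIntegrable _ _)
    ((continuous_tderiv_coe hf (n + 1)).intervalIntegrable _ _)
  rw [h]
  have hp : ((2 * Real.pi : ℝ) : Torus) = ((0 : ℝ) : Torus) := AddCircle.coe_period _
  rw [hp, sub_self, zero_sub, neg_mul, ← intervalIntegral.integral_const_mul]
  congr 2; ext x; ring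

theorem integral_fourier_mul_tderiv {f : Torus → ℂ}
    (hf : ContDiff ℝ (⊤ : ℕ∞) fun x : ℝ => f (x : Torus)) (n : ℕ) (k : ℤ) :
    ∫ x : Torus, fourier k x * tderiv n f x
      = (-(Complex.I * k)) ^ n * ∫ x : Torus, fourier k x * f x := by
  induction n with
  | zero => rw [tderiv_zero, pow_zero, one_mul]
  | succ n ih => rw [integral_fourier_mul_tderiv_succ hf, ih, pow_succ']; ring

theorem pow_mul_norm_fourierCoeff_le {f : Torus → ℂ}
    (hf : ContDiff ℝ (⊤ : ℕ∞) fun x : ℝ => f (x : Torus)) (n : ℕ) {C : ℝ} (hC : ∀ x, ‖tderiv n f x‖ ≤ C)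
    (k : ℤ) : |(k : ℝ)| ^ n * ‖fourierCoeff f k‖ ≤ C := by
  have h1 := integral_fourier_mul_tderiv hf n (-k)
  have h2 : ‖∫ x : Torus, fourier (-k) x * tderiv n f x‖ ≤ C * (2 * Real.pi) := by
    refine (norm_integral_le_of_norm_le_const (C := C) (ae_of_all _ fun x => ?_)).trans_eq ?_
    · rw [norm_mul, fourier_apply, Circle.norm_coe, one_mul]; exact hC x
    · simp [Measure.real, AddCircle.measure_univ, Real.pi_pos.le]
  have h3 : |(k : ℝ)| ^ n * ‖fourierCoeff f k‖
      = (2 * Real.pi)⁻¹ * ‖∫ x : Torus, fourier (-k) x * tderiv n f x‖ := by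
    rw [h1, fourierCoeff_eq_integral, norm_mul, norm_mul, norm_pow, norm_neg, norm_mul,
      Complex.norm_real]
    simp [abs_of_pos Real.pi_pos]; ring
  rw [h3]
  have hp := Real.pi_pos
  rw [inv_mul_le_iff₀ (by positivity)]
  linarith

theorem exists_norm_tderiv_le {f : Torus → ℂ} (hf : ContDiff ℝ (⊤ : ℕ∞) fun x : ℝ => f (x : Torus)) (n : ℕ) :
    ∃ C, ∀ x, ‖tderiv n f x‖ ≤ C := by
  obtain ⟨C, hC⟩ := (isCompact_range (continuous_tderiv hf n)).isBounded.exists_norm_le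
  exact ⟨C, fun x => hC _ (mem_range_self x)⟩

/-! ### Sobolev weights -/

/-- The weight `⟨k⟩^s`. -/
def jap (s : ℝ) (k : ℤ) : ℝ := (1 + (k : ℝ) ^ 2) ^ (s / 2)

/-- The bounded weight `min (⟨k⟩^s, R)`. -/
def japMin (s : ℝ) (R : ℕ) (k : ℤ) : ℝ := min (jap s k) R

theorem jap_pos (s : ℝ) (k : ℤ) : 0 < jap s k := Real.rpow_pos_of_pos (by positivity) _

theorem one_le_jap {s : ℝ} (hs : 0 ≤ s) (k : ℤ) : 1 ≤ jap s k :=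
  Real.one_le_rpow (by nlinarith [sq_nonneg (k : ℝ)]) (by linarith)

theorem japMin_nonneg (s : ℝ) (R : ℕ) (k : ℤ) : 0 ≤ japMin s R k :=
  le_min (jap_pos s k).le (Nat.cast_nonneg R)

theorem abs_japMin_le_jap (s : ℝ) (R : ℕ) (k : ℤ) : |japMin s R k| ≤ |jap s k| := by
  rw [abs_of_nonneg (japMin_nonneg s R k), abs_of_pos (jap_pos s k)]; exact min_le_left _ _

theorem abs_japMin_le (s : ℝ) (R : ℕ) (k : ℤ) : |japMin s R k| ≤ R := by
  rw [abs_of_nonneg (japMin_nonneg s R k)]; exact min_le_right _ _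

theorem min_le_mul_min {x y r c : ℝ} (hc : 1 ≤ c) (hr : 0 ≤ r) (h : x ≤ c * y) :
    min x r ≤ c * min y r := by
  rcases le_total y r with h1 | h1
  · rw [min_eq_left h1]; exact (min_le_left _ _).trans h
  · rw [min_eq_right h1]; exact (min_le_right _ _).trans (le_mul_of_one_le_left hr hc)

theorem japMin_add_le {s : ℝ} (hs : 0 ≤ s) (R : ℕ) (j k : ℤ) :
    japMin s R (j + k) ≤ 2 ^ (s / 2) * jap s j * japMin s R k := by
  refine min_le_mul_min ?_ (Nat.cast_nonneg R) ?_
  · exact one_le_mul_of_one_le_of_one_le (Real.one_le_rpow (by norm_num) (by linarith))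
      (one_le_jap hs j)
  · rw [jap, jap, jap, ← Real.mul_rpow (by norm_num) (by positivity),
      ← Real.mul_rpow (by positivity) (by positivity)]
    refine Real.rpow_le_rpow (by positivity) ?_ (by linarith)
    push_cast
    nlinarith [sq_nonneg ((j : ℝ) - k), sq_nonneg ((j : ℝ) * k), sq_nonneg (j : ℝ), sq_nonneg (k : ℝ)]

theorem exists_isWeight_japMin {s : ℝ} (hs : 0 ≤ s) :
    ∃ A : ℝ≥0, ∀ R, IsWeight A (japMin s R) := by
  refine ⟨⟨9 ^ (s / 2), by positivity⟩, fun R => ⟨japMin_nonneg s R, fun k₁ k₂ k₃ => ?_⟩⟩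
  have hA : (1 : ℝ) ≤ 9 ^ (s / 2) := Real.one_le_rpow (by norm_num) (by linarith)
  have key : ∀ k : ℤ, (1 + ((k₁ - k₂ + k₃ : ℤ) : ℝ) ^ 2) ≤ 9 * (1 + (k : ℝ) ^ 2) →
      japMin s R (k₁ - k₂ + k₃) ≤ 9 ^ (s / 2) * japMin s R k := fun k hk => by
    refine min_le_mul_min hA (Nat.cast_nonneg R) ?_
    rw [jap, jap, ← Real.mul_rpow (by norm_num) (by positivity)]
    exact Real.rpow_le_rpow (by positivity) hk (by linarith)
  have h1 := japMin_nonneg s R k₁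
  have h2 := japMin_nonneg s R k₂
  have h3 := japMin_nonneg s R k₃
  have hle : ∃ k ∈ ({k₁, k₂, k₃} : Set ℤ),
      (1 + ((k₁ - k₂ + k₃ : ℤ) : ℝ) ^ 2) ≤ 9 * (1 + (k : ℝ) ^ 2) := by
    by_contra hcon
    push Not at hcon
    have e1 := hcon k₁ (by simp)
    have e2 := hcon k₂ (by simp)
    have e3 := hcon k₃ (by simp)
    push_cast at e1 e2 e3
    nlinarith [sq_nonneg ((k₁ : ℝ) + k₂), sq_nonneg ((k₁ : ℝ) - k₃), sq_nonneg ((k₂ : ℝ) + k₃)]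
  obtain ⟨k, hk, hk'⟩ := hle
  refine (key k hk').trans (mul_le_mul_of_nonneg_left ?_ (by positivity))
  rcases hk with rfl | rfl | rfl <;> linarith

theorem XN_jap_le {β s : ℝ} {w : ℤ × ℝ → ℂ} (hw : AEStronglyMeasurable w nu) {B : ℝ≥0∞}
    (h : ∀ R, XN β (japMin s R) w ≤ B) : XN β (jap s) w ≤ B := by
  rw [← ENNReal.pow_le_pow_left_iff (n := 2) (by norm_num), XN_sq]
  refine le_of_tendsto' (lintegral_tendsto_of_tendsto_of_monotone (μ := nu)
    (f := fun (R : ℕ) q => (ENNReal.ofReal (|japMin s R q.1| * wt β q) * ‖w q‖ₑ) ^ 2)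
    (fun R => ?_) (ae_of_all _ fun q R R' hR => ?_) (ae_of_all _ fun q => ?_))
    (fun R => ?_)
  · exact (((((measurable_fst_comp _).norm.mul (measurable_wt β)).ennreal_ofReal).aemeasurable.mul
      hw.enorm).pow_const 2)
  · simp only
    gcongr
    · exact (wt_pos β q).le
    · exact japMin_nonneg _ _ _
    · exact min_le_min_left _ (by exact_mod_cast hR)
  · refine tendsto_const_nhds.congr' ?_
    obtain ⟨N, hN⟩ := exists_nat_ge (jap s q.1)
    filter_upwards [eventually_ge_atTop N] with R hR
    rw [japMin, min_eq_left (hN.trans (by exact_mod_cast hR))]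
  · rw [← XN_sq]; exact pow_le_pow_left' (h R) 2

/-! ### Multiplication by functions on the torus -/

/-- Multiplication by `A` is bounded by `K` in the weighted norm. -/
def IsMultiplier (K : ℝ≥0) (m : ℤ → ℝ) (A : Torus → ℂ) : Prop :=
  ∀ f : Torus → ℂ, MemLp f 2 volume →
    l2n m (fourierCoeff fun x => A x * f x) ≤ K * l2n m (fourierCoeff f)

theorem enorm_fourierCoeff_mul_le {A f : Torus → ℂ} (hA : Continuous A)
    (hs : Summable (fourierCoeff A)) (hf : Integrable f) (k : ℤ) :
    ‖fourierCoeff (fun x => A x * f x) k‖ₑ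
      ≤ ∑' j, ‖fourierCoeff A j‖ₑ * ‖fourierCoeff f (k - j)‖ₑ := by
  have h1 : ∀ x, HasSum (fun j => fourierCoeff A j • fourier j x) (A x) :=
    has_pointwise_sum_fourier_series_of_summable (f := ⟨A, hA⟩) hs
  have h2 : HasSum (fun j => ∫ x : Torus, fourierCoeff A j * (fourier (-(k - j)) x * f x))
      (∫ x : Torus, fourier (-k) x * (A x * f x)) := by
    have hint : ∀ l : ℤ, Integrable fun x : Torus => (fourier l x : ℂ) * f x := fun l =>
      hf.bdd_mul (c := 1) (fourier l).continuous.aestronglyMeasurable (ae_of_all _ fun x => by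
        rw [fourier_apply, Circle.norm_coe])
    have h3 := hasSum_integral_of_summable_integral_norm (μ := (volume : Measure Torus))
      (F := fun j x => fourierCoeff A j * (fourier (-(k - j)) x * f x))
      (fun j => (hint _).const_mul _) ?_
    · refine (congrArg (HasSum _) (integral_congr_ae (ae_of_all _ fun x => ?_))).mpr h3
      rw [← (((h1 x).mul_right (f x)).mul_left (fourier (-k) x)).tsum_eq]
      congr 1; ext j
      rw [show -(k - j) = -k + j by ring, fourier_add, smul_eq_mul]; ring
    · have e : ∀ j, ∫ x : Torus, ‖fourierCoeff A j * (fourier (-(k - j)) x * f x)‖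
          = ‖fourierCoeff A j‖ * ∫ x, ‖f x‖ := fun j => by
        rw [← integral_const_mul]; congr 1; ext x
        rw [norm_mul, norm_mul, fourier_apply, Circle.norm_coe, one_mul]
      simp_rw [e]
      exact hs.norm.mul_right _
  have h4 : HasSum (fun j => fourierCoeff A j * fourierCoeff f (k - j))
      (fourierCoeff (fun x => A x * f x) k) := by
    rw [fourierCoeff_eq_integral]
    refine (h2.mul_left _).congr_fun ?_
    intro j
    rw [fourierCoeff_eq_integral f, integral_const_mul]; ring
  rw [← h4.tsum_eq]
  refine enorm_tsum_le_tsum_enorm.trans_eq ?_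
  simp_rw [enorm_mul]

theorem tsum_mul_sq_le {ι : Type*} (f g : ι → ℝ≥0∞) :
    (∑' i, f i * g i) ^ 2 ≤ (∑' i, f i ^ 2) * ∑' i, g i ^ 2 := by
  let _ : MeasurableSpace ι := ⊤
  have h := lintegral_mul_sq_le (μ := Measure.count) (f := f) (g := g)
    measurable_from_top.aemeasurable measurable_from_top.aemeasurable
  rwa [lintegral_count' measurable_from_top, lintegral_count' measurable_from_top,
    lintegral_count' measurable_from_top] at h

/-- Convolution with a sequence that is summable against the submultiplicative weight `p`. -/
theorem tsum_conv_sq_le {m : ℤ → ℝ≥0∞} {p : ℤ → ℝ≥0∞}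
    (hp : ∀ j k, m (j + k) ≤ p j * m k) (a f : ℤ → ℝ≥0∞) :
    ∑' k, (m k * ∑' j, a j * f (k - j)) ^ 2
      ≤ (∑' j, a j * p j) ^ 2 * ∑' k, (m k * f k) ^ 2 := by
  have h1 : ∀ k, (m k * ∑' j, a j * f (k - j)) ^ 2
      ≤ (∑' j, a j * p j) * ∑' j, a j * p j * (m (k - j) * f (k - j)) ^ 2 := fun k => by
    have e : m k * ∑' j, a j * f (k - j) ≤ ∑' j, (a j * p j) ^ (1 / 2 : ℝ) *
        ((a j * p j) ^ (1 / 2 : ℝ) * (m (k - j) * f (k - j))) := by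
      rw [← ENNReal.tsum_mul_left]
      refine ENNReal.tsum_le_tsum fun j => ?_
      have e2 : (a j * p j) ^ (1 / 2 : ℝ) * (a j * p j) ^ (1 / 2 : ℝ) = a j * p j := by
        rw [← ENNReal.rpow_add_of_nonneg _ _ (by norm_num) (by norm_num)]; norm_num
      rw [← mul_assoc (_ ^ (1 / 2 : ℝ)), e2]
      have := hp j (k - j)
      rw [add_sub_cancel] at this
      calc m k * (a j * f (k - j)) ≤ p j * m (k - j) * (a j * f (k - j)) := by gcongr
        _ = _ := by ring
    refine (pow_le_pow_left' e 2).trans ((tsum_mul_sq_le _ _).trans_eq ?_)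
    have e2 : ∀ x : ℝ≥0∞, (x ^ (1 / 2 : ℝ)) ^ 2 = x := fun x => by
      rw [← ENNReal.rpow_natCast, ← ENNReal.rpow_mul]; norm_num
    simp_rw [mul_pow _ (_ * _) 2, e2]
  refine (ENNReal.tsum_le_tsum h1).trans_eq ?_
  rw [ENNReal.tsum_mul_left, ENNReal.tsum_comm, sq, mul_assoc]
  congr 1
  rw [← ENNReal.tsum_mul_right]
  congr 1; ext j
  rw [ENNReal.tsum_mul_left]
  congr 1
  exact (Equiv.subRight j).tsum_eq fun k => (m k * f k) ^ 2

theorem summable_one_add_sq_inv : Summable fun j : ℤ => (1 + (j : ℝ) ^ 2)⁻¹ := by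
  have h := Real.summable_one_div_int_pow.2 (show 1 < 2 by norm_num)
  refine (h.add (summable_of_hasFiniteSupport (f := fun j : ℤ => if j = 0 then (1 : ℝ) else 0)
    ((finite_singleton (0 : ℤ)).subset fun j hj => by by_contra hne; simp_all))).of_nonneg_of_le
      (fun j => by positivity) fun j => ?_
  rcases eq_or_ne j 0 with rfl | hj
  · simp
  · have : 0 < (j : ℝ) ^ 2 := by positivity
    simp only [hj, if_false, add_zero, one_div]
    exact inv_anti₀ this (by linarith)

theorem exists_isMultiplier_of_contDiff {A : Torus → ℂ}
    (hA : ContDiff ℝ (⊤ : ℕ∞) fun x : ℝ => A (x : Torus)) {s : ℝ} (hs : 0 ≤ s) :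
    ∃ K : ℝ≥0, ∀ R, IsMultiplier K (japMin s R) A := by
  have hc : Continuous A := by simpa only [tderiv_zero] using continuous_tderiv hA 0
  -- rapid decay of the coefficients
  obtain ⟨N, hN⟩ := exists_nat_ge (s + 2)
  obtain ⟨C₀, h₀⟩ := exists_norm_tderiv_le hA 0
  obtain ⟨C₁, h₁⟩ := exists_norm_tderiv_le hA N
  have hd : ∀ j : ℤ, jap (N : ℝ) j * ‖fourierCoeff A j‖ ≤ 2 ^ ((N : ℝ) / 2) * (C₀ + C₁) := fun j => by
    have e0 := pow_mul_norm_fourierCoeff_le hA 0 h₀ j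
    have e1 := pow_mul_norm_fourierCoeff_le hA N h₁ j
    rw [pow_zero, one_mul] at e0
    have e2 : jap (N : ℝ) j ≤ 2 ^ ((N : ℝ) / 2) * (1 + |(j : ℝ)| ^ N) := by
      have e3 : jap (N : ℝ) j ≤ (2 * max 1 (|(j : ℝ)| ^ 2)) ^ ((N : ℝ) / 2) := by
        refine Real.rpow_le_rpow (by positivity) ?_ (by positivity)
        rw [sq_abs, two_mul]
        exact add_le_add (le_max_left _ _) (le_max_right _ _)
      refine e3.trans ?_
      rw [Real.mul_rpow (by norm_num) (by positivity)]
      refine mul_le_mul_of_nonneg_left ?_ (by positivity)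
      rcases le_total 1 (|(j : ℝ)| ^ 2) with h | h
      · rw [max_eq_right h, ← Real.rpow_natCast |(j : ℝ)| 2, ← Real.rpow_mul (abs_nonneg _)]
        have : ((2 : ℕ) : ℝ) * ((N : ℝ) / 2) = N := by push_cast; ring
        rw [this, Real.rpow_natCast]; linarith
      · rw [max_eq_left h, Real.one_rpow]
        have : 0 ≤ |(j : ℝ)| ^ N := by positivity
        linarith
    calc jap (N : ℝ) j * ‖fourierCoeff A j‖
        ≤ 2 ^ ((N : ℝ) / 2) * (1 + |(j : ℝ)| ^ N) * ‖fourierCoeff A j‖ :=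
          mul_le_mul_of_nonneg_right e2 (norm_nonneg _)
      _ = 2 ^ ((N : ℝ) / 2) * (‖fourierCoeff A j‖ + |(j : ℝ)| ^ N * ‖fourierCoeff A j‖) := by ring
      _ ≤ _ := by gcongr
  have hsum : Summable fun j => ‖fourierCoeff A j‖ * (2 ^ (s / 2) * jap s j) := by
    refine (summable_one_add_sq_inv.mul_left (2 ^ (s / 2) * (2 ^ ((N : ℝ) / 2) * (C₀ + C₁)))).of_nonneg_of_le
      (fun j => mul_nonneg (norm_nonneg _) (mul_nonneg (by positivity) (jap_pos s j).le)) fun j => ?_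
    have e : jap s j * (1 + (j : ℝ) ^ 2) ≤ jap N j := by
      rw [jap, jap]
      nth_rw 2 [← Real.rpow_one (1 + (j : ℝ) ^ 2)]
      rw [← Real.rpow_add (by positivity)]
      exact Real.rpow_le_rpow_of_exponent_le (by nlinarith [sq_nonneg (j : ℝ)]) (by linarith)
    have e2 : ‖fourierCoeff A j‖ * jap s j * (1 + (j : ℝ) ^ 2) ≤ 2 ^ ((N : ℝ) / 2) * (C₀ + C₁) :=
      le_trans (by nlinarith [norm_nonneg (fourierCoeff A j)]) (hd j)
    have hj : 0 < 1 + (j : ℝ) ^ 2 := by positivity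
    rw [← div_eq_mul_inv, le_div_iff₀ hj]
    calc _ = 2 ^ (s / 2) * (‖fourierCoeff A j‖ * jap s j * (1 + (j : ℝ) ^ 2)) := by ring
      _ ≤ _ := mul_le_mul_of_nonneg_left e2 (by positivity)
  have hA1 : Summable (fourierCoeff A) := by
    refine Summable.of_norm (hsum.of_nonneg_of_le (fun j => norm_nonneg _) fun j => ?_)
    exact le_mul_of_one_le_right (norm_nonneg _) (one_le_mul_of_one_le_of_one_le
      (Real.one_le_rpow (by norm_num) (by linarith)) (one_le_jap hs j))
  refine ⟨(∑' j, ‖fourierCoeff A j‖ * (2 ^ (s / 2) * jap s j)).toNNReal, fun R f hf => ?_⟩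
  have hfi : Integrable f := hf.integrable (by norm_num)
  rw [← ENNReal.pow_le_pow_left_iff (n := 2) (by norm_num), mul_pow, l2n_sq, l2n_sq]
  have hK : ∑' j, ‖fourierCoeff A j‖ₑ * ENNReal.ofReal (2 ^ (s / 2) * jap s j)
      = ((∑' j, ‖fourierCoeff A j‖ * (2 ^ (s / 2) * jap s j)).toNNReal : ℝ≥0∞) := by
    rw [← ENNReal.ofReal, ENNReal.ofReal_tsum_of_nonneg (fun j => mul_nonneg (norm_nonneg _)
      (mul_nonneg (by positivity) (jap_pos s j).le)) hsum]
    congr 1; ext j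
    rw [ENNReal.ofReal_mul (norm_nonneg _), ofReal_norm]
  rw [← hK]
  refine le_trans (ENNReal.tsum_le_tsum fun k => ?_) (tsum_conv_sq_le
    (m := fun k => ENNReal.ofReal |japMin s R k|) (fun j k => ?_) (fun j => ‖fourierCoeff A j‖ₑ)
    fun k => ‖fourierCoeff f k‖ₑ)
  · gcongr
    exact enorm_fourierCoeff_mul_le hc hA1 hfi k
  · rw [← ENNReal.ofReal_mul (mul_nonneg (by positivity) (jap_pos s j).le)]
    refine ENNReal.ofReal_le_ofReal ?_
    rw [abs_of_nonneg (japMin_nonneg _ _ _), abs_of_nonneg (japMin_nonneg _ _ _)]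
    exact japMin_add_le hs R j k

/-! ### The weighted norm on time slices -/

theorem FT.XN_zero_sq {u : ℝ × Torus → ℂ} {w : ℤ × ℝ → ℂ} (h : FT u w) (m : ℤ → ℝ) :
    XN 0 m w ^ 2 = ∫⁻ t, l2n m (fun k => coef u k t) ^ 2 := by
  rw [XN_sq, lintegral_nu]
  simp_rw [l2n_sq]
  rw [lintegral_tsum fun k =>
    (((memLp_coef h.memLp_left k).1.enorm.const_mul _).pow_const 2)]
  congr 1; ext k
  simp_rw [wt_zero, mul_one, mul_pow]
  rw [lintegral_const_mul' _ _ (by finiteness), lintegral_const_mul' _ _ (by finiteness),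
    ← eLpNorm_two_sq, ← eLpNorm_two_sq, ← eLpNorm_l2Fourier (memLp_coef h.memLp_left k),
    eLpNorm_congr_ae (h.ae_eq k)]

theorem l2n_const_mul (m : ℤ → ℝ) (c : ℂ) (f : ℤ → ℂ) :
    l2n m (fun k => c * f k) = ‖c‖ₑ * l2n m f := by
  have h : l2n m (fun k => c * f k) ^ 2 = (‖c‖ₑ * l2n m f) ^ 2 := by
    rw [mul_pow, l2n_sq, l2n_sq, ← ENNReal.tsum_mul_left]
    congr 1; ext k
    rw [enorm_mul]; ring
  exact le_antisymm ((ENNReal.pow_le_pow_left_iff two_ne_zero).1 h.le)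
    ((ENNReal.pow_le_pow_left_iff two_ne_zero).1 h.ge)

/-- Multiplication by the real function `c` is bounded by `K` in the weighted norm. -/
def IsMulBound (K : ℝ≥0) (m : ℤ → ℝ) (c : ℝ × Torus → ℝ) : Prop :=
  ∀ (u : ℝ × Torus → ℂ) (w y : ℤ × ℝ → ℂ), FT u w → FT (fun z => c z * u z) y →
    XN 0 m y ≤ K * XN 0 m w

theorem IsMultiplier.isMulBound {K : ℝ≥0} {m : ℤ → ℝ} {A : Torus → ℝ}
    (hA : IsMultiplier K m fun x => A x) {ψ : ℝ → ℝ} {Λ : ℝ≥0} (hψ : ∀ t, |ψ t| ≤ Λ) :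
    IsMulBound (Λ * K) m fun z => ψ z.1 * A z.2 := fun u w y hu hy => by
  rw [← ENNReal.pow_le_pow_left_iff (n := 2) (by norm_num), mul_pow, hu.XN_zero_sq, hy.XN_zero_sq,
    ← lintegral_const_mul' _ _ (by finiteness)]
  refine lintegral_mono_ae ?_
  filter_upwards [ae_memLp_slice hu.memLp_left] with t ht
  rw [← mul_pow]
  refine pow_le_pow_left' ?_ 2
  have e : (fun k => coef (fun z => ((ψ z.1 * A z.2 : ℝ) : ℂ) * u z) k t)
      = fun k => (ψ t : ℂ) * fourierCoeff (fun x => (A x : ℂ) * u (t, x)) k := by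
    ext k
    refine Eq.trans ?_ (coef_const_mul (fun z => (A z.2 : ℂ) * u z) (fun t => (ψ t : ℂ)) k t)
    congr 1; ext z; push_cast; ring
  rw [e, l2n_const_mul, ENNReal.coe_mul, mul_assoc]
  refine mul_le_mul' ?_ (hA _ ht)
  rw [enorm_complex_ofReal, ← ofReal_norm, Real.norm_eq_abs, ← ENNReal.ofReal_coe_nnreal]
  exact ENNReal.ofReal_le_ofReal (hψ t)

theorem isMultiplier_one (m : ℤ → ℝ) : IsMultiplier 1 m fun _ => ((1 : ℝ) : ℂ) :=
  fun f _ => by simp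

theorem XN_zero_hat_gauge_le {τ γ : ℝ} (hγ : 0 ≤ γ) (m : ℤ → ℝ) {g : ℝ × Torus → ℂ}
    (hs : SuppIn τ g) (hg : MemLp g 2 vol) : XN 0 m (hat (gauge γ g)) ≤ XN 0 m (hat g) := by
  have h1 : FT g (hat g) := FT_hat (hs.integrable hg (by norm_num)) hg
  have hgg := hs.memLp_gauge hγ hg
  have h2 : FT (gauge γ g) (hat (gauge γ g)) :=
    FT_hat ((hs.gauge γ).integrable hgg (by norm_num)) hgg
  have e : gauge γ g = fun z => ((min 1 (Real.exp (-γ * z.1)) * 1 : ℝ) : ℂ) * g z := by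
    ext z
    rw [gauge, mul_one]
    by_cases hz : z.1 ∈ Ioo 0 τ
    · rw [min_eq_right (Real.exp_le_one_iff.2 (by nlinarith [hz.1]))]
    · rw [hs z hz]; simp
  have h := (isMultiplier_one m).isMulBound (ψ := fun t => min 1 (Real.exp (-γ * t))) (Λ := 1)
    (fun t => by
      rw [abs_of_nonneg (le_min zero_le_one (Real.exp_pos _).le)]; exact min_le_left _ _)
    g _ (hat (gauge γ g)) h1 (by rw [← e]; exact h2)
  simpa using h

theorem hat_congr {G H : ℝ × Torus → ℂ} (h : G =ᵐ[vol] H) : hat G = hat H := by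
  ext q; exact Real.fourier_congr_ae (coef_congr_ae h q.1) q.2

theorem hat_const_mul (c : ℂ) (H : ℝ × Torus → ℂ) : hat (fun x => c * H x) = c • hat H := by
  ext q
  have e : coef (fun x => c * H x) q.1 = c • coef H q.1 := by
    ext t; exact coef_const_mul H (fun _ => c) q.1 t
  rw [hat, e, Pi.smul_apply, hat, Real.fourier_eq', Real.fourier_eq', ← integral_smul]
  congr 1; ext v; simp [mul_left_comm]

/-! ### Lifts to space-time -/

theorem exists_schwartz {χ : ℝ → ℝ} (hχ : ContDiff ℝ (⊤ : ℕ∞) χ) (hχc : HasCompactSupport χ)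
    (γ : ℝ) : ∃ ρ : 𝓢(ℝ, ℂ), ∀ t, ρ t = ((χ t * Real.exp (γ * t) : ℝ) : ℂ) := by
  have h1 : HasCompactSupport fun t => ((χ t * Real.exp (γ * t) : ℝ) : ℂ) :=
    (hχc.mul_right (f' := fun t => Real.exp (γ * t))).comp_left (g := fun r : ℝ => (r : ℂ))
      Complex.ofReal_zero
  have h2 : ContDiff ℝ (⊤ : ℕ∞) fun t => ((χ t * Real.exp (γ * t) : ℝ) : ℂ) :=
    Complex.ofRealCLM.contDiff.comp (hχ.mul (Real.contDiff_exp.comp (contDiff_const.mul contDiff_id)))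
  exact ⟨h1.toSchwartzMap h2, fun t => rfl⟩

/-- `z` is a function on `ℝ × 𝕋`, with transform `w`, that solves the damped equation with datum
`f` and forcing `H`. -/
structure IsLift (β γ : ℝ) (ρ : 𝓢(ℝ, ℂ)) (lam : ℝ) (c : ℝ × Torus → ℝ) (f : ℤ → ℂ)
    (g z : ℝ × Torus → ℂ) (w : ℤ × ℝ → ℂ) (H : ℝ × Torus → ℂ) : Prop where
  ft : FT z w
  integrable : Integrable H vol
  w_eq : w = dampedHat γ f H
  ae_eq : H =ᵐ[vol] fun x =>
    -(Complex.I * (lam * tri ρ z z z x)) - c x * z x - Complex.I * gauge γ g x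
  ne_top : XN β 1 w ≠ ⊤

theorem isLift_zero (β γ : ℝ) (ρ : 𝓢(ℝ, ℂ)) (lam : ℝ) (c : ℝ × Torus → ℝ) :
    IsLift β γ ρ lam c 0 0 0 0 0 := by
  have h0 : hat 0 = 0 := by
    have := hat_const_mul 0 0
    rw [zero_smul] at this
    rw [← this]; congr 1; ext x; simp
  have hF : FT (0 : ℝ × Torus → ℂ) 0 := by
    have := FT_hat (H := 0) (integrable_zero _ _ _) MemLp.zero
    rwa [h0] at this
  refine ⟨hF, integrable_zero _ _ _, ?_, ae_of_all _ fun x => by simp [tri, gauge], by simp [XN]⟩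
  ext q; simp [dampedHat, h0]

theorem damped_eq_zero_of_neg {γ : ℝ} (hγ : 0 < γ) {f : ℤ → ℂ} {τ : ℝ} {h : ℝ × Torus → ℂ}
    (hs : SuppIn τ h) (hi : Integrable h vol) {z : ℝ × Torus → ℂ}
    (hz : FT z (dampedHat γ f (gauge γ h))) : ∀ᵐ x ∂vol, x.1 ≤ 0 → z x = 0 := by
  have hm : MemLp (fun x : ℝ × Torus => (Iic (0 : ℝ)).indicator (fun _ => (1 : ℂ)) x.1 * z x) 2 vol := by
    have hs : MeasurableSet {x : ℝ × Torus | x.1 ≤ 0} := measurableSet_le measurable_fst measurable_const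
    refine (memLp_congr_ae (ae_of_all _ fun x => ?_)).1 (hz.memLp_left.indicator hs)
    by_cases hx : x.1 ≤ 0 <;> simp [hx]
  have := ae_eq_of_coef_ae_eq hm MemLp.zero (v := 0) fun k => by
    filter_upwards [coef_damped hγ hs hi hz k] with t ht
    rw [coef_const_mul z (fun t => (Iic (0 : ℝ)).indicator (fun _ => (1 : ℂ)) t) k t, ht]
    have e0 : coef (0 : ℝ × Torus → ℂ) k t = 0 := by simp [coef, fourierCoeff]
    rw [e0]
    by_cases h : t ≤ 0
    · rw [Set.indicator_of_notMem (s := Ioi 0) (by simpa using h), mul_zero]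
    · rw [Set.indicator_of_notMem (s := Iic 0) (by simpa using h), zero_mul]
  filter_upwards [this] with x hx h
  rw [Set.indicator_of_mem (show x.1 ∈ Iic 0 from h), one_mul] at hx
  exact hx

theorem IsExponent.exists_lift (hC : IsExponent β C) {γ : ℝ} (hγ : 1 ≤ γ)
    {χ : ℝ → ℝ} {τ lam : ℝ} (hχ : ∀ t, τ ≤ t → χ t = 0) {ρ : 𝓢(ℝ, ℂ)}
    (hρ : ∀ t, ρ t = ((χ t * Real.exp (γ * t) : ℝ) : ℂ)) {Λ : ℝ≥0} {c : ℝ × Torus → ℝ}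
    (hL : IsCoeff Λ (fun t => lam * χ t ^ 2) c) (hc : ∀ x, x.1 ∉ Ioo 0 τ → c x = 0)
    {f : ℤ → ℂ} (hf : l2n 1 f ≠ ⊤) {g u : ℝ × Torus → ℂ} (hgs : SuppIn τ g) (hg : MemLp g 2 vol)
    (hu : IsNLS τ f (fun t => lam * χ t ^ 2) c g u) :
    ∃ z, IsLift β γ ρ lam c f g z
      (dampedHat γ f (gauge γ (cut τ (forcing (fun t => lam * χ t ^ 2) c g u))))
      (gauge γ (cut τ (forcing (fun t => lam * χ t ^ 2) c g u))) ∧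
      (fun x => ρ x.1 * z x) =ᵐ[vol] fun x => χ x.1 * u x := by
  have hγ0 : 0 < γ := by linarith
  set h := cut τ (forcing (fun t => lam * χ t ^ 2) c g u) with hh
  have hs : SuppIn τ h := suppIn_cut _ _
  have hm := hL.memLp_forcing hu.memLp hg hu.supp
  have hi := hs.integrable hm one_le_four_thirds
  have hgm := hs.memLp_gauge hγ0.le hm
  have hgi := (hs.gauge γ).integrable hgm one_le_four_thirds
  obtain ⟨z, hz⟩ := hC.exists_damped hγ hf hgi hgm.eLpNorm_ne_top
  have h1 := hu.mild.gauge_ae_eq hγ0 hs hi hu.memLp_two hu.supp hz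
  have h2 := damped_eq_zero_of_neg hγ0 hs hi hz
  have h3 : ∀ᵐ x ∂vol, (x.1 ∈ Ioo 0 τ → u x = (Real.exp (γ * x.1) : ℂ) * z x) := by
    filter_upwards [h1] with x hx hxt
    rw [cut_apply hxt, gauge] at hx
    rw [← hx, ← mul_assoc, ← Complex.ofReal_mul, ← Real.exp_add]
    simp
  refine ⟨z, ⟨hz, hgi, rfl, ?_, ?_⟩, ?_⟩
  · filter_upwards [h2, h3] with x hx2 hx3
    rcases le_or_gt x.1 0 with h0 | h0
    · have hx : x.1 ∉ Ioo 0 τ := fun hx => absurd hx.1 (not_lt.2 h0)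
      simp [gauge, hs x hx, hgs x hx, tri, hx2 h0]
    rcases lt_or_ge x.1 τ with h4 | h4
    · have hx : x.1 ∈ Ioo 0 τ := ⟨h0, h4⟩
      rw [gauge, hh, cut_apply hx, forcing, cubic, hx3 hx, tri, gauge, hρ]
      have e2 : ((‖(Real.exp (γ * x.1) : ℂ) * z x‖ ^ 2 : ℝ) : ℂ)
          = (Real.exp (γ * x.1) : ℂ) ^ 2 * (z x * starRingEnd ℂ (z x)) := by
        rw [norm_mul, Complex.norm_real, Real.norm_of_nonneg (Real.exp_pos _).le, mul_pow,
          Complex.mul_conj, Complex.normSq_eq_norm_sq]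
        push_cast; ring
      have e3 : (Real.exp (-γ * x.1) : ℂ) * (Real.exp (γ * x.1) : ℂ) = 1 := by
        rw [← Complex.ofReal_mul, ← Real.exp_add]; simp
      rw [e2]
      push_cast at e3 ⊢
      linear_combination (-Complex.I * lam * (χ x.1) ^ 2 * Complex.exp (γ * x.1) ^ 2 *
        (z x * starRingEnd ℂ (z x)) * z x - c x * z x) * e3
    · have hx : x.1 ∉ Ioo 0 τ := fun hx => absurd hx.2 (not_lt.2 h4)
      simp [gauge, hs x hx, hgs x hx, tri, hρ, hχ _ h4, hc x hx]
  · refine ne_top_of_le_ne_top ?_ (hC.XN_dampedHat_one_le hγ f hgi)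
    exact ENNReal.add_ne_top.2 ⟨ENNReal.mul_ne_top (freeConst_ne_top hC.lt_half) hf,
      ENNReal.mul_ne_top ENNReal.ofReal_ne_top (ENNReal.mul_ne_top hC.ne_top hgm.eLpNorm_ne_top)⟩
  · filter_upwards [h2, h3] with x hx2 hx3
    rw [hρ]
    rcases le_or_gt x.1 0 with h0 | h0
    · rw [hx2 h0, hu.supp x fun hx => absurd hx.1 (not_lt.2 h0), mul_zero, mul_zero]
    rcases lt_or_ge x.1 τ with h4 | h4
    · rw [hx3 ⟨h0, h4⟩]; push_cast; ring
    · simp [hχ _ h4]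

/-! ### Differences of solutions in the weighted norms -/

theorem enorm_I : ‖Complex.I‖ₑ = 1 := by rw [← ofReal_norm, Complex.norm_I, ENNReal.ofReal_one]

theorem XN_sub_le_add {β : ℝ} {m : ℤ → ℝ} {w y : ℤ × ℝ → ℂ} {a b : ℝ≥0∞}
    (hw : AEStronglyMeasurable w nu) (hy : AEStronglyMeasurable y nu)
    (ha : XN β m w ≤ a) (hb : XN β m y ≤ b) : XN β m (w - y) ≤ a + b :=
  (XN_sub_le hw hy).trans (add_le_add ha hb)

theorem IsLift.XN_hat_sub_le (hC : IsExponent β C) {A : ℝ≥0} {m : ℤ → ℝ}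
    (hm : IsWeight A m) {ρ : 𝓢(ℝ, ℂ)} (hρ : ∀ t, starRingEnd ℂ (ρ t) = ρ t) {K : ℝ≥0}
    {c : ℝ × Torus → ℝ} (hK : IsMulBound K m c) {Λ : ℝ≥0} {ℓ : ℝ → ℝ} (hL : IsCoeff Λ ℓ c) {τ : ℝ}
    (hc : ∀ x, x.1 ∉ Ioo 0 τ → c x = 0) {γ lam : ℝ} (hγ : 0 ≤ γ) {f f' : ℤ → ℂ}
    {g g' z z' H H' : ℝ × Torus → ℂ} {w w' : ℤ × ℝ → ℂ} (hgs : SuppIn τ g) (hg : MemLp g 2 vol)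
    (hgs' : SuppIn τ g') (hg' : MemLp g' 2 vol)
    (h : IsLift β γ ρ lam c f g z w H) (h' : IsLift β γ ρ lam c f' g' z' w' H')
    (hX : XN β m w ≠ ⊤) (hX' : XN β m w' ≠ ⊤) {V : ℝ≥0∞} (hV : XN β 1 (tmul ρ w) ≤ V)
    (hV' : XN β 1 (tmul ρ w') ≤ V) :
    XN (-β) m (hat (H - H'))
      ≤ (3 * (‖(lam : ℂ)‖ₑ * (ENNReal.ofReal (2 * Real.pi) * A * C)) * V ^ 2 + K) * XN β m (w - w')
        + 3 * (‖(lam : ℂ)‖ₑ * (ENNReal.ofReal (2 * Real.pi) * A * C)) * V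
          * XN β 1 (tmul ρ (w - w')) * (XN β m w + XN β m w')
        + XN 0 m (hat (g - g')) := by
  have hβ0 : 0 ≤ β := by linarith [hC.five_lt]
  have hS := hC.toIsStrichartzConst
  have hd := h.ft.sub h'.ft
  have hXd1 : XN β 1 (w - w') ≠ ⊤ := ne_top_of_le_ne_top (ENNReal.add_ne_top.2 ⟨h.ne_top, h'.ne_top⟩)
    (XN_sub_le h.ft.memLp_right.1 h'.ft.memLp_right.1)
  have hXd : XN β m (w - w') ≠ ⊤ := ne_top_of_le_ne_top (ENNReal.add_ne_top.2 ⟨hX, hX'⟩)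
    (XN_sub_le h.ft.memLp_right.1 h'.ft.memLp_right.1)
  have h4 := hS.memLp_four h.ft h.ne_top
  have h4' := hS.memLp_four h'.ft h'.ne_top
  have h4d := hS.memLp_four hd hXd1
  have hcs : SuppIn τ fun x => (c x : ℂ) * (z - z') x := fun x hx => by simp [hc x hx]
  have hcm : MemLp (fun x => (c x : ℂ) * (z - z') x) 2 vol := by
    refine (hd.memLp_left.const_mul (Λ : ℂ)).mono
      ((Complex.continuous_ofReal.comp_aestronglyMeasurable hL.aestronglyMeasurable_right).mul
        hd.memLp_left.1) ?_
    filter_upwards [hL.right_le] with x hx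
    rw [norm_mul, norm_mul, Complex.norm_real]
    refine mul_le_mul_of_nonneg_right (hx.trans_eq ?_) (norm_nonneg _)
    simp
  have hci := hcs.integrable hcm (by norm_num)
  have hgd := hgs.sub hgs'
  have hgdm := (hgd.memLp_gauge hγ (hg.sub hg'))
  have hgdi := (hgd.gauge γ).integrable hgdm (by norm_num)
  set T₁ := tri ρ (z - z') z z
  set T₂ := tri ρ z' (z - z') z
  set T₃ := tri ρ z' z' (z - z')
  have i₁ : Integrable T₁ vol := integrable_tri ρ h4d h.ft.memLp_left h4
  have i₂ : Integrable T₂ vol := integrable_tri ρ h4' hd.memLp_left h4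
  have i₃ : Integrable T₃ vol := integrable_tri ρ h4' h'.ft.memLp_left h4d
  have e : H - H' =ᵐ[vol] (fun x => -(Complex.I * lam) * T₁ x) - (fun x => (Complex.I * lam) * T₂ x)
      - (fun x => (Complex.I * lam) * T₃ x) - (fun x => (c x : ℂ) * (z - z') x)
      - fun x => Complex.I * gauge γ (g - g') x := by
    filter_upwards [h.ae_eq, h'.ae_eq] with x hx hx'
    simp only [Pi.sub_apply, hx, hx', T₁, T₂, T₃, tri, gauge, map_sub]
    ring
  have j₁ := i₁.const_mul (-(Complex.I * lam))
  have j₂ := i₂.const_mul (Complex.I * lam)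
  have j₃ := i₃.const_mul (Complex.I * lam)
  have hn : ‖-(Complex.I * (lam : ℂ))‖ₑ = ‖(lam : ℂ)‖ₑ := by simp [enorm_I]
  have hn' : ‖Complex.I * (lam : ℂ)‖ₑ = ‖(lam : ℂ)‖ₑ := by simp [enorm_I]
  set κ := ENNReal.ofReal (2 * Real.pi) * A * C
  set Vd := XN β 1 (tmul ρ (w - w'))
  set Xd := XN β m (w - w')
  set X := XN β m w
  set X' := XN β m w'
  have b₁ : XN (-β) m (hat fun x => -(Complex.I * lam) * T₁ x)
      ≤ ‖(lam : ℂ)‖ₑ * (κ * (Xd * V * V + Vd * X * V + Vd * V * X)) := by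
    rw [hat_const_mul, XN_const_mul, hn]
    refine mul_le_mul' le_rfl ((hC.XN_tri_le hm hρ hd h.ft h.ft hXd1 h.ne_top h.ne_top hXd hX hX).trans ?_)
    rw [triBound]; gcongr
  have b₂ : XN (-β) m (hat fun x => (Complex.I * lam) * T₂ x)
      ≤ ‖(lam : ℂ)‖ₑ * (κ * (X' * Vd * V + V * Xd * V + V * Vd * X)) := by
    rw [hat_const_mul, XN_const_mul, hn']
    refine mul_le_mul' le_rfl ((hC.XN_tri_le hm hρ h'.ft hd h.ft h'.ne_top hXd1 h.ne_top hX' hXd hX).trans ?_)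
    rw [triBound]; gcongr
  have b₃ : XN (-β) m (hat fun x => (Complex.I * lam) * T₃ x)
      ≤ ‖(lam : ℂ)‖ₑ * (κ * (X' * V * Vd + V * X' * Vd + V * V * Xd)) := by
    rw [hat_const_mul, XN_const_mul, hn']
    refine mul_le_mul' le_rfl ((hC.XN_tri_le hm hρ h'.ft h'.ft hd h'.ne_top h'.ne_top hXd1 hX' hX' hXd).trans ?_)
    rw [triBound]; gcongr
  have b₄ : XN (-β) m (hat fun x => (c x : ℂ) * (z - z') x) ≤ K * Xd :=
    (XN_mono (by linarith) (fun _ => le_rfl) _).trans ((hK _ _ _ hd (FT_hat hci hcm)).trans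
      (mul_le_mul' le_rfl (XN_mono hβ0 (fun _ => le_rfl) _)))
  have b₅ : XN (-β) m (hat fun x => Complex.I * gauge γ (g - g') x) ≤ XN 0 m (hat (g - g')) := by
    rw [hat_const_mul, XN_const_mul]
    rw [enorm_I, one_mul]
    exact (XN_mono (by linarith) (fun _ => le_rfl) _).trans
      (XN_zero_hat_gauge_le hγ m hgd (hg.sub hg'))
  have ms : ∀ {G : ℝ × Torus → ℂ}, Integrable G vol → AEStronglyMeasurable (hat G) nu :=
    fun hG => (measurable_hat hG).aestronglyMeasurable
  have j₅ := hgdi.const_mul Complex.I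
  rw [hat_congr e, hat_sub (((j₁.sub j₂).sub j₃).sub hci) j₅, hat_sub ((j₁.sub j₂).sub j₃) hci,
    hat_sub (j₁.sub j₂) j₃, hat_sub j₁ j₂]
  refine (XN_sub_le_add ((((ms j₁).sub (ms j₂)).sub (ms j₃)).sub (ms hci)) (ms j₅)
    (XN_sub_le_add (((ms j₁).sub (ms j₂)).sub (ms j₃)) (ms hci)
      (XN_sub_le_add ((ms j₁).sub (ms j₂)) (ms j₃)
        (XN_sub_le_add (ms j₁) (ms j₂) b₁ b₂) b₃) b₄) b₅).trans ?_
  set Y := XN 0 m (hat (g - g'))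
  have e5 : (3 * (‖(lam : ℂ)‖ₑ * κ) * V ^ 2 + K) * Xd + 3 * (‖(lam : ℂ)‖ₑ * κ) * V * Vd * (X + X') + Y
      = ‖(lam : ℂ)‖ₑ * (κ * (Xd * V * V + Vd * X * V + Vd * V * X))
      + ‖(lam : ℂ)‖ₑ * (κ * (X' * Vd * V + V * Xd * V + V * Vd * X))
      + ‖(lam : ℂ)‖ₑ * (κ * (X' * V * Vd + V * X' * Vd + V * V * Xd)) + K * Xd + Y := by ring
  exact e5.ge

theorem isNLS_zero (τ : ℝ) (ℓ : ℝ → ℝ) (c : ℝ × Torus → ℝ) : IsNLS τ 0 ℓ c 0 0 := by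
  refine ⟨fun _ _ => rfl, MemLp.zero, ?_⟩
  have : cut τ (forcing ℓ c 0 0) = 0 := by rw [forcing_zero]; ext x; simp [cut]
  rw [this]; exact isMild_zero τ

/-- The solution, cut off in time, depends Lipschitz continuously on the data in `X_{β,0}`. -/
theorem IsExponent.exists_XN_cutoff_le (hC : IsExponent β C) (Λ : ℝ≥0)
    {χ : ℝ → ℝ} (hχ : ContDiff ℝ (⊤ : ℕ∞) χ) (hχc : HasCompactSupport χ) {τ lam : ℝ}
    (hχτ : ∀ t, τ ≤ t → χ t = 0) {B : ℝ≥0∞} (hB : B ≠ ⊤) :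
    ∃ D : ℝ≥0∞, D ≠ ⊤ ∧ ∀ {c : ℝ × Torus → ℝ}, IsCoeff Λ (fun t => lam * χ t ^ 2) c →
      (∀ x, x.1 ∉ Ioo 0 τ → c x = 0) → ∀ {f f' : ℤ → ℂ} {g g' u u' : ℝ × Torus → ℂ},
      l2n 1 f ≠ ⊤ → l2n 1 f' ≠ ⊤ → SuppIn τ g → MemLp g 2 vol → SuppIn τ g' → MemLp g' 2 vol →
      IsNLS τ f (fun t => lam * χ t ^ 2) c g u → IsNLS τ f' (fun t => lam * χ t ^ 2) c g' u' →
      eLpNorm u 4 vol ≤ B → eLpNorm u' 4 vol ≤ B →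
      ∀ y, FT (fun x => χ x.1 * (u x - u' x)) y →
        XN β 1 y ≤ D * (l2n 1 (f - f') + eLpNorm (g - g') 2 vol) := by
  have hβ := hC.lt_half
  have hβ5 := hC.five_lt
  obtain ⟨γ, hγ, hlip⟩ := hC.exists_gauge_sub_le Λ τ hB
  have hγ0 : 0 ≤ γ := by linarith
  obtain ⟨ρ, hρ⟩ := exists_schwartz hχ hχc γ
  set P := lipConst Λ τ B
  have hP := lipConst_ne_top Λ τ hB
  have hF := freeConst_ne_top hβ
  have hM := multConst_ne_top (b := β) (by linarith) ρ
  have hCt := hC.ne_top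
  have hI := incl_ne_top τ
  refine ⟨multConst β ρ * (freeConst β + C * (P * (2 * (C * (freeConst β + C * incl τ))) + incl τ)),
    ?_, ?_⟩
  · exact ENNReal.mul_ne_top hM (by finiteness)
  intro c hL hc f f' g g' u u' hf hf' hgs hg hgs' hg' hu hu' huB huB' y hy
  obtain ⟨z, hz, hzu⟩ := hC.exists_lift hγ hχτ hρ hL hc hf hgs hg hu
  obtain ⟨z', hz', hzu'⟩ := hC.exists_lift hγ hχτ hρ hL hc hf' hgs' hg' hu'
  have hd := hz.ft.sub hz'.ft
  have h1 : y =ᵐ[nu] tmul ρ (_ - _) := hy.right_unique ((hd.time_mul ρ).congr_left (by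
    filter_upwards [hzu, hzu'] with x h1 h2
    rw [Pi.sub_apply, mul_sub, h1, h2, mul_sub]))
  have e : dampedHat γ f (gauge γ (cut τ (forcing (fun t => lam * χ t ^ 2) c g u)))
      - dampedHat γ f' (gauge γ (cut τ (forcing (fun t => lam * χ t ^ 2) c g' u')))
      = dampedHat γ (f - f') (gauge γ (cut τ (forcing (fun t => lam * χ t ^ 2) c g u)
          - cut τ (forcing (fun t => lam * χ t ^ 2) c g' u'))) := by
    have e2 : gauge γ (cut τ (forcing (fun t => lam * χ t ^ 2) c g u)
          - cut τ (forcing (fun t => lam * χ t ^ 2) c g' u'))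
        = gauge γ (cut τ (forcing (fun t => lam * χ t ^ 2) c g u))
          - gauge γ (cut τ (forcing (fun t => lam * χ t ^ 2) c g' u')) := by
      ext x; simp [gauge, mul_sub]
    ext q
    simp only [Pi.sub_apply, dampedHat, e2, hat_sub hz.integrable hz'.integrable]
    ring
  rw [XN_congr h1, e]
  have hHi : Integrable (gauge γ (cut τ (forcing (fun t => lam * χ t ^ 2) c g u)
          - cut τ (forcing (fun t => lam * χ t ^ 2) c g' u'))) vol := by
    refine (hz.integrable.sub hz'.integrable).congr (ae_of_all _ fun x => ?_)
    simp [gauge, mul_sub]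
  refine (XN_tmul_le (by linarith) 1 ρ (measurable_dampedHat γ _ hHi).aestronglyMeasurable).trans ?_
  rw [mul_assoc]
  refine mul_le_mul' le_rfl ((hC.XN_dampedHat_one_le hγ _ hHi).trans ?_)
  have h2 := hL.eLpNorm_forcing_sub_le (τ := τ) hγ0 hu.memLp.1 hu'.memLp.1 hg.1 hg'.1 hu.supp
    hu'.supp huB huB'
  have h3 := hlip hL hf hf' hg hg' hu hu' huB huB'
  set a := l2n 1 (f - f')
  set d := eLpNorm (g - g') 2 vol
  calc _ ≤ freeConst β * a + 1 * (C * (P * (2 * (C * (freeConst β * a + C * (incl τ * d)))) + incl τ * d)) := by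
        gcongr
        · exact ofReal_rpow_neg_le_one hγ (by linarith)
        · exact h2.trans (by gcongr)
    _ ≤ freeConst β * (a + d)
        + 1 * (C * (P * (2 * (C * (freeConst β * (a + d) + C * (incl τ * (a + d))))) + incl τ * (a + d))) := by
        gcongr <;> first | exact le_self_add | exact le_add_self
    _ = _ := by ring

/-! ### The anticausal extension -/

theorem fourier_conj_neg (h : ℝ → ℂ) (ξ : ℝ) :
    𝓕 (fun t => starRingEnd ℂ (h (-t))) ξ = starRingEnd ℂ (𝓕 h ξ) := by
  rw [Real.fourier_real_eq_integral_exp_smul, Real.fourier_real_eq_integral_exp_smul, ← integral_conj,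
    ← integral_neg_eq_self]
  congr 1; ext v
  rw [neg_neg, smul_eq_mul, smul_eq_mul, map_mul, ← Complex.exp_conj]
  congr 2
  simp [Complex.conj_ofNat]

theorem anticausal_eq_zero {γ : ℝ} (hγ : 0 < γ) {f : ℤ → ℂ} {v : ℝ × Torus → ℂ}
    (hv : FT v fun q => f q.1 * starRingEnd ℂ (1 / dmp γ q)) : ∀ᵐ x ∂vol, 0 < x.1 → v x = 0 := by
  have hk : ∀ k, coef v k =ᵐ[volume]
      fun t => f k * starRingEnd ℂ (ker γ (symb k) (-t)) := fun k => by
    have hi : Integrable fun t => f k * starRingEnd ℂ (ker γ (symb k) (-t)) :=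
      Integrable.const_mul ((Complex.conjCLE.toContinuousLinearMap).integrable_comp
        (integrable_ker hγ (symb k)).comp_neg) (f k)
    have hm : MemLp (fun t => f k * starRingEnd ℂ (ker γ (symb k) (-t))) 2 volume := by
      refine memLp_two_of_integrable_of_bound hi (D := ‖f k‖) (fun t => ?_)
      rw [norm_mul, RCLike.norm_conj]
      exact mul_le_of_le_one_right (norm_nonneg _) (norm_ker_le hγ _ _)
    refine ae_eq_of_l2Fourier_ae_eq (memLp_coef hv.memLp_left k) hm ((hv.ae_eq k).trans ?_)
    refine EventuallyEq.trans ?_ (l2Fourier_ae_eq_fourier hi hm).symm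
    refine ae_of_all _ fun ξ => ?_
    have e : 𝓕 (fun t => f k * starRingEnd ℂ (ker γ (symb k) (-t))) ξ
        = f k * 𝓕 (fun t => starRingEnd ℂ (ker γ (symb k) (-t))) ξ := by
      rw [Real.fourier_real_eq_integral_exp_smul, Real.fourier_real_eq_integral_exp_smul,
        ← integral_const_mul]
      congr 1; ext v; simp only [smul_eq_mul]; ring
    rw [e, fourier_conj_neg, fourier_ker hγ]
  have hm : MemLp (fun x : ℝ × Torus => (Ioi (0 : ℝ)).indicator (fun _ => (1 : ℂ)) x.1 * v x) 2 vol := by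
    have hs : MeasurableSet {x : ℝ × Torus | 0 < x.1} := measurableSet_lt measurable_const measurable_fst
    refine (memLp_congr_ae (ae_of_all _ fun x => ?_)).1 (hv.memLp_left.indicator hs)
    by_cases hx : 0 < x.1 <;> simp [hx]
  have := ae_eq_of_coef_ae_eq hm MemLp.zero (v := 0) fun k => by
    filter_upwards [hk k] with t ht
    rw [coef_const_mul v (fun t => (Ioi (0 : ℝ)).indicator (fun _ => (1 : ℂ)) t) k t, ht]
    have e0 : coef (0 : ℝ × Torus → ℂ) k t = 0 := by simp [coef, fourierCoeff]
    rw [e0]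
    by_cases h : 0 < t
    · rw [ker, Set.indicator_of_notMem (s := Ioi 0) (a := -t) (by simpa using h.le)]; simp
    · rw [Set.indicator_of_notMem (s := Ioi 0) (by simpa using h), zero_mul]
  filter_upwards [this] with x hx h
  rw [Set.indicator_of_mem (show x.1 ∈ Ioi 0 from h), one_mul] at hx
  exact hx

/-! ### The extension of a solution to a function in the Bourgain space -/

theorem XN_le_mul_one {β : ℝ} {m : ℤ → ℝ} {M : ℝ} (hm : ∀ k, |m k| ≤ M) (w : ℤ × ℝ → ℂ) :
    XN β m w ≤ ‖(M : ℂ)‖ₑ * XN β 1 w := by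
  rw [← XN_const_mul]
  refine XN_mono_enorm fun q => ?_
  have h1 := hm q.1
  have hM : 0 ≤ M := (abs_nonneg _).trans h1
  rw [Pi.smul_apply, smul_eq_mul, norm_mul, Complex.norm_real, Real.norm_of_nonneg hM, Pi.one_apply,
    abs_one, one_mul]
  have h2 := (wt_pos β q).le
  calc |m q.1| * wt β q * ‖w q‖ ≤ M * wt β q * ‖w q‖ := by gcongr
    _ = _ := by ring

theorem IsLift.sub_eq {β γ lam : ℝ} {ρ : 𝓢(ℝ, ℂ)} {c : ℝ × Torus → ℝ} {f f' : ℤ → ℂ}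
    {g g' z z' H H' : ℝ × Torus → ℂ} {w w' : ℤ × ℝ → ℂ} (h : IsLift β γ ρ lam c f g z w H)
    (h' : IsLift β γ ρ lam c f' g' z' w' H') : w - w' = dampedHat γ (f - f') (H - H') := by
  ext q
  simp only [Pi.sub_apply, h.w_eq, h'.w_eq, dampedHat, hat_sub h.integrable h'.integrable]
  ring

theorem norm_one_div_dmp_add_conj_le {γ : ℝ} (hγ : 1 ≤ γ) (q : ℤ × ℝ) :
    ‖1 / dmp γ q + starRingEnd ℂ (1 / dmp γ q)‖ ≤ 2 * γ * wt (-2) q := by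
  have hw : wt (-2) q = (1 + modul q ^ 2)⁻¹ := by
    rw [wt, show (-2 : ℝ) / 2 = -1 by norm_num, Real.rpow_neg_one]
  have hγ0 : 0 ≤ γ := by linarith
  rw [Complex.add_conj, Complex.norm_real, hw, one_div, Complex.inv_re, Complex.normSq_apply]
  have h1 : (dmp γ q).re = γ := by simp [dmp]
  have h2 : (dmp γ q).im = modul q := by simp [dmp]
  rw [h1, h2, Real.norm_of_nonneg (mul_nonneg zero_le_two (div_nonneg hγ0
      (add_nonneg (mul_self_nonneg _) (mul_self_nonneg _)))), mul_assoc, div_eq_mul_inv]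
  gcongr
  · nlinarith
  · exact (sq _).le

theorem XN_correction_le {b γ : ℝ} (hb : b < 3 / 2) (hγ : 1 ≤ γ) (m : ℤ → ℝ) (f : ℤ → ℂ) :
    XN b m (fun q => f q.1 * (1 / dmp γ q + starRingEnd ℂ (1 / dmp γ q)))
      ≤ ‖((2 * γ : ℝ) : ℂ)‖ₑ * (freeConst (b - 1) * l2n m f) := by
  have h := XN_free_le (β := b - 1) (by linarith) m f (g := fun q => f q.1 * (wt (-1) q : ℂ))
    fun q => by rw [norm_mul, Complex.norm_real, Real.norm_of_nonneg (wt_pos _ _).le]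
  refine le_trans ?_ (mul_le_mul' le_rfl h)
  rw [← XN_const_mul]
  refine XN_mono_enorm fun q => ?_
  have h1 := norm_one_div_dmp_add_conj_le hγ q
  have h2 := (wt_pos b q).le
  have h3 : wt b q * wt (-2) q = wt (b - 1) q * wt (-1) q := by
    rw [wt_mul, wt_mul]; congr 1; ring
  simp only [Pi.smul_apply, smul_eq_mul]
  rw [norm_mul, norm_mul, norm_mul, Complex.norm_real, Complex.norm_real,
    Real.norm_of_nonneg (by linarith), Real.norm_of_nonneg (wt_pos _ _).le]
  calc |m q.1| * wt b q * (‖f q.1‖ * ‖1 / dmp γ q + starRingEnd ℂ (1 / dmp γ q)‖)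
      ≤ |m q.1| * wt b q * (‖f q.1‖ * (2 * γ * wt (-2) q)) := by gcongr
    _ = |m q.1| * (wt b q * wt (-2) q) * ‖f q.1‖ * (2 * γ) := by ring
    _ = _ := by rw [h3]; ring

theorem IsLift.exists_extension {β γ lam : ℝ} {ρ : 𝓢(ℝ, ℂ)} {c : ℝ × Torus → ℝ} {f f' : ℤ → ℂ}
    {g g' z z' H H' : ℝ × Torus → ℂ} {w w' : ℤ × ℝ → ℂ} (hγ : 1 ≤ γ)
    (h : IsLift β γ ρ lam c f g z w H) (h' : IsLift β γ ρ lam c f' g' z' w' H')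
    (hf : l2n 1 (f - f') ≠ ⊤) :
    ∃ Z Y, FT Z Y ∧ (∀ᵐ x ∂vol, 0 < x.1 → Z x = ρ x.1 * (z x - z' x)) ∧
      ∀ b m, 0 ≤ b → b ≤ 1 - β → b < 3 / 2 → XN b m Y ≤ multConst b ρ *
        (XN (-β) m (hat (H - H')) + ‖((2 * γ : ℝ) : ℂ)‖ₑ * (freeConst (b - 1) * l2n m (f - f'))) := by
  have hHi := h.integrable.sub h'.integrable
  set F := f - f'
  have hconj : AEStronglyMeasurable (fun q => F q.1 * starRingEnd ℂ (1 / dmp γ q)) nu :=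
    ((measurable_from_top (f := F)).comp measurable_fst).aestronglyMeasurable.mul
      (Complex.continuous_conj.measurable.comp
        (measurable_const.div (measurable_dmp γ))).aestronglyMeasurable
  have hm : MemLp (fun q => F q.1 * starRingEnd ℂ (1 / dmp γ q)) 2 nu := by
    refine memLp_two_of_XN (β := 0) le_rfl hconj
      (ne_top_of_le_ne_top (ENNReal.mul_ne_top (freeConst_ne_top (β := 0) (by norm_num)) hf)
        (XN_free_le (by norm_num) 1 F fun q => ?_))
    have := norm_div_dmp_le hγ (F q.1) q
    rwa [norm_mul, RCLike.norm_conj, ← norm_mul, mul_one_div]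
  obtain ⟨v, hv⟩ := exists_FT_left hm
  have hv0 := anticausal_eq_zero (by linarith) hv
  have hsum := ((h.ft.sub h'.ft).add hv).time_mul ρ
  refine ⟨_, _, hsum, ?_, fun b m hb0 hb1 hb2 => ?_⟩
  · filter_upwards [hv0] with x hx h0
    simp [hx h0]
  have e : w - w' + (fun q => F q.1 * starRingEnd ℂ (1 / dmp γ q))
      = (fun q => hat (H - H') q / dmp γ q)
        + fun q => F q.1 * (1 / dmp γ q + starRingEnd ℂ (1 / dmp γ q)) := by
    rw [h.sub_eq h']
    ext q
    simp only [Pi.add_apply, dampedHat]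
    ring
  refine (XN_tmul_le hb0 m ρ (((h.ft.sub h'.ft).add hv).memLp_right.1)).trans ?_
  refine mul_le_mul' le_rfl ?_
  rw [e]
  have hh := (measurable_hat hHi).div (measurable_dmp γ)
  refine (XN_add_le hh.aestronglyMeasurable ?_).trans (add_le_add ?_ (XN_correction_le hb2 hγ m F))
  · have e2 : (fun q => F q.1 * (1 / dmp γ q + starRingEnd ℂ (1 / dmp γ q)))
        = (fun q => F q.1 / dmp γ q) + fun q => F q.1 * starRingEnd ℂ (1 / dmp γ q) := by
      ext q; simp only [Pi.add_apply]; ring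
    rw [e2]
    exact (((measurable_from_top (f := F)).comp measurable_fst).div
      (measurable_dmp γ)).aestronglyMeasurable.add hconj
  · refine (XN_div_dmp_le hγ le_rfl zero_le_one b m _).trans ?_
    rw [neg_zero, Real.rpow_zero, ENNReal.ofReal_one, one_mul]
    exact XN_mono (by linarith) (fun _ => le_rfl) _

/-- The difference of two solutions has an extension in `X_{b,s}`, with norm bounded by the
difference of the data. The constant depends only on the size of the data in `L²`. -/
theorem IsExponent.exists_extension (hC : IsExponent β C) {b : ℝ} (hb0 : 0 ≤ b)
    (hb1 : b ≤ 1 - β) (Λ A K : ℝ≥0) {χ : ℝ → ℝ} (hχ : ContDiff ℝ (⊤ : ℕ∞) χ)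
    (hχc : HasCompactSupport χ) {τ lam : ℝ} (hχτ : ∀ t, τ ≤ t → χ t = 0) {B D₀ : ℝ≥0∞}
    (hB : B ≠ ⊤) (hD₀ : D₀ ≠ ⊤) :
    ∃ E : ℝ≥0∞, E ≠ ⊤ ∧ ∀ {c : ℝ × Torus → ℝ}, IsCoeff Λ (fun t => lam * χ t ^ 2) c →
      (∀ x, x.1 ∉ Ioo 0 τ → c x = 0) → ∀ {f f' : ℤ → ℂ} {g g' u u' : ℝ × Torus → ℂ},
      l2n 1 f + eLpNorm g 2 vol ≤ D₀ → l2n 1 f' + eLpNorm g' 2 vol ≤ D₀ →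
      SuppIn τ g → MemLp g 2 vol → SuppIn τ g' → MemLp g' 2 vol →
      IsNLS τ f (fun t => lam * χ t ^ 2) c g u → IsNLS τ f' (fun t => lam * χ t ^ 2) c g' u' →
      eLpNorm u 4 vol ≤ B → eLpNorm u' 4 vol ≤ B →
      ∃ Z Y, FT Z Y ∧ (∀ᵐ x ∂vol, 0 < x.1 → Z x = χ x.1 * (u x - u' x)) ∧
        ∀ m M, IsWeight A m → IsMulBound K m c → (∀ k, |m k| ≤ M) →
          XN b m Y ≤ E * (l2n m (f - f') + XN 0 m (hat (g - g'))
            + (l2n 1 (f - f') + eLpNorm (g - g') 2 vol)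
              * (l2n m f + l2n m f' + (XN 0 m (hat g) + XN 0 m (hat g')))) := by
  have hβ := hC.lt_half
  have hβ5 := hC.five_lt
  obtain ⟨D, hD, hcut⟩ := hC.exists_XN_cutoff_le Λ hχ hχc (lam := lam) hχτ hB
  set V := D * D₀
  have hVt : V ≠ ⊤ := ENNReal.mul_ne_top hD hD₀
  set κ := ‖(lam : ℂ)‖ₑ * (ENNReal.ofReal (2 * Real.pi) * A * C)
  have hκ : κ ≠ ⊤ := ENNReal.mul_ne_top enorm_ne_top
    (ENNReal.mul_ne_top (ENNReal.mul_ne_top ENNReal.ofReal_ne_top (by simp)) hC.ne_top)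
  set P := 3 * κ * V ^ 2 + K
  set Q := 3 * κ * V
  have hP : P ≠ ⊤ := by finiteness
  have hQ : Q ≠ ⊤ := by finiteness
  obtain ⟨γ, hγ, hε⟩ := exists_gamma_le (θ := 1 - 2 * β) (by linarith) (X := P + Q * V) (ε := 2⁻¹)
    (by finiteness) (by norm_num)
  set ε := ENNReal.ofReal (γ ^ (-(1 - 2 * β)))
  have hε1 : ε ≤ 1 := ofReal_rpow_neg_le_one hγ (by linarith)
  obtain ⟨ρ, hρ⟩ := exists_schwartz hχ hχc γ
  have hρc : ∀ t, starRingEnd ℂ (ρ t) = ρ t := fun t => by rw [hρ, Complex.conj_ofReal]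
  set fc := freeConst β
  have hfc : fc ≠ ⊤ := freeConst_ne_top hβ
  set fb := ‖((2 * γ : ℝ) : ℂ)‖ₑ * freeConst (b - 1)
  have hfb : fb ≠ ⊤ := ENNReal.mul_ne_top enorm_ne_top (freeConst_ne_top (by linarith))
  have hMb := multConst_ne_top (b := b) (by linarith) ρ
  refine ⟨multConst b ρ * ((2 * P + 1) * (fc + 1) + (4 * P * Q + 2 * Q) * D * (fc + 1) + fb),
    by finiteness, ?_⟩
  intro c hL hc f f' g g' u u' hD₁ hD₁' hgs hg hgs' hg' hu hu' huB huB'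
  have hf : l2n 1 f ≠ ⊤ := ne_top_of_le_ne_top hD₀ (le_self_add.trans hD₁)
  have hf' : l2n 1 f' ≠ ⊤ := ne_top_of_le_ne_top hD₀ (le_self_add.trans hD₁')
  obtain ⟨z, hz, hzu⟩ := hC.exists_lift hγ hχτ hρ hL hc hf hgs hg hu
  obtain ⟨z', hz', hzu'⟩ := hC.exists_lift hγ hχτ hρ hL hc hf' hgs' hg' hu'
  set w := dampedHat γ f (gauge γ (cut τ (forcing (fun t => lam * χ t ^ 2) c g u)))
  set w' := dampedHat γ f' (gauge γ (cut τ (forcing (fun t => lam * χ t ^ 2) c g' u')))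
  set H := gauge γ (cut τ (forcing (fun t => lam * χ t ^ 2) c g u))
  set H' := gauge γ (cut τ (forcing (fun t => lam * χ t ^ 2) c g' u'))
  obtain ⟨Z, Y, hZ, hZe, hZb⟩ := hz.exists_extension hγ hz' (l2n_sub_ne_top hf hf')
  refine ⟨Z, Y, hZ, ?_, fun m M hm hK hM => ?_⟩
  · filter_upwards [hZe, hzu, hzu'] with x h1 h2 h3 h0
    rw [h1 h0, mul_sub, h2, h3, mul_sub]
  -- the norms of the time localized solutions
  have hz0 := isLift_zero β γ ρ lam c
  have hf0 : l2n 1 (0 : ℤ → ℂ) ≠ ⊤ := by simp [l2n]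
  have hV : XN β 1 (tmul ρ w) ≤ V := by
    have := hcut hL hc hf hf0 hgs hg (g' := 0) (fun _ _ => rfl) MemLp.zero hu (isNLS_zero τ _ c) huB
      (by simp) (tmul ρ w) ((hz.ft.time_mul ρ).congr_left (by simpa using hzu))
    rw [sub_zero, sub_zero] at this
    exact this.trans (mul_le_mul' le_rfl hD₁)
  have hV' : XN β 1 (tmul ρ w') ≤ V := by
    have := hcut hL hc hf' hf0 hgs' hg' (g' := 0) (fun _ _ => rfl) MemLp.zero hu' (isNLS_zero τ _ c)
      huB' (by simp) (tmul ρ w') ((hz'.ft.time_mul ρ).congr_left (by simpa using hzu'))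
    rw [sub_zero, sub_zero] at this
    exact this.trans (mul_le_mul' le_rfl hD₁')
  have hVd : XN β 1 (tmul ρ (w - w')) ≤ D * (l2n 1 (f - f') + eLpNorm (g - g') 2 vol) := by
    refine hcut hL hc hf hf' hgs hg hgs' hg' hu hu' huB huB' _
      (((hz.ft.sub hz'.ft).time_mul ρ).congr_left ?_)
    filter_upwards [hzu, hzu'] with x h1 h2
    rw [Pi.sub_apply, mul_sub, h1, h2, mul_sub]
  have h00 : tmul ρ (0 : ℤ × ℝ → ℂ) = 0 := by simpa using tmul_sub ρ hz.ft.memLp_right hz.ft.memLp_right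
  have hV0 : XN β 1 (tmul ρ (0 : ℤ × ℝ → ℂ)) ≤ V := by rw [h00]; simp [XN]
  have hX0 : XN β m (0 : ℤ × ℝ → ℂ) = 0 := by simp [XN]
  have hXt : ∀ {y}, XN β 1 y ≠ ⊤ → XN β m y ≠ ⊤ := fun hy =>
    ne_top_of_le_ne_top (ENNReal.mul_ne_top enorm_ne_top hy) (XN_le_mul_one hM _)
  have hγ0 : 0 ≤ γ := by linarith
  have hX : ∀ {f : ℤ → ℂ} {g z H : ℝ × Torus → ℂ} {w : ℤ × ℝ → ℂ}, SuppIn τ g → MemLp g 2 vol →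
      IsLift β γ ρ lam c f g z w H → XN β 1 (tmul ρ w) ≤ V →
      XN β m w ≤ 2 * (fc * l2n m f + XN 0 m (hat g)) := by
    intro f g z H w hgs hg hz hV
    refine le_two_mul_of_le_add_half (hXt hz.ne_top) ?_
    have h1 := hz.XN_hat_sub_le hC hm hρc hK hL hc hγ0 hgs hg (g' := 0) (fun _ _ => rfl) MemLp.zero
      hz0 (hXt hz.ne_top) (by simp [hX0]) hV hV0
    rw [sub_zero, sub_zero, sub_zero, hX0, add_zero] at h1
    have h2 : XN β m w ≤ fc * l2n m f + ε * XN (-β) m (hat H) := by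
      rw [hz.w_eq]; exact XN_dampedHat_le (by linarith) hβ hγ m f hz.integrable
    set x := XN β m w
    calc x ≤ fc * l2n m f + ε * (P * x + Q * V * x + XN 0 m (hat g)) := by
          refine h2.trans ?_
          gcongr
          exact h1.trans (by gcongr)
      _ = fc * l2n m f + ε * XN 0 m (hat g) + ε * (P + Q * V) * x := by ring
      _ ≤ fc * l2n m f + 1 * XN 0 m (hat g) + 2⁻¹ * x := by gcongr
      _ = _ := by rw [one_mul]
  have x1 := hX hgs hg hz hV
  have x2 := hX hgs' hg' hz' hV'
  have hN := hz.XN_hat_sub_le hC hm hρc hK hL hc hγ0 hgs hg hgs' hg' hz' (hXt hz.ne_top)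
    (hXt hz'.ne_top) hV hV'
  have hxd : XN β m (w - w') ≤ fc * l2n m (f - f') + ε * XN (-β) m (hat (H - H')) := by
    rw [hz.sub_eq hz']
    exact XN_dampedHat_le (by linarith) hβ hγ m _ (hz.integrable.sub hz'.integrable)
  have hxt : XN β m (w - w') ≠ ⊤ := hXt (ne_top_of_le_ne_top
    (ENNReal.add_ne_top.2 ⟨hz.ne_top, hz'.ne_top⟩) (XN_sub_le hz.ft.memLp_right.1 hz'.ft.memLp_right.1))
  have hY := hZb b m hb0 hb1 (by linarith)
  set X := XN β m w
  set X' := XN β m w'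
  set Xd := XN β m (w - w')
  set Vd := XN β 1 (tmul ρ (w - w'))
  set δ := l2n 1 (f - f') + eLpNorm (g - g') 2 vol
  set ad := l2n m (f - f')
  set gd := XN 0 m (hat (g - g'))
  set S := l2n m f + l2n m f' + (XN 0 m (hat g) + XN 0 m (hat g')) with hS
  set N := XN (-β) m (hat (H - H'))
  have hXX : X + X' ≤ 2 * ((fc + 1) * S) := by
    refine (add_le_add x1 x2).trans ?_
    calc 2 * (fc * l2n m f + XN 0 m (hat g)) + 2 * (fc * l2n m f' + XN 0 m (hat g'))
        = 2 * (fc * (l2n m f + l2n m f') + (XN 0 m (hat g) + XN 0 m (hat g'))) := by ring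
      _ ≤ 2 * (fc * S + S) := by
          gcongr
          · exact le_self_add
          · exact le_add_self
      _ = _ := by ring
  have hN2 : N ≤ P * Xd + Q * (D * δ) * (2 * ((fc + 1) * S)) + gd := hN.trans (by gcongr)
  have hXd : Xd ≤ 2 * (fc * ad + gd + Q * (D * δ) * (2 * ((fc + 1) * S))) := by
    refine le_two_mul_of_le_add_half hxt ?_
    calc Xd ≤ fc * ad + ε * (P * Xd + Q * (D * δ) * (2 * ((fc + 1) * S)) + gd) := hxd.trans (by gcongr)
      _ = fc * ad + ε * (gd + Q * (D * δ) * (2 * ((fc + 1) * S))) + ε * P * Xd := by ring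
      _ ≤ fc * ad + 1 * (gd + Q * (D * δ) * (2 * ((fc + 1) * S))) + 2⁻¹ * Xd := by
          gcongr
          exact le_trans (by gcongr; exact le_self_add) hε
      _ = _ := by ring
  have hF : fc * ad + gd ≤ (fc + 1) * (ad + gd) := by
    calc fc * ad + gd ≤ fc * (ad + gd) + (ad + gd) := by
          gcongr
          · exact le_self_add
          · exact le_add_self
      _ = _ := by ring
  have hgd : gd ≤ (fc + 1) * (ad + gd) := le_add_self.trans hF
  refine hY.trans ?_
  rw [mul_assoc (multConst b ρ)]
  refine mul_le_mul' le_rfl ?_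
  calc N + ‖((2 * γ : ℝ) : ℂ)‖ₑ * (freeConst (b - 1) * ad)
      ≤ P * (2 * ((fc + 1) * (ad + gd) + Q * (D * δ) * (2 * ((fc + 1) * S))))
        + Q * (D * δ) * (2 * ((fc + 1) * S)) + (fc + 1) * (ad + gd)
        + ‖((2 * γ : ℝ) : ℂ)‖ₑ * (freeConst (b - 1) * ad) := by
        gcongr
        refine hN2.trans ?_
        gcongr
        exact hXd.trans (by gcongr)
    _ = ((2 * P + 1) * (fc + 1)) * (ad + gd) + ((4 * P * Q + 2 * Q) * D * (fc + 1)) * (δ * S)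
        + fb * ad := by ring
    _ ≤ ((2 * P + 1) * (fc + 1)) * (ad + gd + δ * S)
        + ((4 * P * Q + 2 * Q) * D * (fc + 1)) * (ad + gd + δ * S) + fb * (ad + gd + δ * S) := by
        exact add_le_add (add_le_add (mul_le_mul' le_rfl le_self_add) (mul_le_mul' le_rfl le_add_self))
          (mul_le_mul' le_rfl (le_self_add.trans le_self_add))
    _ = _ := by ring

/-! ### Smooth functions on space-time -/

/-- Smooth functions on `ℝ × 𝕋`. -/
def IsSmooth (θ : ℝ × Torus → ℂ) : Prop :=
  ContDiff ℝ (⊤ : ℕ∞) fun z : ℝ × ℝ => θ (z.1, (z.2 : Torus))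

theorem IsSmooth.slice {θ : ℝ × Torus → ℂ} (h : IsSmooth θ) (t : ℝ) :
    ContDiff ℝ (⊤ : ℕ∞) fun x : ℝ => θ (t, (x : Torus)) :=
  ContDiff.comp (g := fun z : ℝ × ℝ => θ (z.1, (z.2 : Torus))) h (contDiff_const.prodMk contDiff_id)

theorem IsSmooth.continuous {θ : ℝ × Torus → ℂ} (h : IsSmooth θ) : Continuous θ :=
  (IsOpenQuotientMap.id.prodMap (QuotientAddGroup.isOpenQuotientMap_mk
    (N := AddSubgroup.zmultiples (2 * Real.pi)))).continuous_comp_iff.1 (ContDiff.continuous h)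

theorem IsSmooth.hasDerivAt_dt {θ : ℝ × Torus → ℂ} (h : IsSmooth θ) (t : ℝ) (x : Torus) :
    HasDerivAt (fun r => θ (r, x)) (dt θ t x) t := by
  induction x using QuotientAddGroup.induction_on with
  | H x =>
    have h1 : ContDiff ℝ (⊤ : ℕ∞) fun r : ℝ => θ (r, ((x : ℝ) : Torus)) :=
      ContDiff.comp (g := fun z : ℝ × ℝ => θ (z.1, (z.2 : Torus))) h (contDiff_id.prodMk contDiff_const)
    exact ((h1.differentiable (by simp)) t).hasDerivAt

theorem contDiff_deriv_fst {F : ℝ × ℝ → ℂ} (hF : ContDiff ℝ (⊤ : ℕ∞) F) :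
    ContDiff ℝ (⊤ : ℕ∞) fun z : ℝ × ℝ => deriv (fun r => F (r, z.2)) z.1 := by
  have e : (fun z : ℝ × ℝ => deriv (fun r => F (r, z.2)) z.1) = fun z => fderiv ℝ F z (1, 0) := by
    ext z
    have h1 := ((hF.differentiable (by simp)) z).hasFDerivAt
    have h2 : HasDerivAt (fun r : ℝ => (r, z.2)) ((1 : ℝ), (0 : ℝ)) z.1 :=
      (hasDerivAt_id z.1).prodMk (hasDerivAt_const z.1 z.2)
    exact (h1.comp_hasDerivAt z.1 h2).deriv
  rw [e]
  exact (hF.fderiv_right (m := (⊤ : ℕ∞)) (by simp)).clm_apply contDiff_const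

theorem IsSmooth.dt {θ : ℝ × Torus → ℂ} (h : IsSmooth θ) : IsSmooth fun z => dt θ z.1 z.2 :=
  contDiff_deriv_fst h

theorem IsSmooth.dx {θ : ℝ × Torus → ℂ} (h : IsSmooth θ) (n : ℕ) : IsSmooth fun z => dx n θ z.1 z.2 := by
  have e : ∀ n (z : ℝ × ℝ), FourthOrderNLS.dx n θ z.1 (z.2 : Torus)
      = iteratedDeriv n (fun y : ℝ => θ (z.1, (y : Torus))) z.2 := fun n z =>
    tderiv_coe n (fun x => θ (z.1, x)) z.2
  rw [IsSmooth]
  simp only [e]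
  induction n with
  | zero => simp only [iteratedDeriv_zero]; exact h
  | succ n ih =>
    simp only [iteratedDeriv_succ]
    have h1 := contDiff_deriv_fst (ih.comp (contDiff_snd.prodMk contDiff_fst))
    exact h1.comp (contDiff_snd.prodMk contDiff_fst)

theorem IsSmooth.add {θ θ' : ℝ × Torus → ℂ} (h : IsSmooth θ) (h' : IsSmooth θ') :
    IsSmooth fun z => θ z + θ' z := ContDiff.add h h'

theorem IsSmooth.const_mul {θ : ℝ × Torus → ℂ} (h : IsSmooth θ) (c : ℂ) :
    IsSmooth fun z => c * θ z := ContDiff.mul contDiff_const h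

/-- The function `t ↦ ∫ e_k θ(t, x) dx`. -/
def fint (θ : ℝ × Torus → ℂ) (k : ℤ) (t : ℝ) : ℂ := ∫ x : Torus, fourier k x * θ (t, x)

theorem continuous_fint {θ : ℝ × Torus → ℂ} (h : Continuous θ) (k : ℤ) : Continuous (fint θ k) :=
  continuous_parametric_integral_of_continuous (μ := (volume : Measure Torus))
    (f := fun (t : ℝ) (x : Torus) => fourier k x * θ (t, x)) (by fun_prop) isCompact_univ |>.congr
      fun t => by simp [fint]

theorem norm_fourier_apply (k : ℤ) (x : Torus) : ‖(fourier k x : ℂ)‖ = 1 := by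
  rw [fourier_apply, Circle.norm_coe]

theorem exists_bound_of_continuous {θ : ℝ × Torus → ℂ} (h : Continuous θ) (a b : ℝ) :
    ∃ C, 0 ≤ C ∧ ∀ t ∈ Icc a b, ∀ x, ‖θ (t, x)‖ ≤ C := by
  obtain ⟨C, hC⟩ := (isCompact_Icc.prod (isCompact_univ (X := Torus))).exists_bound_of_continuousOn
    (s := Icc a b ×ˢ univ) h.continuousOn
  exact ⟨max C 0, le_max_right _ _, fun t ht x => (hC (t, x) ⟨ht, mem_univ _⟩).trans (le_max_left _ _)⟩

theorem IsSmooth.hasDerivAt_fint {θ : ℝ × Torus → ℂ} (h : IsSmooth θ) (k : ℤ) (t : ℝ) :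
    HasDerivAt (fint θ k) (fint (fun z => FourthOrderNLS.dt θ z.1 z.2) k t) t := by
  obtain ⟨C, -, hC⟩ := exists_bound_of_continuous h.dt.continuous (t - 1) (t + 1)
  have hc : ∀ t, Continuous fun x : Torus => (fourier k x : ℂ) * θ (t, x) := fun t =>
    (fourier k).continuous.mul (h.continuous.comp (by fun_prop))
  have hc' : ∀ t, Continuous fun x : Torus => (fourier k x : ℂ) * FourthOrderNLS.dt θ t x := fun t =>
    (fourier k).continuous.mul (h.dt.continuous.comp (f := fun x => (t, x)) (by fun_prop))
  refine (hasDerivAt_integral_of_dominated_loc_of_deriv_le (bound := fun _ => C)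
    (F := fun t x => (fourier k x : ℂ) * θ (t, x))
    (F' := fun t x => (fourier k x : ℂ) * FourthOrderNLS.dt θ t x)
    (Icc_mem_nhds (show t - 1 < t by linarith) (show t < t + 1 by linarith))
    (Eventually.of_forall fun t => (hc t).aestronglyMeasurable)
    ((hc t).integrable_of_hasCompactSupport (HasCompactSupport.of_compactSpace _))
    (hc' t).aestronglyMeasurable (ae_of_all _ fun x r hr => ?_) (integrable_const C)
    (ae_of_all _ fun x r _ => (h.hasDerivAt_dt r x).const_mul _)).2
  rw [norm_mul, norm_fourier_apply, one_mul]
  exact hC r hr x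

theorem IsSmooth.fint_dx {θ : ℝ × Torus → ℂ} (h : IsSmooth θ) (n : ℕ) (k : ℤ) (t : ℝ) :
    fint (fun z => FourthOrderNLS.dx n θ z.1 z.2) k t = (-(Complex.I * k)) ^ n * fint θ k t :=
  integral_fourier_mul_tderiv (f := fun x => θ (t, x)) (h.slice t) n k

theorem norm_integral_torus_le {F : Torus → ℂ} {C : ℝ} (h : ∀ x, ‖F x‖ ≤ C) :
    ‖∫ x, F x‖ ≤ C * (2 * Real.pi) := by
  refine (norm_integral_le_of_norm_le_const (C := C) (ae_of_all _ h)).trans_eq ?_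
  simp [Measure.real, AddCircle.measure_univ, Real.pi_pos.le]

theorem IsSmooth.exists_norm_fint_le {θ : ℝ × Torus → ℂ} (h : IsSmooth θ) (a b : ℝ) :
    ∃ C, 0 ≤ C ∧ ∀ t ∈ Icc a b, ∀ k : ℤ, ‖fint θ k t‖ ≤ C * (1 + (k : ℝ) ^ 2)⁻¹ := by
  obtain ⟨C₀, h0, hC₀⟩ := exists_bound_of_continuous h.continuous a b
  obtain ⟨C₂, h2, hC₂⟩ := exists_bound_of_continuous (h.dx 2).continuous a b
  refine ⟨(C₀ + C₂) * (2 * Real.pi), by positivity, fun t ht k => ?_⟩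
  have e0 : ‖fint θ k t‖ ≤ C₀ * (2 * Real.pi) := norm_integral_torus_le fun x => by
    rw [norm_mul, norm_fourier_apply, one_mul]; exact hC₀ t ht x
  have e2 : ‖fint (fun z => FourthOrderNLS.dx 2 θ z.1 z.2) k t‖ ≤ C₂ * (2 * Real.pi) :=
    norm_integral_torus_le fun x => by
      rw [norm_mul, norm_fourier_apply, one_mul]; exact hC₂ t ht x
  rw [h.fint_dx, norm_mul, norm_pow, norm_neg, norm_mul, Complex.norm_I, one_mul, Complex.norm_intCast,
    sq_abs] at e2
  rw [← div_eq_mul_inv, le_div_iff₀ (by positivity)]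
  linarith

/-! ### Parseval's identity with a smooth function -/

theorem hasSum_fint {G : ℝ × Torus → ℂ} (hG : IsSmooth G) (t : ℝ) (x : Torus) :
    HasSum (fun k : ℤ => ((2 * Real.pi)⁻¹ : ℝ) * fint G k t * fourier (-k) x) (G (t, x)) := by
  have hc : Continuous fun x => G (t, x) := hG.continuous.comp (by fun_prop)
  obtain ⟨C, -, hC⟩ := hG.exists_norm_fint_le t t
  have e : ∀ k, fourierCoeff (fun x => G (t, x)) k = ((2 * Real.pi)⁻¹ : ℝ) * fint G (-k) t := fun k => by
    rw [fourierCoeff_eq_integral, fint]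
  have hs : Summable (fourierCoeff fun x => G (t, x)) := by
    refine Summable.of_norm_bounded (g := fun k : ℤ => (2 * Real.pi)⁻¹ * (C * (1 + (k : ℝ) ^ 2)⁻¹))
      ((summable_one_add_sq_inv.mul_left _).mul_left _) fun k => ?_
    have h1 := hC t ⟨le_rfl, le_rfl⟩ (-k)
    rw [e, norm_mul, Complex.norm_real, Real.norm_of_nonneg (by positivity)]
    push_cast at h1
    rw [neg_sq] at h1
    gcongr
  have h1 := has_pointwise_sum_fourier_series_of_summable (f := ⟨fun x => G (t, x), hc⟩) hs x
  rw [← (Equiv.neg ℤ).hasSum_iff] at h1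
  refine h1.congr_fun fun k => ?_
  simp only [Function.comp_apply, Equiv.neg_apply, ContinuousMap.coe_mk, smul_eq_mul]
  rw [e, neg_neg]

theorem hasSum_integral_coef_mul_fint {G v : ℝ × Torus → ℂ} (hG : IsSmooth G) {T : ℝ}
    (hv : Integrable v ((volume.restrict (Ioo 0 T)).prod volume)) :
    HasSum (fun k => ∫ t in Ioo 0 T, coef v k t * fint G k t)
      (∫ t in Ioo 0 T, ∫ x, v (t, x) * G (t, x)) := by
  obtain ⟨C, hC0, hC⟩ := hG.exists_norm_fint_le 0 T
  set μ : Measure (ℝ × Torus) := (volume.restrict (Ioo 0 T)).prod volume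
  set F : ℤ → ℝ × Torus → ℂ := fun k z =>
    ((2 * Real.pi)⁻¹ : ℝ) * fint G k z.1 * fourier (-k) z.2 * v z with hF
  have hmem : ∀ᵐ z ∂μ, z.1 ∈ Ioo 0 T := by
    have h1 : ∀ᵐ t ∂(volume.restrict (Ioo 0 T)), t ∈ Ioo 0 T := ae_restrict_mem measurableSet_Ioo
    exact Measure.quasiMeasurePreserving_fst.ae h1
  have hb : ∀ k, ∀ᵐ z ∂μ, ‖F k z‖ ≤ (2 * Real.pi)⁻¹ * (C * (1 + (k : ℝ) ^ 2)⁻¹) * ‖v z‖ := fun k => by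
    filter_upwards [hmem] with z hz
    rw [hF]
    simp only
    rw [norm_mul, norm_mul, norm_mul, norm_fourier_apply, mul_one, Complex.norm_real,
      Real.norm_of_nonneg (by positivity)]
    gcongr
    exact hC _ (Ioo_subset_Icc_self hz) k
  have hm : ∀ k, AEStronglyMeasurable (F k) μ := fun k =>
    (Continuous.aestronglyMeasurable (by
      have := continuous_fint hG.continuous k
      fun_prop)).mul hv.1
  have hi : ∀ k, Integrable (F k) μ := fun k => (hv.norm.const_mul _).mono' (hm k) (hb k)
  have h := hasSum_integral_of_summable_integral_norm hi (by
    refine ((((summable_one_add_sq_inv.mul_left C).mul_left (2 * Real.pi)⁻¹)).mul_right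
      (∫ z, ‖v z‖ ∂μ)).of_nonneg_of_le (fun k => integral_nonneg fun _ => norm_nonneg _) fun k => ?_
    rw [← integral_const_mul]
    exact integral_mono_ae (hi k).norm (hv.norm.const_mul _) (hb k))
  have e1 : ∀ k, ∫ z, F k z ∂μ = ∫ t in Ioo 0 T, coef v k t * fint G k t := fun k => by
    rw [integral_prod _ (hi k)]
    congr 1; ext t
    rw [coef, fourierCoeff_eq_integral]
    simp only [hF]
    simp_rw [mul_assoc]
    rw [integral_const_mul, integral_const_mul]; ring
  have e2 : ∫ z, ∑' k, F k z ∂μ = ∫ t in Ioo 0 T, ∫ x, v (t, x) * G (t, x) := by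
    have e3 : ∀ z, ∑' k, F k z = v z * G z := fun z => by
      rw [((hasSum_fint hG z.1 z.2).mul_right (v z)).tsum_eq, mul_comm]
    simp_rw [e3]
    obtain ⟨D, hD0, hD⟩ := exists_bound_of_continuous hG.continuous 0 T
    refine integral_prod (fun z => v z * G z) (hv.mul_bdd (c := D) hG.continuous.aestronglyMeasurable ?_)
    filter_upwards [hmem] with z hz
    exact hD _ (Ioo_subset_Icc_self hz) _
  rw [e2] at h
  simpa only [e1] using h

/-! ### Integration by parts for the mild formulation -/

theorem integral_primitive_mul_deriv {T : ℝ} (hT : 0 ≤ T) {q η η' : ℝ → ℂ}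
    (hq : IntegrableOn q (Ioc 0 T)) (hη : ∀ t, HasDerivAt η (η' t) t) (hη' : Continuous η')
    (h0 : η T = 0) (c : ℂ) :
    ∫ t in (0 : ℝ)..T, (c + ∫ r in (0 : ℝ)..t, q r) * η' t
      = -(c * η 0) - ∫ t in (0 : ℝ)..T, q t * η t := by
  set μ := (volume : Measure ℝ).restrict (Ioc 0 T)
  have hηi : ∀ a b, IntervalIntegrable η' volume a b := fun a b => hη'.intervalIntegrable a b
  have hη'i : Integrable η' μ := (intervalIntegrable_iff_integrableOn_Ioc_of_le hT).1 (hηi 0 T)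
  have hint : Integrable (fun z : ℝ × ℝ => {z : ℝ × ℝ | z.2 < z.1}.indicator
      (fun z => η' z.1 * q z.2) z) (μ.prod μ) :=
    (hη'i.mul_prod hq).indicator (measurableSet_lt measurable_snd measurable_fst)
  have hsw := integral_integral_swap (f := fun t r => {z : ℝ × ℝ | z.2 < z.1}.indicator
      (fun z => η' z.1 * q z.2) (t, r)) hint
  have e1 : ∀ t ∈ Ioc 0 T, ∫ r, {z : ℝ × ℝ | z.2 < z.1}.indicator (fun z => η' z.1 * q z.2) (t, r) ∂μ
      = (∫ r in (0 : ℝ)..t, q r) * η' t := fun t ht => by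
    rw [intervalIntegral.integral_of_le ht.1.le,
      (integral_Ioc_eq_integral_Ioo : ∫ r in Ioc 0 t, q r = ∫ r in Ioo 0 t, q r), ← integral_mul_const,
      ← integral_indicator measurableSet_Ioo, ← integral_indicator measurableSet_Ioc]
    congr 1; ext r
    by_cases hr : r ∈ Ioo 0 t
    · rw [indicator_of_mem (show r ∈ Ioc 0 T from ⟨hr.1, hr.2.le.trans ht.2⟩),
        indicator_of_mem (show (t, r) ∈ {z : ℝ × ℝ | z.2 < z.1} from hr.2), indicator_of_mem hr,
        mul_comm]
    · rw [indicator_of_notMem hr]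
      by_cases hr2 : r ∈ Ioc 0 T
      · rw [indicator_of_mem hr2, indicator_of_notMem]
        exact fun h => hr ⟨hr2.1, h⟩
      · rw [indicator_of_notMem hr2]
  have e2 : ∀ r ∈ Ioc 0 T, ∫ t, {z : ℝ × ℝ | z.2 < z.1}.indicator (fun z => η' z.1 * q z.2) (t, r) ∂μ
      = -(q r * η r) := fun r hr => by
    have h3 := intervalIntegral.integral_eq_sub_of_hasDerivAt (fun x _ => hη x) (hηi r T)
    rw [h0, zero_sub, intervalIntegral.integral_of_le hr.2] at h3
    rw [← mul_neg, ← h3, mul_comm, ← integral_mul_const, ← integral_indicator measurableSet_Ioc,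
      ← integral_indicator measurableSet_Ioc]
    congr 1; ext t
    by_cases ht : t ∈ Ioc r T
    · rw [indicator_of_mem ht, indicator_of_mem (show t ∈ Ioc 0 T from ⟨hr.1.trans ht.1, ht.2⟩),
        indicator_of_mem (show (t, r) ∈ {z : ℝ × ℝ | z.2 < z.1} from ht.1)]
    · rw [indicator_of_notMem ht]
      by_cases ht2 : t ∈ Ioc 0 T
      · rw [indicator_of_mem ht2, indicator_of_notMem]
        exact fun h => ht ⟨h, ht2.2⟩
      · rw [indicator_of_notMem ht2]
  rw [setIntegral_congr_fun measurableSet_Ioc e1, setIntegral_congr_fun measurableSet_Ioc e2,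
    integral_neg] at hsw
  have hP : IntegrableOn (fun t => (∫ r in (0 : ℝ)..t, q r) * η' t) (Ioc 0 T) :=
    hint.integral_prod_left.congr (by
      filter_upwards [ae_restrict_mem measurableSet_Ioc] with t ht using e1 t ht)
  rw [intervalIntegral.integral_of_le hT, intervalIntegral.integral_of_le hT]
  simp_rw [add_mul]
  rw [integral_add (hη'i.const_mul c) hP, hsw, integral_const_mul, ← intervalIntegral.integral_of_le hT,
    intervalIntegral.integral_eq_sub_of_hasDerivAt (fun x _ => hη x) (hηi 0 T), h0]
  ring

theorem integral_mildCoef_mul {T : ℝ} (hT : 0 ≤ T) (f : ℤ → ℂ) {h : ℝ × Torus → ℂ}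
    (hh : Integrable h vol) (k : ℤ) {ψ ψ' : ℝ → ℂ} (hψ : ∀ t, HasDerivAt ψ (ψ' t) t)
    (hψ' : Continuous ψ') (h0 : ψ T = 0) :
    ∫ t in (0 : ℝ)..T, mildCoef f h k t * (ψ' t - Complex.I * symb k * ψ t)
      = -(f k * ψ 0) - ∫ t in (0 : ℝ)..T, coef h k t * ψ t := by
  have hc : Continuous ψ := continuous_iff_continuousAt.2 fun t => (hψ t).continuousAt
  have hE : ∀ t : ℝ, HasDerivAt (fun t : ℝ => Complex.exp (-(Complex.I * symb k * t)))
      (Complex.exp (-(Complex.I * symb k * t)) * -(Complex.I * symb k)) t := fun t => by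
    have h1 : HasDerivAt (fun t : ℝ => -(Complex.I * symb k * (t : ℂ))) (-(Complex.I * symb k)) t := by
      exact ((Complex.ofRealCLM.hasDerivAt (x := t)).const_mul (Complex.I * symb k)).neg.congr_deriv
        (by simp)
    exact h1.cexp
  have hi := (intervalIntegrable_iff_integrableOn_Ioc_of_le hT).1
    (intervalIntegrable_exp_mul (integrable_coef hh k) (symb k) 0 T)
  have key := integral_primitive_mul_deriv hT hi
    (η := fun t => Complex.exp (-(Complex.I * symb k * t)) * ψ t)
    (η' := fun t => Complex.exp (-(Complex.I * symb k * t)) * -(Complex.I * symb k) * ψ t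
      + Complex.exp (-(Complex.I * symb k * t)) * ψ' t)
    (fun t => (hE t).mul (hψ t)) (by fun_prop) (by simp [h0]) (f k)
  simp only [Complex.ofReal_zero, mul_zero, neg_zero, Complex.exp_zero, one_mul] at key
  convert key using 1
  · congr 1; ext t; rw [mildCoef]; ring
  · congr 2; ext t
    have : Complex.exp (Complex.I * symb k * t) * Complex.exp (-(Complex.I * symb k * t)) = 1 := by
      rw [← Complex.exp_add]; simp
    linear_combination (-(coef h k t * ψ t)) * this

/-! ### Weak solutions are mild solutions -/

/-- Weak solutions, with the coefficient `c` in place of `φ²(t) a²(x)`. -/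
structure IsWeak (S lam : ℝ) (c : ℝ × Torus → ℝ) (u₀ : Torus → ℂ) (g u : ℝ × Torus → ℂ) : Prop where
  integrable_cubic : Integrable (fun z => ((‖u z‖ ^ 2 : ℝ) : ℂ) * u z) (slab (uIoo 0 S))
  weak_eq : ∀ θ : ℝ × Torus → ℂ, IsTestFunction S θ →
    ∫ t in (0 : ℝ)..S, ∫ x : Torus,
      (u (t, x) * (-Complex.I * dt θ t x + dx 2 θ t x - dx 4 θ t x)
        + (Complex.I * (c (t, x) : ℂ) * u (t, x)
          - (lam : ℂ) * (((‖u (t, x)‖ ^ 2 : ℝ) : ℂ) * u (t, x)) - g (t, x)) * θ (t, x))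
    = Complex.I * ∫ x : Torus, u₀ x * θ (0, x)

theorem isSolution_iff {S lam : ℝ} {a : Torus → ℝ} {φ : ℝ → ℝ} {u₀ : Torus → ℂ}
    {g u : ℝ × Torus → ℂ} : IsSolution S lam a φ u₀ g u ↔
      IsWeak S lam (fun z => φ z.1 ^ 2 * a z.2 ^ 2) u₀ g u :=
  ⟨fun h => ⟨h.1, h.2⟩, fun h => ⟨h.1, h.2⟩⟩

theorem hasSum_fourierCoeff_mul_fint {u₀ : Torus → ℂ} (hu : Integrable u₀) {θ : ℝ × Torus → ℂ}
    (hθ : IsSmooth θ) :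
    HasSum (fun k => fourierCoeff u₀ k * fint θ k 0) (∫ x, u₀ x * θ (0, x)) := by
  have hG : IsSmooth fun z => θ (0, z.2) := ContDiff.comp (g := fun x : ℝ => θ (0, (x : Torus)))
    (hθ.slice 0) contDiff_snd
  have h := hasSum_integral_coef_mul_fint hG (T := 1) (v := fun z => u₀ z.2) (hu.comp_snd _)
  simpa [coef, fint] using h

theorem hasSum_weak {T lam : ℝ} (hT : 0 ≤ T) {c : ℝ × Torus → ℝ} {g u : ℝ × Torus → ℂ}
    (hu : Integrable (cut T u) vol) (hh : Integrable (cut T (forcing (fun _ => lam) c g u)) vol)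
    {θ : ℝ × Torus → ℂ} (hθ : IsSmooth θ) :
    HasSum (fun k => (∫ t in Ioo 0 T, coef (cut T u) k t *
          (fint (fun z => dt θ z.1 z.2) k t - Complex.I * symb k * fint θ k t))
        + ∫ t in Ioo 0 T, coef (cut T (forcing (fun _ => lam) c g u)) k t * fint θ k t)
      (Complex.I * ∫ t in (0 : ℝ)..T, ∫ x : Torus,
        (u (t, x) * (-Complex.I * dt θ t x + dx 2 θ t x - dx 4 θ t x)
          + (Complex.I * (c (t, x) : ℂ) * u (t, x)
            - (lam : ℂ) * (((‖u (t, x)‖ ^ 2 : ℝ) : ℂ) * u (t, x)) - g (t, x)) * θ (t, x))) := by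
  set h := cut T (forcing (fun _ => lam) c g u) with hdef
  set L : ℝ × Torus → ℂ := fun z => dt θ z.1 z.2 + Complex.I * dx 2 θ z.1 z.2
    + -Complex.I * dx 4 θ z.1 z.2 with hL
  have hLs : IsSmooth L := (hθ.dt.add ((hθ.dx 2).const_mul _)).add ((hθ.dx 4).const_mul _)
  set μ := (volume.restrict (Ioo 0 T)).prod (volume : Measure Torus) with hμ
  have hle : μ ≤ vol := by rw [hμ, ← strip_restrict]; exact Measure.restrict_le_self
  have hu' : Integrable (cut T u) μ := hu.mono_measure hle
  have hh' : Integrable h μ := hh.mono_measure hle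
  have hmem : ∀ᵐ z ∂μ, z.1 ∈ Ioo 0 T :=
    Measure.quasiMeasurePreserving_fst.ae (ae_restrict_mem measurableSet_Ioo)
  have hint : ∀ {v G : ℝ × Torus → ℂ}, Integrable v μ → IsSmooth G →
      Integrable (fun z => v z * G z) μ := fun hv hG => by
    obtain ⟨D, _, hD⟩ := exists_bound_of_continuous hG.continuous 0 T
    refine hv.mul_bdd (c := D) hG.continuous.aestronglyMeasurable ?_
    filter_upwards [hmem] with z hz
    exact hD _ (Ioo_subset_Icc_self hz) _
  have i1 := hint hu' hLs
  have i2 := hint hh' hθ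
  have key := (hasSum_integral_coef_mul_fint hLs hu').add (hasSum_integral_coef_mul_fint hθ hh')
  have hf : ∀ k t, fint L k t = fint (fun z => dt θ z.1 z.2) k t - Complex.I * symb k * fint θ k t := by
    intro k t
    have hc : ∀ {G : ℝ × Torus → ℂ}, IsSmooth G → Integrable fun x : Torus => (fourier k x : ℂ) * G (t, x) :=
      fun hG => Continuous.integrable_of_hasCompactSupport
        ((fourier k).continuous.mul (hG.continuous.comp (f := fun x => (t, x)) (by fun_prop)))
        (HasCompactSupport.of_compactSpace _)
    have e : fint L k t = fint (fun z => dt θ z.1 z.2) k t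
        + Complex.I * fint (fun z => dx 2 θ z.1 z.2) k t
        + -Complex.I * fint (fun z => dx 4 θ z.1 z.2) k t := by
      have a1 := integral_add ((hc hθ.dt).add ((hc (hθ.dx 2)).const_mul Complex.I))
        ((hc (hθ.dx 4)).const_mul (-Complex.I))
      have a2 := integral_add (hc hθ.dt) ((hc (hθ.dx 2)).const_mul Complex.I)
      simp only [Pi.add_apply, integral_const_mul] at a1 a2
      rw [a2] at a1
      refine Eq.trans (integral_congr_ae (ae_of_all _ fun x => ?_)) a1
      simp only [hL]; ring
    rw [e, hθ.fint_dx, hθ.fint_dx, symb]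
    push_cast
    linear_combination (Complex.I * (k : ℂ) ^ 2 - Complex.I * (Complex.I ^ 2 - 1) * (k : ℂ) ^ 4) *
      fint θ k t * Complex.I_sq
  simp_rw [hf] at key
  convert key using 1
  rw [← integral_prod _ i1, ← integral_prod _ i2, ← integral_add i1 i2,
    integral_prod (fun a => cut T u a * L a + h a * θ a) (i1.add i2),
    intervalIntegral.integral_of_le hT, integral_Ioc_eq_integral_Ioo, ← integral_const_mul]
  refine setIntegral_congr_fun measurableSet_Ioo fun t ht => ?_
  rw [← integral_const_mul]
  congr 1; ext x
  rw [hdef, cut_apply (z := (t, x)) ht, cut_apply (z := (t, x)) ht, forcing, cubic]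
  simp only [hL]
  linear_combination (-(u (t, x) * dt θ t x) - lam * (((‖u (t, x)‖ ^ 2 : ℝ) : ℂ) * u (t, x)) * θ (t, x) * 0
    + c (t, x) * u (t, x) * θ (t, x)) * Complex.I_sq

theorem eq_of_I_mul_eq_neg {x y : ℂ} (h : Complex.I * x = -y) : x = Complex.I * y := by
  linear_combination -Complex.I * h + x * Complex.I_sq

theorem IsMild.isWeak {T lam : ℝ} (hT : 0 < T) {c : ℝ × Torus → ℝ} {u₀ : Torus → ℂ}
    (hu₀ : Integrable u₀) {g u : ℝ × Torus → ℂ} (hu : Integrable (cut T u) vol)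
    (hh : Integrable (cut T (forcing (fun _ => lam) c g u)) vol)
    (hc : Integrable (cubic u) (slab (uIoo 0 T)))
    (hm : IsMild T (fourierCoeff u₀) (cut T (forcing (fun _ => lam) c g u)) (cut T u)) :
    IsWeak T lam c u₀ g u := by
  refine ⟨hc, fun θ hθ => ?_⟩
  obtain ⟨hθ, ε, hε, h0⟩ := hθ
  have h1 := hasSum_weak hT.le hu hh hθ
  have h2 := (hasSum_fourierCoeff_mul_fint hu₀ hθ).neg
  have hz : ∀ k, fint θ k T = 0 := fun k => by
    simp only [fint]
    have : ∀ x, θ (T, x) = 0 := fun x => h0 T x (by simpa using hε)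
    simp [this]
  have e : ∀ k, (∫ t in Ioo 0 T, coef (cut T u) k t *
          (fint (fun z => dt θ z.1 z.2) k t - Complex.I * symb k * fint θ k t))
        + ∫ t in Ioo 0 T, coef (cut T (forcing (fun _ => lam) c g u)) k t * fint θ k t
        = -(fourierCoeff u₀ k * fint θ k 0) := fun k => by
    have h3 := integral_mildCoef_mul hT.le (fourierCoeff u₀) hh k (IsSmooth.hasDerivAt_fint hθ k)
      (continuous_fint (IsSmooth.dt hθ).continuous k) (hz k)
    rw [intervalIntegral.integral_of_le hT.le, intervalIntegral.integral_of_le hT.le,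
      integral_Ioc_eq_integral_Ioo, integral_Ioc_eq_integral_Ioo] at h3
    have h4 : ∫ t in Ioo 0 T, coef (cut T u) k t *
          (fint (fun z => dt θ z.1 z.2) k t - Complex.I * symb k * fint θ k t)
        = ∫ t in Ioo 0 T, mildCoef (fourierCoeff u₀) (cut T (forcing (fun _ => lam) c g u)) k t *
          (fint (fun z => dt θ z.1 z.2) k t - Complex.I * symb k * fint θ k t) := by
      refine setIntegral_congr_ae measurableSet_Ioo ?_
      filter_upwards [hm k] with t ht htt
      rw [ht htt]
    rw [h4, h3]; ring
  simp_rw [e] at h1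
  exact eq_of_I_mul_eq_neg (h1.unique h2)

theorem exists_primitive {T : ℝ} {ϕ : ℝ → ℝ} (hϕ : ContDiff ℝ (⊤ : ℕ∞) ϕ)
    (hs : tsupport ϕ ⊆ Ioo 0 T) :
    ∃ η : ℝ → ℂ, ContDiff ℝ (⊤ : ℕ∞) η ∧ (∀ t, HasDerivAt η (ϕ t) t) ∧
      ∃ ε > 0, ∀ t, |t - T| < ε → η t = 0 := by
  have hc : Continuous fun t => (ϕ t : ℂ) := Complex.continuous_ofReal.comp hϕ.continuous
  have hd : ∀ t, HasDerivAt (fun t => ∫ r in T..t, (ϕ r : ℂ)) (ϕ t : ℂ) t := fun t =>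
    (hc.integral_hasStrictDerivAt T t).hasDerivAt
  refine ⟨fun t => ∫ r in T..t, (ϕ r : ℂ), ?_, hd, ?_⟩
  · rw [contDiff_infty_iff_deriv]
    refine ⟨fun t => (hd t).differentiableAt, ?_⟩
    rw [show deriv (fun t => ∫ r in T..t, (ϕ r : ℂ)) = fun t => (ϕ t : ℂ) from
      funext fun t => (hd t).deriv]
    exact Complex.ofRealCLM.contDiff.comp hϕ
  · have hT : T ∉ tsupport ϕ := fun h => lt_irrefl _ (hs h).2
    obtain ⟨ε, hε, hb⟩ := Metric.isOpen_iff.1 (isClosed_tsupport ϕ).isOpen_compl T hT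
    refine ⟨ε, hε, fun t ht => ?_⟩
    refine intervalIntegral.integral_zero_ae (ae_of_all _ fun r hr => ?_)
    have hr' : |r - T| ≤ |t - T| := abs_sub_left_of_mem_uIcc (uIoc_subset_uIcc hr)
    have hrb : r ∉ tsupport ϕ := hb (by
      rw [Metric.mem_ball, Real.dist_eq]; exact hr'.trans_lt ht)
    rw [image_eq_zero_of_notMem_tsupport hrb, Complex.ofReal_zero]

theorem isSmooth_mul_fourier {ψ : ℝ → ℂ} (hψ : ContDiff ℝ (⊤ : ℕ∞) ψ) (k : ℤ) :
    IsSmooth fun z => ψ z.1 * fourier k z.2 := by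
  have h : ContDiff ℝ (⊤ : ℕ∞) fun x : ℝ => (fourier k (x : Torus) : ℂ) := by
    simp only [fourier_coe_apply]
    have := Complex.ofRealCLM.contDiff (n := (⊤ : ℕ∞))
    refine ((contDiff_const.mul this).div_const _).cexp
  exact (hψ.comp contDiff_fst).mul (h.comp contDiff_snd)

theorem fint_mul_fourier (ψ : ℝ → ℂ) (j k : ℤ) (t : ℝ) :
    fint (fun z => ψ z.1 * fourier (-k) z.2) j t = if j = k then 2 * Real.pi * ψ t else 0 := by
  have e : fint (fun z => ψ z.1 * fourier (-k) z.2) j t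
      = ψ t * ∫ x : Torus, (fourier (j - k) x : ℂ) := by
    rw [fint, ← integral_const_mul]
    congr 1; ext x
    rw [sub_eq_add_neg, fourier_add]; ring
  have e2 : fourierCoeff (fun _ : Torus => (1 : ℂ)) (k - j) = if j = k then 1 else 0 := by
    have h := congrFun (fourierCoeff_fourier (T := 2 * Real.pi) 0) (k - j)
    have h1 : (fun _ : Torus => (1 : ℂ)) = (fourier 0 : C(Torus, ℂ)) := by ext x; simp
    rw [h1, h, Pi.single_apply]
    simp only [sub_eq_zero, eq_comm]
  rw [fourierCoeff_eq_integral] at e2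
  simp only [neg_sub, mul_one] at e2
  have hpi : ((2 * Real.pi : ℝ) : ℂ) ≠ 0 := by exact_mod_cast Real.two_pi_pos.ne'
  rw [Complex.ofReal_inv, inv_mul_eq_iff_eq_mul₀ hpi] at e2
  rw [e, e2]
  split_ifs
  · push_cast; ring
  · ring

theorem continuous_mildCoef (f : ℤ → ℂ) {h : ℝ × Torus → ℂ} (hh : Integrable h vol) (k : ℤ) :
    Continuous (mildCoef f h k) := by
  have := intervalIntegral.continuous_primitive
    (fun a b => intervalIntegrable_exp_mul (integrable_coef hh k) (symb k) a b) 0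
  unfold mildCoef
  fun_prop

theorem IsWeak.isMild {T lam : ℝ} (hT : 0 < T) {c : ℝ × Torus → ℝ} {u₀ : Torus → ℂ}
    (hu₀ : Integrable u₀) {g u : ℝ × Torus → ℂ} (hu : Integrable (cut T u) vol)
    (hh : Integrable (cut T (forcing (fun _ => lam) c g u)) vol) (hw : IsWeak T lam c u₀ g u) :
    IsMild T (fourierCoeff u₀) (cut T (forcing (fun _ => lam) c g u)) (cut T u) := by
  intro k
  set h := cut T (forcing (fun _ => lam) c g u)
  set E : ℝ → ℂ := fun t => Complex.exp (Complex.I * symb k * t) with hE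
  have hEs : ContDiff ℝ (⊤ : ℕ∞) E := (contDiff_const.mul (Complex.ofRealCLM.contDiff)).cexp
  have hEd : ∀ t, HasDerivAt E (E t * (Complex.I * symb k)) t := fun t =>
    (((Complex.ofRealCLM.hasDerivAt (x := t)).const_mul (Complex.I * symb k)).congr_deriv
      (by simp)).cexp
  have hci : IntegrableOn (fun t => (coef (cut T u) k t - mildCoef (fourierCoeff u₀) h k t) * E t)
      (Ioo 0 T) := by
    have h1 : IntegrableOn (fun t => coef (cut T u) k t - mildCoef (fourierCoeff u₀) h k t) (Ioo 0 T) :=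
      (integrable_coef hu k).integrableOn.sub
        (((continuous_mildCoef _ hh k).integrableOn_Icc).mono_set Ioo_subset_Icc_self)
    exact h1.mul_bdd (c := 1) hEs.continuous.aestronglyMeasurable
      (ae_of_all _ fun t => (norm_exp_I_mul (symb k) t).le)
  have key : ∀ᵐ t : ℝ, t ∈ Ioo 0 T → (coef (cut T u) k t - mildCoef (fourierCoeff u₀) h k t) * E t = 0 := by
    refine isOpen_Ioo.ae_eq_zero_of_integral_contDiff_smul_eq_zero hci.locallyIntegrableOn
      fun ϕ hϕ _ hs => ?_
    obtain ⟨η, hη, hηd, ε, hε, hη0⟩ := exists_primitive hϕ hs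
    set ψ : ℝ → ℂ := fun t => E t * η t with hψ
    have hψs : ContDiff ℝ (⊤ : ℕ∞) ψ := hEs.mul hη
    have hψd : ∀ t, HasDerivAt ψ (E t * (Complex.I * symb k) * η t + E t * ϕ t) t := fun t =>
      (hEd t).mul (hηd t)
    have hθs := isSmooth_mul_fourier hψs (-k)
    have hψT : ψ T = 0 := by simp [hψ, hη0 T (by simpa using hε)]
    have h1 := hasSum_weak hT.le hu hh hθs
    have htest : IsTestFunction T fun z => ψ z.1 * fourier (-k) z.2 :=
      ⟨hθs, ε, hε, fun t x ht => by
        show E t * η t * _ = 0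
        rw [hη0 t ht, mul_zero, zero_mul]⟩
    rw [hw.weak_eq _ htest] at h1
    have h2 := hasSum_fourierCoeff_mul_fint hu₀ hθs
    have hfd : ∀ j t, fint (fun z => dt (fun z => ψ z.1 * fourier (-k) z.2) z.1 z.2) j t
        = if j = k then 2 * Real.pi * (E t * (Complex.I * symb k) * η t + E t * ϕ t) else 0 :=
      fun j t => by
        refine (hθs.hasDerivAt_fint j t).unique ?_
        have e : fint (fun z => ψ z.1 * fourier (-k) z.2) j
            = fun t => if j = k then 2 * Real.pi * ψ t else 0 := funext (fint_mul_fourier ψ j k)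
        rw [e]
        split_ifs
        · exact (hψd t).const_mul _
        · exact hasDerivAt_const t 0
    have s1 := h1.unique (hasSum_single k fun j hj => by
      simp only [hfd, fint_mul_fourier, if_neg hj, mul_zero, sub_zero, integral_zero, add_zero])
    have s2 := h2.unique (hasSum_single k fun j hj => by rw [fint_mul_fourier, if_neg hj, mul_zero])
    rw [s2] at s1
    simp only [hfd, fint_mul_fourier, if_true] at s1
    have h3 := integral_mildCoef_mul hT.le (fourierCoeff u₀) hh k hψd
      ((((hEs.continuous.mul continuous_const).mul hη.continuous).add (hEs.continuous.mul
        (Complex.continuous_ofReal.comp hϕ.continuous)))) hψT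
    rw [intervalIntegral.integral_of_le hT.le, intervalIntegral.integral_of_le hT.le,
      integral_Ioc_eq_integral_Ioo, integral_Ioc_eq_integral_Ioo] at h3
    have hgen : ∀ v : ℝ → ℂ, ∫ t in Ioo 0 T, v t * (E t * (Complex.I * symb k) * η t + E t * ϕ t
        - Complex.I * symb k * ψ t) = ∫ t in Ioo 0 T, v t * (E t * ϕ t) := fun v => by
      congr 1; ext t; simp only [hψ]; ring
    have hgen2 : ∀ v : ℝ → ℂ, ∫ t in Ioo 0 T, v t * (2 * Real.pi * (E t * (Complex.I * symb k) * η t + E t * ϕ t)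
        - Complex.I * symb k * (2 * Real.pi * ψ t)) = 2 * Real.pi * ∫ t in Ioo 0 T, v t * (E t * ϕ t) := fun v => by
      rw [← integral_const_mul]; congr 1; ext t; simp only [hψ]; ring
    have hgen3 : ∀ v : ℝ → ℂ, ∫ t in Ioo 0 T, v t * (2 * Real.pi * ψ t)
        = 2 * Real.pi * ∫ t in Ioo 0 T, v t * ψ t := fun v => by
      rw [← integral_const_mul]; congr 1; ext t; ring
    rw [hgen] at h3
    rw [hgen2, hgen3] at s1
    have hpi : (2 * Real.pi : ℂ) ≠ 0 := by exact_mod_cast Real.two_pi_pos.ne'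
    have s3 : ∫ t in Ioo 0 T, coef (cut T u) k t * (E t * ϕ t)
        = ∫ t in Ioo 0 T, mildCoef (fourierCoeff u₀) h k t * (E t * ϕ t) := by
      rw [h3]
      apply mul_left_cancel₀ hpi
      linear_combination -s1 + (fourierCoeff u₀ k * (2 * Real.pi * ψ 0)) * Complex.I_sq
    have hz : ∀ t, t ∉ Ioo 0 T → ϕ t = 0 := fun t ht =>
      image_eq_zero_of_notMem_tsupport fun hmem => ht (hs hmem)
    rw [← setIntegral_eq_integral_of_forall_compl_eq_zero (s := Ioo 0 T)
      (fun t ht => by rw [hz t ht, zero_smul])]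
    have hb : ∀ {v : ℝ → ℂ}, IntegrableOn v (Ioo 0 T) →
        IntegrableOn (fun t => v t * (E t * ϕ t)) (Ioo 0 T) := fun hv => by
      obtain ⟨D, hD⟩ := isCompact_Icc.exists_bound_of_continuousOn (s := Icc 0 T)
        (f := fun t => E t * (ϕ t : ℂ)) (hEs.continuous.mul
          (Complex.continuous_ofReal.comp hϕ.continuous)).continuousOn
      refine hv.mul_bdd (c := D) (hEs.continuous.mul
          (Complex.continuous_ofReal.comp hϕ.continuous)).aestronglyMeasurable ?_
      filter_upwards [ae_restrict_mem measurableSet_Ioo] with t ht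
      exact hD t (Ioo_subset_Icc_self ht)
    calc _ = ∫ t in Ioo 0 T, (coef (cut T u) k t * (E t * ϕ t)
          - mildCoef (fourierCoeff u₀) h k t * (E t * ϕ t)) := by
          congr 1; ext t; rw [Complex.real_smul]; ring
      _ = 0 := by
          rw [integral_sub (hb (integrable_coef hu k).integrableOn)
            (hb (((continuous_mildCoef _ hh k).integrableOn_Icc).mono_set Ioo_subset_Icc_self)), s3,
            sub_self]
  filter_upwards [key] with t ht htt
  exact sub_eq_zero.1 ((mul_eq_zero.1 (ht htt)).resolve_right (Complex.exp_ne_zero _))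

theorem ofReal_rpow_eq_jap_sq (s : ℝ) (k : ℤ) :
    ENNReal.ofReal ((1 + (k : ℝ) ^ 2) ^ s) = ENNReal.ofReal |jap s k| ^ 2 := by
  rw [← ENNReal.ofReal_pow (abs_nonneg _), sq_abs, jap, ← Real.rpow_mul_natCast (by positivity)]
  congr 2; push_cast; ring

theorem hsNorm_eq (s : ℝ) (f : Torus → ℂ) : hsNorm s f = l2n (jap s) (fourierCoeff f) := by
  rw [hsNorm, l2n]
  congr 2; ext k
  rw [ofReal_rpow_eq_jap_sq, mul_pow]

theorem FT.bourgainNorm_eq {u : ℝ × Torus → ℂ} {w : ℤ × ℝ → ℂ} (h : FT u w) (b s : ℝ) :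
    bourgainNorm b s u = XN b (jap s) w := by
  have e : bourgainNorm b s u = (XN b (jap s) w ^ 2) ^ (1 / 2 : ℝ) := by
    rw [bourgainNorm, XN_sq, lintegral_nu]
    congr 2; ext k
    refine lintegral_congr_ae ?_
    filter_upwards [h.ae_eq k] with ξ hξ
    rw [show spaceTimeFourier u k ξ = w (k, ξ) from hξ, mul_pow,
      ENNReal.ofReal_mul (by positivity), ENNReal.ofReal_mul (abs_nonneg _), mul_pow,
      ofReal_rpow_eq_jap_sq, ← ENNReal.ofReal_pow (wt_pos _ _).le, wt,
      ← Real.rpow_mul_natCast (by positivity)]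
    simp [modul, symb]
  rw [e, ← ENNReal.rpow_natCast, ← ENNReal.rpow_mul]; norm_num

theorem l2n_mono {m m' : ℤ → ℝ} (h : ∀ k, |m k| ≤ |m' k|) (f : ℤ → ℂ) : l2n m f ≤ l2n m' f := by
  refine ENNReal.rpow_le_rpow (ENNReal.tsum_le_tsum fun k => ?_) (by norm_num)
  exact pow_le_pow_left' (mul_le_mul_left (ENNReal.ofReal_le_ofReal (h k)) _) 2

theorem one_le_abs_jap {s : ℝ} (hs : 0 ≤ s) (k : ℤ) : |(1 : ℤ → ℝ) k| ≤ |jap s k| := by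
  rw [abs_of_pos (jap_pos s k), Pi.one_apply, abs_one]; exact one_le_jap hs k

theorem l2n_one_le_hsNorm {s : ℝ} (hs : 0 ≤ s) (f : Torus → ℂ) :
    l2n 1 (fourierCoeff f) ≤ hsNorm s f := by
  rw [hsNorm_eq]; exact l2n_mono (one_le_abs_jap hs) _

theorem memLp_cut_of_slab {T : ℝ} {p : ℝ≥0∞} {g : ℝ × Torus → ℂ} {I : Set ℝ} (hI : Ioo 0 T ⊆ I)
    (hg : MemLp g p (slab I)) : MemLp (cut T g) p vol :=
  (memLp_indicator_iff_restrict (measurableSet_strip T)).2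
    (hg.mono_measure (Measure.restrict_mono (prod_mono hI Subset.rfl) le_rfl))

theorem Ioo_subset_Icc_neg {T : ℝ} (hT : 0 ≤ T) : Ioo 0 T ⊆ Icc (-T) T :=
  Ioo_subset_Icc_self.trans (Icc_subset_Icc (by linarith) le_rfl)

theorem XN_hat_cut_le {T : ℝ} (hT : 0 ≤ T) (s : ℝ) {g : ℝ × Torus → ℂ} (hg : MemLp (cut T g) 2 vol) :
    XN 0 (jap s) (hat (cut T g)) ≤ l2HsNorm T s g := by
  have h1 := (FT_hat ((suppIn_cut T g).integrable hg (by norm_num)) hg).XN_zero_sq (jap s)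
  rw [← ENNReal.pow_le_pow_left_iff (n := 2) (by norm_num), h1, l2HsNorm, ← ENNReal.rpow_natCast,
    ← ENNReal.rpow_mul]
  norm_num
  rw [← lintegral_indicator measurableSet_Icc]
  refine lintegral_mono fun t => ?_
  by_cases ht : t ∈ Ioo 0 T
  · rw [indicator_of_mem (Ioo_subset_Icc_neg hT ht), hsNorm_eq]
    refine pow_le_pow_left' (le_of_eq ?_) 2
    congr 1; ext k; exact coef_cut g k ht
  · have e : (fun k => coef (cut T g) k t) = 0 := by
      ext k
      rw [coef, show (fun x => cut T g (t, x)) = fun _ => 0 from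
        funext fun x => suppIn_cut T g (t, x) ht]
      simp [fourierCoeff]
    rw [e]; simp [l2n]

theorem eLpNorm_cut_le_l2HsNorm {T s : ℝ} (hT : 0 ≤ T) (hs : 0 ≤ s) {g : ℝ × Torus → ℂ}
    (hg : MemLp (cut T g) 2 vol) :
    eLpNorm (cut T g) 2 vol ≤ ENNReal.ofReal (2 * Real.pi) ^ (1 / 2 : ℝ) * l2HsNorm T s g := by
  rw [(FT_hat ((suppIn_cut T g).integrable hg (by norm_num)) hg).eLpNorm_eq, ← XN_zero_one]
  gcongr
  exact (XN_mono le_rfl (one_le_abs_jap hs) _).trans (XN_hat_cut_le hT s hg)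

theorem exists_isMultiplier_of_memLp {A : Torus → ℝ} (hA : MemLp A ⊤ volume) :
    ∃ K : ℝ≥0, ∀ R, IsMultiplier K (japMin 0 R) fun x => (A x : ℂ) := by
  have hK : eLpNormEssSup A volume ≠ ⊤ := by simpa [eLpNorm_exponent_top] using hA.2.ne
  refine ⟨(eLpNormEssSup A volume).toNNReal, fun R f hf => ?_⟩
  rw [ENNReal.coe_toNNReal hK]
  have hAf : MemLp (fun x => (A x : ℂ) * f x) 2 volume := by
    have := hf.mul (hA.ofReal (K := ℂ)) (r := 2)
    exact this
  have e : ∀ h : ℤ → ℂ, l2n (japMin 0 R) h ^ 2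
      = ENNReal.ofReal |min 1 (R : ℝ)| ^ 2 * ∑' k, ‖h k‖ₑ ^ 2 := fun h => by
    rw [l2n_sq, ← ENNReal.tsum_mul_left]
    congr 1; ext k; simp [japMin, jap, mul_pow]
  have h2π : ENNReal.ofReal (2 * Real.pi) ≠ 0 := by simp [Real.pi_pos]
  have key : ∑' k, ‖fourierCoeff (fun x => (A x : ℂ) * f x) k‖ₑ ^ 2
      ≤ eLpNormEssSup A volume ^ 2 * ∑' k, ‖fourierCoeff f k‖ₑ ^ 2 := by
    rw [← ENNReal.mul_le_mul_iff_right h2π ENNReal.ofReal_ne_top, mul_left_comm,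
      tsum_enorm_fourierCoeff_sq hAf, tsum_enorm_fourierCoeff_sq hf,
      ← lintegral_const_mul' _ _ (by finiteness)]
    refine lintegral_mono_ae ?_
    filter_upwards [enorm_ae_le_eLpNormEssSup A volume] with x hx
    rw [enorm_mul, mul_pow]
    gcongr
    simpa [enorm_eq_nnnorm] using hx
  rw [← ENNReal.pow_le_pow_left_iff (n := 2) (by norm_num), mul_pow, e, e, mul_left_comm]
  gcongr

/-- Bounded damping coefficients supported in `(0, T)` that act on the weighted spaces. -/
structure IsDamping (T s : ℝ) (Λ K : ℝ≥0) (c : ℝ × Torus → ℝ) : Prop where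
  aestronglyMeasurable : AEStronglyMeasurable c vol
  abs_le : ∀ᵐ z ∂vol, |c z| ≤ Λ
  eq_zero : ∀ z, z.1 ∉ Ioo 0 T → c z = 0
  isMulBound : ∀ R, IsMulBound K (japMin s R) c

theorem IsDamping.isCoeff {T s : ℝ} {Λ K : ℝ≥0} {c : ℝ × Torus → ℝ} (hc : IsDamping T s Λ K c)
    {ℓ : ℝ → ℝ} (hm : Measurable ℓ) {Λ' : ℝ≥0} (hℓ : ∀ t, |ℓ t| ≤ Λ') :
    IsCoeff (max Λ' Λ) ℓ c :=
  ⟨hm, fun t => (hℓ t).trans (by exact_mod_cast le_max_left _ _), hc.aestronglyMeasurable,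
    hc.abs_le.mono fun z hz => hz.trans (by exact_mod_cast le_max_right _ _)⟩

theorem cut_eq_cut {T : ℝ} {F G : ℝ × Torus → ℂ} (h : ∀ z : ℝ × Torus, z.1 ∈ Ioo 0 T → F z = G z) :
    cut T F = cut T G := by
  ext z
  by_cases hz : z.1 ∈ Ioo 0 T
  · rw [cut_apply hz, cut_apply hz, h z hz]
  · rw [suppIn_cut T F z hz, suppIn_cut T G z hz]

theorem cut_forcing {T lam : ℝ} {ℓ : ℝ → ℝ} (hℓ : ∀ t ∈ Ioo 0 T, ℓ t = lam) (c : ℝ × Torus → ℝ)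
    (g u : ℝ × Torus → ℂ) :
    cut T (forcing ℓ c (cut T g) (cut T u)) = cut T (forcing (fun _ => lam) c g u) :=
  cut_eq_cut fun z hz => by rw [forcing, forcing, cubic, cubic, cut_apply hz, cut_apply hz, hℓ _ hz]

theorem uIoo_zero {T : ℝ} (hT : 0 < T) : uIoo 0 T = Ioo 0 T := uIoo_of_le hT.le

theorem MemHs.integrable {s : ℝ} {f : Torus → ℂ} (h : MemHs s f) : Integrable f :=
  h.1.integrable (by norm_num)

theorem MemHs.l2n_ne_top {s : ℝ} (hs : 0 ≤ s) {f : Torus → ℂ} (h : MemHs s f) :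
    l2n 1 (fourierCoeff f) ≠ ⊤ := ((l2n_one_le_hsNorm hs f).trans_lt h.2).ne

theorem MemL2Hs.memLp_cut {T s : ℝ} (hT : 0 < T) {g : ℝ × Torus → ℂ} (h : MemL2Hs T s g) :
    MemLp (cut T g) 2 vol := memLp_cut_of_slab (Ioo_subset_Icc_neg hT.le) h.1

theorem MemBourgainOn.memLp_cut {β b s T : ℝ} {C : ℝ≥0∞} (hC : IsStrichartzConst β C) (hβ : β ≤ b)
    (hs : 0 ≤ s) {v : ℝ × Torus → ℂ} (hv : MemBourgainOn b s (Ioo 0 T) v) :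
    MemLp (cut T v) 4 vol := by
  obtain ⟨V, ⟨hV, hVX⟩, hVv⟩ := hv
  have hF := exists_FT_right hV
  rw [hF.bourgainNorm_eq] at hVX
  have h4 := hC.memLp_four hF ((XN_mono hβ (one_le_abs_jap hs) _).trans_lt hVX).ne
  refine (memLp_congr_ae ?_).1 (memLp_cut_of_slab (I := Ioo 0 T) Subset.rfl
    (h4.mono_measure Measure.restrict_le_self))
  refine cut_congr ?_
  filter_upwards [(ae_restrict_iff' (measurableSet_strip T)).1 hVv] with z hz hzt
  exact hz ⟨hzt, mem_univ _⟩

theorem IsWeak.isNLS {T s lam : ℝ} (hT : 0 < T) {Λ : ℝ≥0} {c : ℝ × Torus → ℝ}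
    (hL : IsCoeff Λ (fun _ => lam) c) {u₀ : Torus → ℂ} {g v : ℝ × Torus → ℂ} (hu₀ : MemHs s u₀)
    (hg : MemLp (cut T g) 2 vol) (h4 : MemLp (cut T v) 4 vol) (hw : IsWeak T lam c u₀ g v) :
    IsNLS T (fourierCoeff u₀) (fun _ => lam) c (cut T g) (cut T v) := by
  have e := cut_forcing (fun _ _ => rfl) c g v (lam := lam) (T := T)
  have h := (suppIn_cut T _).integrable (hL.memLp_forcing h4 hg (suppIn_cut T v))
    (by rw [ENNReal.le_div_iff_mul_le] <;> norm_num)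
  rw [e] at h
  refine ⟨suppIn_cut T v, h4, ?_⟩
  rw [e]
  exact hw.isMild hT hu₀.integrable ((suppIn_cut T v).integrable h4 (by norm_num)) h

theorem IsNLS.cut_constant {T τ lam : ℝ} (hτ : T ≤ τ) {ℓ : ℝ → ℝ} (hℓ : ∀ t ∈ Ioo 0 T, ℓ t = lam)
    {c : ℝ × Torus → ℝ} {f : ℤ → ℂ} {g u : ℝ × Torus → ℂ} (h : IsNLS τ f ℓ c (cut T g) u) :
    IsNLS T f (fun _ => lam) c (cut T g) (cut T u) := by
  have h1 := h.restrict hτ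
  refine ⟨h1.supp, h1.memLp, ?_⟩
  have h2 := h1.mild
  rw [cut_forcing hℓ] at h2
  rwa [cut_forcing fun _ _ => rfl]

theorem IsNLS.isWeak {T s lam : ℝ} (hT : 0 < T) {Λ : ℝ≥0} {c : ℝ × Torus → ℝ}
    (hL : IsCoeff Λ (fun _ => lam) c) {u₀ : Torus → ℂ} {g u : ℝ × Torus → ℂ} (hu₀ : MemHs s u₀)
    (hg : MemLp (cut T g) 2 vol)
    (h : IsNLS T (fourierCoeff u₀) (fun _ => lam) c (cut T g) (cut T u)) :
    IsWeak T lam c u₀ g u := by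
  have hp : (1 : ℝ≥0∞) ≤ 4 / 3 := by rw [ENNReal.le_div_iff_mul_le] <;> norm_num
  have e := cut_forcing (fun _ _ => rfl) c g u (lam := lam) (T := T)
  have h1 := (suppIn_cut T _).integrable (hL.memLp_forcing h.memLp hg (suppIn_cut T u)) hp
  have h2 := h.mild
  rw [e] at h1 h2
  refine IsMild.isWeak hT hu₀.integrable ((suppIn_cut T u).integrable h.memLp (by norm_num)) h1 ?_ h2
  have h3 : Integrable (cubic (cut T u)) vol :=
    (((suppIn_cut T u).memLp_of_le h.memLp (q := 3) (by norm_num)).integrable_norm_pow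
      (p := 3) (by norm_num)).mono' (aestronglyMeasurable_cubic h.memLp.1)
      (ae_of_all _ fun z => by simp [cubic, pow_succ])
  rw [slab, uIoo_zero hT]
  refine (integrable_indicator_iff (measurableSet_strip T)).1 (h3.congr (ae_of_all _ fun z => ?_))
  by_cases hz : z ∈ Ioo 0 T ×ˢ (univ : Set Torus)
  · rw [indicator_of_mem hz, cubic, cubic, cut_apply hz.1]
  · simp [indicator_of_notMem hz, cubic, cut]

theorem exists_cutoff {T : ℝ} (hT : 0 < T) : ∃ χ : ℝ → ℝ, ContDiff ℝ (⊤ : ℕ∞) χ ∧ HasCompactSupport χ ∧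
    (∀ t ∈ Ioo 0 T, χ t = 1) ∧ (∀ t, T + 1 ≤ t → χ t = 0) ∧ ∀ t, |χ t| ≤ 1 := by
  let B : ContDiffBump (T / 2) := ⟨T / 2, T / 2 + 1, by linarith, by linarith⟩
  refine ⟨B, B.contDiff, B.hasCompactSupport, fun t ht => B.one_of_mem_closedBall ?_,
    fun t ht => B.zero_of_le_dist ?_, fun t => ?_⟩
  · rw [Metric.mem_closedBall, Real.dist_eq, abs_le]; constructor <;> simp only [B] <;> linarith [ht.1, ht.2]
  · rw [Real.dist_eq, abs_of_nonneg (by linarith)]; simp only [B]; linarith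
  · rw [abs_of_nonneg B.nonneg]; exact B.le_one

/-- A space-time function is controlled by data of size `R` if it is a solution with cut-off
nonlinearity on `(0, τ)` and its `L⁴` norm is at most `M`. -/
structure IsControlled (T s τ : ℝ) (ℓ : ℝ → ℝ) (c : ℝ × Torus → ℝ) (R : ℝ≥0) (M : ℝ≥0∞)
    (u₀ : Torus → ℂ) (g u : ℝ × Torus → ℂ) : Prop where
  memHs : MemHs s u₀
  memLp_cut : MemLp (cut T g) 2 vol
  hsNorm_le : hsNorm s u₀ ≤ R
  l2HsNorm_le : l2HsNorm T s g ≤ R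
  isNLS : IsNLS τ (fourierCoeff u₀) ℓ c (cut T g) u
  eLpNorm_le : eLpNorm u 4 vol ≤ M

theorem SuppIn.mono {τ τ' : ℝ} (h : τ ≤ τ') {u : ℝ × Torus → ℂ} (hu : SuppIn τ u) : SuppIn τ' u :=
  fun z hz => hu z fun hz' => hz ⟨hz'.1, hz'.2.trans_le h⟩

theorem fourierCoeff_zero_fun : fourierCoeff (0 : Torus → ℂ) = 0 := by
  ext k; simp [fourierCoeff]

theorem cut_zero_fun (T : ℝ) : cut T 0 = 0 := indicator_zero' _

theorem isControlled_zero {T s τ : ℝ} {ℓ : ℝ → ℝ} {c : ℝ × Torus → ℝ} {R : ℝ≥0} {M : ℝ≥0∞} :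
    IsControlled T s τ ℓ c R M 0 0 0 := by
  have h : hsNorm s (0 : Torus → ℂ) = 0 := by
    rw [hsNorm_eq, fourierCoeff_zero_fun, l2n]; simp
  refine ⟨⟨MemLp.zero, by simp [h]⟩, ?_, by simp [h], ?_, ?_, by simp⟩
  · rw [cut_zero_fun]; exact MemLp.zero
  · have : l2HsNorm T s 0 = 0 := by
      rw [l2HsNorm]
      simp only [Pi.zero_apply]
      rw [show (fun _ : Torus => (0 : ℂ)) = 0 from rfl, h]; simp
    simp [this]
  · rw [fourierCoeff_zero_fun, cut_zero_fun]; exact isNLS_zero _ _ _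

theorem mul_add_mul_four_le (E c₀ x y R : ℝ≥0∞) :
    E * (x + y + (x + c₀ * y) * (R + R + (R + R))) ≤ E * (1 + (1 + c₀) * (4 * R)) * (x + y) := by
  calc _ ≤ E * ((x + y) + (x + y + c₀ * (x + y)) * (R + R + (R + R))) := by
        gcongr
        · exact le_self_add
        · exact le_add_self
    _ = _ := by ring

theorem exists_isExponent {b : ℝ} (hb : 1 / 2 ≤ b) (hb' : b < 11 / 16) :
    ∃ β C, IsExponent β C ∧ b ≤ 1 - β ∧ β ≤ b := by
  obtain ⟨C, hC⟩ := exists_isStrichartzConst (β := (5 / 16 + (1 - b)) / 2) (by linarith)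
  exact ⟨_, C, ⟨hC, by linarith, by linarith⟩, by linarith, by linarith⟩

theorem IsExponent.exists_lipschitz_extension {β b s T lam : ℝ} {C : ℝ≥0∞} (hC : IsExponent β C)
    (hb0 : 0 ≤ b) (hbβ : b ≤ 1 - β) (hs : 0 ≤ s) (hT : 0 < T) {Λ K : ℝ≥0} {c : ℝ × Torus → ℝ}
    (hc : IsDamping T s Λ K c) {χ : ℝ → ℝ} (hχ : ContDiff ℝ (⊤ : ℕ∞) χ) (hχc : HasCompactSupport χ)
    (hχT : ∀ t, T + 1 ≤ t → χ t = 0) (hχ1 : ∀ t, |χ t| ≤ 1) (R : ℝ≥0) {M : ℝ≥0∞} (hM : M ≠ ⊤) :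
    ∃ L : ℝ≥0, ∀ {u₀ v₀ : Torus → ℂ} {g h u v : ℝ × Torus → ℂ},
      IsControlled T s (T + 1) (fun t => lam * χ t ^ 2) c R M u₀ g u →
      IsControlled T s (T + 1) (fun t => lam * χ t ^ 2) c R M v₀ h v →
      ∃ Z, MemLp Z 2 volume ∧ (∀ᵐ x ∂vol, 0 < x.1 → Z x = χ x.1 * (u x - v x)) ∧
        bourgainNorm b s Z ≤ L * (hsNorm s (u₀ - v₀) + l2HsNorm T s (g - h)) := by
  obtain ⟨A, hA⟩ := exists_isWeight_japMin hs
  set c₀ := ENNReal.ofReal (2 * Real.pi) ^ (1 / 2 : ℝ)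
  have hc₀ : c₀ ≠ ⊤ := by finiteness
  have hL := hc.isCoeff (ℓ := fun t => lam * χ t ^ 2) (Λ' := ‖lam‖₊)
    ((hχ.continuous.measurable.pow_const 2).const_mul lam) fun t => by
      rw [abs_mul, abs_pow, coe_nnnorm, Real.norm_eq_abs]
      exact mul_le_of_le_one_right (abs_nonneg _) (pow_le_one₀ (abs_nonneg _) (hχ1 t))
  obtain ⟨E, hE, key⟩ := hC.exists_extension hb0 hbβ (max ‖lam‖₊ Λ) A K hχ hχc (lam := lam) hχT hM
    (D₀ := R + c₀ * R) (by finiteness)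
  have hLt : E * (1 + (1 + c₀) * (4 * R)) ≠ ⊤ := by finiteness
  refine ⟨(E * (1 + (1 + c₀) * (4 * R))).toNNReal, fun {u₀ v₀ g h u v} hu hv => ?_⟩
  have hD : ∀ {u₀ : Torus → ℂ} {g u : ℝ × Torus → ℂ},
      IsControlled T s (T + 1) (fun t => lam * χ t ^ 2) c R M u₀ g u →
      l2n 1 (fourierCoeff u₀) + eLpNorm (cut T g) 2 vol ≤ R + c₀ * R := fun hu => by
    gcongr
    · exact (l2n_one_le_hsNorm hs _).trans hu.hsNorm_le
    · refine (eLpNorm_cut_le_l2HsNorm hT.le hs hu.memLp_cut).trans ?_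
      gcongr
      exact hu.l2HsNorm_le
  have hS : ∀ g, SuppIn (T + 1) (cut T g) := fun g => (suppIn_cut T g).mono (by linarith)
  obtain ⟨Z, Y, hZ, hZe, hY⟩ := key hL
    (fun x hx => hc.eq_zero x fun hx' => hx ⟨hx'.1, hx'.2.trans (by linarith)⟩)
    (hD hu) (hD hv) (hS g) hu.memLp_cut (hS h) hv.memLp_cut hu.isNLS hv.isNLS hu.eLpNorm_le hv.eLpNorm_le
  refine ⟨Z, hZ.memLp_left, hZe, ?_⟩
  rw [hZ.bourgainNorm_eq, ENNReal.coe_toNNReal hLt]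
  refine XN_jap_le hZ.memLp_right.1 fun r => ?_
  refine (hY _ r (hA r) (hc.isMulBound r) (abs_japMin_le s r)).trans
    (le_trans ?_ (mul_add_mul_four_le E c₀ _ _ _))
  have hle := abs_japMin_le_jap s r
  have hf : fourierCoeff u₀ - fourierCoeff v₀ = fourierCoeff (u₀ - v₀) := by
    ext k; exact (fourierCoeff_sub hu.memHs.integrable hv.memHs.integrable k).symm
  have hg : cut T g - cut T h = cut T (g - h) := (indicator_sub' _ _ _).symm
  have hgh : MemLp (cut T (g - h)) 2 vol := hg ▸ hu.memLp_cut.sub hv.memLp_cut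
  have h1 : ∀ {g : ℝ × Torus → ℂ}, MemLp (cut T g) 2 vol →
      XN 0 (japMin s r) (hat (cut T g)) ≤ l2HsNorm T s g := fun hg =>
    (XN_mono le_rfl hle _).trans (XN_hat_cut_le hT.le s hg)
  have h2 : ∀ f : Torus → ℂ, l2n (japMin s r) (fourierCoeff f) ≤ hsNorm s f := fun f => by
    rw [hsNorm_eq]; exact l2n_mono hle _
  rw [hf, hg]
  gcongr
  · exact h2 _
  · exact h1 hgh
  · exact l2n_one_le_hsNorm hs _
  · exact eLpNorm_cut_le_l2HsNorm hT.le hs hgh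
  · exact (h2 _).trans hu.hsNorm_le
  · exact (h2 _).trans hv.hsNorm_le
  · exact (h1 hu.memLp_cut).trans hu.l2HsNorm_le
  · exact (h1 hv.memLp_cut).trans hv.l2HsNorm_le

/-- Existence, uniqueness and Lipschitz dependence on the data, on the time interval between `0`
and `S`, for the equation with damping coefficient `c`. -/
def IsWellPosed (T s b lam S : ℝ) (c : ℝ × Torus → ℝ) : Prop :=
  (∀ (u₀ : Torus → ℂ) (g : ℝ × Torus → ℂ), MemHs s u₀ → MemL2Hs T s g →
    ∃ u : ℝ × Torus → ℂ, (MemBourgainOn b s (uIoo 0 S) u ∧ IsWeak S lam c u₀ g u) ∧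
      ∀ v : ℝ × Torus → ℂ, MemBourgainOn b s (uIoo 0 S) v → IsWeak S lam c u₀ g v →
        v =ᵐ[slab (uIoo 0 S)] u) ∧
  (∀ R : ℝ≥0, ∃ L : ℝ≥0, ∀ (u₀ v₀ : Torus → ℂ) (g h u v : ℝ × Torus → ℂ),
    MemHs s u₀ → MemHs s v₀ → MemL2Hs T s g → MemL2Hs T s h →
    hsNorm s u₀ ≤ R → hsNorm s v₀ ≤ R → l2HsNorm T s g ≤ R → l2HsNorm T s h ≤ R →
    MemBourgainOn b s (uIoo 0 S) u → IsWeak S lam c u₀ g u →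
    MemBourgainOn b s (uIoo 0 S) v → IsWeak S lam c v₀ h v →
      bourgainNormOn b s (uIoo 0 S) (u - v) ≤
        L * (hsNorm s (u₀ - v₀) + l2HsNorm T s (g - h)))

theorem isWellPosed_of_isDamping {T s b lam : ℝ} (hT : 0 < T) (hs : 0 ≤ s) (hb : 1 / 2 ≤ b)
    (hb' : b < 11 / 16) {Λ K : ℝ≥0} {c : ℝ × Torus → ℝ} (hc : IsDamping T s Λ K c) :
    IsWellPosed T s b lam T c := by
  obtain ⟨β, C, hC, hbβ, hβb⟩ := exists_isExponent hb hb'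
  obtain ⟨χ, hχ, hχc, hχ1, hχT, hχb⟩ := exists_cutoff hT
  set ℓ : ℝ → ℝ := fun t => lam * χ t ^ 2
  have hℓ : ∀ t ∈ Ioo 0 T, ℓ t = lam := fun t ht => by simp [ℓ, hχ1 t ht]
  have hLℓ : IsCoeff (max ‖lam‖₊ Λ) ℓ c :=
    hc.isCoeff ((hχ.continuous.measurable.pow_const 2).const_mul lam) fun t => by
      rw [abs_mul, abs_pow, coe_nnnorm, Real.norm_eq_abs]
      exact mul_le_of_le_one_right (abs_nonneg _) (pow_le_one₀ (abs_nonneg _) (hχb t))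
  have hL : IsCoeff (max ‖lam‖₊ Λ) (fun _ => lam) c :=
    hc.isCoeff measurable_const fun t => by rw [coe_nnnorm, Real.norm_eq_abs]
  set c₀ := ENNReal.ofReal (2 * Real.pi) ^ (1 / 2 : ℝ)
  have hc₀ : c₀ ≠ ⊤ := by finiteness
  -- solutions of controlled size
  have hex : ∀ R : ℝ≥0, ∃ M : ℝ≥0∞, M ≠ ⊤ ∧ ∀ {u₀ : Torus → ℂ} {g : ℝ × Torus → ℂ}, MemHs s u₀ →
      MemL2Hs T s g → hsNorm s u₀ ≤ R → l2HsNorm T s g ≤ R →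
      ∃ u, IsControlled T s (T + 1) ℓ c R M u₀ g u := fun R => by
    obtain ⟨M, hM, h⟩ := hC.exists_global (max ‖lam‖₊ Λ) (τ := T + 1) (by linarith)
      (A := R) (G := c₀ * R) (by finiteness) (by finiteness)
    refine ⟨M, hM, fun {u₀ g} hu₀ hg h1 h2 => ?_⟩
    obtain ⟨u, hu, huM⟩ := h hLℓ ((l2n_one_le_hsNorm hs u₀).trans h1) (hg.memLp_cut hT)
      ((eLpNorm_cut_le_l2HsNorm hT.le hs (hg.memLp_cut hT)).trans (by gcongr))
    exact ⟨u, hu₀, hg.memLp_cut hT, h1, h2, hu, huM⟩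
  have hcut : ∀ {R : ℝ≥0} {M : ℝ≥0∞} {u₀ : Torus → ℂ} {g u : ℝ × Torus → ℂ},
      IsControlled T s (T + 1) ℓ c R M u₀ g u →
      IsNLS T (fourierCoeff u₀) (fun _ => lam) c (cut T g) (cut T u) := fun hu =>
    hu.isNLS.cut_constant (by linarith) hℓ
  -- weak solutions coincide with solutions of controlled size
  have huniq : ∀ {R : ℝ≥0} {M : ℝ≥0∞} {u₀ : Torus → ℂ} {g u v : ℝ × Torus → ℂ},
      IsControlled T s (T + 1) ℓ c R M u₀ g u → MemBourgainOn b s (uIoo 0 T) v →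
      IsWeak T lam c u₀ g v → v =ᵐ[slab (uIoo 0 T)] u := fun {R M u₀ g u v} hu hv hw => by
    rw [uIoo_zero hT] at hv ⊢
    have h1 := hw.isNLS hT hL hu.memHs hu.memLp_cut (hv.memLp_cut hC.toIsStrichartzConst hβb hs)
    have h2 := hC.unique hL (hu.memHs.l2n_ne_top hs) hu.memLp_cut h1 (hcut hu)
    refine (ae_restrict_iff' (measurableSet_strip T)).2 ?_
    filter_upwards [h2] with z hz hzt
    rwa [cut_apply hzt.1, cut_apply hzt.1] at hz
  have hext : ∀ (R : ℝ≥0) {M : ℝ≥0∞}, M ≠ ⊤ → ∃ L : ℝ≥0, ∀ {u₀ v₀ : Torus → ℂ} {g h u v : ℝ × Torus → ℂ},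
      IsControlled T s (T + 1) ℓ c R M u₀ g u → IsControlled T s (T + 1) ℓ c R M v₀ h v →
      ∃ Z, MemLp Z 2 volume ∧ Z =ᵐ[slab (uIoo 0 T)] u - v ∧
        bourgainNorm b s Z ≤ L * (hsNorm s (u₀ - v₀) + l2HsNorm T s (g - h)) := fun R {M} hM => by
    obtain ⟨L, hLip⟩ := hC.exists_lipschitz_extension (lam := lam) (by linarith) hbβ hs hT hc hχ hχc hχT hχb R hM
    refine ⟨L, fun {u₀ v₀ g h u v} hu hv => ?_⟩
    obtain ⟨Z, hZ, hZe, hZn⟩ := hLip hu hv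
    refine ⟨Z, hZ, ?_, hZn⟩
    rw [slab, uIoo_zero hT]
    refine (ae_restrict_iff' (measurableSet_strip T)).2 ?_
    filter_upwards [hZe] with z hz hzt
    rw [hz hzt.1.1, hχ1 _ hzt.1, Complex.ofReal_one, one_mul, Pi.sub_apply]
  refine ⟨fun u₀ g hu₀ hg => ?_, fun R => ?_⟩
  · set R : ℝ≥0 := max (hsNorm s u₀).toNNReal (l2HsNorm T s g).toNNReal
    have h1 : hsNorm s u₀ ≤ R := by
      rw [← ENNReal.coe_toNNReal hu₀.2.ne]; exact_mod_cast le_max_left _ _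
    have h2 : l2HsNorm T s g ≤ R := by
      rw [← ENNReal.coe_toNNReal hg.2.ne]; exact_mod_cast le_max_right _ _
    obtain ⟨M, hM, hR⟩ := hex R
    obtain ⟨u, hu⟩ := hR hu₀ hg h1 h2
    obtain ⟨L, hLip⟩ := hext R hM
    obtain ⟨Z, hZ, hZe, hZn⟩ := hLip hu isControlled_zero
    rw [sub_zero] at hZe hZn
    refine ⟨u, ⟨⟨Z, ⟨hZ, hZn.trans_lt ?_⟩, hZe⟩, (hcut hu).isWeak hT hL hu₀ hu.memLp_cut⟩,
      fun v hv hw => huniq hu hv hw⟩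
    rw [sub_zero]
    exact ENNReal.mul_lt_top (by simp) (ENNReal.add_lt_top.2 ⟨hu₀.2, hg.2⟩)
  · obtain ⟨M, hM, hR⟩ := hex R
    obtain ⟨L, hLip⟩ := hext R hM
    refine ⟨L, fun u₀ v₀ g h u v hu₀ hv₀ hg hh h1 h2 h3 h4 hu huw hv hvw => ?_⟩
    obtain ⟨u', hu'⟩ := hR hu₀ hg h1 h3
    obtain ⟨v', hv'⟩ := hR hv₀ hh h2 h4
    obtain ⟨Z, hZ, hZe, hZn⟩ := hLip hu' hv'
    by_cases htop : bourgainNorm b s Z < ⊤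
    · refine le_trans (iInf₂_le Z ⟨⟨hZ, htop⟩, hZe.trans ?_⟩) hZn
      filter_upwards [huniq hu' hu huw, huniq hv' hv hvw] with z hz1 hz2
      rw [Pi.sub_apply, Pi.sub_apply, hz1, hz2]
    · exact le_top.trans ((not_lt_top_iff.1 htop).symm.le.trans hZn)

/-- Time reversal, composed with complex conjugation. -/
def refl (u : ℝ × Torus → ℂ) (z : ℝ × Torus) : ℂ := starRingEnd ℂ (u (-z.1, z.2))

/-- The action of `refl` on the space-time Fourier transform. -/
def hatRefl (w : ℤ × ℝ → ℂ) (q : ℤ × ℝ) : ℂ := starRingEnd ℂ (w (-q.1, q.2))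

theorem refl_refl (u : ℝ × Torus → ℂ) : refl (refl u) = u := by ext z; simp [refl]

theorem refl_sub (u v : ℝ × Torus → ℂ) : refl (u - v) = refl u - refl v := by ext z; simp [refl]

/-- Time reversal of space-time. -/
def negTime : ℝ × Torus ≃ᵐ ℝ × Torus := (MeasurableEquiv.neg ℝ).prodCongr (MeasurableEquiv.refl Torus)

theorem measurePreserving_negTime : MeasurePreserving negTime vol vol :=
  (Measure.measurePreserving_neg volume).prod (MeasurePreserving.id volume)

theorem measurePreserving_negTime_slab {I J : Set ℝ} (h : ∀ t, -t ∈ J ↔ t ∈ I) :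
    MeasurePreserving negTime (slab I) (slab J) := by
  have := measurePreserving_negTime.restrict_preimage_emb negTime.measurableEmbedding (J ×ˢ univ)
  rwa [show negTime ⁻¹' (J ×ˢ univ) = I ×ˢ univ from ext fun z => by
    simp [negTime, h, MeasurableEquiv.prodCongr]] at this

theorem memLp_refl {μ ν : Measure (ℝ × Torus)} (h : MeasurePreserving negTime μ ν) {p : ℝ≥0∞}
    {u : ℝ × Torus → ℂ} (hu : MemLp u p ν) : MemLp (refl u) p μ :=
  (hu.comp_measurePreserving h).star

theorem eLpNorm_refl {μ ν : Measure (ℝ × Torus)} (h : MeasurePreserving negTime μ ν) {p : ℝ≥0∞}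
    {u : ℝ × Torus → ℂ} (hu : AEStronglyMeasurable u ν) : eLpNorm (refl u) p μ = eLpNorm u p ν := by
  rw [← eLpNorm_comp_measurePreserving hu h]
  exact eLpNorm_congr_norm_ae (ae_of_all _ fun z => by
    rw [refl, RCLike.norm_conj]; rfl)

theorem ae_eq_refl {μ ν : Measure (ℝ × Torus)} (h : MeasurePreserving negTime μ ν)
    {u v : ℝ × Torus → ℂ} (e : u =ᵐ[ν] v) : refl u =ᵐ[μ] refl v := by
  filter_upwards [h.quasiMeasurePreserving.ae e] with z hz
  exact congrArg (starRingEnd ℂ) hz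

/-- Reflection of the spatial frequency. -/
def negFreq : ℤ × ℝ ≃ᵐ ℤ × ℝ := (MeasurableEquiv.neg ℤ).prodCongr (MeasurableEquiv.refl ℝ)

theorem measurePreserving_negFreq : MeasurePreserving negFreq nu nu :=
  (Measure.measurePreserving_neg Measure.count).prod (MeasurePreserving.id volume)

theorem memLp_hatRefl {p : ℝ≥0∞} {w : ℤ × ℝ → ℂ} (hw : MemLp w p nu) : MemLp (hatRefl w) p nu :=
  (hw.comp_measurePreserving measurePreserving_negFreq).star

theorem eLpNorm_hatRefl {p : ℝ≥0∞} {w : ℤ × ℝ → ℂ} (hw : AEStronglyMeasurable w nu) :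
    eLpNorm (hatRefl w) p nu = eLpNorm w p nu := by
  rw [← eLpNorm_comp_measurePreserving hw measurePreserving_negFreq]
  exact eLpNorm_congr_norm_ae (ae_of_all _ fun z => by
    rw [hatRefl, RCLike.norm_conj]; rfl)

theorem refl_check (w : ℤ × ℝ → ℂ) : refl (check w) = check (hatRefl w) := by
  ext z
  rw [refl, check, check, ← integral_conj,
    ← measurePreserving_negFreq.integral_comp negFreq.measurableEmbedding]
  congr 1; ext q
  have e : starRingEnd ℂ (chr (-z.1, z.2) (negFreq q)) = chr z q := by
    have h1 : starRingEnd ℂ (Real.fourierChar (q.2 * -z.1) : ℂ) = Real.fourierChar (q.2 * z.1) := by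
      rw [mul_neg, ← Circle.coe_inv_eq_conj, AddChar.map_neg_eq_inv, inv_inv]
    have h2 : starRingEnd ℂ (fourier (-q.1) z.2 : ℂ) = fourier q.1 z.2 := by
      rw [fourier_neg, Complex.conj_conj]
    rw [chr, chr, map_mul, ← h1, ← h2]; rfl
  rw [map_mul, e]; rfl

theorem FT.refl {u : ℝ × Torus → ℂ} {w : ℤ × ℝ → ℂ} (h : FT u w) :
    FT (refl u) (hatRefl w) := by
  have ht := tendsto_trunc h.memLp_right
  have hd : ∀ n, FT (u - check (trunc n w)) (w - trunc n w) := fun n =>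
    h.sub (FT_check_trunc h.memLp_right n)
  refine FT.of_tendsto (un := fun n => FourthOrderNLS.refl (check (trunc n w)))
    (wn := fun n => hatRefl (trunc n w)) (fun n => ?_)
    (memLp_refl measurePreserving_negTime h.memLp_left) (memLp_hatRefl h.memLp_right) ?_ ?_
  · rw [refl_check]
    have hi := memLp_one_iff_integrable.2 (integrable_trunc h.memLp_right n)
    exact FT_check (memLp_one_iff_integrable.1 (memLp_hatRefl hi))
      (memLp_hatRefl (memLp_trunc h.memLp_right n))
  · have e : ∀ n, eLpNorm (FourthOrderNLS.refl u - FourthOrderNLS.refl (check (trunc n w))) 2 vol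
        = ENNReal.ofReal (2 * Real.pi) ^ (1 / 2 : ℝ) * eLpNorm (w - trunc n w) 2 nu := fun n => by
      rw [← refl_sub, eLpNorm_refl measurePreserving_negTime (hd n).memLp_left.1, (hd n).eLpNorm_eq]
    simp_rw [e]
    simpa using ENNReal.Tendsto.const_mul ht (Or.inr (by finiteness))
  · refine ht.congr fun n => ?_
    rw [← eLpNorm_hatRefl (hd n).memLp_right.1]
    congr 1; ext q; simp [hatRefl]

theorem XN_jap_hatRefl (β s : ℝ) (w : ℤ × ℝ → ℂ) : XN β (jap s) (hatRefl w) = XN β (jap s) w := by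
  rw [← (ENNReal.pow_right_strictMono two_ne_zero).injective.eq_iff, XN_sq, XN_sq,
    ← measurePreserving_negFreq.lintegral_comp_emb negFreq.measurableEmbedding]
  congr 1; ext q
  rw [show ‖hatRefl w (negFreq q)‖ₑ = ‖w q‖ₑ by
    rw [hatRefl, RCLike.enorm_conj, show (-(negFreq q).1, (negFreq q).2) = q from
      Prod.ext (neg_neg q.1) rfl]]
  simp [negFreq, MeasurableEquiv.prodCongr, jap, wt, modul, symb, Even.neg_pow (n := 4) (by decide)]

theorem MemBourgain.refl {b s : ℝ} {u : ℝ × Torus → ℂ} (h : MemBourgain b s u) :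
    MemBourgain b s (refl u) ∧ bourgainNorm b s (refl u) = bourgainNorm b s u := by
  have hF := exists_FT_right h.1
  have e : bourgainNorm b s (FourthOrderNLS.refl u) = bourgainNorm b s u := by
    rw [hF.refl.bourgainNorm_eq, hF.bourgainNorm_eq, XN_jap_hatRefl]
  exact ⟨⟨hF.refl.memLp_left, e ▸ h.2⟩, e⟩

theorem neg_mem_uIoo {S t : ℝ} : -t ∈ uIoo 0 (-S) ↔ t ∈ uIoo 0 S := by
  simp only [uIoo, mem_Ioo, inf_lt_iff, lt_sup_iff, Left.neg_neg_iff, Left.neg_pos_iff, neg_lt_neg_iff]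
  exact and_comm

theorem IsExtension.refl {b s S : ℝ} {u v : ℝ × Torus → ℂ} (h : IsExtension b s (uIoo 0 (-S)) u v) :
    IsExtension b s (uIoo 0 S) (refl u) (refl v) :=
  ⟨h.1.refl.1, ae_eq_refl (measurePreserving_negTime_slab fun _ => neg_mem_uIoo) h.2⟩

theorem MemBourgainOn.refl {b s S : ℝ} {u : ℝ × Torus → ℂ} (h : MemBourgainOn b s (uIoo 0 (-S)) u) :
    MemBourgainOn b s (uIoo 0 S) (refl u) := h.elim fun _ hv => ⟨_, hv.refl⟩

theorem bourgainNormOn_refl_le {b s S : ℝ} (u : ℝ × Torus → ℂ) :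
    bourgainNormOn b s (uIoo 0 S) (refl u) ≤ bourgainNormOn b s (uIoo 0 (-S)) u :=
  le_iInf₂ fun _ hV => (iInf₂_le _ hV.refl).trans_eq hV.1.refl.2

theorem fourierCoeff_conj (f : Torus → ℂ) (k : ℤ) :
    fourierCoeff (fun x => starRingEnd ℂ (f x)) k = starRingEnd ℂ (fourierCoeff f (-k)) := by
  rw [fourierCoeff, fourierCoeff, ← integral_conj]
  congr 1; ext x
  rw [smul_eq_mul, smul_eq_mul, map_mul, fourier_neg, fourier_neg, fourier_neg, Complex.conj_conj]

theorem hsNorm_conj (s : ℝ) (f : Torus → ℂ) : hsNorm s (fun x => starRingEnd ℂ (f x)) = hsNorm s f := by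
  rw [hsNorm, hsNorm, ← (Equiv.neg ℤ).tsum_eq]
  congr 2; ext k
  rw [fourierCoeff_conj, RCLike.enorm_conj]; simp

theorem MemHs.conj {s : ℝ} {f : Torus → ℂ} (h : MemHs s f) : MemHs s fun x => starRingEnd ℂ (f x) :=
  ⟨h.1.star, by rw [hsNorm_conj]; exact h.2⟩

theorem l2HsNorm_refl (T s : ℝ) (g : ℝ × Torus → ℂ) : l2HsNorm T s (refl g) = l2HsNorm T s g := by
  rw [l2HsNorm, l2HsNorm]
  congr 1
  have h := (Measure.measurePreserving_neg (volume : Measure ℝ)).setLIntegral_comp_preimage_emb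
    (MeasurableEquiv.neg ℝ).measurableEmbedding (fun t => hsNorm s (fun x => g (t, x)) ^ 2) (Icc (-T) T)
  rw [← h]
  simp only [neg_preimage, neg_Icc, neg_neg]
  congr 1; ext t
  exact congrArg (· ^ 2) (hsNorm_conj s _)

theorem MemL2Hs.refl {T s : ℝ} {g : ℝ × Torus → ℂ} (h : MemL2Hs T s g) : MemL2Hs T s (refl g) :=
  ⟨memLp_refl (measurePreserving_negTime_slab fun t => by simp [neg_le, and_comm]) h.1,
    by rw [l2HsNorm_refl]; exact h.2⟩

theorem iteratedDeriv_conj (n : ℕ) (f : ℝ → ℂ) :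
    iteratedDeriv n (fun y => starRingEnd ℂ (f y)) = fun y => starRingEnd ℂ (iteratedDeriv n f y) := by
  induction n with
  | zero => simp
  | succ n ih => rw [iteratedDeriv_succ, ih, iteratedDeriv_succ]; exact deriv.star'

theorem dx_refl (n : ℕ) (θ : ℝ × Torus → ℂ) (t : ℝ) (x : Torus) :
    dx n (refl θ) t x = starRingEnd ℂ (dx n θ (-t) x) :=
  congrFun (iteratedDeriv_conj n fun y : ℝ => θ (-t, x + (y : Torus))) 0

theorem dt_refl (θ : ℝ × Torus → ℂ) (t : ℝ) (x : Torus) :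
    dt (refl θ) t x = -starRingEnd ℂ (dt θ (-t) x) := by
  have h := deriv_comp_neg (fun r => starRingEnd ℂ (θ (r, x))) t
  rw [dt, dt, show (fun r => refl θ (r, x)) = fun r => starRingEnd ℂ (θ (-r, x)) from rfl, h,
    neg_inj]
  exact deriv.star

theorem IsTestFunction.refl {S : ℝ} {θ : ℝ × Torus → ℂ} (h : IsTestFunction S θ) :
    IsTestFunction (-S) (refl θ) := by
  obtain ⟨h1, ε, hε, h2⟩ := h
  refine ⟨Complex.conjCLE.contDiff.comp (h1.comp (contDiff_fst.neg.prodMk contDiff_snd)), ε, hε,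
    fun t x ht => ?_⟩
  rw [FourthOrderNLS.refl, h2 (-t) x (by rw [← abs_neg]; ring_nf at ht ⊢; exact ht), map_zero]

theorem intervalIntegral_conj (f : ℝ → ℂ) (a b : ℝ) :
    ∫ t in a..b, starRingEnd ℂ (f t) = starRingEnd ℂ (∫ t in a..b, f t) := by
  simp only [intervalIntegral, integral_conj, map_sub]

theorem IsWeak.refl {S lam : ℝ} {c : ℝ × Torus → ℝ} {u₀ : Torus → ℂ} {g u : ℝ × Torus → ℂ}
    (h : IsWeak S lam c u₀ g u) :
    IsWeak (-S) lam (fun z => -c (-z.1, z.2)) (fun x => starRingEnd ℂ (u₀ x)) (refl g) (refl u) := by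
  refine ⟨?_, fun θ hθ => ?_⟩
  · have h1 := memLp_refl (measurePreserving_negTime_slab (I := uIoo 0 (-S)) fun t => by
      rw [← neg_mem_uIoo, neg_neg]) (memLp_one_iff_integrable.2 h.integrable_cubic)
    refine (memLp_one_iff_integrable.1 h1).congr (ae_of_all _ fun z => ?_)
    simp [FourthOrderNLS.refl]
  · have h1 := congrArg (starRingEnd ℂ) (h.weak_eq _ (by simpa using hθ.refl))
    rw [intervalIntegral.integral_symm, neg_eq_iff_eq_neg]
    rw [← neg_zero, ← intervalIntegral.integral_comp_neg]
    rw [map_mul, ← integral_conj, ← intervalIntegral_conj, Complex.conj_I] at h1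
    refine Eq.trans ?_ (h1.trans ?_)
    · congr 1; ext t
      rw [← integral_conj]
      congr 1; ext x
      simp only [dt_refl, dx_refl]
      simp [FourthOrderNLS.refl]
    · rw [neg_mul]
      congr 3; ext x; simp [FourthOrderNLS.refl]

theorem IsWellPosed.refl {T s b lam S : ℝ} {c : ℝ × Torus → ℝ}
    (h : IsWellPosed T s b lam S fun z => -c (-z.1, z.2)) : IsWellPosed T s b lam (-S) c := by
  have hw : ∀ {u₀ : Torus → ℂ} {g u : ℝ × Torus → ℂ}, IsWeak (-S) lam c u₀ g u →
      IsWeak S lam (fun z => -c (-z.1, z.2)) (fun x => starRingEnd ℂ (u₀ x))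
        (FourthOrderNLS.refl g) (FourthOrderNLS.refl u) := fun h => by simpa using h.refl
  have hMP := measurePreserving_negTime_slab (I := uIoo 0 (-S)) (J := uIoo 0 S) fun t => by
    rw [← neg_mem_uIoo, neg_neg]
  refine ⟨fun u₀ g hu₀ hg => ?_, fun R => ?_⟩
  · obtain ⟨u, ⟨hu, huw⟩, huniq⟩ := h.1 _ _ hu₀.conj hg.refl
    refine ⟨FourthOrderNLS.refl u, ⟨?_, ?_⟩, fun v hv hvw => ?_⟩
    · exact MemBourgainOn.refl (by rwa [neg_neg])
    · simpa [refl_refl] using huw.refl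
    · have := ae_eq_refl hMP (huniq _ hv.refl (hw hvw))
      rwa [refl_refl] at this
  · obtain ⟨L, hL⟩ := h.2 R
    refine ⟨L, fun u₀ v₀ g h u v hu₀ hv₀ hg hh h1 h2 h3 h4 hu huw hv hvw => ?_⟩
    have key := hL _ _ _ _ _ _ hu₀.conj hv₀.conj hg.refl hh.refl (by rwa [hsNorm_conj])
      (by rwa [hsNorm_conj]) (by rwa [l2HsNorm_refl]) (by rwa [l2HsNorm_refl]) hu.refl (hw huw)
      hv.refl (hw hvw)
    rw [← refl_sub, ← refl_sub, l2HsNorm_refl, show (fun x => starRingEnd ℂ (u₀ x)) -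
      (fun x => starRingEnd ℂ (v₀ x)) = fun x => starRingEnd ℂ ((u₀ - v₀) x) from
        funext fun x => (map_sub _ _ _).symm, hsNorm_conj] at key
    have h5 := bourgainNormOn_refl_le (S := -S) (b := b) (s := s) (FourthOrderNLS.refl (u - v))
    rw [refl_refl, neg_neg] at h5
    exact h5.trans key

theorem IsWeak.congr_coeff {S lam : ℝ} {c c' : ℝ × Torus → ℝ}
    (hc : ∀ z : ℝ × Torus, z.1 ∈ uIoo 0 S → c z = c' z) {u₀ : Torus → ℂ} {g u : ℝ × Torus → ℂ}
    (h : IsWeak S lam c u₀ g u) : IsWeak S lam c' u₀ g u := by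
  refine ⟨h.integrable_cubic, fun θ hθ => Eq.trans ?_ (h.weak_eq θ hθ)⟩
  refine intervalIntegral.integral_congr_ae ?_
  have hne : ∀ r : ℝ, ∀ᵐ t : ℝ, t ≠ r := fun r => by simp [ae_iff]
  filter_upwards [hne (max 0 S)] with t h1 ht
  simp only [hc (t, _) ⟨ht.1, ht.2.lt_of_ne h1⟩]

theorem IsWellPosed.congr_coeff {T s b lam S : ℝ} {c c' : ℝ × Torus → ℝ}
    (hc : ∀ z : ℝ × Torus, z.1 ∈ uIoo 0 S → c z = c' z) (h : IsWellPosed T s b lam S c) :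
    IsWellPosed T s b lam S c' := by
  have e : IsWeak S lam c = IsWeak S lam c' := by
    ext u₀ g u
    exact ⟨IsWeak.congr_coeff hc, IsWeak.congr_coeff fun z hz => (hc z hz).symm⟩
  rw [IsWellPosed] at h ⊢
  rwa [e] at h

theorem exists_isDamping {T s : ℝ} (hs : 0 ≤ s) {a : Torus → ℝ}
    (ha : ContDiff ℝ (⊤ : ℕ∞) (fun x : ℝ => a (x : Torus)) ∨ (s = 0 ∧ MemLp a ⊤ volume))
    {ψ : ℝ → ℝ} (hψ : Continuous ψ) {Φ : ℝ≥0} (hΦ : ∀ t, |ψ t| ≤ Φ) :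
    ∃ Λ K, IsDamping T s Λ K fun z => (Ioo 0 T).indicator ψ z.1 * a z.2 ^ 2 := by
  have hi : ∀ t, |(Ioo 0 T).indicator ψ t| ≤ Φ := fun t => by
    by_cases ht : t ∈ Ioo 0 T <;> simp [ht, hΦ t]
  have hm : MemLp (fun x => a x ^ 2) ⊤ volume := by
    have h2 : MemLp a ⊤ volume := by
      rcases ha with ha | ha
      · have hc : Continuous a := (QuotientAddGroup.isQuotientMap_mk
          (N := AddSubgroup.zmultiples (2 * Real.pi))).continuous_iff.2 ha.continuous
        obtain ⟨C, hC⟩ := (isCompact_range hc).isBounded.exists_norm_le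
        exact memLp_top_of_bound hc.aestronglyMeasurable C (ae_of_all _ fun x => hC _ (mem_range_self x))
      · exact ha.2
    have h3 := h2.mul h2 (r := ⊤)
    exact (memLp_congr_ae (ae_of_all _ fun x => by simp [sq])).1 h3
  obtain ⟨K, hK⟩ : ∃ K : ℝ≥0, ∀ R, IsMultiplier K (japMin s R) fun x => ((a x ^ 2 : ℝ) : ℂ) := by
    rcases ha with ha | ⟨rfl, -⟩
    · exact exists_isMultiplier_of_contDiff (Complex.ofRealCLM.contDiff.comp (ha.pow 2)) hs
    · exact exists_isMultiplier_of_memLp hm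
  have hN : eLpNormEssSup (fun x => a x ^ 2) volume ≠ ⊤ := by
    simpa only [eLpNorm_exponent_top] using hm.2.ne
  refine ⟨Φ * (eLpNormEssSup (fun x => a x ^ 2) volume).toNNReal, Φ * K, ?_, ?_, fun z hz => ?_,
    fun R => (hK R).isMulBound hi⟩
  · exact (hψ.measurable.indicator measurableSet_Ioo).aestronglyMeasurable.comp_fst.mul
      hm.1.comp_snd
  · have h1 : ∀ᵐ x : Torus, |a x ^ 2| ≤ (eLpNormEssSup (fun x => a x ^ 2) volume).toNNReal := by
      filter_upwards [enorm_ae_le_eLpNormEssSup (fun x => a x ^ 2) volume] with x hx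
      rw [← ENNReal.coe_toNNReal hN, enorm_eq_nnnorm] at hx
      exact_mod_cast hx
    filter_upwards [Measure.quasiMeasurePreserving_snd.ae h1] with z hz
    rw [abs_mul, NNReal.coe_mul]
    exact mul_le_mul (hi _) hz (abs_nonneg _) Φ.2
  · rw [indicator_of_notMem hz, zero_mul]

theorem isWellPosed_time_mul {T s b lam : ℝ} (hT : 0 < T) (hs : 0 ≤ s) (hb : 1 / 2 ≤ b)
    (hb' : b < 11 / 16) {a : Torus → ℝ}
    (ha : ContDiff ℝ (⊤ : ℕ∞) (fun x : ℝ => a (x : Torus)) ∨ (s = 0 ∧ MemLp a ⊤ volume))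
    {ψ : ℝ → ℝ} (hψ : Continuous ψ) (hψc : HasCompactSupport ψ) :
    IsWellPosed T s b lam T fun z => ψ z.1 * a z.2 ^ 2 := by
  obtain ⟨C, hC⟩ := hψ.bounded_above_of_compact_support hψc
  have hC0 : 0 ≤ C := (norm_nonneg _).trans (hC 0)
  obtain ⟨Λ, K, h⟩ := exists_isDamping (T := T) hs ha hψ (Φ := ⟨C, hC0⟩) hC
  refine (isWellPosed_of_isDamping hT hs hb hb' h).congr_coeff fun z hz => ?_
  rw [uIoo_zero hT] at hz
  simp only [indicator_of_mem hz]

end FourthOrderNLS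

end

end

theorem theorem3p1 (T s lam b : ℝ) (hT : 0 < T) (hs : 0 ≤ s)
    (hb : 1 / 2 ≤ b) (hb' : b < 11 / 16)
    (a : Torus → ℝ) (φ : ℝ → ℝ)
    (ha : ContDiff ℝ ∞ (fun x : ℝ => a (x : Torus)) ∨ (s = 0 ∧ MemLp a ⊤ volume))
    (hφ : ContDiff ℝ ∞ φ) (hφc : HasCompactSupport φ)
    -- `S = T` is the interval `(0, T)`, and `S = -T` the interval `(-T, 0)`
    (S : ℝ) (hS : S = T ∨ S = -T) :
    -- existence and uniqueness
    (∀ (u₀ : Torus → ℂ) (g : ℝ × Torus → ℂ), MemHs s u₀ → MemL2Hs T s g →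
      ∃ u : ℝ × Torus → ℂ,
        (MemBourgainOn b s (uIoo 0 S) u ∧ IsSolution S lam a φ u₀ g u) ∧
        ∀ v : ℝ × Torus → ℂ,
          MemBourgainOn b s (uIoo 0 S) v → IsSolution S lam a φ u₀ g v →
            v =ᵐ[slab (uIoo 0 S)] u) ∧
    -- the data-to-solution map is Lipschitz on bounded sets
    (∀ R : ℝ≥0, ∃ L : ℝ≥0,
      ∀ (u₀ v₀ : Torus → ℂ) (g h u v : ℝ × Torus → ℂ),
        MemHs s u₀ → MemHs s v₀ → MemL2Hs T s g → MemL2Hs T s h →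
        hsNorm s u₀ ≤ R → hsNorm s v₀ ≤ R → l2HsNorm T s g ≤ R → l2HsNorm T s h ≤ R →
        MemBourgainOn b s (uIoo 0 S) u → IsSolution S lam a φ u₀ g u →
        MemBourgainOn b s (uIoo 0 S) v → IsSolution S lam a φ v₀ h v →
          bourgainNormOn b s (uIoo 0 S) (u - v) ≤
            L * (hsNorm s (u₀ - v₀) + l2HsNorm T s (g - h))) := by
  have key : IsWellPosed T s b lam S fun z => φ z.1 ^ 2 * a z.2 ^ 2 := by
    rcases hS with rfl | rfl
    · exact isWellPosed_time_mul hT hs hb hb' ha (ψ := fun t => φ t ^ 2) (hφ.continuous.pow 2)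
        (hφc.comp_left (g := fun r : ℝ => r ^ 2) (by norm_num))
    · refine IsWellPosed.refl ?_
      have h := isWellPosed_time_mul (b := b) (lam := lam) hT hs hb hb' ha
        (ψ := fun t => -φ (-t) ^ 2) ((hφ.continuous.comp continuous_neg).pow 2).neg
        ((hφc.comp_homeomorph (Homeomorph.neg ℝ)).comp_left (g := fun r : ℝ => -r ^ 2) (by norm_num))
      simpa only [neg_mul] using h
  simp only [isSolution_iff]
  exact key
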